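/- Let $d\ge 1$ and write $x=(x_1,x_\perp)\in\mathbb R\times\mathbb R^{d-1}$, $\langle x\rangle=\sqrt{|x|^2+1}$. Let $2\le p\le\infty$ (with $1/p=0$ if $p=\infty$), $3/8<\beta<1/2$ and $s>\frac d2-\frac{d-1}{p}+1$. Let $$\|\psi\|_{H^{0,s}}=\|\langle x\rangle^s\psi\|_{L^2(\mathbb R^d)},\qquad \hat\psi(\xi)=(2\pi)^{-d/2}\int_{\mathbb R^d}e^{-ix\cdot\xi}\psi(x)\,dx$$ (extended to $L^2$ by Plancherel), and for real $a$ let $\langle\partial_{x_1}\rangle^{a}$ be the Fourier multiplier on tempered distributions with symbol $(1+\xi_1^2)^{a/2}$. For $t>0$ let $\mu=\mu(t,x)=(\mu_1,\mu_\perp)$, where $$\mu_1=\Big\{\tfrac{1}{2t}\Big(x_1+\sqrt{x_1^2+\tfrac4{27}t^2}\Big)\Big\}^{1/3}+\Big\{\tfrac{1}{2t}\Big(x_1-\sqrt{x_1^2+\tfrac4{27}t^2}\Big)\Big\}^{1/3},\qquad \mu_\perp=\frac{x_\perp}{t},$$ with real cube roots. Then there is a constant $C$, depending only on $d,p,\beta,s$,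 such that the following holds. Let $\psi\in H^{0,s}(\mathbb R^d)$ and let $u\in C([0,\infty);L^2(\mathbb R^d))$ satisfy $u(0)=\psi$ and, in the sense of tempered distributions for every $t>0$, $$i\partial_tu+\tfrac12\Delta u-\tfrac14\partial_{x_1}^4u=0 .$$ Then for every $t\ge2$, $$u(t,x)=\frac{t^{-d/2}}{\sqrt{3\mu_1^2+1}}\,\hat\psi(\mu)\,e^{\frac34it\mu_1^4+\frac12it|\mu|^2-i\frac d4\pi}+R(t,x)\quad\text{for a.e. }x\in\mathbb R^d,$$ where $R(t)\in L^2(\mathbb R^d)$, $\langle\partial_{x_1}\rangle^{1-\frac2p}R(t)\in L^p(\mathbb R^d)$ and $$\big\|\langle\partial_{x_1}\rangle^{1-\frac2p}R(t)\big\|_{L^p}\le C\,t^{-d\left(\frac12-\frac1p\right)-\beta}\,\|\psi\|_{H^{0,s}} .$$ -/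

import Mathlib

open MeasureTheory SchwartzMap
open scoped ENNReal FourierTransform LineDeriv Laplacian

noncomputable section

namespace Aniso4NLS

/-- The Euclidean space `ℝ^d`. Below `d ≥ 1`, and the coordinate `x₁` is the one of index `0`. -/
abbrev Space (d : ℕ) : Type := EuclideanSpace ℝ (Fin d)

/-- The complex Hilbert space `L²(ℝ^d)`. -/
abbrev L2 (d : ℕ) : Type := Lp ℂ 2 (volume : Measure (Space d))

/-- The unit vector in the direction `x₁`. -/
def e₁ (d : ℕ) [NeZero d] : Space d := EuclideanSpace.single 0 1

/-- `u ∈ C([0,∞); L²(ℝ^d))` solves the Cauchy problem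
`i ∂_t u + (1/2) Δ u - (1/4) ∂_{x₁}^4 u = 0` for `t > 0`, `u(0) = ψ`.
The equation holds in the space of tempered distributions for every `t > 0`: the derivative
`∂_t u(t) = u'` is taken in the (weak) topology of that space, `Δ` and `∂_{x₁}` are
distributional derivatives. -/
structure IsSolution {d : ℕ} [NeZero d] (ψ : L2 d) (u : ℝ → L2 d) : Prop where
  continuousOn : ContinuousOn u (Set.Ici 0)
  initial : u 0 = ψ
  equation : ∀ t : ℝ, 0 < t → ∃ u' : 𝓢'(Space d, ℂ),
    (∀ φ : 𝓢(Space d, ℂ),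
      HasDerivAt (fun τ : ℝ => Lp.toTemperedDistribution (u τ) φ) (u' φ) t) ∧
    Complex.I • u' + (1 / 2 : ℂ) • Δ (Lp.toTemperedDistribution (u t))
      - (1 / 4 : ℂ) •
        ∂_{e₁ d} (∂_{e₁ d} (∂_{e₁ d} (∂_{e₁ d} (Lp.toTemperedDistribution (u t))))) = 0

/-- The Fourier transform of `ψ ∈ L²` in the unitary normalization
`ψ̂(ξ) = (2π)^{-d/2} ∫ e^{-i x·ξ} ψ(x) dx` (extended to `L²` by Plancherel). Mathlib's `𝓕` has the
kernel `e^{-2π i x·ξ}`. The function is defined up to null sets. -/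
def hat {d : ℕ} (ψ : L2 d) (ξ : Space d) : ℂ :=
  (((2 * Real.pi) ^ (-(d : ℝ) / 2) : ℝ) : ℂ) * (𝓕 ψ : L2 d) ((2 * Real.pi)⁻¹ • ξ)

/-- The real cube root of a real number, odd in `y`. -/
def cbrt (y : ℝ) : ℝ := Real.sign y * |y| ^ (1 / 3 : ℝ)

/-- The first component of the stationary point, by Cardano's formula. -/
def mu₁ (t x₁ : ℝ) : ℝ :=
  cbrt (1 / (2 * t) * (x₁ + √(x₁ ^ 2 + 4 / 27 * t ^ 2)))
    + cbrt (1 / (2 * t) * (x₁ - √(x₁ ^ 2 + 4 / 27 * t ^ 2)))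

/-- The stationary point `μ = (μ₁, x_⊥ / t)`. -/
def mu {d : ℕ} [NeZero d] (t : ℝ) (x : Space d) : Space d :=
  WithLp.toLp 2 fun j => if j = 0 then mu₁ t (x 0) else x j / t

/-- The leading term
`t^{-d/2} (3μ₁² + 1)^{-1/2} ψ̂(μ) exp((3/4) i t μ₁⁴ + (1/2) i t |μ|² - i (d/4) π)`. -/
def leading {d : ℕ} [NeZero d] (ψ : L2 d) (t : ℝ) (x : Space d) : ℂ :=
  ((t ^ (-(d : ℝ) / 2) / √(3 * mu₁ t (x 0) ^ 2 + 1) : ℝ) : ℂ) * hat ψ (mu t x) *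
    Complex.exp (Complex.I * ((3 / 4 * t * mu₁ t (x 0) ^ 4 + 1 / 2 * t * ‖mu t x‖ ^ 2
      - (d : ℝ) / 4 * Real.pi : ℝ) : ℂ))

/-- The symbol of `⟨∂_{x₁}⟩^a`, in the frequency variable of Mathlib's `𝓕` (there
`∂_{x₁}` has the symbol `2π i ξ₁`). -/
def japSymbol (d : ℕ) [NeZero d] (a : ℝ) (ξ : Space d) : ℂ :=
  (((1 + (2 * Real.pi * ξ 0) ^ 2) ^ (a / 2) : ℝ) : ℂ)

/-- The symbol has temperate growth, so that the multiplier below is the actual one. -/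
theorem japSymbol_hasTemperateGrowth (d : ℕ) [NeZero d] (a : ℝ) :
    (japSymbol d a).HasTemperateGrowth := by
  have h : (fun ξ : Space d => (1 + ‖2 * Real.pi * ξ 0‖ ^ 2) ^ (a / 2)).HasTemperateGrowth :=
    (Function.hasTemperateGrowth_one_add_norm_sq_rpow ℝ (a / 2)).comp
      ((2 * Real.pi) • EuclideanSpace.proj (𝕜 := ℝ) (0 : Fin d)).hasTemperateGrowth
  simp only [Real.norm_eq_abs, sq_abs] at h
  exact Complex.ofRealCLM.hasTemperateGrowth.comp h

/-- `⟨∂_{x₁}⟩^a` on tempered distributions. -/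
def japDeriv₁ (d : ℕ) [NeZero d] (a : ℝ) : 𝓢'(Space d, ℂ) →L[ℂ] 𝓢'(Space d, ℂ) :=
  TemperedDistribution.fourierMultiplierCLM ℂ (japSymbol d a)

/-- The function `⟨x⟩^s ψ(x)`, where `⟨x⟩ = (|x|² + 1)^{1/2}`. -/
def weighted {d : ℕ} (s : ℝ) (ψ : L2 d) (x : Space d) : ℂ :=
  ((√(‖x‖ ^ 2 + 1) ^ s : ℝ) : ℂ) * ψ x

/-- Membership in `H^{0,s}`, for `s ≥ 0`, where `H^{0,s} ⊆ L²`. -/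
def MemH0 {d : ℕ} (s : ℝ) (ψ : L2 d) : Prop := MemLp (weighted s ψ) 2 volume

/-- The norm `‖ψ‖_{H^{0,s}} = ‖⟨x⟩^s ψ‖_{L²}`. -/
def normH0 {d : ℕ} (s : ℝ) (ψ : L2 d) : ℝ := (eLpNorm (weighted s ψ) 2 volume).toReal

end Aniso4NLS

end

noncomputable section

namespace Aniso4NLS

/-! ### The stationary point -/

/-! In frequency the flow is multiplication by `exp(-it(|ξ|²/2 + ξ₁⁴/4))`, so the propagator is the
product of a one-dimensional oscillatory integral in `x₁` and a Schrödinger kernel in `x_⊥`. The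
phase `x₁ζ - t(ζ²/2 + ζ⁴/4)` has one real critical point `μ₁`, where `t(μ₁ + μ₁³) = x₁` and the
second derivative is `-tℓ`, `ℓ = 1 + 3μ₁²`. Expanding at `μ₁(x₁)`, keeping only the quadratic part
and, of the datum variable, only `exp(-iy₁μ₁)`, and dropping the chirp `exp(i|y_⊥|²/(2t))` in the
transverse kernel, gives exactly the integral kernel of the leading term. The remainder is therefore
an integral operator whose kernel is a difference of two explicit functions.

Kernel estimates: the line of integration is moved to the line of slope `-1/2` through `μ₁`, where
the full exponential has Gaussian decay at scale `λ⁻¹ = (tℓ)^(-1/2)`. For `|y₁| ≤ √t` the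
one-dimensional kernels differ by `O((1+|y₁|)/(tℓ))` and their second derivatives by `O((1+|y₁|)/t)`
(`norm_kern_sub_lead_le`, `norm_kernDeriv2_sub_le`).

For data supported in a ball of radius `r ≥ 1` this yields two bounds. In `L²` the remainder is
`O(r^(3/2) t^(-1/2))` (`exists_norm_remainder_le`): Plancherel in `x_⊥`, Cauchy–Schwarz in `y₁`, and
`∫ ℓ⁻² dx₁ ≤ πt`. Pointwise, with one derivative in `x₁`, it is `O(t^(-d/2-1/2) r^(1+d/2))`
(`exists_heatBounded_remainder`). This derivative is measured through `H_σ = (1-∂²)e^{-σ(1-∂²)}`: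
with `θ = 1/p`, `⟨∂₁⟩^(1-2θ) = Γ(θ+1/2)⁻¹ ∫ σ^(θ-1/2) H_σ dσ`, and `HeatBounded` says that `√σ |H_σ
φ|` and `∫ σ^(-1/2)|H_σ φ| dσ` are controlled. A function of size `A/w` with second derivative of
size `Aw` satisfies this with a multiple of `A`, whatever the frequency `w`.

The pointwise bound is interpolated with the square function `∫ σ|H_σ f|² dσ`, whose integral over
space is at most `‖f‖²`. The result is the Gagliardo–Nirenberg type inequality `‖⟨∂₁⟩^(1-2/p) f‖_p ≤
C B^(1-2/p) ‖f‖₂^(2/p)` (`exists_norm_japDeriv₁_le`). For the remainder it gives the factor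
`t^(-d(1/2-1/p)-1/2) r^(d/2-(d-1)/p+1)`. Splitting the datum into dyadic shells in `⟨x⟩` leaves a
geometric series, convergent exactly because `s` exceeds the exponent of `r`. The rate `1/2` is
better than `β`. Finally, a solution in the weak sense is the Fourier flow, by
`IsSolution.eq_evolution`. -/

theorem cbrt_pow_three (y : ℝ) : cbrt y ^ 3 = y := by
  unfold cbrt
  have h : (|y| ^ (1 / 3 : ℝ)) ^ 3 = |y| := by
    rw [← Real.rpow_natCast, ← Real.rpow_mul (abs_nonneg y)]; norm_num
  rw [mul_pow, h]
  rcases lt_trichotomy y 0 with hy | hy | hy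
  · rw [Real.sign_of_neg hy, abs_of_neg hy]; ring
  · simp [hy]
  · rw [Real.sign_of_pos hy, abs_of_pos hy]; ring

/-- Cardano: the two cube roots satisfy `A³ + B³ = x/t` and `AB = -1/3`, so `A + B` solves `m + m³ =
x/t`. This is the stationarity condition for the phase `xζ - t(ζ²/2 + ζ⁴/4)`. -/
theorem mu₁_spec {t : ℝ} (ht : 0 < t) (x : ℝ) : t * (mu₁ t x + mu₁ t x ^ 3) = x := by
  set q := √(x ^ 2 + 4 / 27 * t ^ 2) with hq
  have hq2 : q ^ 2 = x ^ 2 + 4 / 27 * t ^ 2 := Real.sq_sqrt (by positivity)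
  set A := cbrt (1 / (2 * t) * (x + q)) with hA
  set B := cbrt (1 / (2 * t) * (x - q)) with hB
  have hm : mu₁ t x = A + B := rfl
  have hA3 : A ^ 3 = 1 / (2 * t) * (x + q) := cbrt_pow_three _
  have hB3 : B ^ 3 = 1 / (2 * t) * (x - q) := cbrt_pow_three _
  have hAB3 : (A * B) ^ 3 = (-1 / 3) ^ 3 := by
    rw [mul_pow, hA3, hB3]
    field_simp
    nlinarith
  have hAB : A * B = -1 / 3 := (Odd.strictMono_pow (by decide : Odd 3)).injective hAB3
  have : (A + B) ^ 3 = A ^ 3 + B ^ 3 + 3 * (A * B) * (A + B) := by ring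
  rw [hm, this, hAB, hA3, hB3]
  field_simp
  ring

theorem mu₁_unique {t : ℝ} (ht : 0 < t) {m x : ℝ} (h : t * (m + m ^ 3) = x) : mu₁ t x = m := by
  have h1 := mu₁_spec ht x
  have h2 : (mu₁ t x - m) * (t * (1 + mu₁ t x ^ 2 + mu₁ t x * m + m ^ 2)) = 0 := by
    linear_combination h1 - h
  have h3 : 0 < t * (1 + mu₁ t x ^ 2 + mu₁ t x * m + m ^ 2) := by
    apply mul_pos ht; nlinarith [sq_nonneg (mu₁ t x + m), sq_nonneg (mu₁ t x), sq_nonneg m]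
  rcases mul_eq_zero.1 h2 with h | h
  · linarith
  · exact absurd h h3.ne'

/-- The inverse map `m ↦ t(m + m³)` has slope at least `t`. -/
theorem abs_mu₁_sub_le {t : ℝ} (ht : 0 < t) (x y : ℝ) :
    |mu₁ t x - mu₁ t y| ≤ |x - y| / t := by
  set a := mu₁ t x
  set b := mu₁ t y
  have h : x - y = t * (1 + a ^ 2 + a * b + b ^ 2) * (a - b) := by
    linear_combination -(mu₁_spec ht x) + mu₁_spec ht y
  have h3 : 1 ≤ 1 + a ^ 2 + a * b + b ^ 2 := by
    nlinarith [sq_nonneg (a + b), sq_nonneg a, sq_nonneg b]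
  have h4 : |t * (1 + a ^ 2 + a * b + b ^ 2)| = t * (1 + a ^ 2 + a * b + b ^ 2) :=
    abs_of_nonneg (mul_nonneg ht.le (by linarith))
  rw [le_div_iff₀ ht, h, abs_mul, h4]
  nlinarith [mul_nonneg (mul_nonneg ht.le (abs_nonneg (a - b))) (sub_nonneg.2 h3)]

theorem continuous_mu₁ {t : ℝ} (ht : 0 < t) : Continuous (mu₁ t) := by
  have : LipschitzWith (Real.toNNReal (1 / t)) (mu₁ t) := by
    apply LipschitzWith.of_dist_le_mul
    intro x y
    rw [Real.coe_toNNReal _ (by positivity), Real.dist_eq, Real.dist_eq]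
    simpa [div_eq_inv_mul] using abs_mu₁_sub_le ht x y
  exact this.continuous

/-- Half of the Hessian weight of the phase: `ℓ(m) = 1 + 3 m²`. -/
def ell (m : ℝ) : ℝ := 3 * m ^ 2 + 1

theorem ell_pos (m : ℝ) : 0 < ell m := by unfold ell; positivity

theorem one_le_ell (m : ℝ) : 1 ≤ ell m := by unfold ell; nlinarith [sq_nonneg m]

theorem abs_le_ell (m : ℝ) : |m| ≤ ell m := by
  unfold ell; nlinarith [sq_abs m, sq_nonneg (|m| - 1)]

theorem one_add_abs_sq_le (m : ℝ) : (1 + |m|) ^ 2 ≤ 2 * ell m := by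
  unfold ell; nlinarith [sq_abs m, sq_nonneg (|m| - 1)]

theorem hasDerivAt_mu₁ {t : ℝ} (ht : 0 < t) (x : ℝ) :
    HasDerivAt (mu₁ t) (t * ell (mu₁ t x))⁻¹ x := by
  have h : HasDerivAt (fun m : ℝ => t * (m + m ^ 3)) (t * ell (mu₁ t x)) (mu₁ t x) := by
    refine (((hasDerivAt_id' (mu₁ t x)).add (hasDerivAt_pow 3 (mu₁ t x))).const_mul t).congr_deriv ?_
    simp only [ell]; push_cast; ring
  exact h.of_local_left_inverse (continuous_mu₁ ht).continuousAt
    (mul_pos ht (ell_pos _)).ne' (Filter.Eventually.of_forall fun y => mu₁_spec ht y)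

/-- The weight `1 + |μ|` is slowly varying: a translation by `h` costs a factor `1 + |h|`, which
Gaussian averages in `h` absorb. This allows weights to be frozen at the base point. -/
theorem one_add_abs_mu₁_sub_le {t : ℝ} (ht : 1 ≤ t) (x h : ℝ) :
    1 + |mu₁ t (x - h)| ≤ (1 + |mu₁ t x|) * (1 + |h|) := by
  have h1 := abs_mu₁_sub_le (by linarith) (x - h) x (t := t)
  have h2 : |x - h - x| / t ≤ |h| := by
    rw [show x - h - x = -h by ring, abs_neg]
    exact div_le_self (abs_nonneg _) ht
  have h3 : |mu₁ t (x - h)| ≤ |mu₁ t x| + |mu₁ t (x - h) - mu₁ t x| := by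
    have := abs_add_le (mu₁ t x) (mu₁ t (x - h) - mu₁ t x)
    simpa using this
  nlinarith [mul_nonneg (abs_nonneg (mu₁ t x)) (abs_nonneg h)]

/-! ### Contour deformation -/

/-- A continuous function on `[a, b]` with vanishing derivative inside takes the same value at the
end points. -/
theorem eq_of_hasDerivAt_zero {E : Type*} [NormedAddCommGroup E] [NormedSpace ℝ E] {f : ℝ → E}
    {a b : ℝ} (hab : a < b) (hc : ContinuousOn f (Set.Icc a b))
    (hd : ∀ x ∈ Set.Ioo a b, HasDerivAt f 0 x) : f a = f b := by
  have h1 : ∀ c ∈ Set.Ioo a b, f c = f b := by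
    intro c hcab
    have := constant_of_has_deriv_right_zero (f := f) (a := c) (b := b)
      (hc.mono (Set.Icc_subset_Icc_left hcab.1.le))
      (fun x hx => (hd x ⟨hcab.1.trans_le hx.1, hx.2⟩).hasDerivWithinAt) b
      (Set.right_mem_Icc.2 hcab.2.le)
    exact this.symm
  have h2 : Filter.Tendsto f (nhdsWithin a (Set.Ioo a b)) (nhds (f a)) :=
    ((hc a (Set.left_mem_Icc.2 hab.le)).mono Set.Ioo_subset_Icc_self)
  have h3 : Filter.Tendsto f (nhdsWithin a (Set.Ioo a b)) (nhds (f b)) := by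
    apply tendsto_const_nhds.congr'
    filter_upwards [self_mem_nhdsWithin] with c hc using (h1 c hc).symm
  haveI : (nhdsWithin a (Set.Ioo a b)).NeBot := left_nhdsWithin_Ioo_neBot hab
  exact tendsto_nhds_unique h2 h3

/-- The integral of an entire function over a line is unchanged under an affine deformation of the
line, as long as the function and its derivative are uniformly dominated. -/
theorem integral_line_deform {F F' : ℂ → ℂ} (hF : ∀ z, HasDerivAt F (F' z) z)
    (hF' : Continuous F') (a₀ a₁ b₀ b₁ : ℂ) {g : ℝ → ℝ}
    (hg : Integrable fun r : ℝ => (1 + |r|) * g r)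
    (h0 : ∀ s ∈ Set.Icc (0 : ℝ) 1, ∀ r : ℝ, ‖F (a₀ + s * a₁ + (b₀ + s * b₁) * r)‖ ≤ g r)
    (h1 : ∀ s ∈ Set.Icc (0 : ℝ) 1, ∀ r : ℝ, ‖F' (a₀ + s * a₁ + (b₀ + s * b₁) * r)‖ ≤ g r) :
    ∫ r : ℝ, F (a₀ + b₀ * r) * b₀ = ∫ r : ℝ, F (a₀ + a₁ + (b₀ + b₁) * r) * (b₀ + b₁) := by
  have hFc : Continuous F := continuous_iff_continuousAt.2 fun z => (hF z).continuousAt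
  set γ : ℝ → ℝ → ℂ := fun s r => a₀ + s * a₁ + (b₀ + s * b₁) * r with hγ
  set I : ℝ → ℂ := fun s => ∫ r : ℝ, F (γ s r) * (b₀ + s * b₁) with hI
  have hg0 : ∀ r, 0 ≤ g r := fun r => (norm_nonneg _).trans (h0 0 (by simp) r)
  have hgm : ∀ r, g r ≤ (1 + |r|) * g r := fun r => by nlinarith [hg0 r, abs_nonneg r]
  have hgr : ∀ r, |r| * g r ≤ (1 + |r|) * g r := fun r => by nlinarith [hg0 r, abs_nonneg r]
  have hb : ∀ s ∈ Set.Icc (0 : ℝ) 1, ‖b₀ + s * b₁‖ ≤ ‖b₀‖ + ‖b₁‖ := by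
    intro s hs
    refine (norm_add_le _ _).trans ?_
    rw [norm_mul, Complex.norm_real, Real.norm_of_nonneg hs.1]
    nlinarith [norm_nonneg b₁, hs.2]
  have hl : ∀ r : ℝ, ‖a₁ + b₁ * r‖ ≤ (‖a₁‖ + ‖b₁‖) * (1 + |r|) := by
    intro r
    refine (norm_add_le _ _).trans ?_
    rw [norm_mul, Complex.norm_real, Real.norm_eq_abs]
    nlinarith [norm_nonneg a₁, norm_nonneg b₁, abs_nonneg r,
      mul_nonneg (norm_nonneg a₁) (abs_nonneg r)]
  have hmeas : ∀ s, AEStronglyMeasurable (fun r : ℝ => F (γ s r) * (b₀ + s * b₁)) := by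
    intro s
    apply Continuous.aestronglyMeasurable
    simp only [hγ]; fun_prop
  have hbd : ∀ s ∈ Set.Icc (0 : ℝ) 1, ∀ r : ℝ,
      ‖F (γ s r) * (b₀ + s * b₁)‖ ≤ (‖b₀‖ + ‖b₁‖) * ((1 + |r|) * g r) := by
    intro s hs r
    rw [norm_mul, mul_comm]
    exact mul_le_mul (hb s hs) ((h0 s hs r).trans (hgm r)) (norm_nonneg _) (by positivity)
  have hcont : ContinuousOn I (Set.Icc 0 1) := by
    apply continuousOn_of_dominated (bound := fun r => (‖b₀‖ + ‖b₁‖) * ((1 + |r|) * g r))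
    · exact fun s _ => hmeas s
    · exact fun s hs => Filter.Eventually.of_forall (hbd s hs)
    · exact hg.const_mul _
    · refine Filter.Eventually.of_forall fun r => Continuous.continuousOn ?_
      simp only [hγ]; fun_prop
  have hder : ∀ s ∈ Set.Ioo (0 : ℝ) 1, HasDerivAt I 0 s := by
    intro s hs
    have hs' := Set.Ioo_subset_Icc_self hs
    -- Equality of mixed derivatives: `D` is both the `s`-derivative of `F(γ) ∂_rγ` and the
    -- `r`-derivative of `F(γ) ∂_sγ`. Its integral in `r` is that of an exact derivative, hence
    -- zero.
    set D : ℝ → ℝ → ℂ := fun s r =>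
      F' (γ s r) * (a₁ + b₁ * r) * (b₀ + s * b₁) + F (γ s r) * b₁ with hD
    have hγs : ∀ s r : ℝ, HasDerivAt (fun s : ℝ => γ s r) (a₁ + b₁ * r) s := by
      intro s r
      have h1 : HasDerivAt (fun s : ℝ => (s : ℂ)) 1 s := Complex.ofRealCLM.hasDerivAt
      refine (((h1.mul_const a₁).const_add a₀).add
        (((h1.mul_const b₁).const_add b₀).mul_const (r : ℂ))).congr_deriv (by ring)
    have hγr : ∀ s r : ℝ, HasDerivAt (fun r : ℝ => γ s r) (b₀ + s * b₁) r := by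
      intro s r
      have h1 : HasDerivAt (fun s : ℝ => (s : ℂ)) 1 r := Complex.ofRealCLM.hasDerivAt
      refine ((h1.const_mul (b₀ + s * b₁)).const_add (a₀ + s * a₁)).congr_deriv (by ring)
    have hDs : ∀ s r : ℝ, HasDerivAt (fun s : ℝ => F (γ s r) * (b₀ + s * b₁)) (D s r) s := by
      intro s r
      have h1 : HasDerivAt (fun s : ℝ => (s : ℂ)) 1 s := Complex.ofRealCLM.hasDerivAt
      refine (((hF _).comp s (hγs s r)).mul ((h1.mul_const b₁).const_add b₀)).congr_deriv ?_
      simp only [hD, Function.comp_apply]; ring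
    have hDr : ∀ s r : ℝ, HasDerivAt (fun r : ℝ => F (γ s r) * (a₁ + b₁ * r)) (D s r) r := by
      intro s r
      have h1 : HasDerivAt (fun s : ℝ => (s : ℂ)) 1 r := Complex.ofRealCLM.hasDerivAt
      refine (((hF _).comp r (hγr s r)).mul ((h1.const_mul b₁).const_add a₁)).congr_deriv ?_
      simp only [hD, Function.comp_apply]; ring
    have hDb : ∀ s ∈ Set.Icc (0 : ℝ) 1, ∀ r : ℝ, ‖D s r‖ ≤
        ((‖a₁‖ + ‖b₁‖) * (‖b₀‖ + ‖b₁‖) + ‖b₁‖) * ((1 + |r|) * g r) := by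
      intro s hs r
      refine (norm_add_le _ _).trans ?_
      rw [norm_mul, norm_mul, norm_mul, add_mul]
      refine add_le_add ?_ ?_
      · calc ‖F' (γ s r)‖ * ‖a₁ + b₁ * r‖ * ‖b₀ + s * b₁‖
            ≤ g r * ((‖a₁‖ + ‖b₁‖) * (1 + |r|)) * (‖b₀‖ + ‖b₁‖) := by
              have := hg0 r
              gcongr
              · exact h1 s hs r
              · exact hl r
              · exact hb s hs
          _ = _ := by ring
      · rw [mul_comm]
        exact mul_le_mul_of_nonneg_left ((h0 s hs r).trans (hgm r)) (norm_nonneg _)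
    have hDm : ∀ s, AEStronglyMeasurable (fun r : ℝ => D s r) := by
      intro s
      apply Continuous.aestronglyMeasurable
      simp only [hD, hγ]; fun_prop
    have hDi : Integrable (D s) :=
      (hg.const_mul _).mono' (hDm s) (Filter.Eventually.of_forall (hDb s hs'))
    have hFi : Integrable fun r : ℝ => F (γ s r) * (a₁ + b₁ * r) := by
      refine (hg.const_mul (‖a₁‖ + ‖b₁‖)).mono' ?_ (Filter.Eventually.of_forall fun r => ?_)
      · apply Continuous.aestronglyMeasurable
        simp only [hγ]; fun_prop
      · rw [norm_mul]
        calc _ ≤ g r * ((‖a₁‖ + ‖b₁‖) * (1 + |r|)) :=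
              mul_le_mul (h0 s hs' r) (hl r) (norm_nonneg _) (hg0 r)
          _ = _ := by ring
    have hz : ∫ r, D s r = 0 := integral_eq_zero_of_hasDerivAt_of_integrable (hDr s) hDi hFi
    have := (hasDerivAt_integral_of_dominated_loc_of_deriv_le (μ := volume)
      (F := fun (s : ℝ) (r : ℝ) => F (γ s r) * (b₀ + s * b₁)) (F' := D) (x₀ := s)
      (bound := fun r => ((‖a₁‖ + ‖b₁‖) * (‖b₀‖ + ‖b₁‖) + ‖b₁‖) * ((1 + |r|) * g r))
      (Ioo_mem_nhds hs.1 hs.2) (Filter.Eventually.of_forall hmeas)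
      ((hg.const_mul _).mono' (hmeas s) (Filter.Eventually.of_forall (hbd s hs')))
      (hDm s) (Filter.Eventually.of_forall fun r x hx => hDb x (Set.Ioo_subset_Icc_self hx) r)
      (hg.const_mul _) (Filter.Eventually.of_forall fun r x _ => hDs x r)).2
    rw [hz] at this
    exact this
  have := eq_of_hasDerivAt_zero zero_lt_one hcont hder
  simpa [hI, hγ] using this

/-! ### Gaussian majorants -/

theorem one_add_pow_le_exp (N : ℕ) {r : ℝ} (hr : 0 ≤ r) :
    (1 + r) ^ N ≤ (N.factorial : ℝ) * Real.exp (1 + r) := by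
  have := Real.pow_div_factorial_le_exp (1 + r) (by linarith) N
  rwa [div_le_iff₀ (by positivity), mul_comm] at this

theorem integrable_poly_gauss (N : ℕ) (B : ℝ) {δ : ℝ} (hδ : 0 < δ) :
    Integrable fun r : ℝ => (1 + |r|) ^ N * Real.exp (B * |r| - δ * r ^ 2) := by
  have h1 : Integrable fun r : ℝ => ((N.factorial : ℝ) * Real.exp (1 + (B + 1) ^ 2 / (2 * δ))) *
      Real.exp (-(δ / 2) * r ^ 2) := (integrable_exp_neg_mul_sq (by positivity)).const_mul _
  refine h1.mono' (Continuous.aestronglyMeasurable (by fun_prop))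
    (Filter.Eventually.of_forall fun r => ?_)
  rw [Real.norm_of_nonneg (by positivity)]
  calc (1 + |r|) ^ N * Real.exp (B * |r| - δ * r ^ 2)
      ≤ ((N.factorial : ℝ) * Real.exp (1 + |r|)) * Real.exp (B * |r| - δ * r ^ 2) := by
        gcongr; exact one_add_pow_le_exp N (abs_nonneg r)
    _ = (N.factorial : ℝ) * Real.exp (1 + |r| + (B * |r| - δ * r ^ 2)) := by
        rw [mul_assoc, ← Real.exp_add]
    _ ≤ (N.factorial : ℝ) * Real.exp (1 + (B + 1) ^ 2 / (2 * δ) + -(δ / 2) * r ^ 2) := by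
        refine mul_le_mul_of_nonneg_left (Real.exp_le_exp.2 ?_) (by positivity)
        -- Completing the square sacrifices half of the Gaussian to absorb the linear exponent.
        have h2 : (B + 1) * |r| - δ / 2 * r ^ 2 ≤ (B + 1) ^ 2 / (2 * δ) := by
          rw [le_div_iff₀ (by positivity), ← sq_abs r]
          nlinarith [sq_nonneg (B + 1 - δ * |r|)]
        linarith
    _ = _ := by rw [mul_assoc, ← Real.exp_add]

/-- `(1 + |s|)^k e^{-s²/32}`. -/
def gaussWeight (k : ℕ) (s : ℝ) : ℝ := (1 + |s|) ^ k * Real.exp (-(s ^ 2 / 32))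

theorem gaussWeight_nonneg (k : ℕ) (s : ℝ) : 0 ≤ gaussWeight k s := by
  unfold gaussWeight; positivity

theorem integrable_gaussWeight (k : ℕ) : Integrable (gaussWeight k) := by
  have := integrable_poly_gauss k 0 (δ := 1 / 32) (by norm_num)
  refine this.congr (Filter.Eventually.of_forall fun r => ?_)
  simp only [gaussWeight]; congr 2; ring

/-- The total mass of `gaussWeight k`. -/
def gaussMass (k : ℕ) : ℝ := ∫ s, gaussWeight k s

theorem gaussMass_nonneg (k : ℕ) : 0 ≤ gaussMass k := integral_nonneg (gaussWeight_nonneg k)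

theorem integrable_gaussWeight_comp (k : ℕ) {l : ℝ} (hl : 0 < l) :
    Integrable fun r : ℝ => gaussWeight k (l * r) :=
  (integrable_gaussWeight k).comp_mul_left' hl.ne'

theorem integral_gaussWeight_comp (k : ℕ) {l : ℝ} (hl : 0 < l) :
    ∫ r : ℝ, gaussWeight k (l * r) = l⁻¹ * gaussMass k := by
  rw [Measure.integral_comp_mul_left (gaussWeight k) l, abs_of_pos (by positivity)]; rfl

theorem norm_integral_le_gaussMass {f : ℝ → ℂ} {k : ℕ} {l A : ℝ} (hl : 0 < l)
    (hf : ∀ r, ‖f r‖ ≤ A * gaussWeight k (l * r)) : ‖∫ r, f r‖ ≤ A * (l⁻¹ * gaussMass k) := by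
  rw [← integral_gaussWeight_comp k hl, ← integral_const_mul]
  exact norm_integral_le_of_norm_le ((integrable_gaussWeight_comp k hl).const_mul A)
    (Filter.Eventually.of_forall hf)

/-! ### The oscillatory exponential on slanted lines -/

/-- The direction of the slanted line of integration. -/
def slant : ℂ := 1 - Complex.I / 2

/-- `e^{i x ζ - (ε + i t) ζ² / 2 - i t ζ⁴ / 4}`. -/
def osc (ε t x : ℝ) (ζ : ℂ) : ℂ :=
  Complex.exp (Complex.I * x * ζ - (ε + Complex.I * t) * ζ ^ 2 / 2 - Complex.I * t * ζ ^ 4 / 4)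

theorem norm_slant_le : ‖slant‖ ≤ 2 := by
  unfold slant
  refine (norm_sub_le _ _).trans ?_
  simp; norm_num

theorem norm_osc (ε t x p q : ℝ) : ‖osc ε t x (p + q * Complex.I)‖ =
    Real.exp (-(x * q) - ε * (p ^ 2 - q ^ 2) / 2 + t * p * q + t * p * q * (p ^ 2 - q ^ 2)) := by
  unfold osc
  rw [Complex.norm_exp]
  congr 1
  have : Complex.I * x * (p + q * Complex.I) - (ε + Complex.I * t) * (p + q * Complex.I) ^ 2 / 2
      - Complex.I * t * (p + q * Complex.I) ^ 4 / 4 =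
    ((-(x * q) - ε * (p ^ 2 - q ^ 2) / 2 + t * p * q + t * p * q * (p ^ 2 - q ^ 2) : ℝ) : ℂ) +
    ((x * p - ε * p * q - t * (p ^ 2 - q ^ 2) / 2 -
      t * ((p ^ 2 - q ^ 2) ^ 2 - 4 * p ^ 2 * q ^ 2) / 4 : ℝ) : ℂ) * Complex.I := by
    push_cast
    have h2 : Complex.I ^ 2 = -1 := Complex.I_sq
    have h3 : Complex.I ^ 3 = -Complex.I := by rw [pow_succ, h2]; ring
    have h4 : Complex.I ^ 4 = 1 := by rw [pow_succ, h3]; linear_combination -h2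
    have h5 : Complex.I ^ 5 = Complex.I := by rw [pow_succ, h4]; ring
    ring_nf
    simp only [h2, h3, h4, h5]
    ring
  rw [this, Complex.add_re, Complex.ofReal_re, Complex.re_ofReal_mul, Complex.I_re]
  ring

/-- On the slanted line the exponent has real part `(x - t(c + c³)) r/2 - t r² (ℓ(c)/2 + 11cr/8 +
3r²/8)` plus the `ε` term. The linear part vanishes at the stationary point. The slope `-1/2` makes
the bracket positive, which keeps the cubic and quartic terms from destroying the decay. -/
theorem norm_osc_slant_le {ε t x c : ℝ} (ht : 0 ≤ t) (r : ℝ) :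
    ‖osc ε t x (c + slant * r)‖ ≤ Real.exp (|x - t * (c + c ^ 3)| * |r| / 2
      - t * ell c * r ^ 2 / 16 - ε * ((c + r) ^ 2 - r ^ 2 / 4) / 2) := by
  have h : (c : ℂ) + slant * r = ((c + r : ℝ) : ℂ) + ((-r / 2 : ℝ) : ℂ) * Complex.I := by
    unfold slant; push_cast; ring
  rw [h, norm_osc, Real.exp_le_exp]
  have h1 : (x - t * (c + c ^ 3)) * r ≤ |x - t * (c + c ^ 3)| * |r| := by
    rw [← abs_mul]; exact le_abs_self _
  -- Positivity of a quadratic form in `(c, r)` after giving up `ℓ(c)/16`; the discriminant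
  -- condition is `(11/8)² < 4 · (21/16) · (3/8)`.
  have h2 : 0 ≤ t * (r ^ 2 * (ell c / 2 + 11 / 8 * c * r + 3 / 8 * r ^ 2 - ell c / 16)) := by
    apply mul_nonneg ht
    apply mul_nonneg (sq_nonneg r)
    unfold ell
    nlinarith [sq_nonneg (c * 11 / 6 + r), sq_nonneg c]
  unfold ell at *
  nlinarith

theorem hasDerivAt_osc (ε t x : ℝ) (ζ : ℂ) : HasDerivAt (osc ε t x)
    ((Complex.I * x - (ε + Complex.I * t) * ζ - Complex.I * t * ζ ^ 3) * osc ε t x ζ) ζ := by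
  unfold osc
  have h : HasDerivAt (fun ζ : ℂ => Complex.I * x * ζ - (ε + Complex.I * t) * ζ ^ 2 / 2
      - Complex.I * t * ζ ^ 4 / 4)
      (Complex.I * x - (ε + Complex.I * t) * ζ - Complex.I * t * ζ ^ 3) ζ := by
    refine ((((hasDerivAt_id' ζ).const_mul (Complex.I * x)).sub
      (((hasDerivAt_pow 2 ζ).const_mul ((ε : ℂ) + Complex.I * t)).div_const 2)).sub
      (((hasDerivAt_pow 4 ζ).const_mul (Complex.I * t)).div_const 4)).congr_deriv ?_
    push_cast; ring
  refine h.cexp.congr_deriv (by ring)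

theorem continuous_osc (ε t x : ℝ) : Continuous (osc ε t x) :=
  continuous_iff_continuousAt.2 fun z => (hasDerivAt_osc ε t x z).continuousAt

/-- The oscillatory integral `∫ ζ^k e^{i x ζ - i t (ζ² / 2 + ζ⁴ / 4)} dζ` over a slanted line. -/
def oscMoment (t x : ℝ) (k : ℕ) : ℂ := ∫ r : ℝ, (slant * r) ^ k * osc 0 t x (slant * r) * slant

theorem norm_line_le (c r : ℝ) : ‖(c : ℂ) + slant * r‖ ≤ 2 * (1 + |c|) * (1 + |r|) := by
  refine (norm_add_le _ _).trans ?_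
  rw [norm_mul, Complex.norm_real, Complex.norm_real, Real.norm_eq_abs, Real.norm_eq_abs]
  nlinarith [mul_le_mul_of_nonneg_right norm_slant_le (abs_nonneg r), abs_nonneg c, abs_nonneg r,
    mul_nonneg (abs_nonneg c) (abs_nonneg r)]

/-- The line of integration may be translated. -/
theorem oscMoment_eq {t : ℝ} (ht : 0 < t) (x c : ℝ) (k : ℕ) : oscMoment t x k =
    ∫ r : ℝ, (c + slant * r) ^ k * osc 0 t x (c + slant * r) * slant := by
  set B : ℝ := |x| + t * (|c| + |c| ^ 3) with hB
  set P : ℝ := 2 * (1 + |c|) with hP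
  have hP1 : 1 ≤ P := by rw [hP]; linarith [abs_nonneg c]
  set M : ℝ := P ^ k + (k * P ^ (k - 1) + P ^ k * (|x| + t * P + t * P ^ 3)) with hM
  set g : ℝ → ℝ := fun r => M * ((1 + |r|) ^ (k + 3) * Real.exp (B * |r| - t / 16 * r ^ 2)) with hg
  have hosc : ∀ s ∈ Set.Icc (0 : ℝ) 1, ∀ r : ℝ, ‖osc 0 t x ((0 : ℂ) + s * c + slant * r)‖ ≤
      Real.exp (B * |r| - t / 16 * r ^ 2) := by
    intro s hs r
    have h0 := norm_osc_slant_le (ε := 0) (x := x) (c := s * c) ht.le r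
    have e : ((0 : ℂ) + s * c + slant * r) = ((s * c : ℝ) : ℂ) + slant * r := by push_cast; ring
    rw [e]
    refine h0.trans (Real.exp_le_exp.2 ?_)
    have h1 : |s * c| ≤ |c| := by
      rw [abs_mul, abs_of_nonneg hs.1]; nlinarith [abs_nonneg c, hs.2]
    have h2 : |x - t * (s * c + (s * c) ^ 3)| ≤ B := by
      refine (abs_sub _ _).trans ?_
      rw [abs_mul, abs_of_pos ht]
      have := abs_add_le (s * c) ((s * c) ^ 3)
      rw [abs_pow] at this
      have h3 : |s * c| ^ 3 ≤ |c| ^ 3 := by gcongr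
      rw [hB]; nlinarith
    have h3 : t * r ^ 2 * 1 ≤ t * r ^ 2 * ell (s * c) := by
      gcongr; exact one_le_ell _
    have h4 := mul_le_mul_of_nonneg_right h2 (abs_nonneg r)
    have h5 : 0 ≤ B * |r| := by positivity
    linarith
  have hlin : ∀ s ∈ Set.Icc (0 : ℝ) 1, ∀ r : ℝ, ‖(0 : ℂ) + s * c + slant * r‖ ≤ P * (1 + |r|) := by
    intro s hs r
    have e : ((0 : ℂ) + s * c + slant * r) = ((s * c : ℝ) : ℂ) + slant * r := by push_cast; ring
    rw [e]
    refine (norm_line_le _ _).trans ?_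
    have h1 : |s * c| ≤ |c| := by
      rw [abs_mul, abs_of_nonneg hs.1]; nlinarith [abs_nonneg c, hs.2]
    rw [hP]; gcongr
  -- The lines of the deformation are parallel and pass through `s c`. The bounds above are uniform
  -- in `s` because `|s c| ≤ |c|`.
  have key := integral_line_deform (F := fun ζ => ζ ^ k * osc 0 t x ζ)
    (F' := fun ζ => (k * ζ ^ (k - 1) + ζ ^ k * (Complex.I * x - Complex.I * t * ζ
      - Complex.I * t * ζ ^ 3)) * osc 0 t x ζ)
    (fun z => ((hasDerivAt_pow k z).mul (hasDerivAt_osc 0 t x z)).congr_deriv (by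
      rw [Complex.ofReal_zero, zero_add]; simp only [add_mul]; ring))
    (by have := continuous_osc 0 t x; fun_prop) 0 c slant 0 (g := g)
    (by
      have := (integrable_poly_gauss (k + 4) B (δ := t / 16) (by positivity)).const_mul M
      refine this.congr (Filter.Eventually.of_forall fun r => ?_)
      simp only [hg]; ring)
    (by
      intro s hs r
      rw [mul_zero, add_zero, norm_mul, norm_pow]
      have hr : 1 ≤ 1 + |r| := by linarith [abs_nonneg r]
      calc _ ≤ (P * (1 + |r|)) ^ k * Real.exp (B * |r| - t / 16 * r ^ 2) := by
            gcongr
            · exact hlin s hs r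
            · exact hosc s hs r
        _ = P ^ k * (1 + |r|) ^ k * Real.exp (B * |r| - t / 16 * r ^ 2) := by rw [mul_pow]
        _ ≤ M * (1 + |r|) ^ (k + 3) * Real.exp (B * |r| - t / 16 * r ^ 2) := by
            gcongr
            · rw [hM]
              have : 0 ≤ (k * P ^ (k - 1) + P ^ k * (|x| + t * P + t * P ^ 3)) := by positivity
              linarith
            · omega
        _ = g r := by simp only [hg]; ring)
    (by
      intro s hs r
      rw [mul_zero, add_zero, norm_mul]
      have hr : 1 ≤ 1 + |r| := by linarith [abs_nonneg r]
      set z : ℂ := (0 : ℂ) + s * c + slant * r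
      set T := 1 + |r|
      have hz : ‖z‖ ≤ P * T := hlin s hs r
      have h1 : ‖(k * z ^ (k - 1) + z ^ k * (Complex.I * x - Complex.I * t * z
          - Complex.I * t * z ^ 3))‖ ≤ k * (P * T) ^ (k - 1) + (P * T) ^ k *
            (|x| + t * (P * T) + t * (P * T) ^ 3) := by
        refine (norm_add_le _ _).trans ?_
        rw [norm_mul, norm_mul, norm_pow, norm_pow, Complex.norm_natCast]
        gcongr
        refine (norm_sub_le _ _).trans (add_le_add ((norm_sub_le _ _).trans (add_le_add ?_ ?_)) ?_)
        · simp
        · rw [norm_mul, norm_mul]; simp only [Complex.norm_I, Complex.norm_real, Real.norm_eq_abs,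
            abs_of_pos ht, one_mul]; gcongr
        · rw [norm_mul, norm_mul, norm_pow]; simp only [Complex.norm_I, Complex.norm_real,
            Real.norm_eq_abs, abs_of_pos ht, one_mul]; gcongr
      have h2 : k * (P * T) ^ (k - 1) + (P * T) ^ k *
            (|x| + t * (P * T) + t * (P * T) ^ 3) ≤ M * T ^ (k + 3) := by
        have a1 : T ^ (k - 1) ≤ T ^ (k + 3) := pow_le_pow_right₀ hr (by omega)
        have a2 : T ^ k ≤ T ^ (k + 3) := pow_le_pow_right₀ hr (by omega)
        have a3 : T ^ (k + 1) ≤ T ^ (k + 3) := pow_le_pow_right₀ hr (by omega)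
        have e : k * (P * T) ^ (k - 1) + (P * T) ^ k * (|x| + t * (P * T) + t * (P * T) ^ 3) =
          k * P ^ (k - 1) * T ^ (k - 1) + P ^ k * |x| * T ^ k + P ^ k * (t * P) * T ^ (k + 1) +
          P ^ k * (t * P ^ 3) * T ^ (k + 3) := by ring
        rw [e, hM]
        have b1 : k * P ^ (k - 1) * T ^ (k - 1) ≤ k * P ^ (k - 1) * T ^ (k + 3) := by gcongr
        have b2 : P ^ k * |x| * T ^ k ≤ P ^ k * |x| * T ^ (k + 3) := by gcongr
        have b3 : P ^ k * (t * P) * T ^ (k + 1) ≤ P ^ k * (t * P) * T ^ (k + 3) := by gcongr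
        have b4 : 0 ≤ P ^ k * T ^ (k + 3) := by positivity
        linarith
      calc _ ≤ (M * T ^ (k + 3)) * Real.exp (B * |r| - t / 16 * r ^ 2) :=
            mul_le_mul (h1.trans h2) (hosc s hs r) (norm_nonneg _) (by positivity)
        _ = g r := by simp only [hg]; ring)
  simpa [oscMoment] using key

theorem norm_slant_mul_le (r : ℝ) : ‖slant * r‖ ≤ 2 * |r| := by
  rw [norm_mul, Complex.norm_real, Real.norm_eq_abs]
  exact mul_le_mul_of_nonneg_right norm_slant_le (abs_nonneg r)

/-- Each `x`-derivative brings down `iζ`, that is, raises the moment by one. Differentiation under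
the integral is dominated by a Gaussian, uniformly for `x` in a unit ball. -/
theorem hasDerivAt_oscMoment {t : ℝ} (ht : 0 < t) (x : ℝ) (k : ℕ) :
    HasDerivAt (fun x => oscMoment t x k) (Complex.I * oscMoment t x (k + 1)) x := by
  unfold oscMoment
  rw [← integral_const_mul]
  have hb : ∀ y ∈ Metric.ball x 1, ∀ r : ℝ, ∀ k : ℕ, ‖(slant * r) ^ k * osc 0 t y (slant * r) * slant‖
      ≤ 2 ^ (k + 1) * ((1 + |r|) ^ k * Real.exp ((|x| + 1) * |r| - t / 16 * r ^ 2)) := by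
    intro y hy r k
    have h1 : |y| ≤ |x| + 1 := by
      rw [Metric.mem_ball, Real.dist_eq] at hy
      have := abs_add_le x (y - x)
      rw [add_sub_cancel] at this
      linarith
    have h2 := norm_osc_slant_le (ε := 0) (x := y) (c := 0) ht.le r
    simp only [Complex.ofReal_zero, zero_add, ell] at h2
    rw [norm_mul, norm_mul, norm_pow]
    calc _ ≤ (2 * |r|) ^ k * Real.exp ((|x| + 1) * |r| - t / 16 * r ^ 2) * 2 := by
          gcongr
          · exact norm_slant_mul_le r
          · refine h2.trans (Real.exp_le_exp.2 ?_)
            have h3 : |y - t * (0 ^ 3)| = |y| := by norm_num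
            rw [h3]
            nlinarith [abs_nonneg r, abs_nonneg y, mul_le_mul_of_nonneg_right h1 (abs_nonneg r)]
          · exact norm_slant_le
      _ = 2 ^ (k + 1) * (|r| ^ k * Real.exp ((|x| + 1) * |r| - t / 16 * r ^ 2)) := by
          rw [mul_pow]; ring
      _ ≤ _ := by gcongr; linarith [abs_nonneg r]
  have hm : ∀ y : ℝ, ∀ k : ℕ, AEStronglyMeasurable
      (fun r : ℝ => (slant * r) ^ k * osc 0 t y (slant * r) * slant) volume := by
    intro y k
    have := continuous_osc 0 t y
    exact Continuous.aestronglyMeasurable (by fun_prop)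
  have hx : x ∈ Metric.ball x 1 := Metric.mem_ball_self one_pos
  refine (hasDerivAt_integral_of_dominated_loc_of_deriv_le
    (F' := fun y r => Complex.I * ((slant * r) ^ (k + 1) * osc 0 t y (slant * r) * slant))
    (Metric.ball_mem_nhds x one_pos) (Filter.Eventually.of_forall fun y => hm y k)
    (((integrable_poly_gauss k (|x| + 1) (δ := t / 16) (by positivity)).const_mul _).mono' (hm x k)
      (Filter.Eventually.of_forall fun r => hb x hx r k)) ((hm x (k + 1)).const_mul _)
    (bound := fun r => 2 ^ (k + 2) * ((1 + |r|) ^ (k + 1) *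
      Real.exp ((|x| + 1) * |r| - t / 16 * r ^ 2)))
    (Filter.Eventually.of_forall fun r y hy => ?_)
    ((integrable_poly_gauss (k + 1) (|x| + 1) (δ := t / 16) (by positivity)).const_mul _)
    (Filter.Eventually.of_forall fun r y _ => ?_)).2
  · rw [norm_mul, Complex.norm_I, one_mul]
    exact hb y hy r (k + 1)
  · have h1 : HasDerivAt (fun s : ℝ => (s : ℂ)) 1 y := Complex.ofRealCLM.hasDerivAt
    have h2 : HasDerivAt (fun y : ℝ => osc 0 t y (slant * r))
        (osc 0 t y (slant * r) * (Complex.I * (slant * r))) y := by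
      unfold osc
      refine HasDerivAt.cexp ?_
      refine ((((h1.const_mul Complex.I).mul_const (slant * r)).sub_const _).sub_const _).congr_deriv
        (by ring)
    refine ((h2.const_mul _).mul_const slant).congr_deriv (by ring)

theorem continuous_oscMoment {t : ℝ} (ht : 0 < t) (k : ℕ) :
    Continuous fun x => oscMoment t x k :=
  continuous_iff_continuousAt.2 fun x => (hasDerivAt_oscMoment ht x k).continuousAt

/-- The value of the phase at the stationary point. -/
def statPhase (t m : ℝ) : ℝ := t * (m ^ 2 / 2 + 3 / 4 * m ^ 4)

/-- The quadratic part of the phase around the stationary point. -/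
def quadPart (t m : ℝ) (z : ℂ) : ℂ := -(Complex.I * t * ell m * z ^ 2 / 2)

/-- The part of the phase around the stationary point of order at least three. -/
def cubicPart (t m : ℝ) (z : ℂ) : ℂ := -(Complex.I * t * (m * z ^ 3 + z ^ 4 / 4))

/-- Taylor expansion of the quartic phase at `μ(x)`. The linear term cancels by stationarity, and
the shift `y` survives only in `exp(-iyμ)` and `exp(-iyz)`; so the same critical point serves for
every `y`. -/
theorem osc_mu₁ {t : ℝ} (ht : 0 < t) (x y : ℝ) (z : ℂ) : osc 0 t (x - y) (mu₁ t x + z) =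
    Complex.exp (Complex.I * (statPhase t (mu₁ t x) - y * mu₁ t x : ℝ)) *
      (Complex.exp (-(Complex.I * y * z) + cubicPart t (mu₁ t x) z) *
        Complex.exp (quadPart t (mu₁ t x) z)) := by
  unfold osc
  rw [← Complex.exp_add, ← Complex.exp_add]
  congr 1
  have hx : (x : ℂ) = t * (mu₁ t x + mu₁ t x ^ 3) := by exact_mod_cast (mu₁_spec ht x).symm
  set m : ℂ := (mu₁ t x : ℂ)
  unfold cubicPart quadPart statPhase ell
  push_cast
  rw [hx]
  ring

/-- The frequency scale at the stationary point, `√(t ℓ(μ))`. -/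
def lam (t m : ℝ) : ℝ := √(t * ell m)

theorem lam_sq {t : ℝ} (ht : 0 ≤ t) (m : ℝ) : lam t m ^ 2 = t * ell m :=
  Real.sq_sqrt (mul_nonneg ht (ell_pos m).le)

theorem sqrt_le_lam {t : ℝ} (ht : 0 ≤ t) (m : ℝ) : √t ≤ lam t m :=
  Real.sqrt_le_sqrt (by nlinarith [one_le_ell m])

theorem one_le_lam {t : ℝ} (ht : 1 ≤ t) (m : ℝ) : 1 ≤ lam t m := by
  refine le_trans ?_ (sqrt_le_lam (by linarith) m)
  rwa [Real.one_le_sqrt]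

theorem lam_pos {t : ℝ} (ht : 1 ≤ t) (m : ℝ) : 0 < lam t m := by linarith [one_le_lam ht m]

theorem sqrt_mul_le_lam {t : ℝ} (ht : 0 ≤ t) (m : ℝ) : √t * (1 + |m|) ≤ 2 * lam t m := by
  have h1 : 1 + |m| ≤ 2 * √(ell m) := by
    have h2 : (1 + |m|) ^ 2 ≤ (2 * √(ell m)) ^ 2 := by
      rw [mul_pow, Real.sq_sqrt (ell_pos m).le]
      linarith [one_add_abs_sq_le m, ell_pos m]
    exact le_of_sq_le_sq h2 (by positivity)
  unfold lam
  rw [Real.sqrt_mul ht]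
  nlinarith [Real.sqrt_nonneg t]
where le_of_sq_le_sq {a b : ℝ} (h : a ^ 2 ≤ b ^ 2) (hb : 0 ≤ b) : a ≤ b :=
  abs_le_of_sq_le_sq' h hb |>.2

theorem norm_osc_mu₁_le {t : ℝ} (ht : 1 ≤ t) (x r : ℝ) :
    ‖osc 0 t x (mu₁ t x + slant * r)‖ ≤ Real.exp (-((lam t (mu₁ t x) * r) ^ 2 / 16)) := by
  refine (norm_osc_slant_le (by linarith) r).trans (Real.exp_le_exp.2 ?_)
  rw [mul_pow, lam_sq (by linarith), mu₁_spec (by linarith)]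
  simp only [sub_self, abs_zero]
  linarith

/-- After moving the line through `μ`, the decay in `λr` makes the measure contribute `λ⁻¹`, while
each factor `ζ` contributes `1 + |μ|`. -/
theorem norm_oscMoment_le {t : ℝ} (ht : 1 ≤ t) (x : ℝ) (k : ℕ) :
    ‖oscMoment t x k‖ ≤ 2 ^ (k + 1) * (1 + |mu₁ t x|) ^ k *
      ((lam t (mu₁ t x))⁻¹ * gaussMass k) := by
  rw [oscMoment_eq (by linarith) x (mu₁ t x) k]
  apply norm_integral_le_gaussMass (lam_pos ht _)
  intro r
  have hl := one_le_lam ht (mu₁ t x)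
  have hr : |r| ≤ |lam t (mu₁ t x) * r| := by
    rw [abs_mul, abs_of_pos (lam_pos ht _)]; nlinarith [abs_nonneg r]
  rw [norm_mul, norm_mul, norm_pow]
  calc _ ≤ (2 * (1 + |mu₁ t x|) * (1 + |lam t (mu₁ t x) * r|)) ^ k *
        Real.exp (-((lam t (mu₁ t x) * r) ^ 2 / 32)) * 2 := by
        gcongr
        · refine (norm_line_le _ _).trans ?_
          gcongr
        · refine (norm_osc_mu₁_le ht x r).trans (Real.exp_le_exp.2 ?_)
          linarith [sq_nonneg (lam t (mu₁ t x) * r)]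
        · exact norm_slant_le
    _ = _ := by unfold gaussWeight; rw [mul_pow, mul_pow]; ring

/-! ### The one-dimensional kernels -/

/-- The fundamental solution of the one-dimensional equation. -/
def kern (t x : ℝ) : ℂ := (2 * Real.pi : ℝ)⁻¹ * oscMoment t x 0

/-- The leading term for a point mass at `y`. -/
def lead (t y x : ℝ) : ℂ := ((√(2 * Real.pi))⁻¹ * (lam t (mu₁ t x))⁻¹ : ℝ) *
  Complex.exp (Complex.I * (statPhase t (mu₁ t x) - y * mu₁ t x - Real.pi / 4 : ℝ))

theorem hasDerivAt_kern {t : ℝ} (ht : 0 < t) (x : ℝ) :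
    HasDerivAt (kern t) ((2 * Real.pi : ℝ)⁻¹ * (Complex.I * oscMoment t x 1)) x :=
  (hasDerivAt_oscMoment ht x 0).const_mul _

theorem hasDerivAt_deriv_kern {t : ℝ} (ht : 0 < t) (x : ℝ) :
    HasDerivAt (fun x => ((2 * Real.pi : ℝ)⁻¹ * (Complex.I * oscMoment t x 1) : ℂ))
      (-((2 * Real.pi : ℝ)⁻¹ * oscMoment t x 2)) x := by
  refine (((hasDerivAt_oscMoment ht x 1).const_mul Complex.I).const_mul _).congr_deriv ?_
  rw [← mul_assoc Complex.I, Complex.I_mul_I]; ring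

theorem norm_lead (t y x : ℝ) :
    ‖lead t y x‖ = (√(2 * Real.pi))⁻¹ * (lam t (mu₁ t x))⁻¹ := by
  unfold lead
  rw [norm_mul, mul_comm Complex.I, Complex.norm_exp_ofReal_mul_I, mul_one, Complex.norm_real,
    Real.norm_of_nonneg]
  have : 0 ≤ lam t (mu₁ t x) := Real.sqrt_nonneg _
  positivity

/-- The complex Gaussian integral determines the value only through a square root. Both candidates
have the same square, and the sign is decided by the positivity of both real parts after division by
`slant`. -/
theorem gaussian_slant {a : ℝ} (ha : 0 < a) :
    ∫ r : ℝ, Complex.exp (-(Complex.I * a * (slant * r) ^ 2 / 2)) * slant =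
      (√(2 * Real.pi) * (√a)⁻¹ : ℝ) * Complex.exp (Complex.I * (-(Real.pi / 4) : ℝ)) := by
  set b : ℂ := (a / 2 : ℝ) * (1 + 3 / 4 * Complex.I) with hb
  have hb2 : Complex.I * a * slant ^ 2 / 2 = b := by
    rw [hb]; unfold slant; push_cast
    linear_combination (-(a : ℂ) / 2 + a / 8 * Complex.I) * Complex.I_sq
  have hbre : 0 < b.re := by rw [hb, Complex.re_ofReal_mul]; simp; linarith
  have hb0 : b ≠ 0 := fun h => by rw [h] at hbre; simp at hbre
  have e1 : ∀ r : ℝ, Complex.exp (-(Complex.I * a * (slant * r) ^ 2 / 2)) =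
      Complex.exp (-b * (r : ℂ) ^ 2) := fun r => by rw [← hb2]; congr 1; ring
  simp_rw [e1]
  rw [integral_mul_const, integral_gaussian_complex hbre]
  set w : ℂ := (Real.pi / b) ^ (1 / 2 : ℂ) with hw
  set v : ℂ := (√(2 * Real.pi) * (√a)⁻¹ : ℝ) * Complex.exp (Complex.I * (-(Real.pi / 4) : ℝ)) with hv
  have hs0 : slant ≠ 0 := by
    intro h
    have := congrArg Complex.re h
    simp [slant] at this
  have hw2 : w ^ 2 = Real.pi / b := by
    rw [hw, ← Complex.cpow_mul_nat]; norm_num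
  have hv2 : v ^ 2 = (2 * Real.pi / a : ℝ) * (-Complex.I) := by
    rw [hv, mul_pow, ← Complex.exp_nat_mul]
    have : ((2 : ℕ) : ℂ) * (Complex.I * (-(Real.pi / 4) : ℝ)) = -(Real.pi / 2 * Complex.I) := by
      push_cast; ring
    rw [this, Complex.exp_neg, Complex.exp_pi_div_two_mul_I, Complex.inv_I]
    congr 1
    rw [← Complex.ofReal_pow, mul_pow, inv_pow, Real.sq_sqrt (by positivity), Real.sq_sqrt ha.le]
    rfl
  have hsq : w ^ 2 = (v / slant) ^ 2 := by
    rw [hw2, div_pow, hv2, ← hb2]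
    have ha' : (a : ℂ) ≠ 0 := by exact_mod_cast ha.ne'
    push_cast
    field_simp
    rw [Complex.I_sq]
    ring
  -- The principal root halves the argument, and `π/b` has argument below `π/2` in modulus because
  -- `b` has positive real part.
  have hwre : 0 < w.re := by
    have hpb : (Real.pi / b : ℂ) ≠ 0 := div_ne_zero (by exact_mod_cast Real.pi_ne_zero) hb0
    have harg : |((Real.pi : ℂ) / b).arg| < Real.pi / 2 := by
      rw [Complex.abs_arg_lt_pi_div_two_iff]
      left
      rw [Complex.div_re]
      simp only [Complex.ofReal_re, Complex.ofReal_im, zero_mul, zero_div, add_zero]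
      have : 0 < Complex.normSq b := Complex.normSq_pos.2 hb0
      positivity
    have : |w.arg| < Real.pi / 2 := by
      rw [hw, Complex.cpow_def_of_ne_zero hpb]
      rw [show Complex.log ((Real.pi : ℂ) / b) * (1 / 2) =
        ((Real.log ‖(Real.pi : ℂ) / b‖ / 2 : ℝ) : ℂ) + ((((Real.pi : ℂ) / b).arg / 2 : ℝ) : ℂ) * Complex.I by
          rw [Complex.log]; push_cast; ring]
      rw [Complex.exp_add, ← Complex.ofReal_exp, Complex.arg_real_mul _ (Real.exp_pos _)]
      have h1 := abs_lt.1 harg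
      rw [Complex.arg_exp_mul_I, toIocMod_eq_self (by positivity) |>.2 ⟨by linarith [Real.pi_pos], by linarith [Real.pi_pos]⟩]
      rw [abs_div]; norm_num; linarith [abs_nonneg (((Real.pi : ℂ) / b).arg), Real.pi_pos]
    rcases (Complex.abs_arg_lt_pi_div_two_iff.1 this) with h | h
    · exact h
    · rw [hw, Complex.cpow_eq_zero_iff] at h
      exact absurd h.1 hpb
  have hvre : 0 < (v / slant).re := by
    have e2 : v / slant = ((√(2 * Real.pi) * (√a)⁻¹ * (√2 / 2) * (4 / 5) : ℝ) : ℂ) *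
        (3 / 2 - 1 / 2 * Complex.I) := by
      rw [div_eq_iff hs0, hv]
      have : Complex.exp (Complex.I * (-(Real.pi / 4) : ℝ)) = (√2 / 2 : ℝ) * (1 - Complex.I) := by
        rw [mul_comm, Complex.exp_mul_I, ← Complex.ofReal_cos, ← Complex.ofReal_sin, Real.cos_neg,
          Real.sin_neg, Real.cos_pi_div_four, Real.sin_pi_div_four]
        push_cast; ring
      rw [this]
      unfold slant
      push_cast
      ring_nf
      rw [Complex.I_sq]
      ring
    rw [e2, Complex.re_ofReal_mul]
    simp
    positivity
  rcases sq_eq_sq_iff_eq_or_eq_neg.1 hsq with h | h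
  · rw [h, div_mul_cancel₀ _ hs0]
  · rw [h, Complex.neg_re] at hwre
    linarith

/-- The leading term is the saddle integral in which only the quadratic part of the exponent is
kept. With `kern_sub_eq_integral`, which has the same prefactor, its difference to the kernel is a
single integral of `(exp(-iyz + cubic) - 1) exp(quad)`. -/
theorem lead_eq_integral {t : ℝ} (ht : 0 < t) (y x : ℝ) : lead t y x =
    (2 * Real.pi : ℝ)⁻¹ * (Complex.exp (Complex.I * (statPhase t (mu₁ t x) - y * mu₁ t x : ℝ)) *
      ∫ r : ℝ, Complex.exp (quadPart t (mu₁ t x) (slant * r)) * slant) := by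
  have ha : 0 < t * ell (mu₁ t x) := mul_pos ht (ell_pos _)
  have h := gaussian_slant ha
  have e : ∀ r : ℝ, quadPart t (mu₁ t x) (slant * r) =
      -(Complex.I * (t * ell (mu₁ t x) : ℝ) * (slant * r) ^ 2 / 2) := by
    intro r; unfold quadPart; push_cast; ring
  simp_rw [e]
  rw [h]
  unfold lead lam
  have h1 : (√(2 * Real.pi))⁻¹ = (2 * Real.pi)⁻¹ * √(2 * Real.pi) := by
    have : √(2 * Real.pi) ^ 2 = 2 * Real.pi := Real.sq_sqrt (by positivity)
    field_simp
    rw [this]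
  rw [show (Complex.I * (statPhase t (mu₁ t x) - y * mu₁ t x - Real.pi / 4 : ℝ) : ℂ) =
    Complex.I * (statPhase t (mu₁ t x) - y * mu₁ t x : ℝ) + Complex.I * (-(Real.pi / 4) : ℝ) by
      push_cast; ring, Complex.exp_add, h1]
  push_cast
  ring

theorem kern_sub_eq_integral {t : ℝ} (ht : 0 < t) (k : ℕ) (y x : ℝ) : oscMoment t (x - y) k =
    Complex.exp (Complex.I * (statPhase t (mu₁ t x) - y * mu₁ t x : ℝ)) *
      ∫ r : ℝ, (mu₁ t x + slant * r) ^ k *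
        (Complex.exp (-(Complex.I * y * (slant * r)) + cubicPart t (mu₁ t x) (slant * r)) *
        Complex.exp (quadPart t (mu₁ t x) (slant * r))) * slant := by
  rw [oscMoment_eq ht _ (mu₁ t x), ← integral_const_mul]
  congr 1; ext r
  rw [osc_mu₁ ht]
  ring

/-- Mean value inequality along the segment from `0` to `z`. The bound involves `|exp z|` and not
`exp |z|`: here `z` contains a quartic term, and only the true exponential, paired with the
quadratic one, decays. -/
theorem norm_exp_sub_one_le (z : ℂ) : ‖Complex.exp z - 1‖ ≤ ‖z‖ * (1 + ‖Complex.exp z‖) := by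
  have h : ∀ s ∈ Set.Icc (0:ℝ) 1, ‖z * Complex.exp (s * z)‖ ≤ ‖z‖ * (1 + ‖Complex.exp z‖) := by
    intro s hs
    rw [norm_mul]
    refine mul_le_mul_of_nonneg_left ?_ (norm_nonneg _)
    rw [Complex.norm_exp, Complex.norm_exp, Complex.re_ofReal_mul]
    rcases le_total z.re 0 with h0 | h0
    · have : Real.exp (s * z.re) ≤ 1 := Real.exp_le_one_iff.2 (mul_nonpos_of_nonneg_of_nonpos hs.1 h0)
      linarith [Real.exp_pos z.re]
    · have : Real.exp (s * z.re) ≤ Real.exp z.re := Real.exp_le_exp.2 (by nlinarith [hs.2])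
      linarith
  have hd : ∀ s : ℝ, HasDerivAt (fun s : ℝ => Complex.exp (s * z)) (z * Complex.exp (s * z)) s := by
    intro s
    have h1 : HasDerivAt (fun s : ℝ => (s : ℂ)) 1 s := Complex.ofRealCLM.hasDerivAt
    exact ((h1.mul_const z).cexp).congr_deriv (by ring)
  have := (convex_Icc (0:ℝ) 1).norm_image_sub_le_of_norm_hasDerivWithin_le
    (fun s _ => (hd s).hasDerivWithinAt) h (Set.left_mem_Icc.2 zero_le_one)
    (Set.right_mem_Icc.2 zero_le_one)
  simpa using this

/-- The bound on the exponents in the comparison of the kernel with its leading term. -/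
theorem norm_exponent_le {t : ℝ} (ht : 1 ≤ t) (m y r : ℝ) :
    ‖-(Complex.I * y * (slant * r)) + cubicPart t m (slant * r)‖ ≤
      12 * (1 + |y|) * (lam t m)⁻¹ * (1 + |lam t m * r|) ^ 4 := by
  set l := lam t m with hl
  have hl0 : 0 < l := lam_pos ht m
  have hl1 : 1 ≤ l := one_le_lam ht m
  have hlsq : l ^ 2 = t * ell m := lam_sq (by linarith) m
  set s := |l * r| with hs
  have hs0 : 0 ≤ s := abs_nonneg _
  have hr : |r| = s / l := by rw [hs, abs_mul, abs_of_pos hl0]; field_simp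
  have hz : ‖slant * r‖ ≤ 2 * s / l := by
    refine (norm_slant_mul_le r).trans (le_of_eq ?_); rw [hr]; ring
  have h1 : ‖-(Complex.I * y * (slant * r))‖ ≤ |y| * (2 * s / l) := by
    rw [norm_neg, norm_mul, norm_mul, Complex.norm_I, one_mul, Complex.norm_real, Real.norm_eq_abs]
    exact mul_le_mul_of_nonneg_left hz (abs_nonneg y)
  have h2 : ‖cubicPart t m (slant * r)‖ ≤ t * (|m| * (2 * s / l) ^ 3 + (2 * s / l) ^ 4 / 4) := by
    unfold cubicPart
    rw [norm_neg, norm_mul, norm_mul, Complex.norm_I, one_mul, Complex.norm_real,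
      Real.norm_of_nonneg (by linarith)]
    refine mul_le_mul_of_nonneg_left ?_ (by linarith)
    refine (norm_add_le _ _).trans ?_
    rw [norm_mul, norm_div, norm_pow, norm_pow, Complex.norm_real, Real.norm_eq_abs]
    have h4 : ‖(4 : ℂ)‖ = 4 := by simp
    rw [h4]
    gcongr
  -- Scaling: with `z` of size `λ⁻¹`, the cubic term is `t|m|λ⁻³ ≤ λ⁻¹` and the quartic one is `tλ⁻⁴
  -- ≤ λ⁻¹`. The latter uses `λ ≥ 1` to pass from `λ²` to `λ³`.
  have h3 : t * |m| ≤ l ^ 2 := by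
    rw [hlsq]; exact mul_le_mul_of_nonneg_left (abs_le_ell m) (by linarith)
  have h4 : t ≤ l ^ 3 := by
    have : t ≤ l ^ 2 := by rw [hlsq]; nlinarith [one_le_ell m]
    nlinarith [sq_nonneg l]
  have h5 : t * (|m| * (2 * s / l) ^ 3) ≤ 8 * s ^ 3 / l := by
    have : t * (|m| * (2 * s / l) ^ 3) = (t * |m|) * (8 * s ^ 3 / l ^ 3) := by field_simp; ring
    rw [this]
    calc _ ≤ l ^ 2 * (8 * s ^ 3 / l ^ 3) := by gcongr
      _ = _ := by field_simp
  have h6 : t * ((2 * s / l) ^ 4 / 4) ≤ 4 * s ^ 4 / l := by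
    have : t * ((2 * s / l) ^ 4 / 4) = t * (4 * s ^ 4 / l ^ 4) := by field_simp; ring
    rw [this]
    calc _ ≤ l ^ 3 * (4 * s ^ 4 / l ^ 4) := by gcongr
      _ = _ := by field_simp
  calc _ ≤ |y| * (2 * s / l) + (8 * s ^ 3 / l + 4 * s ^ 4 / l) := by
        refine (norm_add_le _ _).trans (add_le_add h1 (h2.trans ?_))
        rw [mul_add]; exact add_le_add h5 h6
    _ = (2 * |y| * s + (8 * s ^ 3 + 4 * s ^ 4)) * l⁻¹ := by field_simp
    _ ≤ (12 * (1 + |y|) * (1 + s) ^ 4) * l⁻¹ := by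
        gcongr
        have a1 : s ≤ (1 + s) ^ 4 := by nlinarith [sq_nonneg s, sq_nonneg (s ^ 2), pow_nonneg hs0 3]
        have a2 : 8 * s ^ 3 + 4 * s ^ 4 ≤ 12 * (1 + s) ^ 4 := by
          nlinarith [sq_nonneg s, sq_nonneg (s ^ 2), pow_nonneg hs0 3]
        have a3 := mul_le_mul_of_nonneg_left a1 (abs_nonneg y)
        have a4 : 0 ≤ |y| * (1 + s) ^ 4 := by positivity
        nlinarith
    _ = _ := by ring

theorem re_quadPart {t : ℝ} (ht : 0 ≤ t) (m r : ℝ) :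
    ‖Complex.exp (quadPart t m (slant * r))‖ = Real.exp (-((lam t m * r) ^ 2 / 2)) := by
  rw [Complex.norm_exp]
  congr 1
  rw [mul_pow, lam_sq ht]
  have : quadPart t m (slant * r) = ((-(t * ell m * r ^ 2 / 2) : ℝ) : ℂ) +
      ((-(3 / 8 * t * ell m * r ^ 2) : ℝ) : ℂ) * Complex.I := by
    unfold quadPart slant
    push_cast
    linear_combination (t * ell m * r ^ 2 / 2 - t * ell m * r ^ 2 / 8 * Complex.I) * Complex.I_sq
  rw [this, Complex.add_re, Complex.ofReal_re, Complex.re_ofReal_mul, Complex.I_re]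
  ring

/-- For `|y| ≤ √t` the full integrand retains Gaussian decay. -/
theorem norm_integrand_le {t : ℝ} (ht : 1 ≤ t) {x y : ℝ} (hy : |y| ≤ √t) (r : ℝ) :
    ‖Complex.exp (-(Complex.I * y * (slant * r)) + cubicPart t (mu₁ t x) (slant * r)) *
      Complex.exp (quadPart t (mu₁ t x) (slant * r))‖ ≤
      Real.exp 2 * Real.exp (-((lam t (mu₁ t x) * r) ^ 2 / 32)) := by
  have h0 := norm_osc_mu₁_le ht x r
  -- With `y = 0` the expansion shows that `exp(cubic)` and `exp(quad)` together decay as on the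
  -- slanted line, although the first factor alone may grow.
  have h1 := osc_mu₁ (t := t) (by linarith) x 0 (slant * r)
  rw [sub_zero] at h1
  rw [h1, norm_mul, mul_comm Complex.I, Complex.norm_exp_ofReal_mul_I, one_mul, norm_mul] at h0
  simp only [Complex.ofReal_zero, mul_zero, zero_mul, neg_zero, zero_add] at h0
  rw [Complex.exp_add, norm_mul, norm_mul, mul_assoc]
  set l := lam t (mu₁ t x)
  have h2 : ‖Complex.exp (-(Complex.I * y * (slant * r)))‖ ≤ Real.exp (|l * r| / 2) := by
    rw [Complex.norm_exp, Real.exp_le_exp]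
    have e : -(Complex.I * y * (slant * r)) = ((-(y * r / 2) : ℝ) : ℂ) + ((-(y * r) : ℝ) : ℂ) * Complex.I := by
      unfold slant; push_cast; linear_combination (y * r / 2 : ℂ) * Complex.I_sq
    rw [e, Complex.add_re, Complex.ofReal_re, Complex.re_ofReal_mul, Complex.I_re, mul_zero, add_zero]
    have h3 : |y| ≤ l := hy.trans (sqrt_le_lam (by linarith) _)
    have h4 : -(y * r) ≤ |y| * |r| := by rw [← abs_mul]; exact neg_le_abs _
    rw [abs_mul, abs_of_pos (lam_pos ht _)]
    nlinarith [mul_le_mul_of_nonneg_right h3 (abs_nonneg r)]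
  calc _ ≤ Real.exp (|l * r| / 2) * Real.exp (-((l * r) ^ 2 / 16)) :=
        mul_le_mul h2 h0 (by positivity) (by positivity)
    _ ≤ _ := by
        rw [← Real.exp_add, ← Real.exp_add, Real.exp_le_exp, ← sq_abs (l * r)]
        -- The tilt by `y` costs `exp(|λr|/2)`; half of the rate `1/16` absorbs it, since `v/2 -
        -- v²/16 ≤ 2 - v²/32`. This is the origin of the `1/32` in `gaussWeight` and of the factor
        -- `e²`.
        nlinarith [sq_nonneg (|l * r| - 8)]

/-- The derivative of `kern`. -/
def kernDeriv (t x : ℝ) : ℂ := (2 * Real.pi : ℝ)⁻¹ * (Complex.I * oscMoment t x 1)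

/-- The second derivative of `kern`. -/
def kernDeriv2 (t x : ℝ) : ℂ := -((2 * Real.pi : ℝ)⁻¹ * oscMoment t x 2)

theorem inv_lam_le {t : ℝ} (ht : 1 ≤ t) (m : ℝ) : (lam t m)⁻¹ ≤ 2 / (√t * (1 + |m|)) := by
  rw [inv_eq_one_div, div_le_div_iff₀ (lam_pos ht m) (by positivity)]
  linarith [sqrt_mul_le_lam (by linarith : 0 ≤ t) m]

theorem inv_two_pi_le : (2 * Real.pi)⁻¹ ≤ 1 := inv_le_one_of_one_le₀ (by linarith [Real.pi_gt_three])

theorem norm_two_pi_inv : ‖(((2 * Real.pi)⁻¹ : ℝ) : ℂ)‖ = (2 * Real.pi)⁻¹ := by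
  rw [Complex.norm_real, Real.norm_of_nonneg (by positivity)]

/-- With `w = 1 + |μ|`, the `k`-th moment is of size `w^k λ⁻¹`, and `λ⁻¹ ≤ 2/(√t w)`. So the kernel
behaves like a function of frequency `w`: size `1/w`, second derivative `w`. The bound on the first
derivative is deliberately crude, since only its growth is needed. -/
theorem exists_kern_bounds : ∃ C : ℝ, 0 < C ∧ ∀ t : ℝ, 1 ≤ t → ∀ x : ℝ,
    ‖kern t x‖ ≤ C / √t / (1 + |mu₁ t x|) ∧ ‖kernDeriv t x‖ ≤ C / √t * (1 + |mu₁ t x|) ∧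
    ‖kernDeriv2 t x‖ ≤ C / √t * (1 + |mu₁ t x|) := by
  set M := gaussMass 0 + gaussMass 1 + gaussMass 2 + 1 with hM
  have g0 := gaussMass_nonneg 0
  have g1 := gaussMass_nonneg 1
  have g2 := gaussMass_nonneg 2
  refine ⟨16 * M, by positivity, fun t ht x => ?_⟩
  set w := 1 + |mu₁ t x| with hw
  have hw1 : 1 ≤ w := by rw [hw]; linarith [abs_nonneg (mu₁ t x)]
  have ht' : 0 < √t := Real.sqrt_pos.2 (by linarith)
  have hl := inv_lam_le ht (mu₁ t x)
  rw [← hw] at hl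
  have key : ∀ k : ℕ, k ≤ 2 → ‖oscMoment t x k‖ ≤ 8 * w ^ k * (2 / (√t * w) * M) := by
    intro k hk
    refine (norm_oscMoment_le ht x k).trans ?_
    have h1 : (2 : ℝ) ^ (k + 1) ≤ 8 := by
      calc (2 : ℝ) ^ (k + 1) ≤ 2 ^ 3 := pow_le_pow_right₀ (by norm_num) (by omega)
        _ = 8 := by norm_num
    have h2 : gaussMass k ≤ M := by interval_cases k <;> linarith
    have h3 := gaussMass_nonneg k
    have h4 : 0 < lam t (mu₁ t x) := lam_pos ht _
    gcongr
  have hp := inv_two_pi_le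
  have hp0 : 0 ≤ (2 * Real.pi)⁻¹ := by positivity
  refine ⟨?_, ?_, ?_⟩
  · unfold kern
    rw [norm_mul, norm_two_pi_inv]
    calc _ ≤ 1 * (8 * w ^ 0 * (2 / (√t * w) * M)) := by gcongr; exact key 0 (by norm_num)
      _ = _ := by field_simp; ring
  · unfold kernDeriv
    rw [norm_mul, norm_two_pi_inv, norm_mul, Complex.norm_I, one_mul]
    calc _ ≤ 1 * (8 * w ^ 1 * (2 / (√t * w) * M)) := by gcongr; exact key 1 (by norm_num)
      _ = 16 * M / √t * 1 := by field_simp; ring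
      _ ≤ _ := by gcongr
  · unfold kernDeriv2
    rw [norm_neg, norm_mul, norm_two_pi_inv]
    calc _ ≤ 1 * (8 * w ^ 2 * (2 / (√t * w) * M)) := by gcongr; exact key 2 (by norm_num)
      _ = _ := by field_simp; ring

theorem norm_lead_le {t : ℝ} (ht : 1 ≤ t) (y x : ℝ) :
    ‖lead t y x‖ ≤ 2 / √t / (1 + |mu₁ t x|) := by
  rw [norm_lead]
  have h1 : (√(2 * Real.pi))⁻¹ ≤ 1 := by
    apply inv_le_one_of_one_le₀
    rw [Real.one_le_sqrt]; linarith [Real.pi_gt_three]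
  have h2 := inv_lam_le ht (mu₁ t x)
  have h3 : 0 ≤ (lam t (mu₁ t x))⁻¹ := inv_nonneg.2 (lam_pos ht _).le
  calc _ ≤ 1 * (2 / (√t * (1 + |mu₁ t x|))) := by gcongr
    _ = _ := by rw [one_mul, div_div]

/-- The logarithmic derivative of `lead`, in terms of the stationary point. -/
def leadLog (t y m : ℝ) : ℂ := Complex.I * m - Complex.I * y * (t * ell m : ℝ)⁻¹
  - 3 * m * (t * ell m ^ 2 : ℝ)⁻¹

/-- The derivative of `leadLog` in the stationary point. -/
def leadLogDeriv (t y m : ℝ) : ℂ := Complex.I + Complex.I * y * (6 * m) * (t * ell m ^ 2 : ℝ)⁻¹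
  - 3 * (t * ell m ^ 2 : ℝ)⁻¹ + 36 * m ^ 2 * (t * ell m ^ 3 : ℝ)⁻¹

/-- The second derivative of `lead`. -/
def leadDeriv2 (t y x : ℝ) : ℂ := lead t y x * (leadLog t y (mu₁ t x) ^ 2 +
  leadLogDeriv t y (mu₁ t x) * (t * ell (mu₁ t x) : ℝ)⁻¹)

theorem hasDerivAt_ell (m : ℝ) : HasDerivAt ell (6 * m) m := by
  have := ((hasDerivAt_pow 2 m).const_mul 3).add_const 1
  exact this.congr_deriv (by push_cast; ring)

theorem hasDerivAt_lead {t : ℝ} (ht : 0 < t) (y x : ℝ) :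
    HasDerivAt (lead t y) (lead t y x * leadLog t y (mu₁ t x)) x := by
  set m := mu₁ t x with hm
  have hl0 := ell_pos m
  have hl : lam t m ≠ 0 := (Real.sqrt_pos.2 (mul_pos ht hl0)).ne'
  have hlsq : lam t m ^ 2 = t * ell m := lam_sq ht.le m
  have h1 : HasDerivAt (lam t) (t * (6 * m) / (2 * lam t m)) m :=
    ((hasDerivAt_ell m).const_mul t).sqrt (mul_pos ht hl0).ne'
  have h2 : HasDerivAt (fun m => (√(2 * Real.pi))⁻¹ * (lam t m)⁻¹)
      ((√(2 * Real.pi))⁻¹ * (lam t m)⁻¹ * (-(3 * m / ell m))) m := by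
    refine ((h1.inv hl).const_mul _).congr_deriv ?_
    rw [mul_assoc]
    congr 1
    field_simp
    rw [hlsq]; ring
  have h3 : HasDerivAt (fun m => statPhase t m - y * m - Real.pi / 4) (t * m * ell m - y) m := by
    unfold statPhase ell
    have := (((((hasDerivAt_pow 2 m).div_const 2).add ((hasDerivAt_pow 4 m).const_mul (3/4))).const_mul
      t).sub ((hasDerivAt_id' m).const_mul y)).sub_const (Real.pi / 4)
    exact this.congr_deriv (by push_cast; ring)
  have h4 : HasDerivAt (fun m : ℝ => (((√(2 * Real.pi))⁻¹ * (lam t m)⁻¹ : ℝ) : ℂ) *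
      Complex.exp (Complex.I * (statPhase t m - y * m - Real.pi / 4 : ℝ))) _ m :=
    h2.ofReal_comp.mul ((h3.ofReal_comp.const_mul Complex.I).cexp)
  have h5 := h4.scomp x (hasDerivAt_mu₁ ht x)
  refine h5.congr_deriv ?_
  rw [← hm, Complex.real_smul]
  unfold lead leadLog
  rw [← hm]
  have e1 : (t : ℂ) ≠ 0 := by exact_mod_cast ht.ne'
  have e2 : (ell m : ℂ) ≠ 0 := by exact_mod_cast hl0.ne'
  have e3 : (lam t m : ℂ) ≠ 0 := by exact_mod_cast hl
  have e4 : (√(2 * Real.pi) : ℂ) ≠ 0 := by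
    exact_mod_cast (Real.sqrt_pos.2 (by positivity : 0 < 2 * Real.pi)).ne'
  push_cast
  field_simp
  ring

theorem hasDerivAt_leadLog {t : ℝ} (ht : 0 < t) (y m : ℝ) :
    HasDerivAt (leadLog t y) (leadLogDeriv t y m) m := by
  have hl0 := ell_pos m
  have h0 : HasDerivAt (fun s : ℝ => (s : ℂ)) 1 m := Complex.ofRealCLM.hasDerivAt
  have h1 : HasDerivAt (fun m => (t * ell m)⁻¹) (-(6 * m) * (t * ell m ^ 2)⁻¹) m := by
    refine (((hasDerivAt_ell m).const_mul t).inv (mul_pos ht hl0).ne').congr_deriv ?_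
    field_simp
  have h2 : HasDerivAt (fun m => (t * ell m ^ 2)⁻¹) (-(12 * m) * (t * ell m ^ 3)⁻¹) m := by
    have h : HasDerivAt (fun m => ell m ^ 2) (2 * ell m * (6 * m)) m :=
      ((hasDerivAt_ell m).pow 2).congr_deriv (by push_cast; ring)
    refine ((h.const_mul t).inv (mul_pos ht (pow_pos hl0 2)).ne').congr_deriv ?_
    field_simp
    ring
  have h3 := ((h0.const_mul Complex.I).sub (h1.ofReal_comp.const_mul (Complex.I * y))).sub
    ((h0.const_mul 3).mul h2.ofReal_comp)
  refine (h3.congr_deriv ?_).congr_of_eventuallyEq (Filter.Eventually.of_forall fun m => ?_)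
  · unfold leadLogDeriv
    push_cast
    ring
  · simp only [leadLog, Pi.sub_apply, Pi.mul_apply]

theorem hasDerivAt_deriv_lead {t : ℝ} (ht : 0 < t) (y x : ℝ) :
    HasDerivAt (fun x => lead t y x * leadLog t y (mu₁ t x)) (leadDeriv2 t y x) x := by
  have h := (hasDerivAt_lead ht y x).mul ((hasDerivAt_leadLog ht y (mu₁ t x)).scomp x
    (hasDerivAt_mu₁ ht x))
  refine h.congr_deriv ?_
  unfold leadDeriv2
  rw [Complex.real_smul]
  simp only [Function.comp_apply]
  push_cast
  ring

/-- Differentiating the leading term is multiplication by `iμ` up to this error, caused by the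
amplitude and by the factor `exp(-iyμ)`. -/
theorem norm_leadLog_sub_le {t : ℝ} (ht : 1 ≤ t) (y m : ℝ) :
    ‖leadLog t y m - Complex.I * m‖ ≤ (|y| + 3) / (t * ell m) := by
  have hl := one_le_ell m
  have hl0 := ell_pos m
  have ht0 : 0 < t := by linarith
  have e : leadLog t y m - Complex.I * m = -(Complex.I * y * (t * ell m : ℝ)⁻¹) -
    3 * m * (t * ell m ^ 2 : ℝ)⁻¹ := by unfold leadLog; ring
  rw [e]
  refine (norm_sub_le _ _).trans ?_
  rw [norm_neg, norm_mul, norm_mul, norm_mul, norm_mul, Complex.norm_I]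
  simp only [Complex.norm_real, Real.norm_eq_abs]
  rw [abs_of_pos (by positivity : 0 < (t * ell m)⁻¹),
    abs_of_pos (by positivity : 0 < (t * ell m ^ 2)⁻¹)]
  have h3 : ‖(3 : ℂ)‖ = 3 := by simp
  rw [h3, one_mul, add_div]
  refine add_le_add (le_of_eq (by rw [div_eq_mul_inv])) ?_
  calc 3 * |m| * (t * ell m ^ 2)⁻¹ ≤ 3 * ell m * (t * ell m ^ 2)⁻¹ := by
        gcongr; exact abs_le_ell m
    _ = 3 / (t * ell m) := by field_simp

theorem norm_leadLogDeriv_le {t : ℝ} (ht : 1 ≤ t) (y m : ℝ) :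
    ‖leadLogDeriv t y m‖ ≤ 16 * (1 + |y| / t) := by
  have hl := one_le_ell m
  have hl0 := ell_pos m
  have ht0 : 0 < t := by linarith
  unfold leadLogDeriv
  have a1 : ‖Complex.I * y * (6 * m) * (t * ell m ^ 2 : ℝ)⁻¹‖ ≤ 6 * (|y| / t) := by
    rw [norm_mul, norm_mul, norm_mul, norm_mul, Complex.norm_I]
    simp only [Complex.norm_real, Real.norm_eq_abs]
    rw [abs_of_pos (by positivity : 0 < (t * ell m ^ 2)⁻¹)]
    have h3 : ‖(6 : ℂ)‖ = 6 := by simp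
    rw [h3]
    calc 1 * |y| * (6 * |m|) * (t * ell m ^ 2)⁻¹ ≤ 1 * |y| * (6 * ell m ^ 2) * (t * ell m ^ 2)⁻¹ := by
          gcongr; nlinarith [abs_le_ell m]
      _ = _ := by field_simp
  have a2 : ‖(3 : ℂ) * (t * ell m ^ 2 : ℝ)⁻¹‖ ≤ 3 := by
    rw [norm_mul, Complex.norm_real, Real.norm_of_nonneg (by positivity)]
    have h3 : ‖(3 : ℂ)‖ = 3 := by simp
    rw [h3]
    have : (t * ell m ^ 2)⁻¹ ≤ 1 := inv_le_one_of_one_le₀ (by nlinarith)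
    linarith
  have a3 : ‖(36 : ℂ) * m ^ 2 * (t * ell m ^ 3 : ℝ)⁻¹‖ ≤ 12 := by
    rw [norm_mul, norm_mul, norm_pow]
    simp only [Complex.norm_real, Real.norm_eq_abs]
    rw [abs_of_pos (by positivity : 0 < (t * ell m ^ 3)⁻¹)]
    have h3 : ‖(36 : ℂ)‖ = 36 := by simp
    rw [h3, sq_abs, ← div_eq_mul_inv, div_le_iff₀ (by positivity)]
    have b1 : 3 * m ^ 2 ≤ ell m := by unfold ell; linarith
    have b2 : ell m ≤ ell m ^ 3 := le_self_pow₀ hl (by norm_num)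
    nlinarith
  have a4 := norm_add_le (Complex.I + Complex.I * y * (6 * m) * (t * ell m ^ 2 : ℝ)⁻¹
    - 3 * (t * ell m ^ 2 : ℝ)⁻¹) (36 * m ^ 2 * (t * ell m ^ 3 : ℝ)⁻¹)
  have a5 := norm_sub_le (Complex.I + Complex.I * y * (6 * m) * (t * ell m ^ 2 : ℝ)⁻¹)
    (3 * (t * ell m ^ 2 : ℝ)⁻¹)
  have a6 := norm_add_le Complex.I (Complex.I * y * (6 * m) * (t * ell m ^ 2 : ℝ)⁻¹)
  rw [Complex.norm_I] at a6
  have : 0 ≤ |y| / t := by positivity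
  linarith

theorem norm_leadLog_le {t : ℝ} (ht : 1 ≤ t) (y m : ℝ) :
    ‖leadLog t y m‖ ≤ 3 * ((1 + |m|) * (1 + |y| / t)) := by
  have h := norm_leadLog_sub_le ht y m
  have hl := one_le_ell m
  have ht0 : 0 < t := by linarith
  have h1 : (|y| + 3) / (t * ell m) ≤ |y| / t + 3 := by
    rw [add_div]
    refine add_le_add ?_ ?_
    · apply div_le_div_of_nonneg_left (abs_nonneg y) ht0; nlinarith
    · apply div_le_self (by norm_num); nlinarith
  have h2 := norm_add_le (leadLog t y m - Complex.I * m) (Complex.I * m)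
  rw [sub_add_cancel, norm_mul, Complex.norm_I, one_mul, Complex.norm_real, Real.norm_eq_abs] at h2
  have h3 : 0 ≤ |y| / t := by positivity
  nlinarith [mul_nonneg (abs_nonneg m) h3, abs_nonneg m]

theorem norm_leadDeriv2_le {t : ℝ} (ht : 1 ≤ t) (y x : ℝ) :
    ‖leadDeriv2 t y x‖ ≤ 50 / √t * ((1 + |mu₁ t x|) * (1 + |y| / t) ^ 2) := by
  set m := mu₁ t x with hm
  have ht0 : 0 < t := by linarith
  have hs : 0 < √t := Real.sqrt_pos.2 ht0
  set Y := 1 + |y| / t with hY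
  have hY1 : 1 ≤ Y := by rw [hY]; have : 0 ≤ |y| / t := by positivity
                         linarith
  have hw : 1 ≤ 1 + |m| := by linarith [abs_nonneg m]
  have h1 := norm_lead_le ht y x
  have h2 := norm_leadLog_le ht y m
  have h3 := norm_leadLogDeriv_le ht y m
  rw [← hm] at h1
  rw [← hY] at h2 h3
  have h4 : ‖(((t * ell m)⁻¹ : ℝ) : ℂ)‖ ≤ 1 := by
    rw [Complex.norm_real, Real.norm_of_nonneg (inv_nonneg.2 (mul_pos ht0 (ell_pos m)).le)]
    exact inv_le_one_of_one_le₀ (by nlinarith [one_le_ell m])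
  have h5 : ‖leadLog t y m ^ 2 + leadLogDeriv t y m * (t * ell m : ℝ)⁻¹‖ ≤
      25 * ((1 + |m|) * Y) ^ 2 := by
    refine (norm_add_le _ _).trans ?_
    rw [norm_pow, norm_mul]
    have a1 : ‖leadLog t y m‖ ^ 2 ≤ (3 * ((1 + |m|) * Y)) ^ 2 := by gcongr
    have a2 : ‖leadLogDeriv t y m‖ * ‖(((t * ell m)⁻¹ : ℝ) : ℂ)‖ ≤ (16 * Y) * 1 := by gcongr
    have a3 : Y ≤ ((1 + |m|) * Y) ^ 2 := by
      have : 1 ≤ (1 + |m|) ^ 2 := one_le_pow₀ hw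
      have : Y ≤ Y ^ 2 := by nlinarith
      nlinarith [sq_nonneg Y]
    nlinarith
  unfold leadDeriv2
  rw [norm_mul, ← hm]
  calc _ ≤ (2 / √t / (1 + |m|)) * (25 * ((1 + |m|) * Y) ^ 2) := by gcongr
    _ = _ := by field_simp; ring

theorem norm_leadDeriv_le {t : ℝ} (ht : 1 ≤ t) (y x : ℝ) :
    ‖lead t y x * leadLog t y (mu₁ t x)‖ ≤ 6 / √t * (1 + |y| / t) := by
  have hs : 0 < √t := Real.sqrt_pos.2 (by linarith)
  have hw : 1 ≤ 1 + |mu₁ t x| := by linarith [abs_nonneg (mu₁ t x)]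
  have := norm_leadLog_le ht y (mu₁ t x)
  rw [norm_mul]
  calc _ ≤ (2 / √t / (1 + |mu₁ t x|)) * (3 * ((1 + |mu₁ t x|) * (1 + |y| / t))) := by
        gcongr; exact norm_lead_le ht y x
    _ = _ := by field_simp; ring

/-- The second derivative of the leading term is `(iμ)²` times it up to `O(1/t)`. This matches the
part `μ²` of the factor `ζ²` in the second derivative of the kernel. -/
theorem norm_leadDeriv2_add_le {t : ℝ} (ht : 1 ≤ t) {y : ℝ} (hy : |y| ≤ √t) (x : ℝ) :
    ‖leadDeriv2 t y x + mu₁ t x ^ 2 * lead t y x‖ ≤ 112 / t := by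
  set m := mu₁ t x with hm
  have ht0 : 0 < t := by linarith
  have hs : 0 < √t := Real.sqrt_pos.2 ht0
  have hss : √t ^ 2 = t := Real.sq_sqrt ht0.le
  have hs1 : 1 ≤ √t := by rwa [Real.one_le_sqrt]
  have hl := one_le_ell m
  have hl0 := ell_pos m
  -- With `δ = L - iμ` the square is split as `L² + μ² = δ(δ + 2iμ)`. The factor `ℓ⁻¹` in the bound
  -- of `δ` compensates the growth of `δ + 2iμ`.
  have e : leadDeriv2 t y x + m ^ 2 * lead t y x = lead t y x *
      ((leadLog t y m - Complex.I * m) * ((leadLog t y m - Complex.I * m) + 2 * Complex.I * m) +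
        leadLogDeriv t y m * (t * ell m : ℝ)⁻¹) := by
    unfold leadDeriv2
    rw [← hm]
    linear_combination (m ^ 2 * lead t y x : ℂ) * Complex.I_sq
  have h1 : ‖lead t y x‖ ≤ 2 / √t := by
    refine (norm_lead_le ht y x).trans (div_le_self (by positivity) ?_)
    linarith [abs_nonneg (mu₁ t x)]
  have h2 : ‖leadLog t y m - Complex.I * m‖ ≤ 4 / √t / ell m := by
    refine (norm_leadLog_sub_le ht y m).trans ?_
    rw [← div_div]
    refine div_le_div_of_nonneg_right ?_ hl0.le
    rw [div_le_div_iff₀ ht0 hs]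
    nlinarith
  have h2' : ‖leadLog t y m - Complex.I * m‖ ≤ 4 := by
    refine h2.trans ((div_le_self (by positivity) hl).trans (div_le_self (by norm_num) hs1))
  have h3 : ‖(leadLog t y m - Complex.I * m) + 2 * Complex.I * m‖ ≤ 6 * ell m := by
    refine (norm_add_le _ _).trans ?_
    rw [norm_mul, norm_mul, Complex.norm_I, Complex.norm_real, Real.norm_eq_abs]
    have h3 : ‖(2 : ℂ)‖ = 2 := by simp
    rw [h3]
    nlinarith [abs_le_ell m]
  have h4 : ‖leadLogDeriv t y m * (t * ell m : ℝ)⁻¹‖ ≤ 32 / √t := by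
    rw [norm_mul, Complex.norm_real, Real.norm_of_nonneg (inv_nonneg.2 (mul_pos ht0 hl0).le)]
    have a1 : |y| / t ≤ 1 := by
      rw [div_le_one ht0]; nlinarith
    have a2 := norm_leadLogDeriv_le ht y m
    have a3 : (t * ell m)⁻¹ ≤ 1 / √t := by
      rw [inv_eq_one_div]
      apply one_div_le_one_div_of_le hs
      nlinarith
    calc _ ≤ 32 * (1 / √t) := by
          apply mul_le_mul (by linarith) a3 (by positivity) (by norm_num)
      _ = _ := by ring
  rw [e, norm_mul]
  calc _ ≤ (2 / √t) * (4 / √t / ell m * (6 * ell m) + 32 / √t) := by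
        gcongr
        refine (norm_add_le _ _).trans (add_le_add ?_ h4)
        rw [norm_mul]
        gcongr
    _ = 112 / √t ^ 2 := by field_simp; ring
    _ = _ := by rw [hss]

theorem continuous_cubicPart (t m : ℝ) : Continuous (cubicPart t m) := by
  unfold cubicPart; fun_prop

theorem continuous_quadPart (t m : ℝ) : Continuous (quadPart t m) := by
  unfold quadPart; fun_prop

/-! ### Comparison of the one-dimensional kernel with its leading term for `|y| ≤ √t` -/

section Comparison

variable {t : ℝ} (ht : 1 ≤ t) {x y : ℝ} (hy : |y| ≤ √t)
include ht hy

theorem integrable_full_integrand (k : ℕ) : Integrable fun r : ℝ => (mu₁ t x + slant * r) ^ k *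
    (Complex.exp (-(Complex.I * y * (slant * r)) + cubicPart t (mu₁ t x) (slant * r)) *
      Complex.exp (quadPart t (mu₁ t x) (slant * r))) * slant := by
  have h := (integrable_gaussWeight_comp k (lam_pos ht (mu₁ t x))).const_mul
    ((2 * (1 + |mu₁ t x|)) ^ k * Real.exp 2 * 2)
  refine h.mono' ?_ (Filter.Eventually.of_forall fun r => ?_)
  · have := continuous_cubicPart t (mu₁ t x)
    have := continuous_quadPart t (mu₁ t x)
    exact Continuous.aestronglyMeasurable (by fun_prop)
  · have hr : |r| ≤ |lam t (mu₁ t x) * r| := by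
      rw [abs_mul, abs_of_pos (lam_pos ht _)]; nlinarith [abs_nonneg r, one_le_lam ht (mu₁ t x)]
    rw [norm_mul, norm_mul, norm_pow]
    calc _ ≤ (2 * (1 + |mu₁ t x|) * (1 + |lam t (mu₁ t x) * r|)) ^ k *
          (Real.exp 2 * Real.exp (-((lam t (mu₁ t x) * r) ^ 2 / 32))) * 2 := by
          gcongr
          · refine (norm_line_le _ _).trans ?_
            gcongr
          · exact norm_integrand_le ht hy r
          · exact norm_slant_le
      _ = _ := by unfold gaussWeight; rw [mul_pow]; ring

omit hy in
theorem integrable_quad_integrand : Integrable fun r : ℝ =>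
    Complex.exp (quadPart t (mu₁ t x) (slant * r)) * slant := by
  have h := (integrable_gaussWeight_comp 0 (lam_pos ht (mu₁ t x))).const_mul 2
  refine h.mono' ?_ (Filter.Eventually.of_forall fun r => ?_)
  · have := continuous_quadPart t (mu₁ t x)
    exact Continuous.aestronglyMeasurable (by fun_prop)
  · rw [norm_mul, re_quadPart (by linarith), mul_comm]
    unfold gaussWeight
    rw [pow_zero, one_mul]
    refine mul_le_mul norm_slant_le (Real.exp_le_exp.2 ?_) (Real.exp_pos _).le (by norm_num)
    linarith [sq_nonneg (lam t (mu₁ t x) * r)]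

theorem norm_remainder_integrand_le (r : ℝ) :
    ‖(Complex.exp (-(Complex.I * y * (slant * r)) + cubicPart t (mu₁ t x) (slant * r)) - 1) *
      Complex.exp (quadPart t (mu₁ t x) (slant * r)) * slant‖ ≤
      (12 * (1 + |y|) * (lam t (mu₁ t x))⁻¹ * (1 + Real.exp 2) * 2) *
        gaussWeight 4 (lam t (mu₁ t x) * r) := by
  set l := lam t (mu₁ t x) with hl
  have h1 := norm_exponent_le ht (mu₁ t x) y r
  have h2 := norm_integrand_le ht hy (x := x) r
  have h3 := re_quadPart (by linarith : 0 ≤ t) (mu₁ t x) r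
  set A := -(Complex.I * y * (slant * r)) + cubicPart t (mu₁ t x) (slant * r)
  set G := quadPart t (mu₁ t x) (slant * r)
  rw [norm_mul] at h2
  rw [← hl] at h1 h2 h3
  have h4 : ‖Complex.exp G‖ ≤ Real.exp (-((l * r) ^ 2 / 32)) := by
    rw [h3, Real.exp_le_exp]; linarith [sq_nonneg (l * r)]
  have hl0 : 0 < l := lam_pos ht _
  rw [norm_mul, norm_mul]
  calc _ ≤ (‖A‖ * (1 + ‖Complex.exp A‖)) * ‖Complex.exp G‖ * 2 := by
        gcongr
        · exact norm_exp_sub_one_le A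
        · exact norm_slant_le
    -- The factor `exp A` is regrouped with `exp G`, because only their product is known to decay.
    _ = ‖A‖ * (‖Complex.exp G‖ + ‖Complex.exp A‖ * ‖Complex.exp G‖) * 2 := by ring
    _ ≤ (12 * (1 + |y|) * l⁻¹ * (1 + |l * r|) ^ 4) *
        (Real.exp (-((l * r) ^ 2 / 32)) + Real.exp 2 * Real.exp (-((l * r) ^ 2 / 32))) * 2 := by
        gcongr
    _ = _ := by unfold gaussWeight; ring

/-- One power of `λ⁻¹` comes from the size of the neglected exponent and one from the integration,
and `λ⁻² = (tℓ)⁻¹`. -/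
theorem norm_kern_sub_lead_le : ‖kern t (x - y) - lead t y x‖ ≤
    24 * (1 + Real.exp 2) * gaussMass 4 * ((1 + |y|) / (t * ell (mu₁ t x))) := by
  have ht0 : 0 < t := by linarith
  have hi1 := integrable_full_integrand ht hy (x := x) 0
  have hi2 := integrable_quad_integrand ht (x := x)
  have hl0 : 0 < lam t (mu₁ t x) := lam_pos ht _
  unfold kern
  rw [kern_sub_eq_integral ht0 0 y x, lead_eq_integral ht0, ← mul_sub, ← mul_sub,
    ← integral_sub hi1 hi2, norm_mul, norm_mul, norm_two_pi_inv,
    mul_comm Complex.I, Complex.norm_exp_ofReal_mul_I, one_mul]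
  have hb := norm_integral_le_gaussMass (k := 4) hl0 (norm_remainder_integrand_le ht hy (x := x))
  have e : ∀ r : ℝ, (mu₁ t x + slant * r) ^ 0 *
      (Complex.exp (-(Complex.I * y * (slant * r)) + cubicPart t (mu₁ t x) (slant * r)) *
      Complex.exp (quadPart t (mu₁ t x) (slant * r))) * slant -
      Complex.exp (quadPart t (mu₁ t x) (slant * r)) * slant =
      (Complex.exp (-(Complex.I * y * (slant * r)) + cubicPart t (mu₁ t x) (slant * r)) - 1) *
      Complex.exp (quadPart t (mu₁ t x) (slant * r)) * slant := fun r => by ring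
  simp_rw [e]
  have hp := inv_two_pi_le
  calc _ ≤ 1 * _ := mul_le_mul hp hb (norm_nonneg _) zero_le_one
    _ = 24 * (1 + Real.exp 2) * gaussMass 4 * ((1 + |y|) * ((lam t (mu₁ t x)) ^ 2)⁻¹) := by
        ring
    _ = _ := by rw [lam_sq ht0.le, div_eq_mul_inv]

/-- The factor `ζ² = μ² + z(2μ + z)` cancels the gain `ℓ⁻¹` of the undifferentiated bound: the part
`μ²` because `μ² ≤ ℓ`, the other because `z` gains `λ⁻¹` and `1 + |μ| ≤ 2ℓ`. Hence `1/t` without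
`ℓ⁻¹`. -/
theorem norm_kernDeriv2_sub_le : ‖kernDeriv2 t (x - y) - leadDeriv2 t y x‖ ≤
    (24 * (1 + Real.exp 2) * gaussMass 4 + 32 * Real.exp 2 * gaussMass 2 + 112) *
      ((1 + |y|) / t) := by
  have ht0 : 0 < t := by linarith
  set m := mu₁ t x with hm
  have hi1 := integrable_full_integrand ht hy (x := x) 2
  have hi2 := (integrable_quad_integrand ht (x := x)).const_mul (m ^ 2 : ℂ)
  have hl0 : 0 < lam t m := lam_pos ht _
  have hl1 : 1 ≤ lam t m := one_le_lam ht _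
  have hell := ell_pos m
  have key : ‖(((2 * Real.pi)⁻¹ : ℝ) : ℂ) * oscMoment t (x - y) 2 - m ^ 2 * lead t y x‖ ≤
      (24 * (1 + Real.exp 2) * gaussMass 4 + 32 * Real.exp 2 * gaussMass 2) * ((1 + |y|) / t) := by
    have e0 : ∀ a b c d : ℂ, a * (b * c) - m ^ 2 * (a * (b * d)) = a * (b * (c - m ^ 2 * d)) :=
      fun a b c d => by ring
    rw [kern_sub_eq_integral ht0 2 y x, lead_eq_integral ht0, e0, ← integral_const_mul,
      ← integral_sub hi1 hi2, norm_mul, norm_mul, norm_two_pi_inv,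
      mul_comm Complex.I, Complex.norm_exp_ofReal_mul_I, one_mul]
    have e : ∀ r : ℝ, (m + slant * r) ^ 2 *
        (Complex.exp (-(Complex.I * y * (slant * r)) + cubicPart t m (slant * r)) *
        Complex.exp (quadPart t m (slant * r))) * slant -
        m ^ 2 * (Complex.exp (quadPart t m (slant * r)) * slant) =
        m ^ 2 * ((Complex.exp (-(Complex.I * y * (slant * r)) + cubicPart t m (slant * r)) - 1) *
          Complex.exp (quadPart t m (slant * r)) * slant) +
        (slant * r) * (2 * m + slant * r) *
          (Complex.exp (-(Complex.I * y * (slant * r)) + cubicPart t m (slant * r)) *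
          Complex.exp (quadPart t m (slant * r))) * slant := fun r => by ring
    rw [← hm]
    simp_rw [e]
    have hb1 : ∀ r : ℝ, ‖m ^ 2 * ((Complex.exp (-(Complex.I * y * (slant * r)) +
        cubicPart t m (slant * r)) - 1) * Complex.exp (quadPart t m (slant * r)) * slant)‖ ≤
        m ^ 2 * (12 * (1 + |y|) * (lam t m)⁻¹ * (1 + Real.exp 2) * 2) *
          gaussWeight 4 (lam t m * r) := by
      intro r
      rw [norm_mul, norm_pow, Complex.norm_real, Real.norm_eq_abs, sq_abs]
      refine (mul_le_mul_of_nonneg_left (norm_remainder_integrand_le ht hy (x := x) r)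
        (sq_nonneg m)).trans (le_of_eq ?_)
      rw [← mul_assoc]
    have hb2 : ∀ r : ℝ, ‖(slant * r) * (2 * m + slant * r) *
          (Complex.exp (-(Complex.I * y * (slant * r)) + cubicPart t m (slant * r)) *
          Complex.exp (quadPart t m (slant * r))) * slant‖ ≤
          (8 * (1 + |m|) * (lam t m)⁻¹ * Real.exp 2) * gaussWeight 2 (lam t m * r) := by
      intro r
      set s := |lam t m * r| with hs
      have hs0 : 0 ≤ s := abs_nonneg _
      have hr : |r| = (lam t m)⁻¹ * s := by
        rw [hs, abs_mul, abs_of_pos hl0]; field_simp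
      have hr' : |r| ≤ s := by
        rw [hs, abs_mul, abs_of_pos hl0]; nlinarith [abs_nonneg r]
      have a1 := norm_slant_mul_le r
      have a2 : ‖2 * (m : ℂ) + slant * r‖ ≤ 2 * (1 + |m|) * (1 + s) := by
        refine (norm_add_le _ _).trans ?_
        rw [norm_mul, Complex.norm_real, Real.norm_eq_abs]
        have h3 : ‖(2 : ℂ)‖ = 2 := by simp
        rw [h3]
        nlinarith [abs_nonneg m, mul_nonneg (abs_nonneg m) hs0]
      rw [norm_mul, norm_mul, norm_mul]
      calc _ ≤ (2 * ((lam t m)⁻¹ * s)) * (2 * (1 + |m|) * (1 + s)) *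
            (Real.exp 2 * Real.exp (-((lam t m * r) ^ 2 / 32))) * 2 := by
            gcongr
            · rw [← hr]; exact a1
            · exact norm_integrand_le ht hy r
            · exact norm_slant_le
        _ ≤ (2 * ((lam t m)⁻¹ * (1 + s))) * (2 * (1 + |m|) * (1 + s)) *
            (Real.exp 2 * Real.exp (-((lam t m * r) ^ 2 / 32))) * 2 := by
            gcongr; linarith
        _ = _ := by unfold gaussWeight; rw [← hs]; ring
    have hint1 : Integrable fun r : ℝ => (m : ℂ) ^ 2 * ((Complex.exp (-(Complex.I * y * (slant * r)) +
        cubicPart t m (slant * r)) - 1) * Complex.exp (quadPart t m (slant * r)) * slant) := by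
      refine ((integrable_gaussWeight_comp 4 hl0).const_mul _).mono' ?_
        (Filter.Eventually.of_forall hb1)
      have := continuous_cubicPart t m
      have := continuous_quadPart t m
      exact Continuous.aestronglyMeasurable (by fun_prop)
    have hint2 : Integrable fun r : ℝ => (slant * r) * (2 * m + slant * r) *
          (Complex.exp (-(Complex.I * y * (slant * r)) + cubicPart t m (slant * r)) *
          Complex.exp (quadPart t m (slant * r))) * slant := by
      refine ((integrable_gaussWeight_comp 2 hl0).const_mul _).mono' ?_
        (Filter.Eventually.of_forall hb2)
      have := continuous_cubicPart t m
      have := continuous_quadPart t m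
      exact Continuous.aestronglyMeasurable (by fun_prop)
    rw [integral_add hint1 hint2]
    have c1 := norm_integral_le_gaussMass hl0 hb1
    have c2 := norm_integral_le_gaussMass hl0 hb2
    have hlsq : lam t m ^ 2 = t * ell m := lam_sq ht0.le m
    have g4 := gaussMass_nonneg 4
    have g2 := gaussMass_nonneg 2
    have hy0 := abs_nonneg y
    have d1 : m ^ 2 * (12 * (1 + |y|) * (lam t m)⁻¹ * (1 + Real.exp 2) * 2) *
        ((lam t m)⁻¹ * gaussMass 4) ≤ 24 * (1 + Real.exp 2) * gaussMass 4 * ((1 + |y|) / t) := by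
      have : m ^ 2 * (12 * (1 + |y|) * (lam t m)⁻¹ * (1 + Real.exp 2) * 2) *
        ((lam t m)⁻¹ * gaussMass 4) = 24 * (1 + Real.exp 2) * gaussMass 4 *
          ((1 + |y|) * (m ^ 2 * (lam t m ^ 2)⁻¹)) := by ring
      rw [this, div_eq_mul_inv]
      gcongr
      rw [hlsq, ← div_eq_mul_inv, inv_eq_one_div, div_le_div_iff₀ (by positivity) ht0]
      unfold ell; nlinarith [sq_nonneg m]
    have d2 : (8 * (1 + |m|) * (lam t m)⁻¹ * Real.exp 2) * ((lam t m)⁻¹ * gaussMass 2) ≤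
        32 * Real.exp 2 * gaussMass 2 * ((1 + |y|) / t) := by
      have : (8 * (1 + |m|) * (lam t m)⁻¹ * Real.exp 2) * ((lam t m)⁻¹ * gaussMass 2) =
        Real.exp 2 * gaussMass 2 * (8 * (1 + |m|) * (lam t m ^ 2)⁻¹) := by ring
      rw [this, show 32 * Real.exp 2 * gaussMass 2 * ((1 + |y|) / t) =
        Real.exp 2 * gaussMass 2 * (32 * ((1 + |y|) / t)) by ring]
      refine mul_le_mul_of_nonneg_left ?_ (by positivity)
      rw [hlsq, ← div_eq_mul_inv, ← mul_div_assoc, div_le_div_iff₀ (by positivity) ht0]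
      have : 1 + |m| ≤ 2 * ell m := by linarith [abs_le_ell m, one_le_ell m]
      nlinarith [mul_le_mul_of_nonneg_right this ht0.le, mul_nonneg hy0 (mul_pos ht0 hell).le]
    have hp := inv_two_pi_le
    refine (mul_le_of_le_one_left (norm_nonneg _) hp).trans ?_
    rw [add_mul]
    exact (norm_add_le _ _).trans (add_le_add (c1.trans d1) (c2.trans d2))
  have h2 := norm_leadDeriv2_add_le ht hy x
  -- The quantity `-μ² lead` is inserted between the two second derivatives.
  have e : kernDeriv2 t (x - y) - leadDeriv2 t y x =
      -((((2 * Real.pi)⁻¹ : ℝ) : ℂ) * oscMoment t (x - y) 2 - m ^ 2 * lead t y x) -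
      (leadDeriv2 t y x + m ^ 2 * lead t y x) := by unfold kernDeriv2; ring
  rw [e]
  refine (norm_sub_le _ _).trans ?_
  rw [norm_neg, add_mul]
  refine add_le_add key (h2.trans ?_)
  rw [div_eq_mul_inv, div_eq_mul_inv]
  have : 0 ≤ |y| * t⁻¹ := by positivity
  nlinarith

end Comparison

/-! ### The heat semigroup applied to `1 - ∂²` -/

/-- The heat kernel on the line. -/
def gaussKer (σ h : ℝ) : ℝ := (√(4 * Real.pi * σ))⁻¹ * Real.exp (-(h ^ 2 / (4 * σ)))

/-- The convolution kernel of `(1 - ∂²) e^{-σ (1 - ∂²)}`. -/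
def heatKer (σ h : ℝ) : ℝ :=
  Real.exp (-σ) * (gaussKer σ h * (1 + 1 / (2 * σ) - h ^ 2 / (4 * σ ^ 2)))

/-- A Gaussian majorant with total mass `2`. -/
def wideKer (σ h : ℝ) : ℝ := (√(4 * Real.pi * σ))⁻¹ * Real.exp (-(1 / (16 * σ)) * h ^ 2)

theorem gaussKer_nonneg (σ h : ℝ) : 0 ≤ gaussKer σ h := by unfold gaussKer; positivity

theorem wideKer_nonneg (σ h : ℝ) : 0 ≤ wideKer σ h := by unfold wideKer; positivity

theorem integrable_wideKer {σ : ℝ} (hσ : 0 < σ) : Integrable (wideKer σ) :=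
  (integrable_exp_neg_mul_sq (by positivity)).const_mul _

theorem integral_wideKer {σ : ℝ} (hσ : 0 < σ) : ∫ h, wideKer σ h = 2 := by
  unfold wideKer
  rw [integral_const_mul, integral_gaussian]
  have : Real.pi / (1 / (16 * σ)) = 2 ^ 2 * (4 * Real.pi * σ) := by field_simp; ring
  rw [this, Real.sqrt_mul (by norm_num : (0:ℝ) ≤ 2 ^ 2) (4 * Real.pi * σ), Real.sqrt_sq (by norm_num)]
  have h0 : √(4 * Real.pi * σ) ≠ 0 := (Real.sqrt_pos.2 (by positivity)).ne'
  field_simp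

theorem self_le_exp (u : ℝ) : u ≤ Real.exp u := by linarith [Real.add_one_le_exp u]

/-- From `u e^{-u} ≤ 1`, applied to half of the exponential; the other half is retained. -/
theorem sq_mul_exp_le {σ : ℝ} (hσ : 0 < σ) (h a : ℝ) (ha : 0 < a) :
    h ^ 2 * Real.exp (-(h ^ 2 / (a * σ))) ≤
      2 * a * σ * Real.exp (-(h ^ 2 / (2 * a * σ))) := by
  have h1 := self_le_exp (h ^ 2 / (2 * a * σ))
  have h2 : Real.exp (-(h ^ 2 / (a * σ))) = Real.exp (-(h ^ 2 / (2 * a * σ))) *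
      Real.exp (-(h ^ 2 / (2 * a * σ))) := by
    rw [← Real.exp_add]; congr 1; field_simp; ring
  have h3 : Real.exp (h ^ 2 / (2 * a * σ)) * Real.exp (-(h ^ 2 / (2 * a * σ))) = 1 := by
    rw [← Real.exp_add]; simp
  rw [h2]
  have h4 : h ^ 2 = 2 * a * σ * (h ^ 2 / (2 * a * σ)) := by field_simp
  have h5 : (h ^ 2 / (2 * a * σ)) * Real.exp (-(h ^ 2 / (2 * a * σ))) ≤ 1 := by
    rw [← h3]; gcongr
  calc h ^ 2 * (Real.exp (-(h ^ 2 / (2 * a * σ))) * Real.exp (-(h ^ 2 / (2 * a * σ))))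
      = 2 * a * σ * ((h ^ 2 / (2 * a * σ)) * Real.exp (-(h ^ 2 / (2 * a * σ)))) *
        Real.exp (-(h ^ 2 / (2 * a * σ))) := by
        nth_rewrite 1 [h4]; ring
    _ ≤ 2 * a * σ * 1 * Real.exp (-(h ^ 2 / (2 * a * σ))) := by gcongr
    _ = _ := by ring

/-- A linear weight is absorbed by widening the Gaussian, at the price of a factor growing linearly
in `σ`. The factor `e^{-σ}` in the heat operators compensates this growth. -/
theorem one_add_abs_mul_exp_le {σ : ℝ} (hσ : 0 < σ) (h : ℝ) :
    (1 + |h|) * ((√(4 * Real.pi * σ))⁻¹ * Real.exp (-(h ^ 2 / (8 * σ)))) ≤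
      (2 + 16 * σ) * wideKer σ h := by
  have h1 := sq_mul_exp_le hσ h 8 (by norm_num)
  have e : -(h ^ 2 / (2 * 8 * σ)) = -(1 / (16 * σ)) * h ^ 2 := by field_simp; ring
  rw [e] at h1
  have h2 : 1 + |h| ≤ 2 + h ^ 2 := by nlinarith [sq_abs h, sq_nonneg (|h| - 1)]
  have h3 : Real.exp (-(h ^ 2 / (8 * σ))) ≤ Real.exp (-(1 / (16 * σ)) * h ^ 2) := by
    rw [Real.exp_le_exp, ← e]
    have : h ^ 2 / (2 * 8 * σ) ≤ h ^ 2 / (8 * σ) := by gcongr; linarith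
    linarith
  unfold wideKer
  have h4 : (1 + |h|) * Real.exp (-(h ^ 2 / (8 * σ))) ≤
      (2 + 16 * σ) * Real.exp (-(1 / (16 * σ)) * h ^ 2) := by
    calc _ ≤ (2 + h ^ 2) * Real.exp (-(h ^ 2 / (8 * σ))) := by gcongr
      _ = 2 * Real.exp (-(h ^ 2 / (8 * σ))) + h ^ 2 * Real.exp (-(h ^ 2 / (8 * σ))) := by ring
      _ ≤ 2 * Real.exp (-(1 / (16 * σ)) * h ^ 2) +
          2 * 8 * σ * Real.exp (-(1 / (16 * σ)) * h ^ 2) := by gcongr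
      _ = _ := by ring
  have h5 : 0 ≤ (√(4 * Real.pi * σ))⁻¹ := by positivity
  calc _ = (√(4 * Real.pi * σ))⁻¹ * ((1 + |h|) * Real.exp (-(h ^ 2 / (8 * σ)))) := by ring
    _ ≤ (√(4 * Real.pi * σ))⁻¹ * ((2 + 16 * σ) * Real.exp (-(1 / (16 * σ)) * h ^ 2)) := by gcongr
    _ = _ := by ring

theorem one_add_abs_mul_gaussKer_le {σ : ℝ} (hσ : 0 < σ) (h : ℝ) :
    (1 + |h|) * gaussKer σ h ≤ (2 + 16 * σ) * wideKer σ h := by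
  refine le_trans ?_ (one_add_abs_mul_exp_le hσ h)
  unfold gaussKer
  gcongr
  linarith

theorem sq_mul_gaussKer_le {σ : ℝ} (hσ : 0 < σ) (h : ℝ) :
    h ^ 2 / (4 * σ ^ 2) * gaussKer σ h ≤
      2 / σ * ((√(4 * Real.pi * σ))⁻¹ * Real.exp (-(h ^ 2 / (8 * σ)))) := by
  have h1 := sq_mul_exp_le hσ h 4 (by norm_num)
  have e : 2 * 4 * σ = 8 * σ := by ring
  rw [e] at h1
  have h5 : 0 ≤ (√(4 * Real.pi * σ))⁻¹ := by positivity
  unfold gaussKer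
  calc _ = (√(4 * Real.pi * σ))⁻¹ / (4 * σ ^ 2) * (h ^ 2 * Real.exp (-(h ^ 2 / (4 * σ)))) := by ring
    _ ≤ (√(4 * Real.pi * σ))⁻¹ / (4 * σ ^ 2) * (8 * σ * Real.exp (-(h ^ 2 / (8 * σ)))) := by gcongr
    _ = _ := by field_simp; norm_num

theorem abs_heatKer_le {σ : ℝ} (hσ : 0 < σ) (h : ℝ) : |heatKer σ h| ≤
    Real.exp (-σ) * (1 + 3 / σ) * ((√(4 * Real.pi * σ))⁻¹ * Real.exp (-(h ^ 2 / (8 * σ)))) := by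
  have h1 := sq_mul_gaussKer_le hσ h
  have h0 := gaussKer_nonneg σ h
  have h2 : gaussKer σ h ≤ (√(4 * Real.pi * σ))⁻¹ * Real.exp (-(h ^ 2 / (8 * σ))) := by
    unfold gaussKer; gcongr; linarith
  set E := (√(4 * Real.pi * σ))⁻¹ * Real.exp (-(h ^ 2 / (8 * σ)))
  have hE : 0 ≤ E := h0.trans h2
  unfold heatKer
  rw [abs_mul, abs_of_pos (Real.exp_pos _), mul_assoc]
  refine mul_le_mul_of_nonneg_left ?_ (Real.exp_pos _).le
  have h3 : |gaussKer σ h * (1 + 1 / (2 * σ) - h ^ 2 / (4 * σ ^ 2))| ≤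
      gaussKer σ h * (1 + 1 / (2 * σ)) + h ^ 2 / (4 * σ ^ 2) * gaussKer σ h := by
    have a1 : 0 ≤ gaussKer σ h * (1 + 1 / (2 * σ)) := by positivity
    have a2 : 0 ≤ h ^ 2 / (4 * σ ^ 2) * gaussKer σ h := by positivity
    rw [abs_le]; constructor <;> nlinarith
  have h4 : gaussKer σ h * (1 + 1 / (2 * σ)) ≤ E * (1 + 1 / σ) := by
    have : 1 / (2 * σ) ≤ 1 / σ := by gcongr; linarith
    gcongr
  calc _ ≤ E * (1 + 1 / σ) + 2 / σ * E := h3.trans (add_le_add h4 h1)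
    _ = _ := by ring

theorem one_add_abs_mul_heatKer_le {σ : ℝ} (hσ : 0 < σ) (h : ℝ) :
    (1 + |h|) * |heatKer σ h| ≤ 50 / σ * wideKer σ h := by
  have h1 := abs_heatKer_le hσ h
  have h2 := one_add_abs_mul_exp_le hσ h
  -- The numerator is `(σ + 3)(2 + 16σ) = 16σ² + 50σ + 6`, which is at most `50(1 + σ + σ²/2) ≤ 50
  -- e^σ`.
  have h3 : Real.exp (-σ) * (1 + 3 / σ) * (2 + 16 * σ) ≤ 50 / σ := by
    have e := Real.quadratic_le_exp_of_nonneg hσ.le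
    have : Real.exp (-σ) * (1 + 3 / σ) * (2 + 16 * σ) =
      Real.exp (-σ) * ((σ + 3) * (2 + 16 * σ)) / σ := by field_simp
    rw [this]
    gcongr
    rw [Real.exp_neg, inv_mul_le_iff₀ (Real.exp_pos _)]
    nlinarith
  have hw := wideKer_nonneg σ h
  calc _ ≤ (1 + |h|) * (Real.exp (-σ) * (1 + 3 / σ) *
        ((√(4 * Real.pi * σ))⁻¹ * Real.exp (-(h ^ 2 / (8 * σ))))) := by gcongr
    _ = Real.exp (-σ) * (1 + 3 / σ) * ((1 + |h|) *
        ((√(4 * Real.pi * σ))⁻¹ * Real.exp (-(h ^ 2 / (8 * σ))))) := by ring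
    _ ≤ Real.exp (-σ) * (1 + 3 / σ) * ((2 + 16 * σ) * wideKer σ h) := by gcongr
    _ = Real.exp (-σ) * (1 + 3 / σ) * (2 + 16 * σ) * wideKer σ h := by ring
    _ ≤ _ := by gcongr

theorem continuous_gaussKer (σ : ℝ) : Continuous (gaussKer σ) := by unfold gaussKer; fun_prop

theorem continuous_heatKer (σ : ℝ) : Continuous (heatKer σ) := by
  unfold heatKer; have := continuous_gaussKer σ; fun_prop

theorem measurable_heatKer : Measurable (Function.uncurry heatKer) := by
  unfold Function.uncurry heatKer gaussKer; fun_prop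

theorem abs_heatKer_le_wideKer {σ : ℝ} (hσ : 0 < σ) (h : ℝ) :
    |heatKer σ h| ≤ 50 / σ * wideKer σ h := by
  refine le_trans ?_ (one_add_abs_mul_heatKer_le hσ h)
  nlinarith [abs_nonneg h, abs_nonneg (heatKer σ h)]

theorem integrable_heatKer {σ : ℝ} (hσ : 0 < σ) : Integrable (heatKer σ) :=
  ((integrable_wideKer hσ).const_mul (50 / σ)).mono' (continuous_heatKer σ).aestronglyMeasurable
    (Filter.Eventually.of_forall fun h => abs_heatKer_le_wideKer hσ h)

/-- Integration against the kernel `heatKer`. -/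
def heatOp (φ : ℝ → ℂ) (σ : ℝ) : ℂ := ∫ h, (heatKer σ h : ℂ) * φ h

/-- The bound for functions of small size, without regularity: the mass of the kernel of
`(1-∂²)e^{-σ(1-∂²)}` is of order `1/σ`, even with the weight `1 + |h|`. -/
theorem norm_heatOp_le {φ : ℝ → ℂ} {M : ℝ} (hφ : ∀ h, ‖φ h‖ ≤ M * (1 + |h|)) {σ : ℝ}
    (hσ : 0 < σ) : ‖heatOp φ σ‖ ≤ 100 * M / σ := by
  have hM : 0 ≤ M := by have := (norm_nonneg _).trans (hφ 0); simpa using this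
  calc _ ≤ ∫ h, M * (50 / σ * wideKer σ h) := by
        refine norm_integral_le_of_norm_le (((integrable_wideKer hσ).const_mul _).const_mul _)
          (Filter.Eventually.of_forall fun h => ?_)
        rw [norm_mul, Complex.norm_real, Real.norm_eq_abs]
        calc _ ≤ |heatKer σ h| * (M * (1 + |h|)) := by gcongr; exact hφ h
          _ = M * ((1 + |h|) * |heatKer σ h|) := by ring
          _ ≤ _ := by exact mul_le_mul_of_nonneg_left (one_add_abs_mul_heatKer_le hσ h) (by positivity)
    _ = _ := by rw [integral_const_mul, integral_const_mul, integral_wideKer hσ]; ring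

theorem hasDerivAt_gaussKer {σ : ℝ} (hσ : 0 < σ) (h : ℝ) :
    HasDerivAt (gaussKer σ) (-(h / (2 * σ)) * gaussKer σ h) h := by
  unfold gaussKer
  have : HasDerivAt (fun h : ℝ => -(h ^ 2 / (4 * σ))) (-(h / (2 * σ))) h :=
    ((hasDerivAt_pow 2 h).div_const (4 * σ)).neg.congr_deriv (by push_cast; field_simp; ring)
  exact (this.exp.const_mul _).congr_deriv (by ring)

/-- The smoothing identity `(1 - ∂²) e^{σ ∂²} φ = e^{σ ∂²} (φ - φ'')`. -/
theorem heatOp_eq {φ φ' φ'' : ℝ → ℂ} (h1 : ∀ h, HasDerivAt φ (φ' h) h)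
    (h2 : ∀ h, HasDerivAt φ' (φ'' h) h) (hc : AEStronglyMeasurable φ'') {M : ℝ}
    (hφ : ∀ h, ‖φ h‖ ≤ M * (1 + |h|)) (hφ' : ∀ h, ‖φ' h‖ ≤ M * (1 + |h|))
    (hφ'' : ∀ h, ‖φ'' h‖ ≤ M * (1 + |h|)) {σ : ℝ} (hσ : 0 < σ) :
    heatOp φ σ = Real.exp (-σ) * ∫ h, (gaussKer σ h : ℂ) * (φ h - φ'' h) := by
  have hM : 0 ≤ M := by have := (norm_nonneg _).trans (hφ 0); simpa using this
  have cφ : Continuous φ := continuous_iff_continuousAt.2 fun h => (h1 h).continuousAt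
  have cφ' : Continuous φ' := continuous_iff_continuousAt.2 fun h => (h2 h).continuousAt
  have cG := continuous_gaussKer σ
  have dom : ∀ (F : ℝ → ℂ), AEStronglyMeasurable F → (∀ h, ‖F h‖ ≤ M * (1 + |h|)) →
      Integrable fun h => (gaussKer σ h : ℂ) * F h := by
    intro F hF hb
    refine ((integrable_wideKer hσ).const_mul (M * (2 + 16 * σ))).mono'
      ((Complex.continuous_ofReal.comp cG).aestronglyMeasurable.mul hF)
      (Filter.Eventually.of_forall fun h => ?_)
    rw [norm_mul, Complex.norm_real, Real.norm_of_nonneg (gaussKer_nonneg σ h)]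
    calc _ ≤ gaussKer σ h * (M * (1 + |h|)) := by
          gcongr
          · exact gaussKer_nonneg σ h
          · exact hb h
      _ = M * ((1 + |h|) * gaussKer σ h) := by ring
      _ ≤ M * ((2 + 16 * σ) * wideKer σ h) := by exact mul_le_mul_of_nonneg_left (one_add_abs_mul_gaussKer_le hσ h) (by positivity)
      _ = _ := by ring
  have i0 := dom φ cφ.aestronglyMeasurable hφ
  have i1 := dom φ' cφ'.aestronglyMeasurable hφ'
  have i2 := dom φ'' hc hφ''
  have iH : Integrable fun h => (heatKer σ h : ℂ) * φ h := by
    refine ((integrable_wideKer hσ).const_mul (M * (50 / σ))).mono'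
      ((Complex.continuous_ofReal.comp (continuous_heatKer σ)).mul cφ).aestronglyMeasurable
      (Filter.Eventually.of_forall fun h => ?_)
    rw [norm_mul, Complex.norm_real, Real.norm_eq_abs]
    calc _ ≤ |heatKer σ h| * (M * (1 + |h|)) := by gcongr; exact hφ h
      _ = M * ((1 + |h|) * |heatKer σ h|) := by ring
      _ ≤ M * (50 / σ * wideKer σ h) := by exact mul_le_mul_of_nonneg_left (one_add_abs_mul_heatKer_le hσ h) (by positivity)
      _ = _ := by ring
  have ihG : ∀ a : ℝ, (heatKer σ a : ℂ) = Real.exp (-σ) * ((gaussKer σ a : ℂ) -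
      (gaussKer σ a * (a ^ 2 / (4 * σ ^ 2) - 1 / (2 * σ)) : ℝ)) := by
    intro a; unfold heatKer; push_cast; ring
  have i3 : Integrable fun h =>
      ((gaussKer σ h * (h ^ 2 / (4 * σ ^ 2) - 1 / (2 * σ)) : ℝ) : ℂ) * φ h := by
    have := i0.sub (iH.const_mul (Real.exp σ : ℂ))
    refine this.congr (Filter.Eventually.of_forall fun h => ?_)
    simp only [Pi.sub_apply]
    rw [ihG]
    have e : (Real.exp σ : ℂ) * Real.exp (-σ) = 1 := by
      rw [← Complex.ofReal_mul, ← Real.exp_add]; simp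
    push_cast at e ⊢
    linear_combination (-((gaussKer σ h : ℂ) -
      (gaussKer σ h * (h ^ 2 / (4 * σ ^ 2) - 1 / (2 * σ)))) * φ h) * e
  -- `Φ = G'φ - Gφ'` is a primitive of `G''φ - Gφ''`; its integrability and that of its derivative
  -- give both integrations by parts at once.
  set Φ : ℝ → ℂ := fun h => ((-(h / (2 * σ)) * gaussKer σ h : ℝ) : ℂ) * φ h -
    (gaussKer σ h : ℂ) * φ' h with hΦ
  have dΦ : ∀ h, HasDerivAt Φ (((gaussKer σ h * (h ^ 2 / (4 * σ ^ 2) - 1 / (2 * σ)) : ℝ) : ℂ) * φ h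
      - (gaussKer σ h : ℂ) * φ'' h) h := by
    intro h
    have g1 := hasDerivAt_gaussKer hσ h
    have g2 : HasDerivAt (fun h => -(h / (2 * σ)) * gaussKer σ h)
        (gaussKer σ h * (h ^ 2 / (4 * σ ^ 2) - 1 / (2 * σ))) h :=
      (((hasDerivAt_id' h).div_const (2 * σ)).fun_neg.mul g1).congr_deriv (by field_simp; ring)
    refine ((g2.ofReal_comp.mul (h1 h)).sub (g1.ofReal_comp.mul (h2 h))).congr_deriv ?_
    push_cast; ring
  have iΦ : Integrable Φ := by
    refine Integrable.sub ?_ i1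
    have hb : ∀ h : ℝ, |h| * gaussKer σ h * (1 + |h|) ≤
        2 * ((h ^ 2 / (4 * σ ^ 2) * gaussKer σ h) * (4 * σ ^ 2)) + 1 * gaussKer σ h := by
      intro h
      have e : h ^ 2 / (4 * σ ^ 2) * gaussKer σ h * (4 * σ ^ 2) = h ^ 2 * gaussKer σ h := by
        field_simp
      rw [e]
      have : |h| * (1 + |h|) ≤ 2 * h ^ 2 + 1 := by nlinarith [sq_abs h, sq_nonneg (|h| - 1/2)]
      nlinarith [gaussKer_nonneg σ h]
    have hexp : ∀ h : ℝ, (√(4 * Real.pi * σ))⁻¹ * Real.exp (-(h ^ 2 / (8 * σ))) ≤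
        (2 + 16 * σ) * wideKer σ h := fun h => by
      refine le_trans ?_ (one_add_abs_mul_exp_le hσ h)
      have : 0 ≤ (√(4 * Real.pi * σ))⁻¹ * Real.exp (-(h ^ 2 / (8 * σ))) := by positivity
      nlinarith [abs_nonneg h]
    refine ((integrable_wideKer hσ).const_mul (M / (2 * σ) * ((16 * σ + 1) * (2 + 16 * σ)))).mono' ?_
      (Filter.Eventually.of_forall fun h => ?_)
    · exact Continuous.aestronglyMeasurable (by fun_prop)
    · rw [norm_mul, Complex.norm_real, Real.norm_eq_abs, abs_mul, abs_neg, abs_div,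
        abs_of_nonneg (gaussKer_nonneg σ h), abs_of_pos (by positivity : 0 < 2 * σ)]
      have hs := sq_mul_gaussKer_le hσ h
      have hg : gaussKer σ h ≤ (2 + 16 * σ) * wideKer σ h := by
        refine le_trans ?_ (one_add_abs_mul_gaussKer_le hσ h)
        nlinarith [abs_nonneg h, gaussKer_nonneg σ h]
      calc _ ≤ |h| / (2 * σ) * gaussKer σ h * (M * (1 + |h|)) := by
            have := gaussKer_nonneg σ h
            gcongr; exact hφ h
        _ = M / (2 * σ) * (|h| * gaussKer σ h * (1 + |h|)) := by ring
        _ ≤ M / (2 * σ) * (2 * ((2 / σ * ((2 + 16 * σ) * wideKer σ h)) * (4 * σ ^ 2)) +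
            1 * ((2 + 16 * σ) * wideKer σ h)) := by
            gcongr
            refine (hb h).trans ?_
            have := mul_le_mul_of_nonneg_left (hexp h) (by positivity : 0 ≤ 2 / σ)
            have := mul_le_mul_of_nonneg_right (hs.trans this) (by positivity : 0 ≤ 4 * σ ^ 2)
            linarith
        _ = _ := by field_simp; ring
  have hz := integral_eq_zero_of_hasDerivAt_of_integrable dΦ (i3.sub i2) iΦ
  rw [integral_sub i3 i2, sub_eq_zero] at hz
  unfold heatOp
  have e1 : ∀ h, (heatKer σ h : ℂ) * φ h = Real.exp (-σ) * ((gaussKer σ h : ℂ) * φ h -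
      ((gaussKer σ h * (h ^ 2 / (4 * σ ^ 2) - 1 / (2 * σ)) : ℝ) : ℂ) * φ h) := by
    intro h; rw [ihG]; ring
  simp_rw [e1]
  rw [integral_const_mul, integral_sub i0 i3, hz, ← integral_sub i0 i2]
  congr 2
  ext h; ring

/-- The counterpart for smooth functions, without the singularity `1/σ`: both derivatives are moved
onto `φ`. The constant `N` only justifies the integrations by parts and does not enter the result.
-/
theorem norm_heatOp_le_of_deriv2 {φ φ' φ'' : ℝ → ℂ} (h1 : ∀ h, HasDerivAt φ (φ' h) h)
    (h2 : ∀ h, HasDerivAt φ' (φ'' h) h) (hc : AEStronglyMeasurable φ'') {M N : ℝ}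
    (hφ : ∀ h, ‖φ h‖ ≤ M * (1 + |h|)) (hφ' : ∀ h, ‖φ' h‖ ≤ N * (1 + |h|))
    (hφ'' : ∀ h, ‖φ'' h‖ ≤ M * (1 + |h|)) {σ : ℝ} (hσ : 0 < σ) :
    ‖heatOp φ σ‖ ≤ 64 * M := by
  have hM : 0 ≤ M := by have := (norm_nonneg _).trans (hφ 0); simpa using this
  have hb : ∀ {K h : ℝ}, K ≤ max M N → K * (1 + |h|) ≤ max M N * (1 + |h|) := fun hk => by gcongr
  rw [heatOp_eq h1 h2 hc (M := max M N) (fun h => (hφ h).trans (hb (le_max_left _ _)))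
    (fun h => (hφ' h).trans (hb (le_max_right _ _)))
    (fun h => (hφ'' h).trans (hb (le_max_left _ _))) hσ, norm_mul, Complex.norm_real,
    Real.norm_of_nonneg (Real.exp_pos _).le]
  have h3 : ‖∫ h, (gaussKer σ h : ℂ) * (φ h - φ'' h)‖ ≤ ∫ h, 2 * M * ((2 + 16 * σ) * wideKer σ h) := by
    refine norm_integral_le_of_norm_le (((integrable_wideKer hσ).const_mul _).const_mul _)
      (Filter.Eventually.of_forall fun h => ?_)
    rw [norm_mul, Complex.norm_real, Real.norm_of_nonneg (gaussKer_nonneg σ h)]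
    calc _ ≤ gaussKer σ h * (M * (1 + |h|) + M * (1 + |h|)) := by
          gcongr
          · exact gaussKer_nonneg σ h
          · exact (norm_sub_le _ _).trans (add_le_add (hφ h) (hφ'' h))
      _ = 2 * M * ((1 + |h|) * gaussKer σ h) := by ring
      _ ≤ _ := by exact mul_le_mul_of_nonneg_left (one_add_abs_mul_gaussKer_le hσ h) (by positivity)
  rw [integral_const_mul, integral_const_mul, integral_wideKer hσ] at h3
  have h4 : Real.exp (-σ) * (2 + 16 * σ) ≤ 16 := by
    rw [Real.exp_neg, inv_mul_le_iff₀ (Real.exp_pos _)]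
    linarith [Real.add_one_le_exp σ]
  calc _ ≤ Real.exp (-σ) * (2 * M * ((2 + 16 * σ) * 2)) := by gcongr
    _ = (Real.exp (-σ) * (2 + 16 * σ)) * (4 * M) := by ring
    _ ≤ 16 * (4 * M) := by gcongr
    _ = _ := by ring

/-- Two-sided control of `heatOp`, expressing that one derivative of `φ` is bounded by `A` at the
origin. -/
def HeatBounded (φ : ℝ → ℂ) (A : ℝ) : Prop :=
  (∀ σ : ℝ, 0 < σ → ‖heatOp φ σ‖ ≤ A / √σ) ∧
  ∫⁻ σ in Set.Ioi (0 : ℝ), ENNReal.ofReal (σ ^ (-(1 / 2) : ℝ) * ‖heatOp φ σ‖) ≤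
    ENNReal.ofReal (4 * A)

/-! ### Criteria for the heat bound -/

theorem lintegral_Ioc_rpow {r a c : ℝ} (hr : -1 < r) (ha : 0 ≤ a) (hc : 0 ≤ c) :
    ∫⁻ σ in Set.Ioc 0 a, ENNReal.ofReal (c * σ ^ r) = ENNReal.ofReal (c * (a ^ (r + 1) / (r + 1))) := by
  rw [← ofReal_integral_eq_lintegral_ofReal, ← intervalIntegral.integral_of_le ha,
    intervalIntegral.integral_const_mul, integral_rpow (Or.inl hr),
    Real.zero_rpow (by linarith), sub_zero]
  · exact ((intervalIntegrable_iff_integrableOn_Ioc_of_le ha).1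
      (intervalIntegral.intervalIntegrable_rpow' hr)).const_mul c
  · rw [Filter.EventuallyLE, ae_restrict_iff' measurableSet_Ioc]
    exact Filter.Eventually.of_forall fun σ hσ => mul_nonneg hc (Real.rpow_nonneg hσ.1.le _)

theorem lintegral_Ioi_rpow {r a c : ℝ} (hr : r < -1) (ha : 0 < a) (hc : 0 ≤ c) :
    ∫⁻ σ in Set.Ioi a, ENNReal.ofReal (c * σ ^ r) = ENNReal.ofReal (c * (-a ^ (r + 1) / (r + 1))) := by
  rw [← ofReal_integral_eq_lintegral_ofReal, integral_const_mul, integral_Ioi_rpow_of_lt hr ha]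
  · exact (integrableOn_Ioi_rpow_of_lt hr ha).const_mul c
  · rw [Filter.EventuallyLE, ae_restrict_iff' measurableSet_Ioi]
    exact Filter.Eventually.of_forall fun σ hσ => mul_nonneg hc (Real.rpow_nonneg (ha.trans hσ).le _)

theorem lintegral_Ioi_split {a : ℝ} (ha : 0 ≤ a) (f : ℝ → ℝ≥0∞) :
    ∫⁻ σ in Set.Ioi (0 : ℝ), f σ = (∫⁻ σ in Set.Ioc 0 a, f σ) + ∫⁻ σ in Set.Ioi a, f σ := by
  rw [← Set.Ioc_union_Ioi_eq_Ioi ha]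
  exact lintegral_union measurableSet_Ioi (Set.Ioc_disjoint_Ioi le_rfl)

/-- The minimum of `A/(wσ)` and `Aw` is at most `A/√σ`. Its integral against `σ^(-1/2)` is scale
invariant, so the frequency `w` disappears from the conclusion. -/
theorem heatBounded_of_bounds {φ : ℝ → ℂ} {A w : ℝ} (hA : 0 ≤ A) (hw : 0 < w)
    (h1 : ∀ σ : ℝ, 0 < σ → ‖heatOp φ σ‖ ≤ A / w / σ)
    (h2 : ∀ σ : ℝ, 0 < σ → ‖heatOp φ σ‖ ≤ A * w) : HeatBounded φ A := by
  refine ⟨fun σ hσ => ?_, ?_⟩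
  · have hs : 0 < √σ := Real.sqrt_pos.2 hσ
    have hss : √σ ^ 2 = σ := Real.sq_sqrt hσ.le
    rcases le_total (w * √σ) 1 with h | h
    · refine (h2 σ hσ).trans ?_
      rw [le_div_iff₀ hs]; nlinarith
    · refine (h1 σ hσ).trans ?_
      rw [div_div]
      apply div_le_div_of_nonneg_left hA hs
      nlinarith
  · set a := (w ^ 2)⁻¹ with ha
    have ha0 : 0 < a := by positivity
    have e1 : a ^ (1 / 2 : ℝ) = w⁻¹ := by
      rw [ha, ← inv_pow, ← Real.sqrt_eq_rpow, Real.sqrt_sq (by positivity)]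
    have e2 : a ^ (-(1 / 2) : ℝ) = w := by rw [Real.rpow_neg ha0.le, e1, inv_inv]
    rw [lintegral_Ioi_split ha0.le]
    have b1 : ∫⁻ σ in Set.Ioc 0 a, ENNReal.ofReal (σ ^ (-(1 / 2) : ℝ) * ‖heatOp φ σ‖) ≤
        ENNReal.ofReal (2 * A) := by
      calc _ ≤ ∫⁻ σ in Set.Ioc 0 a, ENNReal.ofReal (A * w * σ ^ (-(1 / 2) : ℝ)) := by
            refine setLIntegral_mono' measurableSet_Ioc fun σ hσ => ENNReal.ofReal_le_ofReal ?_
            rw [mul_comm]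
            exact mul_le_mul_of_nonneg_right (h2 σ hσ.1) (Real.rpow_nonneg hσ.1.le _)
        _ = ENNReal.ofReal (2 * A) := by
            rw [lintegral_Ioc_rpow (by norm_num) ha0.le (by positivity)]
            congr 1
            norm_num
            rw [e1]; field_simp
    have b2 : ∫⁻ σ in Set.Ioi a, ENNReal.ofReal (σ ^ (-(1 / 2) : ℝ) * ‖heatOp φ σ‖) ≤
        ENNReal.ofReal (2 * A) := by
      calc _ ≤ ∫⁻ σ in Set.Ioi a, ENNReal.ofReal (A / w * σ ^ (-(3 / 2) : ℝ)) := by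
            refine setLIntegral_mono' measurableSet_Ioi fun σ hσ => ENNReal.ofReal_le_ofReal ?_
            have hσ0 : 0 < σ := ha0.trans hσ
            have e3 : σ ^ (-(3 / 2) : ℝ) = σ ^ (-(1 / 2) : ℝ) * σ⁻¹ := by
              rw [← Real.rpow_neg_one, ← Real.rpow_add hσ0]; norm_num
            rw [e3]
            calc _ ≤ σ ^ (-(1 / 2) : ℝ) * (A / w / σ) :=
                  mul_le_mul_of_nonneg_left (h1 σ hσ0) (Real.rpow_nonneg hσ0.le _)
              _ = _ := by rw [div_eq_mul_inv _ σ]; ring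
        _ = ENNReal.ofReal (2 * A) := by
            rw [lintegral_Ioi_rpow (by norm_num) ha0 (by positivity)]
            congr 1
            rw [show (-(3 / 2) + 1 : ℝ) = -(1 / 2) by norm_num, e2]
            field_simp
    calc _ ≤ ENNReal.ofReal (2 * A) + ENNReal.ofReal (2 * A) := add_le_add b1 b2
      _ = _ := by rw [← ENNReal.ofReal_add (by positivity) (by positivity)]; congr 1; ring

theorem measurable_heatOp {φ : ℝ → ℂ} (hφ : Measurable φ) : Measurable (heatOp φ) := by
  unfold heatOp
  have : Measurable (Function.uncurry fun σ h : ℝ => (heatKer σ h : ℂ) * φ h) :=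
    (Complex.measurable_ofReal.comp measurable_heatKer).mul (hφ.comp measurable_snd)
  exact (this.stronglyMeasurable.integral_prod_right).measurable

theorem integrable_heatKer_mul {φ : ℝ → ℂ} (hφ : Measurable φ) {M : ℝ}
    (hb : ∀ h, ‖φ h‖ ≤ M) {σ : ℝ} (hσ : 0 < σ) : Integrable fun h => (heatKer σ h : ℂ) * φ h :=
  ((integrable_heatKer hσ).ofReal).mul_bdd hφ.aestronglyMeasurable (Filter.Eventually.of_forall hb)

theorem HeatBounded.add_mul {φ₁ φ₂ : ℝ → ℂ} {A₁ A₂ : ℝ} (h1 : HeatBounded φ₁ A₁)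
    (h2 : HeatBounded φ₂ A₂) (hA₁ : 0 ≤ A₁) (hA₂ : 0 ≤ A₂) (m1 : Measurable φ₁) (m2 : Measurable φ₂)
    {M : ℝ} (b1 : ∀ h, ‖φ₁ h‖ ≤ M) (b2 : ∀ h, ‖φ₂ h‖ ≤ M) (P Q : ℂ) :
    HeatBounded (fun h => P * φ₁ h + Q * φ₂ h) (‖P‖ * A₁ + ‖Q‖ * A₂) := by
  have e : ∀ σ : ℝ, 0 < σ → heatOp (fun h => P * φ₁ h + Q * φ₂ h) σ =
      P * heatOp φ₁ σ + Q * heatOp φ₂ σ := by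
    intro σ hσ
    unfold heatOp
    rw [← integral_const_mul, ← integral_const_mul, ← integral_add
      ((integrable_heatKer_mul m1 b1 hσ).const_mul P) ((integrable_heatKer_mul m2 b2 hσ).const_mul Q)]
    congr 1; ext h; ring
  have en : ∀ σ : ℝ, 0 < σ → ‖heatOp (fun h => P * φ₁ h + Q * φ₂ h) σ‖ ≤
      ‖P‖ * ‖heatOp φ₁ σ‖ + ‖Q‖ * ‖heatOp φ₂ σ‖ := by
    intro σ hσ
    rw [e σ hσ, ← norm_mul, ← norm_mul]
    exact norm_add_le _ _
  refine ⟨fun σ hσ => (en σ hσ).trans ?_, ?_⟩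
  · rw [add_div, mul_div_assoc, mul_div_assoc]
    gcongr
    · exact h1.1 σ hσ
    · exact h2.1 σ hσ
  · have mm : ∀ φ : ℝ → ℂ, Measurable φ → Measurable fun σ : ℝ =>
        ENNReal.ofReal (σ ^ (-(1 / 2) : ℝ) * ‖heatOp φ σ‖) := fun φ hφ => by
      have := measurable_heatOp hφ
      fun_prop
    calc _ ≤ ∫⁻ σ in Set.Ioi (0 : ℝ), (ENNReal.ofReal ‖P‖ *
          ENNReal.ofReal (σ ^ (-(1 / 2) : ℝ) * ‖heatOp φ₁ σ‖) + ENNReal.ofReal ‖Q‖ *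
          ENNReal.ofReal (σ ^ (-(1 / 2) : ℝ) * ‖heatOp φ₂ σ‖)) := by
          refine setLIntegral_mono' measurableSet_Ioi fun σ hσ => ?_
          have hp : 0 ≤ σ ^ (-(1 / 2) : ℝ) := Real.rpow_nonneg (le_of_lt hσ) _
          rw [← ENNReal.ofReal_mul (norm_nonneg _), ← ENNReal.ofReal_mul (norm_nonneg _),
            ← ENNReal.ofReal_add (by positivity) (by positivity)]
          refine ENNReal.ofReal_le_ofReal ?_
          calc _ ≤ σ ^ (-(1 / 2) : ℝ) * (‖P‖ * ‖heatOp φ₁ σ‖ + ‖Q‖ * ‖heatOp φ₂ σ‖) :=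
                mul_le_mul_of_nonneg_left (en σ hσ) hp
            _ = _ := by ring
      _ ≤ ENNReal.ofReal ‖P‖ * ENNReal.ofReal (4 * A₁) + ENNReal.ofReal ‖Q‖ * ENNReal.ofReal (4 * A₂) := by
          rw [lintegral_add_left ((mm φ₁ m1).const_mul _), lintegral_const_mul _ (mm φ₁ m1),
            lintegral_const_mul _ (mm φ₂ m2)]
          gcongr
          · exact h1.2
          · exact h2.2
      _ = _ := by
          rw [← ENNReal.ofReal_mul (norm_nonneg _), ← ENNReal.ofReal_mul (norm_nonneg _),
            ← ENNReal.ofReal_add (by positivity) (by positivity)]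
          congr 1; ring

theorem HeatBounded.mono {φ : ℝ → ℂ} {A B : ℝ} (h : HeatBounded φ A) (hAB : A ≤ B) :
    HeatBounded φ B :=
  ⟨fun σ hσ => (h.1 σ hσ).trans (by gcongr), h.2.trans (ENNReal.ofReal_le_ofReal (by linarith))⟩

/-- The hypotheses describe a function oscillating at frequency `w`: size `A/w`, second derivative
`Aw`, both allowed to grow linearly away from the base point. The intermediate derivative needs only
some bound. -/
theorem heatBounded_of_deriv2 {φ φ' φ'' : ℝ → ℂ} (h1 : ∀ h, HasDerivAt φ (φ' h) h)
    (h2 : ∀ h, HasDerivAt φ' (φ'' h) h) (hc : AEStronglyMeasurable φ'') {A N w : ℝ} (hA : 0 ≤ A)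
    (hw : 1 ≤ w) (hφ : ∀ h, ‖φ h‖ ≤ A / w * (1 + |h|)) (hφ' : ∀ h, ‖φ' h‖ ≤ N * (1 + |h|))
    (hφ'' : ∀ h, ‖φ'' h‖ ≤ A * w * (1 + |h|)) : HeatBounded φ (100 * A) := by
  refine heatBounded_of_bounds (w := w) (by positivity) (by linarith) (fun σ hσ => ?_)
    (fun σ hσ => ?_)
  · refine (norm_heatOp_le hφ hσ).trans (le_of_eq (by ring))
  · refine (norm_heatOp_le_of_deriv2 h1 h2 hc (M := A * w) (fun h => (hφ h).trans ?_) hφ' hφ''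
      hσ).trans ?_
    · have : A / w ≤ A * w := by rw [div_le_iff₀ (by linarith)]; nlinarith [mul_nonneg hA (by linarith : 0 ≤ w)]
      gcongr
    · nlinarith [mul_nonneg hA (by linarith : 0 ≤ w)]

/-! ### Heat bounds for the one-dimensional kernels -/

theorem hasDerivAt_comp_const_sub {f : ℝ → ℂ} {f' : ℂ} {a h : ℝ} (hf : HasDerivAt f f' (a - h)) :
    HasDerivAt (fun h => f (a - h)) (-f') h := by
  have := hf.scomp h ((hasDerivAt_id' h).const_sub a)
  exact this.congr_deriv (by simp)

theorem inv_one_add_abs_mu₁_le {t : ℝ} (ht : 1 ≤ t) (a h : ℝ) :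
    (1 + |mu₁ t (a - h)|)⁻¹ ≤ (1 + |mu₁ t a|)⁻¹ * (1 + |h|) := by
  have := one_add_abs_mu₁_sub_le ht (a - h) (-h)
  rw [sub_neg_eq_add, sub_add_cancel, abs_neg] at this
  rw [inv_le_iff_one_le_mul₀ (by positivity), mul_assoc, ← div_eq_inv_mul, one_le_div (by positivity)]
  linarith

theorem continuous_kernDeriv2 {t : ℝ} (ht : 0 < t) : Continuous (kernDeriv2 t) := by
  unfold kernDeriv2
  have := continuous_oscMoment ht 2
  fun_prop

theorem measurable_of_deriv {f g : ℝ → ℂ} (h : ∀ x, HasDerivAt f (g x) x) : Measurable g := by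
  have : g = deriv f := by ext x; exact (h x).deriv.symm
  rw [this]; exact measurable_deriv f

/-- The bound without cancellation, of size `1/√t`. It is used when the datum reaches beyond `√t`,
where the comparison with the leading term is not available. -/
theorem exists_heatBounded_kern : ∃ C : ℝ, 0 < C ∧ ∀ t : ℝ, 1 ≤ t → ∀ a : ℝ,
    HeatBounded (fun h => kern t (a - h)) (C / √t) := by
  obtain ⟨C, hC, hb⟩ := exists_kern_bounds
  refine ⟨100 * C, by positivity, fun t ht a => ?_⟩
  have ht0 : 0 < t := by linarith
  rw [mul_div_assoc]
  have hs : 0 < √t := Real.sqrt_pos.2 ht0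
  have hm := fun h => one_add_abs_mu₁_sub_le ht a h
  have hCt : 0 ≤ C / √t := by positivity
  refine heatBounded_of_deriv2 (φ' := fun h => -kernDeriv t (a - h))
    (φ'' := fun h => kernDeriv2 t (a - h)) (w := 1 + |mu₁ t a|)
    (N := C / √t * (1 + |mu₁ t a|))
    (fun h => hasDerivAt_comp_const_sub (hasDerivAt_kern ht0 _))
    (fun h => ((hasDerivAt_comp_const_sub (hasDerivAt_deriv_kern ht0 (a - h))).neg).congr_deriv
      (by simp [kernDeriv2])) ?_ hCt (by linarith [abs_nonneg (mu₁ t a)]) (fun h => ?_)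
    (fun h => ?_) (fun h => ?_)
  · have := continuous_kernDeriv2 ht0
    exact Continuous.aestronglyMeasurable (by fun_prop)
  · refine (hb t ht (a - h)).1.trans ?_
    rw [div_eq_mul_inv, div_eq_mul_inv (C / √t), mul_assoc]
    exact mul_le_mul_of_nonneg_left (inv_one_add_abs_mu₁_le ht a h) hCt
  · rw [norm_neg, mul_assoc]
    exact (hb t ht (a - h)).2.1.trans (mul_le_mul_of_nonneg_left (hm h) hCt)
  · rw [mul_assoc]
    exact (hb t ht (a - h)).2.2.trans (mul_le_mul_of_nonneg_left (hm h) hCt)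

/-- Because of the factor `exp(-iyμ(x))`, the local frequency of the leading term is controlled by
`(1 + |μ|)(1 + |y|/t)`, and this product is taken as `w`. -/
theorem heatBounded_lead {t : ℝ} (ht : 1 ≤ t) (y a : ℝ) :
    HeatBounded (fun h => lead t y (a - h)) (5000 / √t * (1 + |y| / t)) := by
  have ht0 : 0 < t := by linarith
  have hs : 0 < √t := Real.sqrt_pos.2 ht0
  set Y := 1 + |y| / t with hY
  have hY0 : 0 ≤ |y| / t := by positivity
  have hY1 : 1 ≤ Y := by linarith
  have hm := fun h => one_add_abs_mu₁_sub_le ht a h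
  have hw : 1 ≤ 1 + |mu₁ t a| := by linarith [abs_nonneg (mu₁ t a)]
  have e : 5000 / √t * Y = 100 * (50 / √t * Y) := by ring
  rw [e]
  refine heatBounded_of_deriv2 (φ' := fun h => -(lead t y (a - h) * leadLog t y (mu₁ t (a - h))))
    (φ'' := fun h => leadDeriv2 t y (a - h)) (w := (1 + |mu₁ t a|) * Y) (N := 6 / √t * Y)
    (fun h => hasDerivAt_comp_const_sub (hasDerivAt_lead ht0 y _))
    (fun h => ((hasDerivAt_comp_const_sub (hasDerivAt_deriv_lead ht0 y (a - h))).neg).congr_deriv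
      (by simp)) ?_ (by positivity) (by nlinarith) (fun h => ?_)
    (fun h => ?_) (fun h => ?_)
  · have := measurable_of_deriv (hasDerivAt_deriv_lead ht0 y)
    exact (this.comp (measurable_const.sub measurable_id)).aestronglyMeasurable
  · refine (norm_lead_le ht y (a - h)).trans ?_
    have : 50 / √t * Y / ((1 + |mu₁ t a|) * Y) * (1 + |h|) =
      50 / √t * ((1 + |mu₁ t a|)⁻¹ * (1 + |h|)) := by field_simp
    rw [this, div_eq_mul_inv]
    refine mul_le_mul ?_ (inv_one_add_abs_mu₁_le ht a h) (by positivity) (by positivity)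
    gcongr; norm_num
  · rw [norm_neg]
    refine (norm_leadDeriv_le ht y (a - h)).trans ?_
    have : 0 ≤ 6 / √t * Y * |h| := by positivity
    linarith
  · refine (norm_leadDeriv2_le ht y (a - h)).trans ?_
    rw [← hY]
    calc _ ≤ 50 / √t * ((1 + |mu₁ t a|) * (1 + |h|) * Y ^ 2) := by gcongr; exact hm h
      _ = _ := by ring

/-- With `A` a multiple of `(1+|y|)/t`, the difference is at most `A/ℓ`, which suffices for `A/w` as
`ℓ ≥ w/2`, and its second derivative is at most `A ≤ Aw`. The gain over the separate bounds is
`(1+|y|)/√t`. -/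
theorem exists_heatBounded_diff : ∃ C : ℝ, 0 < C ∧ ∀ t : ℝ, 1 ≤ t → ∀ y : ℝ, |y| ≤ √t → ∀ a : ℝ,
    HeatBounded (fun h => kern t (a - h - y) - lead t y (a - h)) (C * ((1 + |y|) / t)) := by
  obtain ⟨Ck, hCk, hbk⟩ := exists_kern_bounds
  have g4 := gaussMass_nonneg 4
  have g2 := gaussMass_nonneg 2
  set C₁ := 24 * (1 + Real.exp 2) * gaussMass 4 with hC₁
  set C₂ := 24 * (1 + Real.exp 2) * gaussMass 4 + 32 * Real.exp 2 * gaussMass 2 + 112 with hC₂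
  have hC₁0 : 0 ≤ C₁ := by positivity
  have hC₂0 : 0 < C₂ := by positivity
  refine ⟨100 * (2 * C₁ + C₂), by positivity, fun t ht y hy a => ?_⟩
  have ht0 : 0 < t := by linarith
  have hs : 0 < √t := Real.sqrt_pos.2 ht0
  have hw : 1 ≤ 1 + |mu₁ t a| := by linarith [abs_nonneg (mu₁ t a)]
  have hy0 : 0 ≤ (1 + |y|) / t := by positivity
  have hm := fun h => one_add_abs_mu₁_sub_le ht a h
  rw [mul_assoc]
  have e : ∀ h, a - h - y = a - y - h := fun h => by ring
  refine heatBounded_of_deriv2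
    (φ' := fun h => -kernDeriv t (a - h - y) + lead t y (a - h) * leadLog t y (mu₁ t (a - h)))
    (φ'' := fun h => kernDeriv2 t (a - h - y) - leadDeriv2 t y (a - h)) (w := 1 + |mu₁ t a|)
    (N := Ck / √t * (1 + |mu₁ t (a - y)|) + 6 / √t * (1 + |y| / t))
    (fun h => ?_) (fun h => ?_) ?_ (by positivity) hw (fun h => ?_) (fun h => ?_) (fun h => ?_)
  · simp_rw [e]
    exact ((hasDerivAt_comp_const_sub (hasDerivAt_kern ht0 (a - y - h))).sub
      (hasDerivAt_comp_const_sub (hasDerivAt_lead ht0 y (a - h)))).congr_deriv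
        (by simp [kernDeriv])
  · simp_rw [e]
    exact ((hasDerivAt_comp_const_sub (hasDerivAt_deriv_kern ht0 (a - y - h))).fun_neg.add
      (hasDerivAt_comp_const_sub (hasDerivAt_deriv_lead ht0 y (a - h)))).congr_deriv
        (by simp [kernDeriv2]; ring)
  · have h1 := continuous_kernDeriv2 ht0
    have h2 := measurable_of_deriv (hasDerivAt_deriv_lead ht0 y)
    exact ((h1.measurable.comp (by fun_prop)).sub
      (h2.comp (measurable_const.sub measurable_id))).aestronglyMeasurable
  · refine (norm_kern_sub_lead_le ht hy (x := a - h)).trans ?_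
    rw [← hC₁]
    set b := mu₁ t (a - h) with hb
    have h1 : (1 + |y|) / (t * ell b) ≤ 2 * ((1 + |y|) / t * (1 + |b|)⁻¹) := by
      have h2 : 1 + |b| ≤ 2 * ell b := by linarith [abs_le_ell b, one_le_ell b]
      have hl := ell_pos b
      rw [← div_div, div_eq_mul_inv _ (ell b), mul_left_comm]
      refine mul_le_mul_of_nonneg_left ?_ hy0
      rw [inv_eq_one_div, ← div_eq_mul_inv, div_le_div_iff₀ hl (by positivity)]
      linarith
    calc C₁ * ((1 + |y|) / (t * ell b)) ≤ C₁ * (2 * ((1 + |y|) / t * (1 + |b|)⁻¹)) := by gcongr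
      _ ≤ C₁ * (2 * ((1 + |y|) / t * ((1 + |mu₁ t a|)⁻¹ * (1 + |h|)))) := by
          gcongr; exact inv_one_add_abs_mu₁_le ht a h
      _ = (2 * C₁) * ((1 + |y|) / t * ((1 + |mu₁ t a|)⁻¹ * (1 + |h|))) := by ring
      _ ≤ (2 * C₁ + C₂) * ((1 + |y|) / t * ((1 + |mu₁ t a|)⁻¹ * (1 + |h|))) := by
          gcongr; linarith
      _ = _ := by rw [div_eq_mul_inv _ (1 + |mu₁ t a|)]; ring
  · refine (norm_add_le _ _).trans ?_
    rw [norm_neg, add_mul]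
    refine add_le_add ?_ ?_
    · rw [e, mul_assoc]
      exact (hbk t ht (a - y - h)).2.1.trans
        (mul_le_mul_of_nonneg_left (one_add_abs_mu₁_sub_le ht (a - y) h) (by positivity))
    · refine (norm_leadDeriv_le ht y (a - h)).trans ?_
      have : 0 ≤ 6 / √t * (1 + |y| / t) * |h| := by positivity
      linarith
  · refine (norm_kernDeriv2_sub_le ht hy (x := a - h)).trans ?_
    rw [← hC₂]
    calc C₂ * ((1 + |y|) / t) ≤ (2 * C₁ + C₂) * ((1 + |y|) / t) := by gcongr; linarith
      _ = (2 * C₁ + C₂) * ((1 + |y|) / t) * 1 * 1 := by ring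
      _ ≤ _ := by
          have : 1 ≤ 1 + |h| := by linarith [abs_nonneg h]
          gcongr

/-! ### The Fourier transform of `L²` by duality -/

section fourier

variable {E : Type*} [NormedAddCommGroup E] [InnerProductSpace ℝ E] [FiniteDimensional ℝ E]
  [MeasurableSpace E] [BorelSpace E]

theorem ae_eq_of_integral_mul_schwartz {f f' : E → ℂ} (hf : LocallyIntegrable f)
    (hf' : LocallyIntegrable f')
    (h : ∀ φ : 𝓢(E, ℂ), HasCompactSupport φ → ∫ x, f x * φ x = ∫ x, f' x * φ x) :
    f =ᵐ[volume] f' := by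
  refine ae_eq_of_integral_contDiff_smul_eq hf hf' fun g hg hc => ?_
  have h₁ : HasCompactSupport (Complex.ofRealCLM ∘ g) := hc.comp_left rfl
  have h₂ : ContDiff ℝ (⊤ : ℕ∞) (Complex.ofRealCLM ∘ g) := by fun_prop
  have := h (h₁.toSchwartzMap h₂) h₁
  simpa [mul_comm] using this

theorem integral_fourier_mul (f : Lp ℂ 2 (volume : Measure E)) (φ : 𝓢(E, ℂ)) :
    ∫ x, (𝓕 f : Lp ℂ 2 (volume : Measure E)) x * φ x = ∫ x, f x * (𝓕 φ) x := by
  have h := congrArg (fun T : 𝓢'(E, ℂ) => T φ) (Lp.fourier_toTemperedDistribution_eq f)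
  simp only [TemperedDistribution.fourier_apply, Lp.toTemperedDistribution_apply,
    smul_eq_mul] at h
  simpa [mul_comm] using h.symm

theorem integral_mul_eq_fourier (f : Lp ℂ 2 (volume : Measure E)) (φ : 𝓢(E, ℂ)) :
    ∫ x, f x * φ x = ∫ x, (𝓕 f : Lp ℂ 2 (volume : Measure E)) x * (𝓕⁻ φ) x := by
  rw [integral_fourier_mul, FourierTransform.fourier_fourierInv_eq]

theorem locallyIntegrable_Lp (f : Lp ℂ 2 (volume : Measure E)) : LocallyIntegrable f :=
  (Lp.memLp f).locallyIntegrable (by norm_num)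

theorem integrable_L2_mul_schwartz (f : Lp ℂ 2 (volume : Measure E)) (φ : 𝓢(E, ℂ)) :
    Integrable (fun x => f x * φ x) :=
  (Lp.memLp f).integrable_mul (φ.memLp 2)

/-- Both transforms move onto the test function in the same way: one by the definition for tempered
distributions, the other by Fubini. -/
theorem fourier_toLp_ae_eq {f : E → ℂ} (hf : Integrable f) (hf2 : MemLp f 2) :
    (𝓕 (hf2.toLp f) : Lp ℂ 2 (volume : Measure E)) =ᵐ[volume] 𝓕 f := by
  have hc : Continuous (𝓕 f) :=
    VectorFourier.fourierIntegral_continuous Real.continuous_fourierChar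
      (by exact continuous_inner) hf
  refine ae_eq_of_integral_mul_schwartz (locallyIntegrable_Lp _) hc.locallyIntegrable fun φ _ => ?_
  rw [integral_fourier_mul]
  have h := VectorFourier.integral_fourierIntegral_smul_eq_flip (μ := volume) (ν := volume)
    (L := innerₗ E) (f := f) (g := φ) Real.continuous_fourierChar continuous_inner hf φ.integrable
  rw [flip_innerₗ] at h
  simp only [smul_eq_mul] at h
  refine (integral_congr_ae ?_).trans h.symm
  filter_upwards [hf2.coeFn_toLp] with x hx
  rw [hx, SchwartzMap.fourier_coe]
  rfl

end fourier

/-! ### Weighted composition isometries of `L²` -/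

section weightedComp

variable {α : Type*} [MeasurableSpace α] {μ : Measure α}

/-- Data of an isometry `f ↦ a * f ∘ ν` of `L²`. -/
structure IsWeightedComp (μ : Measure α) (a : α → ℂ) (ν : α → α) : Prop where
  measurable_weight : Measurable a
  measurable_map : Measurable ν
  lintegral_eq : ∀ g : α → ℝ≥0∞, Measurable g → ∫⁻ x, ‖a x‖ₑ ^ 2 * g (ν x) ∂μ = ∫⁻ x, g x ∂μ
  weight_ne_zero : ∀ x, a x ≠ 0

variable {a : α → ℂ} {ν : α → α}

/-- Apply the integral identity to the indicator of a null set: as the weight never vanishes, the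
preimage is null. This makes `f ∘ ν` meaningful for classes of functions. -/
theorem IsWeightedComp.quasiMeasurePreserving (h : IsWeightedComp μ a ν) :
    Measure.QuasiMeasurePreserving ν μ μ := by
  refine ⟨h.measurable_map, Measure.AbsolutelyContinuous.mk fun s hs h0 => ?_⟩
  rw [Measure.map_apply h.measurable_map hs]
  have h1 := h.lintegral_eq (s.indicator 1) (measurable_one.indicator hs)
  rw [lintegral_indicator_one hs, h0, lintegral_eq_zero_iff] at h1
  · rw [← compl_compl (ν ⁻¹' s)]
    refine measure_mono_null ?_ h1
    intro x hx
    simp only [compl_compl, Set.mem_preimage] at hx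
    simp [hx, h.weight_ne_zero x]
  · exact (h.measurable_weight.enorm.pow_const 2).mul
      ((measurable_one.indicator hs).comp h.measurable_map)

theorem IsWeightedComp.eLpNorm_eq (h : IsWeightedComp μ a ν) {f : α → ℂ}
    (hf : AEStronglyMeasurable f μ) :
    eLpNorm (fun x => a x * f (ν x)) 2 μ = eLpNorm f 2 μ := by
  obtain ⟨g, hg, hfg⟩ := hf
  have h1 : (fun x => a x * f (ν x)) =ᵐ[μ] fun x => a x * g (ν x) := by
    filter_upwards [h.quasiMeasurePreserving.ae hfg] with x hx
    rw [hx]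
  rw [eLpNorm_congr_ae h1, eLpNorm_congr_ae hfg,
    eLpNorm_eq_lintegral_rpow_enorm_toReal (by norm_num) (by norm_num),
    eLpNorm_eq_lintegral_rpow_enorm_toReal (by norm_num) (by norm_num)]
  simp only [ENNReal.toReal_ofNat, enorm_mul, ENNReal.rpow_ofNat, mul_pow]
  rw [h.lintegral_eq (fun x => ‖g x‖ₑ ^ 2) (hg.measurable.enorm.pow_const 2)]

theorem IsWeightedComp.memLp (h : IsWeightedComp μ a ν) (f : Lp ℂ 2 μ) :
    MemLp (fun x => a x * f (ν x)) 2 μ := by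
  refine ⟨h.measurable_weight.aestronglyMeasurable.mul
    ((Lp.aestronglyMeasurable f).comp_quasiMeasurePreserving h.quasiMeasurePreserving), ?_⟩
  rw [h.eLpNorm_eq (Lp.aestronglyMeasurable f)]
  exact Lp.eLpNorm_lt_top f

/-- The isometry `f ↦ a * f ∘ ν` of `L²`. -/
def weightedComp (h : IsWeightedComp μ a ν) : Lp ℂ 2 μ →ₗᵢ[ℂ] Lp ℂ 2 μ where
  toFun f := (h.memLp f).toLp _
  map_add' f g := by
    refine Lp.ext ?_
    filter_upwards [(h.memLp (f + g)).coeFn_toLp, (h.memLp f).coeFn_toLp, (h.memLp g).coeFn_toLp,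
      Lp.coeFn_add ((h.memLp f).toLp _) ((h.memLp g).toLp _),
      h.quasiMeasurePreserving.ae (Lp.coeFn_add f g)] with x h1 h2 h3 h4 h5
    rw [h1, h4, h5, Pi.add_apply, Pi.add_apply, h2, h3, mul_add]
  map_smul' c f := by
    refine Lp.ext ?_
    filter_upwards [(h.memLp (c • f)).coeFn_toLp, (h.memLp f).coeFn_toLp,
      Lp.coeFn_smul c ((h.memLp f).toLp _),
      h.quasiMeasurePreserving.ae (Lp.coeFn_smul c f)] with x h1 h2 h4 h5
    simp only [RingHom.id_apply]
    rw [h1, h4, h5, Pi.smul_apply, Pi.smul_apply, h2, smul_eq_mul, smul_eq_mul]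
    ring
  norm_map' f := by
    simp only [LinearMap.coe_mk, AddHom.coe_mk]
    rw [Lp.norm_toLp, h.eLpNorm_eq (Lp.aestronglyMeasurable f), Lp.norm_def]

theorem coeFn_weightedComp (h : IsWeightedComp μ a ν) (f : Lp ℂ 2 μ) :
    weightedComp h f =ᵐ[μ] fun x => a x * f (ν x) := (h.memLp f).coeFn_toLp

theorem isWeightedComp_id (ha : Measurable a) (h1 : ∀ x, ‖a x‖ = 1) : IsWeightedComp μ a id where
  measurable_weight := ha
  measurable_map := measurable_id
  lintegral_eq g _ := by
    have : ∀ x, ‖a x‖ₑ = 1 := fun x => by rw [← ofReal_norm, h1]; simp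
    simp [this]
  weight_ne_zero x hx := by have := h1 x; simp [hx] at this

end weightedComp

/-- The symbol of `-(1/2) Δ + (1/4) ∂₁⁴` in the frequency variable of `𝓕`. -/
def dispersion {d : ℕ} [NeZero d] (ξ : Space d) : ℝ :=
  (2 * Real.pi) ^ 2 * ‖ξ‖ ^ 2 / 2 + (2 * Real.pi * ξ 0) ^ 4 / 4

/-! ### The Cauchy problem in frequency and its uniqueness -/

section

variable {d : ℕ} [NeZero d]

theorem contDiff_dispersion {n : WithTop ℕ∞} : ContDiff ℝ n (dispersion (d := d)) := by
  have h : ContDiff ℝ n (fun ξ : Space d => ξ 0) := (EuclideanSpace.proj (𝕜 := ℝ) (0 : Fin d)).contDiff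
  unfold dispersion
  have h2 : ContDiff ℝ n (fun ξ : Space d => ‖ξ‖ ^ 2) := contDiff_norm_sq ℝ
  fun_prop

theorem continuous_dispersion : Continuous (dispersion (d := d)) :=
  (contDiff_dispersion (n := 0)).continuous

theorem hasTemperateGrowth_coord : (fun ξ : Space d => ((ξ 0 : ℝ) : ℂ)).HasTemperateGrowth :=
  Complex.ofRealCLM.hasTemperateGrowth.comp
    (EuclideanSpace.proj (𝕜 := ℝ) (0 : Fin d)).hasTemperateGrowth

theorem hasTemperateGrowth_dispersion :
    (fun ξ : Space d => (dispersion ξ : ℂ)).HasTemperateGrowth := by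
  have h := hasTemperateGrowth_coord (d := d)
  have h2 : (fun ξ : Space d => ((‖ξ‖ ^ 2 : ℝ) : ℂ)).HasTemperateGrowth := by fun_prop
  have h4 : (fun ξ : Space d => ((2 * Real.pi : ℝ) : ℂ) ^ 2 / 2 * ((‖ξ‖ ^ 2 : ℝ) : ℂ)
      + ((2 * Real.pi : ℝ) : ℂ) ^ 4 / 4 * ((ξ 0 : ℝ) : ℂ) ^ 4).HasTemperateGrowth := by fun_prop
  convert h4 using 2 with ξ
  simp only [dispersion]; push_cast; ring

/-- Taylor's formula for `|θ| ≤ 1` and the triangle inequality beyond. A global bound avoids any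
restriction on the frequencies. -/
theorem norm_exp_I_mul_sub_le (θ : ℝ) :
    ‖Complex.exp (Complex.I * θ) - 1 - Complex.I * θ‖ ≤ 2 * θ ^ 2 := by
  have hn : ‖Complex.I * (θ : ℂ)‖ = |θ| := by simp
  rcases le_total |θ| 1 with h | h
  · have := Complex.norm_exp_sub_one_sub_id_le (x := Complex.I * θ) (by rwa [hn])
    rw [hn, sq_abs] at this
    nlinarith [sq_nonneg θ]
  · have h1 := Real.norm_exp_I_mul_ofReal_sub_one_le (x := θ)
    have h2 := norm_sub_le (Complex.exp (Complex.I * θ) - 1) (Complex.I * θ)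
    rw [hn] at h2
    rw [Real.norm_eq_abs] at h1
    nlinarith [sq_abs θ]

/-- A compactly supported Schwartz function transported by the phase. -/
def phaseMul (η : 𝓢(Space d, ℂ)) (hη : HasCompactSupport η) (τ : ℝ) : 𝓢(Space d, ℂ) :=
  (hη.mul_left (f := fun ξ => Complex.exp (Complex.I * ((τ * dispersion ξ : ℝ) : ℂ)))).toSchwartzMap
    (by
      have h : ContDiff ℝ (⊤ : ℕ∞) (fun ξ : Space d => ((τ * dispersion ξ : ℝ) : ℂ)) :=
        Complex.ofRealCLM.contDiff.comp (contDiff_const.mul contDiff_dispersion)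
      exact ((contDiff_const.mul h).cexp).mul η.smooth')

theorem phaseMul_apply (η : 𝓢(Space d, ℂ)) (hη : HasCompactSupport η) (τ : ℝ) (ξ : Space d) :
    phaseMul η hη τ ξ = Complex.exp (Complex.I * ((τ * dispersion ξ : ℝ) : ℂ)) * η ξ := rfl

/-- The second-order Taylor remainder is at most `2(τ-t)²` times `dispersion² |η|`, and this
function lies in `L²`. -/
theorem hasDerivAt_phaseMul_toLp (η : 𝓢(Space d, ℂ)) (hη : HasCompactSupport η) (t : ℝ) :
    HasDerivAt (fun τ => (phaseMul η hη τ).toLp 2 (volume : Measure (Space d)))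
      (Complex.I • (SchwartzMap.smulLeftCLM ℂ (fun ξ : Space d => (dispersion ξ : ℂ))
        (phaseMul η hη t)).toLp 2 (volume : Measure (Space d))) t := by
  have hg := hasTemperateGrowth_dispersion (d := d)
  set M := (SchwartzMap.smulLeftCLM ℂ (fun ξ : Space d => (dispersion ξ : ℂ))
    (SchwartzMap.smulLeftCLM ℂ (fun ξ : Space d => (dispersion ξ : ℂ)) η)) with hM
  set N := SchwartzMap.smulLeftCLM ℂ (fun ξ : Space d => (dispersion ξ : ℂ)) (phaseMul η hη t) with hN
  rw [hasDerivAt_iff_isLittleO]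
  have hb : ∀ τ : ℝ, ‖(phaseMul η hη τ).toLp 2 (volume : Measure (Space d)) -
      (phaseMul η hη t).toLp 2 (volume : Measure (Space d)) -
      (τ - t) • Complex.I • N.toLp 2 (volume : Measure (Space d))‖ ≤
      2 * (τ - t) ^ 2 * ‖M.toLp 2 (volume : Measure (Space d))‖ := by
    intro τ
    refine Lp.norm_le_mul_norm_of_ae_le_mul ?_
    filter_upwards [Lp.coeFn_sub ((phaseMul η hη τ).toLp 2 (volume : Measure (Space d)) -
      (phaseMul η hη t).toLp 2 (volume : Measure (Space d)))
      ((τ - t) • Complex.I • N.toLp 2 (volume : Measure (Space d))),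
      Lp.coeFn_sub ((phaseMul η hη τ).toLp 2 (volume : Measure (Space d)))
      ((phaseMul η hη t).toLp 2 (volume : Measure (Space d))),
      (phaseMul η hη τ).coeFn_toLp 2 (volume : Measure (Space d)),
      (phaseMul η hη t).coeFn_toLp 2 (volume : Measure (Space d)),
      Lp.coeFn_smul (τ - t) (Complex.I • N.toLp 2 (volume : Measure (Space d))),
      Lp.coeFn_smul Complex.I (N.toLp 2 (volume : Measure (Space d))),
      N.coeFn_toLp 2 (volume : Measure (Space d)),
      M.coeFn_toLp 2 (volume : Measure (Space d))] with x h1 h2 h3 h4 h5 h6 h7 h8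
    rw [h1, Pi.sub_apply, h2, Pi.sub_apply, h3, h4, h5, Pi.smul_apply, h6, Pi.smul_apply, h7, h8,
      hN, hM, SchwartzMap.smulLeftCLM_apply_apply hg, SchwartzMap.smulLeftCLM_apply_apply hg,
      SchwartzMap.smulLeftCLM_apply_apply hg, phaseMul_apply, phaseMul_apply]
    set s := dispersion x
    have e1 : Complex.exp (Complex.I * ((τ * s : ℝ) : ℂ)) =
        Complex.exp (Complex.I * ((t * s : ℝ) : ℂ)) *
          Complex.exp (Complex.I * (((τ - t) * s : ℝ) : ℂ)) := by
      rw [← Complex.exp_add]; push_cast; ring_nf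
    have e2 : Complex.exp (Complex.I * ((τ * s : ℝ) : ℂ)) * η x -
        Complex.exp (Complex.I * ((t * s : ℝ) : ℂ)) * η x - (τ - t) • Complex.I •
          ((s : ℂ) • (Complex.exp (Complex.I * ((t * s : ℝ) : ℂ)) * η x)) =
        Complex.exp (Complex.I * ((t * s : ℝ) : ℂ)) *
          ((Complex.exp (Complex.I * (((τ - t) * s : ℝ) : ℂ)) - 1 -
            Complex.I * (((τ - t) * s : ℝ) : ℂ)) * η x) := by
      rw [e1, Complex.real_smul]; simp only [smul_eq_mul]; push_cast; ring
    rw [e2, norm_mul, norm_mul, mul_comm Complex.I ((t * s : ℝ) : ℂ), Complex.norm_exp_ofReal_mul_I,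
      one_mul, smul_eq_mul, smul_eq_mul, norm_mul, norm_mul, Complex.norm_real, Real.norm_eq_abs]
    calc _ ≤ 2 * ((τ - t) * s) ^ 2 * ‖η x‖ :=
          mul_le_mul_of_nonneg_right (norm_exp_I_mul_sub_le _) (norm_nonneg _)
      _ = 2 * (τ - t) ^ 2 * (|s| * (|s| * ‖η x‖)) := by rw [mul_pow, ← sq_abs s]; ring
  refine Asymptotics.IsBigO.trans_isLittleO
    (g := fun τ : ℝ => (τ - t) ^ 2) (Asymptotics.IsBigO.of_bound
      (2 * ‖M.toLp 2 (volume : Measure (Space d))‖) (Filter.Eventually.of_forall fun τ => ?_)) ?_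
  · refine (hb τ).trans (le_of_eq ?_)
    rw [Real.norm_of_nonneg (sq_nonneg _)]; ring
  · have h1 : Filter.Tendsto (fun τ : ℝ => τ - t) (nhds t) (nhds 0) := by
      have : Continuous fun τ : ℝ => τ - t := by fun_prop
      simpa using this.tendsto t
    have := (Asymptotics.isLittleO_pow_id (𝕜 := ℝ) (n := 2) (by norm_num)).comp_tendsto h1
    exact this

/-- A product rule in which `U` is merely continuous: since `V` vanishes at `t`, only the difference
quotient of `V` occurs. It is needed because `u` is differentiable in time only weakly. -/
theorem hasDerivAt_bilin_of_zero {X Y Z : Type*} [NormedAddCommGroup X] [NormedSpace ℝ X]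
    [NormedSpace ℂ X] [NormedAddCommGroup Y] [NormedSpace ℝ Y] [NormedSpace ℂ Y]
    [IsScalarTower ℝ ℂ Y] [NormedAddCommGroup Z] [NormedSpace ℝ Z] [NormedSpace ℂ Z]
    [IsScalarTower ℝ ℂ Z]
    (B : X →L[ℂ] Y →L[ℂ] Z) {U : ℝ → X} {V : ℝ → Y} {V' : Y} {t : ℝ} (hU : ContinuousAt U t)
    (hV : HasDerivAt V V' t) (h0 : V t = 0) : HasDerivAt (fun τ => B (U τ) (V τ)) (B (U t) V') t := by
  rw [hasDerivAt_iff_tendsto_slope] at hV ⊢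
  have h1 : Filter.Tendsto (fun τ => B (U τ) (slope V t τ)) (nhdsWithin t {t}ᶜ)
      (nhds (B (U t) V')) :=
    (B.continuous₂.tendsto (U t, V')).comp
      ((hU.tendsto.mono_left nhdsWithin_le_nhds).prodMk_nhds hV)
  refine h1.congr fun τ => ?_
  simp only [slope, vsub_eq_sub, h0, sub_zero, map_zero]
  rw [← algebraMap_smul ℂ ((τ - t)⁻¹) (V τ), map_smul, algebraMap_smul]

/-- The bilinear pairing of `L²`. -/
def pairing (d : ℕ) : L2 d →L[ℂ] L2 d →L[ℂ] ℂ :=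
  (ContinuousLinearMap.mul ℂ ℂ).lpPairing volume 2 2

theorem pairing_apply {d : ℕ} (f g : L2 d) : pairing d f g = ∫ x, f x * g x := by
  rw [pairing, ContinuousLinearMap.lpPairing_eq_integral]; rfl

theorem pairing_toLp {d : ℕ} (f : L2 d) (φ : 𝓢(Space d, ℂ)) :
    pairing d f (φ.toLp 2) = ∫ x, f x * φ x := by
  rw [pairing_apply]
  refine integral_congr_ae ?_
  filter_upwards [φ.coeFn_toLp 2 (volume : Measure (Space d))] with x hx
  rw [hx]

theorem toTemperedDistribution_fourier {d : ℕ} (U : L2 d) (φ : 𝓢(Space d, ℂ)) :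
    Lp.toTemperedDistribution U (𝓕 φ) = pairing d (𝓕 U) (φ.toLp 2) := by
  rw [pairing_toLp, integral_fourier_mul, Lp.toTemperedDistribution_apply]
  simp [mul_comm]

/-- Testing against a Fourier transform turns the spatial part of the equation into multiplication
by minus the dispersion. -/
theorem generator_apply_fourier (U : L2 d) (φ : 𝓢(Space d, ℂ)) :
    (1 / 2 : ℂ) * (Δ (Lp.toTemperedDistribution U)) (𝓕 φ) - (1 / 4 : ℂ) *
      (∂_{e₁ d} (∂_{e₁ d} (∂_{e₁ d} (∂_{e₁ d} (Lp.toTemperedDistribution U))))) (𝓕 φ) =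
    - pairing d (𝓕 U) ((SchwartzMap.smulLeftCLM ℂ (fun ξ : Space d => (dispersion ξ : ℂ)) φ).toLp 2) := by
  have hin : ∀ ξ : Space d, inner ℝ ξ (e₁ d) = ξ 0 := fun ξ => by
    simp [e₁, EuclideanSpace.inner_single_right]
  have hc := hasTemperateGrowth_coord (d := d)
  have hn : (fun ξ : Space d => ((‖ξ‖ ^ 2 : ℝ) : ℂ)).HasTemperateGrowth := by fun_prop
  have hd := hasTemperateGrowth_dispersion (d := d)
  have hc' : (fun ξ : Space d => ξ 0).HasTemperateGrowth :=
    (EuclideanSpace.proj (𝕜 := ℝ) (0 : Fin d)).hasTemperateGrowth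
  simp only [TemperedDistribution.laplacian_eq_fourierMultiplierCLM,
    TemperedDistribution.lineDeriv_eq_fourierMultiplierCLM, hin, map_smul]
  simp only [smul_apply, TemperedDistribution.fourierMultiplierCLM_apply_apply,
    FourierTransform.fourierInv_fourier_eq, toTemperedDistribution_fourier, pairing_toLp]
  have i1 := integrable_L2_mul_schwartz (𝓕 U : L2 d)
    (SchwartzMap.smulLeftCLM ℂ (fun x : Space d => ((‖x‖ ^ 2 : ℝ) : ℂ)) φ)
  have i2 := integrable_L2_mul_schwartz (𝓕 U : L2 d)
    (SchwartzMap.smulLeftCLM ℂ (fun x : Space d => ((x 0 : ℝ) : ℂ))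
      (SchwartzMap.smulLeftCLM ℂ (fun x : Space d => ((x 0 : ℝ) : ℂ))
        (SchwartzMap.smulLeftCLM ℂ (fun x : Space d => ((x 0 : ℝ) : ℂ))
          (SchwartzMap.smulLeftCLM ℂ (fun x : Space d => ((x 0 : ℝ) : ℂ)) φ))))
  have e : ∀ x : Space d, (𝓕 U : L2 d) x *
      (SchwartzMap.smulLeftCLM ℂ (fun ξ : Space d => (dispersion ξ : ℂ)) φ) x =
      ((2 * Real.pi : ℝ) : ℂ) ^ 2 / 2 * ((𝓕 U : L2 d) x *
        (SchwartzMap.smulLeftCLM ℂ (fun x : Space d => ((‖x‖ ^ 2 : ℝ) : ℂ)) φ) x) +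
      ((2 * Real.pi : ℝ) : ℂ) ^ 4 / 4 * ((𝓕 U : L2 d) x *
        (SchwartzMap.smulLeftCLM ℂ (fun x : Space d => ((x 0 : ℝ) : ℂ))
      (SchwartzMap.smulLeftCLM ℂ (fun x : Space d => ((x 0 : ℝ) : ℂ))
        (SchwartzMap.smulLeftCLM ℂ (fun x : Space d => ((x 0 : ℝ) : ℂ))
          (SchwartzMap.smulLeftCLM ℂ (fun x : Space d => ((x 0 : ℝ) : ℂ)) φ)))) x) := by
    intro x
    simp only [SchwartzMap.smulLeftCLM_apply_apply hd, SchwartzMap.smulLeftCLM_apply_apply hc,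
      SchwartzMap.smulLeftCLM_apply_apply hn, smul_eq_mul]
    rw [dispersion]
    push_cast; ring
  rw [integral_congr_ae (Filter.Eventually.of_forall e),
    integral_add (i1.const_mul _) (i2.const_mul _), integral_const_mul, integral_const_mul,
    Complex.real_smul]
  simp only [smul_eq_mul]
  push_cast
  -- This accounts for the fourth power `(2πi)⁴ = (2π)⁴` of the symbol of `∂₁`.
  linear_combination (-(1 / 4 : ℂ) * (2 * (Real.pi : ℂ)) ^ 4 * (Complex.I ^ 2 - 1) *
    ∫ x, (𝓕 U : L2 d) x * (SchwartzMap.smulLeftCLM ℂ (fun x : Space d => ((x 0 : ℝ) : ℂ))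
      (SchwartzMap.smulLeftCLM ℂ (fun x : Space d => ((x 0 : ℝ) : ℂ))
        (SchwartzMap.smulLeftCLM ℂ (fun x : Space d => ((x 0 : ℝ) : ℂ))
          (SchwartzMap.smulLeftCLM ℂ (fun x : Space d => ((x 0 : ℝ) : ℂ)) φ)))) x) * Complex.I_sq

theorem IsSolution.continuousAt {ψ : L2 d} {u : ℝ → L2 d} (hu : IsSolution ψ u) {t : ℝ}
    (ht : 0 < t) : ContinuousAt u t :=
  hu.continuousOn.continuousAt (Ici_mem_nhds ht)

/-- The profile `e^{iτ dispersion} û(τ)` is constant in time when tested. The moving test function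
is split into its value at `t`, to which the weak equation applies, and an increment vanishing at
`t`. The two derivatives cancel. -/
theorem IsSolution.hasDerivAt_pairing {ψ : L2 d} {u : ℝ → L2 d} (hu : IsSolution ψ u)
    (η : 𝓢(Space d, ℂ)) (hη : HasCompactSupport η) {t : ℝ} (ht : 0 < t) :
    HasDerivAt (fun τ => pairing d (𝓕 (u τ)) ((phaseMul η hη τ).toLp 2)) 0 t := by
  obtain ⟨u', h1, h2⟩ := hu.equation t ht
  set η' := (SchwartzMap.smulLeftCLM ℂ (fun ξ : Space d => (dispersion ξ : ℂ))
        (phaseMul η hη t)) with hη'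
  have h3 := h1 (𝓕 (phaseMul η hη t))
  simp only [toTemperedDistribution_fourier] at h3
  have h4 := generator_apply_fourier (u t) (phaseMul η hη t)
  rw [← hη'] at h4
  have h5 := congrArg (fun T : 𝓢'(Space d, ℂ) => T (𝓕 (phaseMul η hη t))) h2
  simp only [sub_apply, add_apply, smul_apply, zero_apply, smul_eq_mul] at h5
  have hF : ContinuousAt (fun τ => (𝓕 (u τ) : L2 d)) t :=
    (FourierTransform.fourierCLM ℂ (L2 d)).continuous.continuousAt.comp (hu.continuousAt ht)
  -- The increment of the test function is differentiable in `L²`, so norm continuity of `û` is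
  -- enough here.
  have h6 := hasDerivAt_bilin_of_zero (pairing d) (U := fun τ => (𝓕 (u τ) : L2 d))
    (V := fun τ => (phaseMul η hη τ).toLp 2 (volume : Measure (Space d)) -
      (phaseMul η hη t).toLp 2 (volume : Measure (Space d))) hF
    ((hasDerivAt_phaseMul_toLp η hη t).sub_const _) (sub_self _)
  refine ((h3.add h6).congr_of_eventuallyEq (Filter.Eventually.of_forall fun τ => ?_)).congr_deriv ?_
  · simp
  · rw [← hη', map_smul, smul_eq_mul]
    linear_combination (-Complex.I) * h5 + (Complex.I) * h4 + u' (𝓕 (phaseMul η hη t)) * Complex.I_sq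

theorem measurable_phase (t : ℝ) :
    Measurable fun ξ : Space d => Complex.exp (Complex.I * ((t * dispersion ξ : ℝ) : ℂ)) := by
  have := continuous_dispersion (d := d)
  exact Continuous.measurable (by fun_prop)

theorem norm_phase (t : ℝ) (ξ : Space d) :
    ‖Complex.exp (Complex.I * ((t * dispersion ξ : ℝ) : ℂ))‖ = 1 := by
  rw [mul_comm, Complex.norm_exp_ofReal_mul_I]

/-- Multiplication by `e^{i t dispersion}` on `L²`. -/
def phaseOp (d : ℕ) [NeZero d] (t : ℝ) : L2 d →ₗᵢ[ℂ] L2 d :=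
  weightedComp (isWeightedComp_id (measurable_phase t) (norm_phase t))

theorem coeFn_phaseOp (t : ℝ) (f : L2 d) : phaseOp d t f =ᵐ[volume] fun ξ =>
    Complex.exp (Complex.I * ((t * dispersion ξ : ℝ) : ℂ)) * f ξ :=
  coeFn_weightedComp _ f

/-- The free evolution on `L²`. -/
def evolution (d : ℕ) [NeZero d] (t : ℝ) : L2 d →ₗᵢ[ℂ] L2 d :=
  (Lp.fourierTransformₗᵢ (Space d) ℂ).symm.toLinearIsometry.comp
    ((phaseOp d (-t)).comp (Lp.fourierTransformₗᵢ (Space d) ℂ).toLinearIsometry)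

theorem fourier_evolution (t : ℝ) (ψ : L2 d) :
    𝓕 (evolution d t ψ) = phaseOp d (-t) (𝓕 ψ) :=
  (Lp.fourierTransformₗᵢ (Space d) ℂ).apply_symm_apply _

/-- Each tested profile has zero derivative for positive times and is continuous up to time zero,
where it equals the Fourier transform of the datum. Testing determines the profile, and the phase is
then inverted. -/
theorem IsSolution.eq_evolution {ψ : L2 d} {u : ℝ → L2 d} (hu : IsSolution ψ u) {t : ℝ}
    (ht : 0 < t) : u t = evolution d t ψ := by
  have key : phaseOp d t (𝓕 (u t)) = 𝓕 ψ := by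
    refine Lp.ext (ae_eq_of_integral_mul_schwartz (locallyIntegrable_Lp _) (locallyIntegrable_Lp _)
      fun η hη => ?_)
    have hc : ContinuousOn (fun τ => pairing d (𝓕 (u τ)) ((phaseMul η hη τ).toLp 2))
        (Set.Icc 0 t) := by
      have c1 : ContinuousOn (fun τ => (𝓕 (u τ) : L2 d)) (Set.Icc 0 t) :=
        (FourierTransform.fourierCLM ℂ (L2 d)).continuous.comp_continuousOn
          (hu.continuousOn.mono Set.Icc_subset_Ici_self)
      have c2 : Continuous fun τ => (phaseMul η hη τ).toLp 2 (volume : Measure (Space d)) :=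
        continuous_iff_continuousAt.2 fun τ => (hasDerivAt_phaseMul_toLp η hη τ).continuousAt
      exact ((pairing d).continuous.comp_continuousOn c1).clm_apply c2.continuousOn
    have h := eq_of_hasDerivAt_zero ht hc fun τ hτ => hu.hasDerivAt_pairing η hη hτ.1
    simp only [pairing_toLp, hu.initial, phaseMul_apply] at h
    simp only [zero_mul, Complex.ofReal_zero, mul_zero, Complex.exp_zero, one_mul] at h
    rw [h]
    refine integral_congr_ae ?_
    filter_upwards [coeFn_phaseOp t (𝓕 (u t))] with x hx
    rw [hx]; ring
  rw [← FourierTransform.fourierInv_fourier_eq (F := L2 d) (u t),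
    ← FourierTransform.fourierInv_fourier_eq (F := L2 d) (evolution d t ψ), fourier_evolution,
    ← key]
  congr 1
  refine Lp.ext ?_
  filter_upwards [coeFn_phaseOp (-t) (phaseOp d t (𝓕 (u t))), coeFn_phaseOp t (𝓕 (u t))] with x h1 h2
  rw [h1, h2, ← mul_assoc, ← Complex.exp_add]
  push_cast
  ring_nf
  simp

end

/-! ### The change of variables `x ↦ μ` and the isometry defined by the leading term -/

theorem bijective_mu₁ {t : ℝ} (ht : 0 < t) : Function.Bijective (mu₁ t) := by
  refine ⟨fun x y h => ?_, fun m => ⟨t * (m + m ^ 3), mu₁_unique ht rfl⟩⟩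
  rw [← mu₁_spec ht x, ← mu₁_spec ht y, h]

theorem lintegral_mu₁ {t : ℝ} (ht : 0 < t) (g : ℝ → ℝ≥0∞) :
    ∫⁻ x, ENNReal.ofReal (t * ell (mu₁ t x))⁻¹ * g (mu₁ t x) = ∫⁻ m, g m := by
  have h := lintegral_image_eq_lintegral_abs_deriv_mul (s := Set.univ) (f := mu₁ t)
    MeasurableSet.univ (fun x _ => (hasDerivAt_mu₁ ht x).hasDerivWithinAt)
    (bijective_mu₁ ht).injective.injOn g
  rw [Set.image_univ, (bijective_mu₁ ht).surjective.range_eq, Measure.restrict_univ] at h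
  rw [h]
  refine lintegral_congr fun x => ?_
  rw [abs_of_pos (inv_pos.2 (mul_pos ht (ell_pos _)))]

/-- The map acts coordinatewise, so its Jacobian matrix is diagonal. -/
theorem lintegral_coordMap {d : ℕ} {g g' : Fin d → ℝ → ℝ}
    (hg : ∀ j x, HasDerivAt (g j) (g' j x) x) (hb : ∀ j, Function.Bijective (g j))
    (F : Space d → ℝ≥0∞) :
    ∫⁻ x : Space d, ENNReal.ofReal |∏ j, g' j (x j)| * F (WithLp.toLp 2 fun j => g j (x j)) =
      ∫⁻ x, F x := by
  set G : (Fin d → ℝ) → (Fin d → ℝ) := fun x j => g j (x j) with hG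
  have hGb : Function.Bijective G := Function.Bijective.piMap hb
  have hd : ∀ x : Fin d → ℝ, HasFDerivAt G (ContinuousLinearMap.pi fun j =>
      (ContinuousLinearMap.toSpanSingleton ℝ (g' j (x j))).comp (ContinuousLinearMap.proj j)) x := by
    intro x
    rw [hasFDerivAt_pi]
    intro j
    exact (hg j (x j)).hasFDerivAt.comp x (hasFDerivAt_apply j x)
  have h := lintegral_image_eq_lintegral_abs_det_fderiv_mul volume (s := Set.univ) (f := G)
    MeasurableSet.univ (fun x _ => (hd x).hasFDerivWithinAt) hGb.injective.injOn
    (fun x => F (WithLp.toLp 2 x))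
  rw [Set.image_univ, hGb.surjective.range_eq, Measure.restrict_univ,
    (PiLp.volume_preserving_toLp (Fin d)).lintegral_comp_emb
      (MeasurableEquiv.toLp 2 (Fin d → ℝ)).measurableEmbedding] at h
  rw [h, ← (PiLp.volume_preserving_toLp (Fin d)).lintegral_comp_emb
      (MeasurableEquiv.toLp 2 (Fin d → ℝ)).measurableEmbedding]
  refine lintegral_congr fun x => ?_
  rw [ContinuousLinearMap.det_pi]
  simp [ContinuousLinearMap.det, LinearMap.det_ring, hG]

section

variable {d : ℕ} [NeZero d]

/-- The weight of the leading term. -/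
def leadWeight (d : ℕ) [NeZero d] (t : ℝ) (x : Space d) : ℂ :=
  ((t ^ (-(d : ℝ) / 2) / √(3 * mu₁ t (x 0) ^ 2 + 1) : ℝ) : ℂ) *
    (((2 * Real.pi) ^ (-(d : ℝ) / 2) : ℝ) : ℂ) *
    Complex.exp (Complex.I * ((3 / 4 * t * mu₁ t (x 0) ^ 4 + 1 / 2 * t * ‖mu t x‖ ^ 2
      - (d : ℝ) / 4 * Real.pi : ℝ) : ℂ))

theorem leading_eq (ψ : L2 d) (t : ℝ) (x : Space d) :
    leading ψ t x = leadWeight d t x * (𝓕 ψ : L2 d) ((2 * Real.pi)⁻¹ • mu t x) := by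
  simp only [leading, leadWeight, hat]; ring

theorem norm_leadWeight {t : ℝ} (ht : 0 < t) (x : Space d) :
    ‖leadWeight d t x‖ = (2 * Real.pi * t) ^ (-(d : ℝ) / 2) * (√(ell (mu₁ t (x 0))))⁻¹ := by
  rw [leadWeight, norm_mul, norm_mul, mul_comm Complex.I, Complex.norm_exp_ofReal_mul_I, mul_one,
    Complex.norm_real, Complex.norm_real, Real.norm_of_nonneg (by positivity),
    Real.norm_of_nonneg (by positivity), Real.mul_rpow (by positivity) ht.le, ell]
  ring

theorem continuous_mu {t : ℝ} (ht : 0 < t) : Continuous (mu (d := d) t) := by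
  unfold mu
  refine (PiLp.continuous_toLp 2 _).comp (continuous_pi fun j => ?_)
  by_cases hj : j = 0
  · simp only [hj, if_true]
    exact (continuous_mu₁ ht).comp (by fun_prop)
  · simp only [hj, if_false]
    fun_prop

/-- The squared modulus `(2πt)^(-d)/ℓ` of the weight is the Jacobian of `x ↦ μ/(2π)`. Hence the
leading term depends isometrically on the datum. -/
theorem isWeightedComp_lead {t : ℝ} (ht : 0 < t) :
    IsWeightedComp (volume : Measure (Space d)) (leadWeight d t)
      (fun x => (2 * Real.pi)⁻¹ • mu t x) where
  measurable_weight := by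
    have h1 := continuous_mu (d := d) ht
    have h2 : Continuous fun x : Space d => mu₁ t (x 0) := (continuous_mu₁ ht).comp (by fun_prop)
    refine Continuous.measurable ?_
    unfold leadWeight
    have h3 : ∀ x : Space d, √(3 * mu₁ t (x 0) ^ 2 + 1) ≠ 0 := fun x => by positivity
    fun_prop (disch := assumption)
  measurable_map := by
    have := continuous_mu (d := d) ht
    exact Continuous.measurable (by fun_prop)
  weight_ne_zero x := by
    rw [← norm_ne_zero_iff, norm_leadWeight ht]
    have := ell_pos (mu₁ t (x 0))
    positivity
  lintegral_eq F _ := by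
    have hpi := Real.pi_pos
    set g : Fin d → ℝ → ℝ := fun j y => (2 * Real.pi)⁻¹ * if j = 0 then mu₁ t y else y / t with hg
    set g' : Fin d → ℝ → ℝ := fun j y => (2 * Real.pi * t)⁻¹ * if j = 0 then (ell (mu₁ t y))⁻¹ else 1
      with hg'
    have hd : ∀ j x, HasDerivAt (g j) (g' j x) x := by
      intro j x
      by_cases hj : j = 0
      · simp only [hg, hg', hj, if_true]
        refine ((hasDerivAt_mu₁ ht x).const_mul _).congr_deriv ?_
        rw [mul_inv, mul_inv]; ring
      · simp only [hg, hg', hj, if_false]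
        refine (((hasDerivAt_id x).div_const t).const_mul _).congr_deriv ?_
        rw [mul_inv]; simp; ring
    have hb : ∀ j, Function.Bijective (g j) := by
      intro j
      have h0 : Function.Bijective fun y : ℝ => (2 * Real.pi)⁻¹ * y :=
        mulLeft_bijective₀ _ (by positivity)
      by_cases hj : j = 0
      · simp only [hg, hj, if_true]
        exact h0.comp (bijective_mu₁ ht)
      · simp only [hg, hj, if_false]
        refine h0.comp ?_
        simp only [div_eq_mul_inv]
        exact mulRight_bijective₀ _ (by positivity)
    rw [← lintegral_coordMap hd hb F]
    refine lintegral_congr fun x => ?_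
    have e1 : (2 * Real.pi)⁻¹ • mu t x = WithLp.toLp 2 fun j => g j (x j) := by
      ext j
      by_cases hj : j = 0
      · simp [mu, hg, hj]
      · simp [mu, hg, hj]
    have e2 : ∏ j, g' j (x j) = (2 * Real.pi * t)⁻¹ ^ d * (ell (mu₁ t (x 0)))⁻¹ := by
      simp only [hg']
      rw [Finset.prod_mul_distrib, Finset.prod_const, Finset.card_univ, Fintype.card_fin,
        Finset.prod_ite_eq' Finset.univ (0 : Fin d) (fun j => (ell (mu₁ t (x j)))⁻¹)]
      simp
    have hl := ell_pos (mu₁ t (x 0))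
    rw [e1, e2, ← ofReal_norm, ← ENNReal.ofReal_pow (norm_nonneg _), norm_leadWeight ht, mul_pow,
      inv_pow, Real.sq_sqrt hl.le, abs_of_nonneg (by positivity), ← Real.rpow_natCast _ 2,
      ← Real.rpow_mul (by positivity), ← Real.rpow_natCast _ d, Real.inv_rpow (by positivity),
      ← Real.rpow_neg (by positivity)]
    congr 4
    push_cast; ring

/-- The operator `ψ ↦ leading ψ t` on `L²`. -/
def leadOp (d : ℕ) [NeZero d] {t : ℝ} (ht : 0 < t) : L2 d →ₗᵢ[ℂ] L2 d :=
  (weightedComp (isWeightedComp_lead ht)).comp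
    (Lp.fourierTransformₗᵢ (Space d) ℂ).toLinearIsometry

theorem coeFn_leadOp {t : ℝ} (ht : 0 < t) (ψ : L2 d) : leadOp d ht ψ =ᵐ[volume] leading ψ t := by
  filter_upwards [coeFn_weightedComp (isWeightedComp_lead ht) (𝓕 ψ : L2 d)] with x hx
  rw [leading_eq, ← hx]
  rfl

end

/-! ### Regularised one-dimensional integrals and their limits -/

theorem norm_osc_rotated_le {ε t x s : ℝ} (hε : 0 ≤ ε) (ht : 0 ≤ t) (hs : s ∈ Set.Icc (0 : ℝ) 1)
    (r : ℝ) : ‖osc ε t x (0 + s * 0 + (1 + s * (-(Complex.I / 2))) * r)‖ ≤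
      Real.exp (|x| / 2 * |r| - 3 / 8 * ε * r ^ 2) := by
  have h : (0 : ℂ) + s * 0 + (1 + s * (-(Complex.I / 2))) * r =
      (r : ℂ) + ((-(s * r) / 2 : ℝ) : ℂ) * Complex.I := by push_cast; ring
  rw [h, norm_osc, Real.exp_le_exp]
  obtain ⟨h0, h1⟩ := hs
  have h2 : x * r * s ≤ |x| * |r| := by
    have : x * r * s ≤ |x * r * s| := le_abs_self _
    rw [abs_mul, abs_mul, abs_of_nonneg h0] at this
    nlinarith [mul_nonneg (abs_nonneg x) (abs_nonneg r)]
  have hs2 : s ^ 2 ≤ 1 := by nlinarith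
  have h3 : 0 ≤ ε * (r ^ 2 * (1 - s ^ 2)) := by
    apply mul_nonneg hε; apply mul_nonneg (sq_nonneg r); linarith
  have h4 : 0 ≤ t * (s * r ^ 2) := by positivity
  have h5 : 0 ≤ t * (s * r ^ 2 * (r ^ 2 * (4 - s ^ 2))) := by
    have : 0 ≤ 4 - s ^ 2 := by linarith
    positivity
  nlinarith

/-- On the real axis the phase alone gives no decay. The term `ε` supplies a Gaussian along all
lines between the real axis and the slanted one, and this justifies the rotation. -/
theorem integral_osc_rotate {ε t : ℝ} (hε : 0 < ε) (ht : 0 ≤ t) (x : ℝ) :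
    ∫ r : ℝ, osc ε t x r = ∫ r : ℝ, osc ε t x (slant * r) * slant := by
  set A : ℝ := 1 + |x| + (|ε| + |t|) * 2 + |t| * 8 with hA
  have hA0 : 1 ≤ A := by
    have := abs_nonneg x; have := abs_nonneg ε; have := abs_nonneg t
    linarith
  have hI := (integrable_poly_gauss 4 (|x| / 2) (δ := 3 / 8 * ε) (by positivity)).const_mul A
  have hn : ∀ s ∈ Set.Icc (0 : ℝ) 1, ∀ r : ℝ,
      ‖(0 : ℂ) + s * 0 + (1 + s * (-(Complex.I / 2))) * r‖ ≤ 2 * (1 + |r|) := by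
    intro s hs r
    have h1 : ‖(1 : ℂ) + s * (-(Complex.I / 2))‖ ≤ 2 := by
      refine (norm_add_le _ _).trans ?_
      rw [norm_one, norm_mul, norm_neg, norm_div, Complex.norm_I, Complex.norm_real,
        Real.norm_of_nonneg hs.1, Complex.norm_ofNat]
      linarith [hs.2]
    rw [mul_zero, add_zero, zero_add, norm_mul, Complex.norm_real, Real.norm_eq_abs]
    nlinarith [abs_nonneg r]
  have hF : Continuous fun ζ : ℂ => (Complex.I * x - (ε + Complex.I * t) * ζ -
      Complex.I * t * ζ ^ 3) * osc ε t x ζ := by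
    have := continuous_osc ε t x
    fun_prop
  have key := integral_line_deform (hasDerivAt_osc ε t x) hF 0 0 1 (-(Complex.I / 2))
    (g := fun r => A * ((1 + |r|) ^ 3 * Real.exp (|x| / 2 * |r| - 3 / 8 * ε * r ^ 2)))
    (hI.congr (Filter.Eventually.of_forall fun r => by ring)) ?_ ?_
  · have e : (1 : ℂ) + -(Complex.I / 2) = slant := by rw [slant]; ring
    simpa [e] using key
  · intro s hs r
    refine (norm_osc_rotated_le hε.le ht hs r).trans ?_
    have h1 : 1 ≤ (1 + |r|) ^ 3 := one_le_pow₀ (by linarith [abs_nonneg r])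
    have h2 := Real.exp_pos (|x| / 2 * |r| - 3 / 8 * ε * r ^ 2)
    rw [← mul_assoc]
    nlinarith [mul_le_mul hA0 h1 zero_le_one (by linarith)]
  · intro s hs r
    rw [norm_mul, ← mul_assoc]
    refine mul_le_mul ?_ (norm_osc_rotated_le hε.le ht hs r) (norm_nonneg _) (by positivity)
    set ζ := (0 : ℂ) + s * 0 + (1 + s * (-(Complex.I / 2))) * r
    have hz : ‖ζ‖ ≤ 2 * (1 + |r|) := hn s hs r
    have hw : 1 ≤ 1 + |r| := by linarith [abs_nonneg r]
    have b1 : ‖Complex.I * (x : ℂ)‖ = |x| := by simp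
    have b2 : ‖(ε : ℂ) + Complex.I * t‖ ≤ |ε| + |t| := by
      refine (norm_add_le _ _).trans ?_
      simp
    have b3 : ‖Complex.I * (t : ℂ)‖ = |t| := by simp
    calc ‖Complex.I * x - (ε + Complex.I * t) * ζ - Complex.I * t * ζ ^ 3‖
        ≤ |x| + (|ε| + |t|) * (2 * (1 + |r|)) + |t| * (2 * (1 + |r|)) ^ 3 := by
          refine (norm_sub_le _ _).trans (add_le_add ((norm_sub_le _ _).trans ?_) ?_)
          · rw [b1, norm_mul]
            exact add_le_add le_rfl (mul_le_mul b2 hz (norm_nonneg _) (by positivity))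
          · rw [norm_mul, b3, norm_pow]
            gcongr
      _ ≤ A * (1 + |r|) ^ 3 := by
          have c1 : 1 ≤ (1 + |r|) ^ 3 := one_le_pow₀ hw
          have c2 : 1 + |r| ≤ (1 + |r|) ^ 3 := le_self_pow₀ hw (by norm_num)
          have d1 := mul_le_mul_of_nonneg_left c1 (abs_nonneg x)
          have d2 := mul_le_mul_of_nonneg_left c2 (by positivity : 0 ≤ (|ε| + |t|) * 2)
          rw [hA]
          nlinarith

theorem norm_osc_slant_zero_le {ε t x X : ℝ} (hε : 0 ≤ ε) (ht : 0 ≤ t) (hx : |x| ≤ X) (r : ℝ) :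
    ‖osc ε t x (slant * r) * slant‖ ≤ 2 * ((1 + |r|) ^ 0 * Real.exp (X / 2 * |r| - t / 16 * r ^ 2)) := by
  have h := norm_osc_slant_le (ε := ε) (t := t) (x := x) (c := 0) ht r
  rw [Complex.ofReal_zero, zero_add] at h
  rw [norm_mul, mul_comm, pow_zero, one_mul]
  refine mul_le_mul norm_slant_le (h.trans (Real.exp_le_exp.2 ?_)) (norm_nonneg _) zero_le_two
  simp only [ell]
  have h1 : |x| * |r| ≤ X * |r| := mul_le_mul_of_nonneg_right hx (abs_nonneg r)
  have h2 : 0 ≤ ε * r ^ 2 := by positivity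
  norm_num
  nlinarith

/-- After the rotation the decay comes from `t` and is uniform in `ε`, so dominated convergence
applies. -/
theorem tendsto_integral_osc {t : ℝ} (ht : 0 < t) (x : ℝ) :
    Filter.Tendsto (fun ε : ℝ => ∫ r : ℝ, osc ε t x r) (nhdsWithin 0 (Set.Ioi 0))
      (nhds (oscMoment t x 0)) := by
  have h : Filter.Tendsto (fun ε : ℝ => ∫ r : ℝ, osc ε t x (slant * r) * slant)
      (nhdsWithin 0 (Set.Ioi 0)) (nhds (∫ r : ℝ, osc 0 t x (slant * r) * slant)) := by
    refine tendsto_integral_filter_of_dominated_convergence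
      (fun r => 2 * ((1 + |r|) ^ 0 * Real.exp (|x| / 2 * |r| - t / 16 * r ^ 2))) ?_ ?_
      ((integrable_poly_gauss 0 _ (by positivity)).const_mul _) ?_
    · refine Filter.Eventually.of_forall fun ε => Continuous.aestronglyMeasurable ?_
      have := continuous_osc ε t x
      fun_prop
    · filter_upwards [self_mem_nhdsWithin] with ε hε
      exact Filter.Eventually.of_forall fun r => norm_osc_slant_zero_le (le_of_lt hε) ht.le le_rfl r
    · refine Filter.Eventually.of_forall fun r => ?_
      have : Continuous fun ε : ℝ => osc ε t x (slant * r) * slant := by unfold osc; fun_prop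
      exact (this.tendsto 0).mono_left nhdsWithin_le_nhds
  rw [oscMoment]
  simp only [pow_zero, one_mul]
  refine h.congr' ?_
  filter_upwards [self_mem_nhdsWithin] with ε hε
  exact (integral_osc_rotate hε ht.le x).symm

theorem exists_norm_integral_osc_le {t : ℝ} (ht : 0 < t) (X : ℝ) :
    ∃ C : ℝ, ∀ ε : ℝ, 0 < ε → ∀ x : ℝ, |x| ≤ X → ‖∫ r : ℝ, osc ε t x r‖ ≤ C := by
  refine ⟨∫ r : ℝ, 2 * ((1 + |r|) ^ 0 * Real.exp (X / 2 * |r| - t / 16 * r ^ 2)),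
    fun ε hε x hx => ?_⟩
  rw [integral_osc_rotate hε ht.le]
  exact norm_integral_le_of_norm_le ((integrable_poly_gauss 0 _ (by positivity)).const_mul _)
    (Filter.Eventually.of_forall fun r => norm_osc_slant_zero_le hε.le ht.le hx r)

/-- The regularised Schrödinger phase. -/
def quadOsc (ε t z r : ℝ) : ℂ :=
  Complex.exp (Complex.I * z * r - (ε + Complex.I * t) * r ^ 2 / 2)

theorem integral_quadOsc {ε : ℝ} (hε : 0 < ε) (t z : ℝ) : ∫ r, quadOsc ε t z r =
    (Real.pi / ((ε + Complex.I * t) / 2)) ^ (1 / 2 : ℂ) *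
      Complex.exp (-(z : ℂ) ^ 2 / (4 * ((ε + Complex.I * t) / 2))) := by
  rw [← fourierIntegral_gaussian (b := (ε + Complex.I * t) / 2) (by simpa using hε)]
  refine integral_congr_ae (Filter.Eventually.of_forall fun r => ?_)
  simp only [quadOsc]
  rw [← Complex.exp_add]
  ring_nf

theorem tendsto_integral_quadOsc {t : ℝ} (ht : 0 < t) (z : ℝ) :
    Filter.Tendsto (fun ε : ℝ => ∫ r, quadOsc ε t z r) (nhdsWithin 0 (Set.Ioi 0))
      (nhds ((√(2 * Real.pi / t) : ℝ) *
        Complex.exp (Complex.I * ((z ^ 2 / (2 * t) - Real.pi / 4 : ℝ) : ℂ)))) := by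
  have ht' : (t : ℂ) ≠ 0 := by exact_mod_cast ht.ne'
  have hne : ((0 : ℝ) + Complex.I * t) / 2 ≠ 0 := by simp [ht']
  have e0 : (Real.pi : ℂ) / (((0 : ℝ) + Complex.I * t) / 2) = ((2 * Real.pi / t : ℝ) : ℂ) * -Complex.I := by
    push_cast
    rw [zero_add, div_div_eq_mul_div, div_eq_iff (mul_ne_zero Complex.I_ne_zero ht'), mul_assoc,
      div_mul_eq_mul_div, eq_div_iff ht']
    linear_combination (2 * (Real.pi : ℂ) * t) * Complex.I_sq
  have hc : ContinuousAt (fun ε : ℝ => (Real.pi / ((ε + Complex.I * t) / 2)) ^ (1 / 2 : ℂ) *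
      Complex.exp (-(z : ℂ) ^ 2 / (4 * ((ε + Complex.I * t) / 2)))) 0 := by
    have h1 : ContinuousAt (fun ε : ℝ => ((ε : ℂ) + Complex.I * t) / 2) 0 := by fun_prop
    refine ContinuousAt.mul (ContinuousAt.cpow (continuousAt_const.div h1 hne) continuousAt_const ?_)
      (Complex.continuous_exp.continuousAt.comp
        (continuousAt_const.div (continuousAt_const.mul h1) (mul_ne_zero (by norm_num) hne)))
    -- The limit of the base is a positive multiple of `-i`, away from the branch cut, so the square
    -- root is continuous there.
    rw [e0, Complex.mem_slitPlane_iff]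
    right
    simp [ht.ne', Real.pi_ne_zero]
  have hv : (Real.pi / ((((0 : ℝ) : ℂ) + Complex.I * t) / 2)) ^ (1 / 2 : ℂ) *
      Complex.exp (-(z : ℂ) ^ 2 / (4 * ((((0 : ℝ) : ℂ) + Complex.I * t) / 2))) =
      (√(2 * Real.pi / t) : ℝ) *
        Complex.exp (Complex.I * ((z ^ 2 / (2 * t) - Real.pi / 4 : ℝ) : ℂ)) := by
    have ha : 0 < 2 * Real.pi / t := by positivity
    have hI : -Complex.I ≠ 0 := neg_ne_zero.2 Complex.I_ne_zero
    have hs : (√(2 * Real.pi / t) : ℝ) = Real.exp (Real.log (2 * Real.pi / t) * (1 / 2)) := by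
      rw [Real.sqrt_eq_rpow, Real.rpow_def_of_pos ha]
    rw [e0, Complex.cpow_def_of_ne_zero
      (mul_ne_zero (by exact_mod_cast ha.ne') hI), Complex.log_ofReal_mul ha hI,
      Complex.log_neg_I, hs, Complex.ofReal_exp, ← Complex.exp_add, ← Complex.exp_add]
    congr 1
    have e1 : -(z : ℂ) ^ 2 / (4 * ((((0 : ℝ) : ℂ) + Complex.I * t) / 2)) =
        Complex.I * (z ^ 2 / (2 * t)) := by
      rw [Complex.ofReal_zero, zero_add]
      field_simp
      linear_combination (-4 * (z : ℂ) ^ 2) * Complex.I_sq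
    rw [e1]
    push_cast
    ring
  rw [← hv]
  refine (hc.tendsto.mono_left nhdsWithin_le_nhds).congr' ?_
  filter_upwards [self_mem_nhdsWithin] with ε hε
  exact (integral_quadOsc hε t z).symm

theorem norm_integral_quadOsc_le {ε t : ℝ} (hε : 0 < ε) (ht : 0 < t) (z : ℝ) :
    ‖∫ r, quadOsc ε t z r‖ ≤ √(2 * Real.pi / t) := by
  rw [integral_quadOsc hε, norm_mul]
  set b : ℂ := (ε + Complex.I * t) / 2 with hb
  have hbre : b.re = ε / 2 := by simp [hb]
  have hbim : b.im = t / 2 := by simp [hb]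
  have hbn : t / 2 ≤ ‖b‖ := by
    have := Complex.abs_im_le_norm b
    rwa [hbim, abs_of_pos (by positivity)] at this
  have hb0 : 0 < ‖b‖ := by linarith
  have h1 : ‖(Real.pi / b) ^ (1 / 2 : ℂ)‖ ≤ √(2 * Real.pi / t) := by
    have : (1 / 2 : ℂ) = ((1 / 2 : ℝ) : ℂ) := by norm_num
    rw [this, Complex.norm_cpow_real, ← Real.sqrt_eq_rpow, norm_div, Complex.norm_real,
      Real.norm_of_nonneg Real.pi_pos.le]
    refine Real.sqrt_le_sqrt ?_
    rw [div_le_div_iff₀ hb0 ht]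
    nlinarith [Real.pi_pos]
  have h2 : ‖Complex.exp (-(z : ℂ) ^ 2 / (4 * b))‖ ≤ 1 := by
    rw [Complex.norm_exp]
    refine Real.exp_le_one_iff.2 ?_
    have e : -(z : ℂ) ^ 2 / (4 * b) = ((-(z ^ 2 / 4) : ℝ) : ℂ) * b⁻¹ := by
      push_cast; rw [div_eq_mul_inv, mul_inv]; ring
    rw [e, Complex.re_ofReal_mul, Complex.inv_re, hbre]
    have h3 : 0 ≤ ε / 2 / Complex.normSq b := div_nonneg (by positivity) (Complex.normSq_nonneg b)
    nlinarith [sq_nonneg z]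
  calc _ ≤ √(2 * Real.pi / t) * 1 := mul_le_mul h1 h2 (norm_nonneg _) (Real.sqrt_nonneg _)
    _ = _ := mul_one _

/-! ### Factorisation of the regularised propagator -/

section

variable {d : ℕ} [NeZero d]

/-- The transverse factor of the propagator. -/
def transv (d : ℕ) [NeZero d] (t : ℝ) (z : Space d) : ℂ :=
  (((2 * Real.pi * t) ^ (-((d : ℝ) - 1) / 2) : ℝ) : ℂ) *
    Complex.exp (Complex.I * (((‖z‖ ^ 2 - z 0 ^ 2) / (2 * t) - ((d : ℝ) - 1) * (Real.pi / 4) : ℝ) : ℂ))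

/-- The propagator. -/
def fullKern (d : ℕ) [NeZero d] (t : ℝ) (z : Space d) : ℂ := kern t (z 0) * transv d t z

/-- The regularised symbol. -/
def regSymbol (d : ℕ) [NeZero d] (ε t : ℝ) (ξ : Space d) : ℂ :=
  Complex.exp ((-(ε * (2 * Real.pi) ^ 2 / 2) * ‖ξ‖ ^ 2 : ℝ) : ℂ) *
    Complex.exp (Complex.I * ((-t * dispersion ξ : ℝ) : ℂ))

/-- The regularised propagator. -/
def regKernel (d : ℕ) [NeZero d] (ε t : ℝ) (z : Space d) : ℂ :=
  ∫ ξ : Space d, regSymbol d ε t ξ * Complex.exp (Complex.I * ((2 * Real.pi * inner ℝ z ξ : ℝ) : ℂ))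

theorem norm_transv {t : ℝ} (ht : 0 < t) (z : Space d) :
    ‖transv d t z‖ = (2 * Real.pi * t) ^ (-((d : ℝ) - 1) / 2) := by
  rw [transv, norm_mul, mul_comm Complex.I, Complex.norm_exp_ofReal_mul_I, mul_one,
    Complex.norm_real, Real.norm_of_nonneg (by positivity)]

theorem norm_regSymbol (ε t : ℝ) (ξ : Space d) :
    ‖regSymbol d ε t ξ‖ = Real.exp (-(ε * (2 * Real.pi) ^ 2 / 2) * ‖ξ‖ ^ 2) := by
  rw [regSymbol, norm_mul, norm_phase, mul_one, Complex.norm_exp_ofReal]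

theorem continuous_regSymbol (ε t : ℝ) : Continuous (regSymbol d ε t) := by
  have := continuous_dispersion (d := d)
  unfold regSymbol
  fun_prop

theorem integrable_regSymbol {ε : ℝ} (hε : 0 < ε) (t : ℝ) : Integrable (regSymbol d ε t) := by
  have hb : 0 < ((ε * (2 * Real.pi) ^ 2 / 2 : ℝ) : ℂ).re := by
    have := Real.pi_pos
    rw [Complex.ofReal_re]; positivity
  have h := (GaussianFourier.integrable_cexp_neg_mul_sq_norm_add hb 0 (0 : Space d)).norm
  refine Integrable.mono' h (continuous_regSymbol ε t).aestronglyMeasurable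
    (Filter.Eventually.of_forall fun ξ => ?_)
  rw [norm_regSymbol, Complex.norm_exp]
  apply le_of_eq
  simp [← Complex.ofReal_pow]

theorem integral_comp_two_pi_mul (g : ℝ → ℂ) :
    ∫ r : ℝ, g (2 * Real.pi * r) = ((2 * Real.pi)⁻¹ : ℝ) * ∫ r, g r := by
  rw [Measure.integral_comp_mul_left, abs_of_nonneg (by positivity), Complex.real_smul]

/-- The symbol is a product over coordinates, of which only the first carries the quartic term. The
factors `(2π)⁻¹` come from the substitution `r = 2πξ_j`. -/
theorem regKernel_eq (ε t : ℝ) (z : Space d) : regKernel d ε t z =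
    ∏ j : Fin d, ((((2 * Real.pi)⁻¹ : ℝ) : ℂ) *
      if j = 0 then ∫ r : ℝ, osc ε t (z 0) r else ∫ r, quadOsc ε t (z j) r) := by
  have h1 : ∀ v : Fin d → ℝ, regSymbol d ε t (WithLp.toLp 2 v) *
      Complex.exp (Complex.I * ((2 * Real.pi * inner ℝ z (WithLp.toLp 2 v) : ℝ) : ℂ)) =
      ∏ j, (quadOsc ε t (z j) (2 * Real.pi * v j) *
        if j = 0 then Complex.exp (-(Complex.I * t * ((2 * Real.pi * v j : ℝ) : ℂ) ^ 4 / 4)) else 1) := by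
    intro v
    rw [Finset.prod_mul_distrib, Finset.prod_ite_eq' Finset.univ (0 : Fin d)]
    simp only [Finset.mem_univ, if_true, quadOsc]
    rw [← Complex.exp_sum, regSymbol, ← Complex.exp_add, ← Complex.exp_add, ← Complex.exp_add]
    congr 1
    have e1 : ‖(WithLp.toLp 2 v : Space d)‖ ^ 2 = ∑ j, v j ^ 2 := by
      rw [EuclideanSpace.real_norm_sq_eq]
    have e2 : inner ℝ z (WithLp.toLp 2 v) = ∑ j, z j * v j := by
      simp [PiLp.inner_apply, mul_comm]
    rw [dispersion, e1, e2, Finset.sum_sub_distrib]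
    push_cast
    simp only [mul_pow, Finset.mul_sum, Finset.sum_div]
    have e3 : ∀ (a : ℂ) (f : Fin d → ℂ), ∑ j, a * f j = a * ∑ j, f j := fun a f =>
      (Finset.mul_sum _ _ _).symm
    have s1 : ∑ j : Fin d, Complex.I * (z j : ℂ) * (2 * Real.pi * (v j : ℂ)) =
        Complex.I * 2 * Real.pi * ∑ j : Fin d, (z j : ℂ) * v j := by
      rw [Finset.mul_sum]; exact Finset.sum_congr rfl fun j _ => by ring
    have s2 : ∑ j : Fin d, ((ε : ℂ) + Complex.I * t) * (2 ^ 2 * (Real.pi : ℂ) ^ 2 * (v j : ℂ) ^ 2) / 2 =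
        ((ε : ℂ) + Complex.I * t) * 2 * (Real.pi : ℂ) ^ 2 * ∑ j : Fin d, (v j : ℂ) ^ 2 := by
      rw [Finset.mul_sum]; exact Finset.sum_congr rfl fun j _ => by ring
    rw [s1, s2]
    simp only [← Finset.mul_sum, ← Finset.sum_div]
    ring
  rw [regKernel, ← (PiLp.volume_preserving_toLp (Fin d)).integral_comp
    (MeasurableEquiv.toLp 2 (Fin d → ℝ)).measurableEmbedding, integral_congr_ae
    (Filter.Eventually.of_forall h1), integral_fintype_prod_volume_eq_prod
    (f := fun j (r : ℝ) => (quadOsc ε t (z j) (2 * Real.pi * r) *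
        if j = 0 then Complex.exp (-(Complex.I * t * ((2 * Real.pi * r : ℝ) : ℂ) ^ 4 / 4)) else 1))]
  refine Finset.prod_congr rfl fun j _ => ?_
  by_cases hj : j = 0
  · subst hj
    simp only [if_true]
    rw [← integral_comp_two_pi_mul (fun r => osc ε t (z 0) r)]
    refine integral_congr_ae (Filter.Eventually.of_forall fun r => ?_)
    simp only [quadOsc, osc]
    rw [← Complex.exp_add]
    ring_nf
  · simp only [hj, if_false, mul_one]
    rw [← integral_comp_two_pi_mul (fun r => quadOsc ε t (z j) r)]

theorem fullKern_eq {t : ℝ} (ht : 0 < t) (z : Space d) : fullKern d t z =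
    ∏ j : Fin d, ((((2 * Real.pi)⁻¹ : ℝ) : ℂ) *
      if j = 0 then oscMoment t (z 0) 0 else (√(2 * Real.pi / t) : ℝ) *
        Complex.exp (Complex.I * ((z j ^ 2 / (2 * t) - Real.pi / 4 : ℝ) : ℂ))) := by
  have hpi := Real.pi_pos
  rw [← Finset.mul_prod_erase Finset.univ _ (Finset.mem_univ (0 : Fin d)), fullKern, kern]
  simp only [if_true]
  congr 1
  have h1 : ∏ j ∈ Finset.univ.erase (0 : Fin d), ((((2 * Real.pi)⁻¹ : ℝ) : ℂ) *
      if j = 0 then oscMoment t (z 0) 0 else (√(2 * Real.pi / t) : ℝ) *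
        Complex.exp (Complex.I * ((z j ^ 2 / (2 * t) - Real.pi / 4 : ℝ) : ℂ))) =
      ∏ j ∈ Finset.univ.erase (0 : Fin d), ((((2 * Real.pi * t) ^ (-(1 / 2) : ℝ) : ℝ) : ℂ) *
        Complex.exp (Complex.I * ((z j ^ 2 / (2 * t) - Real.pi / 4 : ℝ) : ℂ))) := by
    refine Finset.prod_congr rfl fun j hj => ?_
    rw [if_neg (Finset.ne_of_mem_erase hj), ← mul_assoc, ← Complex.ofReal_mul]
    congr 2
    rw [Real.rpow_neg (by positivity), ← Real.sqrt_eq_rpow, Real.sqrt_div (by positivity),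
      Real.sqrt_mul (by positivity) t]
    have h2 : √(2 * Real.pi) ^ 2 = 2 * Real.pi := Real.sq_sqrt (by positivity)
    have h3 : 0 < √(2 * Real.pi) := by positivity
    have h4 : 0 < √t := by positivity
    rw [show (2 * Real.pi)⁻¹ = (√(2 * Real.pi) ^ 2)⁻¹ by rw [h2]]
    field_simp
  have hd : 1 ≤ d := Nat.one_le_iff_ne_zero.2 (NeZero.ne d)
  have hcard : (Finset.univ.erase (0 : Fin d)).card = d - 1 := by
    rw [Finset.card_erase_of_mem (Finset.mem_univ _), Finset.card_univ, Fintype.card_fin]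
  rw [h1, Finset.prod_mul_distrib, Finset.prod_const, hcard, ← Complex.exp_sum, transv]
  congr 1
  · rw [← Complex.ofReal_pow, ← Real.rpow_natCast, ← Real.rpow_mul (by positivity), Nat.cast_sub hd]
    congr 2
    push_cast; ring
  · congr 1
    rw [← Finset.mul_sum, ← Complex.ofReal_sum, Finset.sum_sub_distrib, Finset.sum_const, hcard,
      ← Finset.sum_div, Finset.sum_erase_eq_sub (Finset.mem_univ _), nsmul_eq_mul, Nat.cast_sub hd,
      EuclideanSpace.real_norm_sq_eq]
    push_cast
    rfl

theorem tendsto_regKernel {t : ℝ} (ht : 0 < t) (z : Space d) :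
    Filter.Tendsto (fun ε : ℝ => regKernel d ε t z) (nhdsWithin 0 (Set.Ioi 0))
      (nhds (fullKern d t z)) := by
  simp only [regKernel_eq, fullKern_eq ht]
  refine tendsto_finsetProd _ fun j _ => Filter.Tendsto.const_mul _ ?_
  by_cases hj : j = 0
  · simp only [hj, if_true]; exact tendsto_integral_osc ht _
  · simp only [hj, if_false]; exact tendsto_integral_quadOsc ht _

/-- The majorant for the first factor depends on the size of `z`, so the bound is local in `z`, but
it is uniform in `ε`. This suffices when both the datum and the test function have bounded support.
-/
theorem exists_norm_regKernel_le {t : ℝ} (ht : 0 < t) (X : ℝ) :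
    ∃ C : ℝ, ∀ ε : ℝ, 0 < ε → ∀ z : Space d, ‖z‖ ≤ X → ‖regKernel d ε t z‖ ≤ C := by
  obtain ⟨C, hC⟩ := exists_norm_integral_osc_le ht X
  refine ⟨∏ j : Fin d, (‖(((2 * Real.pi)⁻¹ : ℝ) : ℂ)‖ * max C (√(2 * Real.pi / t))),
    fun ε hε z hz => ?_⟩
  rw [regKernel_eq, norm_prod]
  refine Finset.prod_le_prod (fun j _ => norm_nonneg _) fun j _ => ?_
  rw [norm_mul]
  refine mul_le_mul_of_nonneg_left ?_ (norm_nonneg _)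
  by_cases hj : j = 0
  · simp only [hj, if_true]
    exact (hC ε hε (z 0) ((PiLp.norm_apply_le z 0).trans hz)).trans (le_max_left _ _)
  · simp only [hj, if_false]
    exact (norm_integral_quadOsc_le hε ht _).trans (le_max_right _ _)

theorem continuous_kern {t : ℝ} (ht : 0 < t) : Continuous (kern t) :=
  continuous_iff_continuousAt.2 fun x => (hasDerivAt_kern ht x).continuousAt

theorem continuous_transv (t : ℝ) : Continuous (transv d t) := by
  unfold transv
  fun_prop

theorem continuous_fullKern {t : ℝ} (ht : 0 < t) : Continuous (fullKern d t) :=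
  ((continuous_kern ht).comp (by fun_prop)).mul (continuous_transv t)

end

/-- `ψ` vanishes outside the ball of radius `r`. -/
def SupportedIn {d : ℕ} (ψ : L2 d) (r : ℝ) : Prop := ∀ᵐ y : Space d, r < ‖y‖ → ψ y = 0

theorem SupportedIn.ae_eq_indicator {d : ℕ} {ψ : L2 d} {r : ℝ} (h : SupportedIn ψ r) :
    ψ =ᵐ[volume] (Metric.closedBall (0 : Space d) r).indicator ψ := by
  filter_upwards [h] with y hy
  by_cases hr : y ∈ Metric.closedBall (0 : Space d) r
  · rw [Set.indicator_of_mem hr]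
  · rw [Set.indicator_of_notMem hr]
    exact hy (by simpa using hr)

theorem exists_lintegral_enorm_le (d : ℕ) : ∃ C : ℝ, 0 < C ∧ ∀ (ψ : L2 d) (r : ℝ), 0 < r →
    SupportedIn ψ r → ∫⁻ y, ‖ψ y‖ₑ ≤ ENNReal.ofReal (C * r ^ ((d : ℝ) / 2) * ‖ψ‖) := by
  set v := (volume (Metric.ball (0 : Space d) 1)).toReal with hv
  have hv' : volume (Metric.ball (0 : Space d) 1) = ENNReal.ofReal v :=
    (ENNReal.ofReal_toReal measure_ball_lt_top.ne).symm
  have hv0 : 0 < v := ENNReal.toReal_pos (Metric.measure_ball_pos _ _ one_pos).ne'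
    measure_ball_lt_top.ne
  refine ⟨v ^ (1 / 2 : ℝ), by positivity, fun ψ r hr h => ?_⟩
  have e1 : ∫⁻ y, ‖ψ y‖ₑ = eLpNorm ψ 1 (volume.restrict (Metric.closedBall (0 : Space d) r)) := by
    rw [← eLpNorm_indicator_eq_eLpNorm_restrict measurableSet_closedBall,
      ← eLpNorm_congr_ae h.ae_eq_indicator, eLpNorm_one_eq_lintegral_enorm]
  rw [e1]
  refine (eLpNorm_le_eLpNorm_mul_rpow_measure_univ (q := 2) (by norm_num)
    (Lp.aestronglyMeasurable ψ).restrict).trans ?_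
  rw [Measure.restrict_apply_univ, Measure.addHaar_closedBall _ _ hr.le, hv', finrank_euclideanSpace,
    Fintype.card_fin, ← ENNReal.ofReal_mul (by positivity)]
  have e2 : (1 / ENNReal.toReal 1 - 1 / ENNReal.toReal 2 : ℝ) = 1 / 2 := by norm_num
  rw [e2, ENNReal.ofReal_rpow_of_pos (by positivity)]
  calc _ ≤ eLpNorm ψ 2 volume * ENNReal.ofReal ((r ^ d * v) ^ (1 / 2 : ℝ)) :=
        mul_le_mul_left (eLpNorm_mono_measure _ Measure.restrict_le_self) _
    _ = _ := by
        rw [← ENNReal.ofReal_toReal (Lp.eLpNorm_ne_top ψ), ← Lp.norm_def,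
          ← ENNReal.ofReal_mul (norm_nonneg _), Real.mul_rpow (by positivity) hv0.le,
          ← Real.rpow_natCast, ← Real.rpow_mul hr.le]
        congr 1
        rw [mul_one_div]; ring

theorem SupportedIn.integrable {d : ℕ} {ψ : L2 d} {r : ℝ} (h : SupportedIn ψ r) : Integrable ψ := by
  obtain ⟨C, _, hC⟩ := exists_lintegral_enorm_le d
  -- The given radius may be nonpositive, whereas the quantitative bound requires a positive one.
  have h' : SupportedIn ψ (max r 1) := by
    filter_upwards [h] with y hy hr
    exact hy (lt_of_le_of_lt (le_max_left _ _) hr)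
  exact ⟨Lp.aestronglyMeasurable ψ, (hC ψ _ (by positivity) h').trans_lt ENNReal.ofReal_lt_top⟩

/-! ### The evolution as an integral operator on compactly supported data -/

section

variable {d : ℕ} [NeZero d]

theorem exists_norm_fullKern_le (d : ℕ) [NeZero d] {t : ℝ} (ht : 1 ≤ t) :
    ∃ C : ℝ, ∀ z : Space d, ‖fullKern d t z‖ ≤ C := by
  obtain ⟨C, hC, h⟩ := exists_kern_bounds
  refine ⟨C / √t * (2 * Real.pi * t) ^ (-((d : ℝ) - 1) / 2), fun z => ?_⟩
  rw [fullKern, norm_mul, norm_transv (by linarith)]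
  refine mul_le_mul_of_nonneg_right ((h t ht (z 0)).1.trans ?_) (by positivity)
  exact div_le_self (by positivity) (by linarith [abs_nonneg (mu₁ t (z 0))])

/-- The integral operator with kernel `k`. -/
def kernelOp {d : ℕ} (k : Space d → Space d → ℂ) (ψ : L2 d) (x : Space d) : ℂ := ∫ y, k x y * ψ y

theorem integrable_kernel_mul {d : ℕ} {k : Space d → Space d → ℂ} {C : ℝ}
    (hk : Measurable (Function.uncurry k)) (hC : ∀ x y, ‖k x y‖ ≤ C) {ψ : L2 d}
    (hψ : Integrable ψ) (x : Space d) : Integrable fun y => k x y * ψ y :=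
  hψ.bdd_mul (c := C) (hk.comp (by fun_prop : Measurable fun y => (x, y))).aestronglyMeasurable
    (Filter.Eventually.of_forall fun y => hC x y)

theorem stronglyMeasurable_kernelOp {d : ℕ} {k : Space d → Space d → ℂ}
    (hk : Measurable (Function.uncurry k)) (ψ : L2 d) : StronglyMeasurable (kernelOp k ψ) := by
  have h : StronglyMeasurable fun p : Space d × Space d => k p.1 p.2 * ψ p.2 :=
    (hk.mul ((Lp.stronglyMeasurable ψ).measurable.comp measurable_snd)).stronglyMeasurable
  exact h.integral_prod_right

theorem norm_kernelOp_le {d : ℕ} {k : Space d → Space d → ℂ} {C : ℝ} (hC : ∀ x y, ‖k x y‖ ≤ C) {ψ : L2 d}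
    (hψ : Integrable ψ) (x : Space d) : ‖kernelOp k ψ x‖ ≤ C * ∫ y, ‖ψ y‖ := by
  rw [← integral_const_mul]
  refine norm_integral_le_of_norm_le (hψ.norm.const_mul C) (Filter.Eventually.of_forall fun y => ?_)
  rw [norm_mul]
  exact mul_le_mul_of_nonneg_right (hC x y) (norm_nonneg _)

theorem locallyIntegrable_of_bounded {E : Type*} [NormedAddCommGroup E] [InnerProductSpace ℝ E]
    [FiniteDimensional ℝ E] [MeasurableSpace E] [BorelSpace E] {f : E → ℂ} {C : ℝ}
    (hf : AEStronglyMeasurable f volume) (hC : ∀ x, ‖f x‖ ≤ C) : LocallyIntegrable f :=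
  (memLp_top_of_bound hf C (Filter.Eventually.of_forall hC)).locallyIntegrable le_top

theorem fourier_mul_fourierInv_eq {d : ℕ} (f : Space d → ℂ) (φ : 𝓢(Space d, ℂ))
    (ξ : Space d) : 𝓕 f ξ * (𝓕⁻ φ : 𝓢(Space d, ℂ)) ξ =
      ∫ p : Space d × Space d, Complex.exp (Complex.I *
        ((2 * Real.pi * inner ℝ (p.1 - p.2) ξ : ℝ) : ℂ)) * (φ p.1 * f p.2) := by
  have h1 : 𝓕 f ξ = ∫ y, Complex.exp (Complex.I * ((-(2 * Real.pi * inner ℝ y ξ) : ℝ) : ℂ)) * f y := by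
    rw [Real.fourier_eq']
    refine integral_congr_ae (Filter.Eventually.of_forall fun y => ?_)
    simp only [smul_eq_mul]
    rw [mul_comm Complex.I]; push_cast; ring_nf
  have h2 : (𝓕⁻ φ : 𝓢(Space d, ℂ)) ξ =
      ∫ x, Complex.exp (Complex.I * ((2 * Real.pi * inner ℝ x ξ : ℝ) : ℂ)) * φ x := by
    rw [SchwartzMap.fourierInv_coe, Real.fourierInv_eq']
    refine integral_congr_ae (Filter.Eventually.of_forall fun y => ?_)
    simp only [smul_eq_mul]
    rw [mul_comm Complex.I]
  rw [h1, h2, mul_comm, ← integral_prod_mul]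
  refine integral_congr_ae (Filter.Eventually.of_forall fun p => ?_)
  simp only [inner_sub_left]
  have : Complex.exp (Complex.I * ((2 * Real.pi * (inner ℝ p.1 ξ - inner ℝ p.2 ξ) : ℝ) : ℂ)) =
      Complex.exp (Complex.I * ((2 * Real.pi * inner ℝ p.1 ξ : ℝ) : ℂ)) *
        Complex.exp (Complex.I * ((-(2 * Real.pi * inner ℝ p.2 ξ) : ℝ) : ℂ)) := by
    rw [← Complex.exp_add]; push_cast; ring_nf
  rw [this]; ring

/-- For `ε > 0` the symbol is integrable, so Fubini converts the pairing in frequency into one with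
the regularised propagator. -/
theorem integral_regSymbol_mul {ε t : ℝ} (hε : 0 < ε) {f : Space d → ℂ} (hf : Integrable f)
    (φ : 𝓢(Space d, ℂ)) :
    ∫ ξ, regSymbol d ε t ξ * (𝓕 f ξ * (𝓕⁻ φ : 𝓢(Space d, ℂ)) ξ) =
      ∫ p : Space d × Space d, regKernel d ε t (p.1 - p.2) * (φ p.1 * f p.2) := by
  simp only [fourier_mul_fourierInv_eq f, ← integral_const_mul]
  rw [integral_integral_swap]
  · refine integral_congr_ae (Filter.Eventually.of_forall fun p => ?_)
    simp only
    rw [regKernel, ← integral_mul_const]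
    exact integral_congr_ae (Filter.Eventually.of_forall fun ξ => by simp only; ring)
  · have h1 : Integrable (fun q : Space d × (Space d × Space d) =>
        regSymbol d ε t q.1 * (φ q.2.1 * f q.2.2)) :=
      (integrable_regSymbol hε t).mul_prod (φ.integrable.mul_prod hf)
    have h2 : Integrable (fun q : Space d × (Space d × Space d) =>
        Complex.exp (Complex.I * ((2 * Real.pi * inner ℝ (q.2.1 - q.2.2) q.1 : ℝ) : ℂ)) *
        (regSymbol d ε t q.1 * (φ q.2.1 * f q.2.2))) := by
      refine h1.bdd_mul (c := 1) (Continuous.aestronglyMeasurable (by fun_prop))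
        (Filter.Eventually.of_forall fun q => ?_)
      rw [mul_comm Complex.I, Complex.norm_exp_ofReal_mul_I]
    refine h2.congr (Filter.Eventually.of_forall fun q => ?_)
    simp only [Function.uncurry]
    ring

/-- Both sides are tested against a compactly supported function and `ε → 0` is taken in the
regularised identity: on the frequency side by integrability of the product of the transforms, on
the space side by the local bound on the kernels. -/
theorem evolution_ae_eq {t : ℝ} (ht : 1 ≤ t) {ψ : L2 d} {r : ℝ} (hψ : SupportedIn ψ r) :
    evolution d t ψ =ᵐ[volume] kernelOp (fun x y => fullKern d t (x - y)) ψ := by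
  have ht0 : 0 < t := by linarith
  have hint := hψ.integrable
  obtain ⟨C, hC⟩ := exists_norm_fullKern_le d ht
  have hmeas : Measurable (Function.uncurry fun x y : Space d => fullKern d t (x - y)) :=
    (continuous_fullKern ht0).measurable.comp (by fun_prop)
  refine ae_eq_of_integral_mul_schwartz (locallyIntegrable_Lp _)
    (locallyIntegrable_of_bounded (stronglyMeasurable_kernelOp hmeas ψ).aestronglyMeasurable
      (norm_kernelOp_le (fun x y => hC (x - y)) hint)) fun φ hφ => ?_
  rw [integral_mul_eq_fourier, fourier_evolution]
  have hF : (𝓕 ψ : L2 d) =ᵐ[volume] 𝓕 (ψ : Space d → ℂ) := by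
    have := fourier_toLp_ae_eq hint (Lp.memLp ψ)
    rwa [Lp.toLp_coeFn] at this
  have hint2 : Integrable fun ξ => 𝓕 (ψ : Space d → ℂ) ξ * (𝓕⁻ φ : 𝓢(Space d, ℂ)) ξ := by
    refine (integrable_L2_mul_schwartz (𝓕 ψ : L2 d) (𝓕⁻ φ)).congr ?_
    filter_upwards [hF] with ξ h
    rw [h]
  have hprod : Integrable (fun p : Space d × Space d => φ p.1 * ψ p.2) := φ.integrable.mul_prod hint
  have l1 : Filter.Tendsto (fun ε : ℝ => ∫ ξ, regSymbol d ε t ξ *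
      (𝓕 (ψ : Space d → ℂ) ξ * (𝓕⁻ φ : 𝓢(Space d, ℂ)) ξ)) (nhdsWithin 0 (Set.Ioi 0))
      (nhds (∫ ξ, phaseOp d (-t) (𝓕 ψ) ξ * (𝓕⁻ φ : 𝓢(Space d, ℂ)) ξ)) := by
    have e : ∫ ξ, phaseOp d (-t) (𝓕 ψ) ξ * (𝓕⁻ φ : 𝓢(Space d, ℂ)) ξ = ∫ ξ, regSymbol d 0 t ξ *
      (𝓕 (ψ : Space d → ℂ) ξ * (𝓕⁻ φ : 𝓢(Space d, ℂ)) ξ) := by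
      refine integral_congr_ae ?_
      filter_upwards [coeFn_phaseOp (-t) (𝓕 ψ : L2 d), hF] with ξ h1 h2
      rw [h1, h2, regSymbol]
      simp [mul_assoc]
    rw [e]
    refine tendsto_integral_filter_of_dominated_convergence _ ?_ ?_ hint2.norm ?_
    · exact Filter.Eventually.of_forall fun ε =>
        (continuous_regSymbol ε t).aestronglyMeasurable.mul hint2.aestronglyMeasurable
    · filter_upwards [self_mem_nhdsWithin] with ε hε
      refine Filter.Eventually.of_forall fun ξ => ?_
      rw [norm_mul, norm_regSymbol]
      refine mul_le_of_le_one_left (norm_nonneg _) (Real.exp_le_one_iff.2 ?_)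
      have : 0 ≤ ε * (2 * Real.pi) ^ 2 / 2 * ‖ξ‖ ^ 2 := by
        have : (0 : ℝ) < ε := hε
        positivity
      linarith
    · refine Filter.Eventually.of_forall fun ξ => ?_
      have : Continuous fun ε : ℝ => regSymbol d ε t ξ *
          (𝓕 (ψ : Space d → ℂ) ξ * (𝓕⁻ φ : 𝓢(Space d, ℂ)) ξ) := by
        unfold regSymbol; fun_prop
      exact (this.tendsto 0).mono_left nhdsWithin_le_nhds
  -- On the supports of `φ` and `ψ` the difference of the variables stays in a ball of radius `X +
  -- r`, where the kernels are bounded uniformly in `ε`.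
  obtain ⟨X, hX⟩ := hφ.isBounded.exists_norm_le
  obtain ⟨C', hC'⟩ := exists_norm_regKernel_le (d := d) ht0 (X + r)
  have l2 : Filter.Tendsto (fun ε : ℝ => ∫ p : Space d × Space d,
      regKernel d ε t (p.1 - p.2) * (φ p.1 * ψ p.2)) (nhdsWithin 0 (Set.Ioi 0))
      (nhds (∫ p : Space d × Space d, fullKern d t (p.1 - p.2) * (φ p.1 * ψ p.2))) := by
    refine tendsto_integral_filter_of_dominated_convergence (fun p => C' * ‖φ p.1 * ψ p.2‖)
      ?_ ?_ (hprod.norm.const_mul _) ?_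
    · refine Filter.Eventually.of_forall fun ε => ?_
      have h : StronglyMeasurable fun q : (Space d × Space d) × Space d => regSymbol d ε t q.2 *
          Complex.exp (Complex.I * ((2 * Real.pi * inner ℝ (q.1.1 - q.1.2) q.2 : ℝ) : ℂ)) := by
        have := continuous_regSymbol (d := d) ε t
        exact Continuous.stronglyMeasurable (by fun_prop)
      exact h.integral_prod_right.aestronglyMeasurable.mul hprod.aestronglyMeasurable
    · filter_upwards [self_mem_nhdsWithin] with ε hε
      have hψ2 : ∀ᵐ p : Space d × Space d, r < ‖p.2‖ → ψ p.2 = 0 :=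
        Measure.quasiMeasurePreserving_snd.ae hψ
      filter_upwards [hψ2] with p hp
      rw [norm_mul]
      by_cases h0 : φ p.1 * ψ p.2 = 0
      · simp [h0]
      · refine mul_le_mul_of_nonneg_right (hC' ε hε _ ((norm_sub_le _ _).trans (add_le_add ?_ ?_)))
          (norm_nonneg _)
        · exact hX _ (subset_tsupport _ (left_ne_zero_of_mul h0))
        · by_contra hlt
          exact right_ne_zero_of_mul h0 (hp (not_le.1 hlt))
    · exact Filter.Eventually.of_forall fun p => (tendsto_regKernel ht0 _).mul_const _
  have l3 := l1.congr' (f₂ := fun ε : ℝ => ∫ p : Space d × Space d,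
      regKernel d ε t (p.1 - p.2) * (φ p.1 * ψ p.2)) (by
    filter_upwards [self_mem_nhdsWithin] with ε hε
    exact integral_regSymbol_mul hε hint φ)
  rw [tendsto_nhds_unique l3 l2]
  have hint3 : Integrable fun p : Space d × Space d => fullKern d t (p.1 - p.2) * (φ p.1 * ψ p.2) :=
    hprod.bdd_mul (c := C) (hmeas.aestronglyMeasurable)
      (Filter.Eventually.of_forall fun p => hC _)
  refine (integral_prod _ hint3).trans (integral_congr_ae (Filter.Eventually.of_forall fun x => ?_))
  simp only [kernelOp]
  rw [← integral_mul_const]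
  exact integral_congr_ae (Filter.Eventually.of_forall fun y => by simp only; ring)

end

/-! ### The kernel of the leading term -/

section

variable {d : ℕ} [NeZero d]

/-- The transverse part of the inner product. -/
def perpInner (x y : Space d) : ℝ := inner ℝ x y - x 0 * y 0

/-- The transverse factor of the kernel of the leading term. -/
def transvPhase (d : ℕ) [NeZero d] (t : ℝ) (x y : Space d) : ℂ :=
  transv d t x * Complex.exp (Complex.I * ((-(perpInner x y / t) : ℝ) : ℂ))

/-- The transverse chirp `e^{i |y_⊥|² / (2t)}`. -/
def chirp (d : ℕ) [NeZero d] (t : ℝ) (y : Space d) : ℂ :=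
  Complex.exp (Complex.I * ((perpInner y y / (2 * t) : ℝ) : ℂ))

/-- The kernel of the leading term. -/
def leadKern (d : ℕ) [NeZero d] (t : ℝ) (x y : Space d) : ℂ :=
  lead t (y 0) (x 0) * transvPhase d t x y

theorem perpInner_self (x : Space d) : perpInner x x = ‖x‖ ^ 2 - x 0 ^ 2 := by
  rw [perpInner, real_inner_self_eq_norm_sq]; ring

theorem perpInner_self_nonneg (x : Space d) : 0 ≤ perpInner x x := by
  rw [perpInner_self]
  have := PiLp.norm_apply_le x 0
  rw [Real.norm_eq_abs] at this
  nlinarith [sq_abs (x 0), abs_nonneg (x 0)]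

theorem perpInner_self_le (x : Space d) : perpInner x x ≤ ‖x‖ ^ 2 := by
  rw [perpInner_self]; nlinarith [sq_nonneg (x 0)]

theorem abs_coord_le (x : Space d) : |x 0| ≤ ‖x‖ := by
  simpa [Real.norm_eq_abs] using PiLp.norm_apply_le x 0

theorem continuous_perpInner : Continuous fun p : Space d × Space d => perpInner p.1 p.2 := by
  unfold perpInner; fun_prop

theorem continuous_transvPhase (t : ℝ) :
    Continuous fun p : Space d × Space d => transvPhase d t p.1 p.2 := by
  have h1 := continuous_perpInner (d := d)
  have h2 := continuous_transv (d := d) t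
  unfold transvPhase; fun_prop

theorem continuous_chirp (t : ℝ) : Continuous (chirp d t) := by
  have h1 := continuous_perpInner (d := d)
  have h2 : Continuous fun y : Space d => perpInner y y :=
    h1.comp (continuous_id.prodMk continuous_id)
  unfold chirp; fun_prop

theorem norm_transvPhase {t : ℝ} (ht : 0 < t) (x y : Space d) :
    ‖transvPhase d t x y‖ = (2 * Real.pi * t) ^ (-((d : ℝ) - 1) / 2) := by
  rw [transvPhase, norm_mul, mul_comm Complex.I, Complex.norm_exp_ofReal_mul_I, mul_one,
    norm_transv ht]

theorem norm_chirp (t : ℝ) (y : Space d) : ‖chirp d t y‖ = 1 := by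
  rw [chirp, mul_comm Complex.I, Complex.norm_exp_ofReal_mul_I]

theorem norm_chirp_sub_one_le {t : ℝ} (ht : 0 < t) (y : Space d) :
    ‖chirp d t y - 1‖ ≤ ‖y‖ ^ 2 / (2 * t) := by
  refine (Real.norm_exp_I_mul_ofReal_sub_one_le).trans ?_
  rw [Real.norm_of_nonneg (div_nonneg (perpInner_self_nonneg y) (by positivity))]
  exact div_le_div_of_nonneg_right (perpInner_self_le y) (by positivity)

/-- Expansion of `|x_⊥ - y_⊥|²`. The chirp is the only transverse factor absent from the kernel of
the leading term. -/
theorem fullKern_sub {t : ℝ} (x y : Space d) :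
    fullKern d t (x - y) = kern t (x 0 - y 0) * (transvPhase d t x y * chirp d t y) := by
  have h : ‖x - y‖ ^ 2 - (x - y) 0 ^ 2 =
      (‖x‖ ^ 2 - x 0 ^ 2) + perpInner y y - 2 * perpInner x y := by
    rw [perpInner_self, perpInner, norm_sub_sq_real, PiLp.sub_apply]; ring
  rw [fullKern, transv, h, transvPhase, chirp, transv, PiLp.sub_apply]
  have h2 : ∀ A B C D : ℂ, A = B + C + D → Complex.exp A =
      Complex.exp B * Complex.exp C * Complex.exp D := fun A B C D h => by
    rw [h, Complex.exp_add, Complex.exp_add]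
  rw [h2 _ (Complex.I * (((‖x‖ ^ 2 - x 0 ^ 2) / (2 * t) - ((d : ℝ) - 1) * (Real.pi / 4) : ℝ) : ℂ))
    (Complex.I * ((-(perpInner x y / t) : ℝ) : ℂ)) (Complex.I * ((perpInner y y / (2 * t) : ℝ) : ℂ))
    (by push_cast; ring)]
  ring

theorem continuous_lead {t : ℝ} (ht : 1 ≤ t) :
    Continuous fun p : ℝ × ℝ => lead t p.1 p.2 := by
  have h := continuous_mu₁ (t := t) (by linarith)
  have h2 : ∀ p : ℝ × ℝ, lam t (mu₁ t p.2) ≠ 0 := fun p => (lam_pos ht _).ne'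
  have h3 : Continuous fun m => lam t m := by unfold lam ell; fun_prop
  have h4 : Continuous fun m => statPhase t m := by unfold statPhase; fun_prop
  have h5 : Continuous fun p : ℝ × ℝ => (√(2 * Real.pi))⁻¹ * (lam t (mu₁ t p.2))⁻¹ :=
    continuous_const.mul ((h3.comp (h.comp continuous_snd)).inv₀ h2)
  have h6 : Continuous fun p : ℝ × ℝ => statPhase t (mu₁ t p.2) - p.1 * mu₁ t p.2 - Real.pi / 4 :=
    (((h4.comp (h.comp continuous_snd)).sub (continuous_fst.mul (h.comp continuous_snd)))).sub
      continuous_const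
  exact (Complex.continuous_ofReal.comp h5).mul
    (Complex.continuous_exp.comp (continuous_const.mul (Complex.continuous_ofReal.comp h6)))

theorem continuous_leadKern {t : ℝ} (ht : 1 ≤ t) :
    Continuous fun p : Space d × Space d => leadKern d t p.1 p.2 := by
  have hg : Continuous fun p : Space d × Space d => ((p.2 0 : ℝ), (p.1 0 : ℝ)) := by fun_prop
  have h := (continuous_lead ht).comp hg
  exact h.mul (continuous_transvPhase t)

theorem inner_mu {t : ℝ} (x y : Space d) :
    inner ℝ y (mu t x) = y 0 * mu₁ t (x 0) + perpInner x y / t := by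
  rw [perpInner, PiLp.inner_apply, PiLp.inner_apply,
    ← Finset.add_sum_erase _ _ (Finset.mem_univ (0 : Fin d)),
    ← Finset.add_sum_erase (f := fun i => inner ℝ (x i) (y i)) _ (Finset.mem_univ (0 : Fin d))]
  have h : ∑ j ∈ Finset.univ.erase (0 : Fin d), inner ℝ (y j) (mu t x j) =
      (∑ j ∈ Finset.univ.erase (0 : Fin d), inner ℝ (x j) (y j)) / t := by
    rw [Finset.sum_div]
    refine Finset.sum_congr rfl fun j hj => ?_
    simp [mu, Finset.ne_of_mem_erase hj]
    ring
  rw [h]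
  simp [mu]
  ring

theorem norm_mu_sq {t : ℝ} (x : Space d) :
    ‖mu t x‖ ^ 2 = mu₁ t (x 0) ^ 2 + perpInner x x / t ^ 2 := by
  have h0 : mu t x 0 = mu₁ t (x 0) := by simp [mu]
  rw [← real_inner_self_eq_norm_sq, inner_mu, h0, perpInner, inner_mu, h0]
  ring

/-- The phases agree since `(3/4)tμ₁⁴ + (1/2)t|μ|²` is the stationary value in `x₁` plus
`|x_⊥|²/(2t)`. The constant phase splits as `π/4` for the first coordinate and `(d-1)π/4` for the
others. -/
theorem leadWeight_mul_exp {t : ℝ} (ht : 0 < t) (x y : Space d) :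
    leadWeight d t x * Complex.exp (Complex.I * ((-inner ℝ y (mu t x) : ℝ) : ℂ)) =
      leadKern d t x y := by
  have hl := ell_pos (mu₁ t (x 0))
  have hm : t ^ (-(d : ℝ) / 2) / √(3 * mu₁ t (x 0) ^ 2 + 1) * (2 * Real.pi) ^ (-(d : ℝ) / 2) =
      (√(2 * Real.pi))⁻¹ * (lam t (mu₁ t (x 0)))⁻¹ * (2 * Real.pi * t) ^ (-((d : ℝ) - 1) / 2) := by
    rw [lam, ell, Real.sqrt_mul ht.le, Real.mul_rpow (by positivity) ht.le, Real.sqrt_eq_rpow (2 * _),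
      Real.sqrt_eq_rpow t, mul_inv, ← Real.rpow_neg (by positivity), ← Real.rpow_neg ht.le]
    have e1 : t ^ (-(d : ℝ) / 2) = t ^ (-(1 / 2) : ℝ) * t ^ (-((d : ℝ) - 1) / 2) := by
      rw [← Real.rpow_add ht]; congr 1; ring
    have e2 : (2 * Real.pi) ^ (-(d : ℝ) / 2) =
        (2 * Real.pi) ^ (-(1 / 2) : ℝ) * (2 * Real.pi) ^ (-((d : ℝ) - 1) / 2) := by
      rw [← Real.rpow_add (by positivity)]; congr 1; ring
    rw [e1, e2]; ring
  have ht' : (t : ℂ) ≠ 0 := by exact_mod_cast ht.ne'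
  rw [leadWeight, leadKern, lead, transvPhase, transv, ← Complex.ofReal_mul, hm]
  set A := (√(2 * Real.pi))⁻¹ * (lam t (mu₁ t (x 0)))⁻¹
  set B := (2 * Real.pi * t) ^ (-((d : ℝ) - 1) / 2)
  rw [Complex.ofReal_mul]
  have e : ∀ a b c : ℝ, ∀ X Y Z W V : ℂ, X * Y = Z * (W * V) →
      (a : ℂ) * b * X * Y = a * Z * (b * W * V) := fun a b c X Y Z W V h => by
    linear_combination ((a : ℂ) * b) * h
  refine e A B 0 _ _ _ _ _ ?_
  rw [← Complex.exp_add, ← Complex.exp_add, ← Complex.exp_add]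
  congr 1
  rw [norm_mu_sq, inner_mu, statPhase, ← perpInner_self]
  push_cast
  field_simp
  ring

theorem leadOp_ae_eq {t : ℝ} (ht : 0 < t) {ψ : L2 d} {r : ℝ} (hψ : SupportedIn ψ r) :
    leadOp d ht ψ =ᵐ[volume] kernelOp (leadKern d t) ψ := by
  have hF : (𝓕 ψ : L2 d) =ᵐ[volume] 𝓕 (ψ : Space d → ℂ) := by
    have := fourier_toLp_ae_eq hψ.integrable (Lp.memLp ψ)
    rwa [Lp.toLp_coeFn] at this
  filter_upwards [coeFn_leadOp ht ψ, (isWeightedComp_lead ht).quasiMeasurePreserving.ae hF]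
    with x h1 h2
  rw [h1, leading_eq, h2, Real.fourier_eq', ← integral_const_mul]
  refine integral_congr_ae (Filter.Eventually.of_forall fun y => ?_)
  simp only [smul_eq_mul]
  rw [← leadWeight_mul_exp ht x y, ← mul_assoc, mul_comm Complex.I]
  have hpi : (2 * Real.pi) ≠ 0 := by positivity
  congr 4
  rw [inner_smul_right]
  congr 1
  field_simp

/-- The kernel of the difference between the evolution and its leading term. -/
def remKern (d : ℕ) [NeZero d] (t : ℝ) (x y : Space d) : ℂ :=
  fullKern d t (x - y) - leadKern d t x y

theorem continuous_remKern {t : ℝ} (ht : 1 ≤ t) :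
    Continuous (Function.uncurry (remKern d t)) := by
  have h1 : Continuous fun p : Space d × Space d => fullKern d t (p.1 - p.2) :=
    (continuous_fullKern (by linarith)).comp (by fun_prop)
  exact h1.sub (continuous_leadKern ht)

theorem exists_norm_leadKern_le (d : ℕ) [NeZero d] {t : ℝ} (ht : 1 ≤ t) :
    ∃ C : ℝ, ∀ x y : Space d, ‖leadKern d t x y‖ ≤ C := by
  refine ⟨2 / √t * (2 * Real.pi * t) ^ (-((d : ℝ) - 1) / 2), fun x y => ?_⟩
  rw [leadKern, norm_mul, norm_transvPhase (by linarith)]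
  refine mul_le_mul_of_nonneg_right ((norm_lead_le ht (y 0) (x 0)).trans ?_) (by positivity)
  exact div_le_self (by positivity) (by linarith [abs_nonneg (mu₁ t (x 0))])

theorem exists_norm_remKern_le (d : ℕ) [NeZero d] {t : ℝ} (ht : 1 ≤ t) :
    ∃ C : ℝ, ∀ x y : Space d, ‖remKern d t x y‖ ≤ C := by
  obtain ⟨C₁, h₁⟩ := exists_norm_fullKern_le d ht
  obtain ⟨C₂, h₂⟩ := exists_norm_leadKern_le d ht
  exact ⟨C₁ + C₂, fun x y => (norm_sub_le _ _).trans (add_le_add (h₁ _) (h₂ x y))⟩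

theorem evolution_sub_leadOp_ae_eq {t : ℝ} (ht : 1 ≤ t) {ψ : L2 d} {r : ℝ}
    (hψ : SupportedIn ψ r) :
    (evolution d t ψ - leadOp d (zero_lt_one.trans_le ht) ψ : L2 d) =ᵐ[volume]
      kernelOp (remKern d t) ψ := by
  have ht0 : 0 < t := by linarith
  obtain ⟨C₁, h₁⟩ := exists_norm_fullKern_le d ht
  obtain ⟨C₂, h₂⟩ := exists_norm_leadKern_le d ht
  filter_upwards [evolution_ae_eq ht hψ, leadOp_ae_eq ht0 hψ, Lp.coeFn_sub (evolution d t ψ)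
    (leadOp d ht0 ψ)] with x e1 e2 e3
  rw [e3, Pi.sub_apply, e1, e2, kernelOp, kernelOp, ← integral_sub
    (integrable_kernel_mul (k := fun x y => fullKern d t (x - y))
      ((continuous_fullKern ht0).measurable.comp
        (by fun_prop : Measurable fun p : Space d × Space d => p.1 - p.2))
      (fun x y => h₁ (x - y)) hψ.integrable x)
    (integrable_kernel_mul (continuous_leadKern ht).measurable h₂ hψ.integrable x)]
  refine integral_congr_ae (Filter.Eventually.of_forall fun y => ?_)
  simp only [remKern]
  ring

end

/-! ### The `L²` bound for the remainder -/

theorem lintegral_comp_inv_smul {n : ℕ} {c : ℝ} (hc : 0 < c) (g : Space n → ℝ≥0∞) :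
    ∫⁻ v, g (c⁻¹ • v) = ENNReal.ofReal (c ^ n) * ∫⁻ v, g v := by
  have h := lintegral_coordMap (d := n) (g := fun _ y => c⁻¹ * y) (g' := fun _ _ => c⁻¹)
    (fun _ x => by simpa using (hasDerivAt_id x).const_mul c⁻¹)
    (fun _ => mulLeft_bijective₀ _ (by positivity)) g
  rw [← h, ← lintegral_const_mul' _ _ ENNReal.ofReal_ne_top]
  refine lintegral_congr fun x => ?_
  rw [← mul_assoc, ← ENNReal.ofReal_mul (by positivity), Finset.prod_const, Finset.card_univ,
    Fintype.card_fin, abs_of_pos (by positivity), ← mul_pow, mul_inv_cancel₀ hc.ne', one_pow,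
    ENNReal.ofReal_one, one_mul]
  congr 1

theorem lintegral_fourier_sq {n : ℕ} {h : Space n → ℂ} (h1 : Integrable h) (h2 : MemLp h 2) :
    ∫⁻ ξ, ‖𝓕 h ξ‖ₑ ^ 2 = ∫⁻ w, ‖h w‖ₑ ^ 2 := by
  have e1 : ∀ f : Space n → ℂ, ∫⁻ w, ‖f w‖ₑ ^ 2 = eLpNorm f 2 volume ^ 2 := fun f => by
    rw [eLpNorm_eq_lintegral_rpow_enorm_toReal (by norm_num) (by norm_num), ENNReal.toReal_ofNat,
      ← ENNReal.rpow_natCast, ← ENNReal.rpow_mul]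
    norm_num
  rw [e1, e1, ← eLpNorm_congr_ae (fourier_toLp_ae_eq h1 h2), ← eLpNorm_congr_ae h2.coeFn_toLp]
  have := Lp.norm_fourier_eq (h2.toLp h)
  rw [Lp.norm_def, Lp.norm_def, ENNReal.toReal_eq_toReal_iff' (Lp.eLpNorm_ne_top _)
    (Lp.eLpNorm_ne_top _)] at this
  rw [this]

/-- Cauchy–Schwarz on an interval of length `2r`. -/
theorem lintegral_sq_le_of_support {r : ℝ} {f : ℝ → ℂ} (hf : Measurable f)
    (h0 : ∀ b, r < |b| → f b = 0) :
    (∫⁻ b, ‖f b‖ₑ) ^ 2 ≤ ENNReal.ofReal (2 * r) * ∫⁻ b, ‖f b‖ₑ ^ 2 := by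
  have hi : f = (Set.Icc (-r) r).indicator f := by
    funext b
    by_cases hb : b ∈ Set.Icc (-r) r
    · rw [Set.indicator_of_mem hb]
    · rw [Set.indicator_of_notMem hb]
      exact h0 b (by by_contra h; exact hb (abs_le.1 (not_lt.1 h)))
  have e1 : ∫⁻ b, ‖f b‖ₑ = eLpNorm f 1 (volume.restrict (Set.Icc (-r) r)) := by
    rw [← eLpNorm_indicator_eq_eLpNorm_restrict measurableSet_Icc, ← hi,
      eLpNorm_one_eq_lintegral_enorm]
  have e2 : ∫⁻ b, ‖f b‖ₑ ^ 2 = eLpNorm f 2 volume ^ 2 := by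
    rw [eLpNorm_eq_lintegral_rpow_enorm_toReal (by norm_num) (by norm_num), ENNReal.toReal_ofNat,
      ← ENNReal.rpow_natCast, ← ENNReal.rpow_mul]
    norm_num
  have h := (eLpNorm_le_eLpNorm_mul_rpow_measure_univ (p := 1) (q := 2) (by norm_num)
    (μ := volume.restrict (Set.Icc (-r) r)) hf.aestronglyMeasurable).trans
    (mul_le_mul_left (eLpNorm_mono_measure f Measure.restrict_le_self) _)
  rw [e1, e2]
  refine (pow_le_pow_left' h 2).trans (le_of_eq ?_)
  rw [mul_pow, Measure.restrict_apply_univ, Real.volume_Icc, ← ENNReal.rpow_natCast,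
    ← ENNReal.rpow_natCast, ← ENNReal.rpow_mul, mul_comm]
  have e3 : (1 / ENNReal.toReal 1 - 1 / ENNReal.toReal 2) * ((2 : ℕ) : ℝ) = 1 := by norm_num
  rw [e3, ENNReal.rpow_one]
  congr 2
  ring

/-- For a fixed first output coordinate the kernel is a factor `D` in the first datum variable times
a Fourier kernel across. So Plancherel in the transverse variables loses nothing, and Cauchy–Schwarz
is spent only on one variable of length `2r`. -/
theorem lintegral_slice_le {n : ℕ} {t r S : ℝ} (ht : 0 < t) (hS : 0 ≤ S)
    {D : ℝ → ℂ} {G : ℝ × Space n → ℂ} (hD : Measurable D) (hDS : ∀ b, |b| ≤ r → ‖D b‖ ≤ S)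
    (hG : Measurable G) (hGi : Integrable G) (hG2 : ∫⁻ p, ‖G p‖ₑ ^ 2 ≠ ∞)
    (hG0 : ∀ p, r < |p.1| → G p = 0) :
    ∫⁻ v : Space n, ‖∫ p : ℝ × Space n,
      Complex.exp (Complex.I * ((-(inner ℝ v p.2 / t) : ℝ) : ℂ)) * (D p.1 * G p)‖ₑ ^ 2 ≤
    ENNReal.ofReal ((2 * Real.pi * t) ^ n) * (ENNReal.ofReal (S ^ 2 * (2 * r)) * ∫⁻ p, ‖G p‖ₑ ^ 2) := by
  have hpi := Real.pi_pos
  set h : Space n → ℂ := fun w => ∫ b, D b * G (b, w) with hh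
  have hmeas : Measurable fun p : ℝ × Space n => D p.1 * G p := (hD.comp measurable_fst).mul hG
  have hle : ∀ p : ℝ × Space n, ‖D p.1 * G p‖ ≤ S * ‖G p‖ := fun p => by
    rw [norm_mul]
    by_cases hp : |p.1| ≤ r
    · exact mul_le_mul_of_nonneg_right (hDS _ hp) (norm_nonneg _)
    · simp [hG0 p (not_le.1 hp)]
  have hint : Integrable fun p : ℝ × Space n => D p.1 * G p :=
    (hGi.norm.const_mul S).mono' hmeas.aestronglyMeasurable (Filter.Eventually.of_forall hle)
  have hhm : StronglyMeasurable h := hmeas.stronglyMeasurable.integral_prod_left'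
  have hsq : ∀ w, ‖h w‖ₑ ^ 2 ≤ ENNReal.ofReal (S ^ 2 * (2 * r)) * ∫⁻ b, ‖G (b, w)‖ₑ ^ 2 := by
    intro w
    have a1 : ‖h w‖ₑ ≤ ENNReal.ofReal S * ∫⁻ b, ‖G (b, w)‖ₑ := by
      rw [← lintegral_const_mul' _ _ ENNReal.ofReal_ne_top]
      refine (enorm_integral_le_lintegral_enorm _).trans (lintegral_mono fun b => ?_)
      rw [← ofReal_norm, ← ofReal_norm, ← ENNReal.ofReal_mul hS]
      exact ENNReal.ofReal_le_ofReal (hle (b, w))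
    refine (pow_le_pow_left' a1 2).trans ?_
    rw [mul_pow, ← ENNReal.ofReal_pow hS, ENNReal.ofReal_mul (by positivity), mul_assoc]
    exact mul_le_mul_right (lintegral_sq_le_of_support (hG.comp (by fun_prop))
      fun b hb => hG0 (b, w) hb) _
  have hsqi : ∫⁻ w, ‖h w‖ₑ ^ 2 ≤ ENNReal.ofReal (S ^ 2 * (2 * r)) * ∫⁻ p, ‖G p‖ₑ ^ 2 := by
    refine (lintegral_mono hsq).trans (le_of_eq ?_)
    rw [lintegral_const_mul' _ _ ENNReal.ofReal_ne_top, Measure.volume_eq_prod,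
      lintegral_prod_symm _ (hG.enorm.pow_const 2).aemeasurable]
  have h2 : MemLp h 2 := by
    refine ⟨hhm.aestronglyMeasurable, ?_⟩
    rw [eLpNorm_lt_top_iff_lintegral_rpow_enorm_lt_top (by norm_num) (by norm_num)]
    simp only [ENNReal.toReal_ofNat, ENNReal.rpow_ofNat]
    exact hsqi.trans_lt (ENNReal.mul_lt_top ENNReal.ofReal_lt_top hG2.lt_top)
  have h1 : Integrable h := hint.integral_prod_right
  -- The slice is the Fourier transform of `h`, evaluated at `v/(2πt)`; this rescaling produces the
  -- factor `(2πt)^n`.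
  have e : ∀ v : Space n, ∫ p : ℝ × Space n,
      Complex.exp (Complex.I * ((-(inner ℝ v p.2 / t) : ℝ) : ℂ)) * (D p.1 * G p) =
      𝓕 h ((2 * Real.pi * t)⁻¹ • v) := by
    intro v
    have hint' : Integrable fun p : ℝ × Space n =>
        Complex.exp (Complex.I * ((-(inner ℝ v p.2 / t) : ℝ) : ℂ)) * (D p.1 * G p) := by
      refine hint.bdd_mul (c := 1) (Continuous.aestronglyMeasurable (by fun_prop))
        (Filter.Eventually.of_forall fun p => ?_)
      rw [mul_comm Complex.I, Complex.norm_exp_ofReal_mul_I]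
    rw [Real.fourier_eq']
    refine (integral_prod_symm _ hint').trans (integral_congr_ae (Filter.Eventually.of_forall
      fun w => ?_))
    simp only [hh, smul_eq_mul]
    rw [integral_const_mul, mul_comm Complex.I, inner_smul_right, real_inner_comm]
    congr 5
    field_simp
  simp only [e]
  rw [lintegral_comp_inv_smul (by positivity) (fun ξ => ‖𝓕 h ξ‖ₑ ^ 2), lintegral_fourier_sq h1 h2]
  exact mul_le_mul_right hsqi _

/-- In the variable `m = μ(a)` the measure becomes `tℓ dm`, and `t ∫ ℓ⁻¹ dm` converges. -/
theorem lintegral_inv_ell_sq_le {t : ℝ} (ht : 0 < t) :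
    ∫⁻ a, ENNReal.ofReal ((ell (mu₁ t a))⁻¹ ^ 2) ≤ ENNReal.ofReal (t * Real.pi) := by
  have h := lintegral_mu₁ ht (fun m => ENNReal.ofReal (t * (ell m)⁻¹))
  have e : ∀ a, ENNReal.ofReal (t * ell (mu₁ t a))⁻¹ * ENNReal.ofReal (t * (ell (mu₁ t a))⁻¹) =
      ENNReal.ofReal ((ell (mu₁ t a))⁻¹ ^ 2) := fun a => by
    have := ell_pos (mu₁ t a)
    rw [← ENNReal.ofReal_mul (by positivity)]
    congr 1
    field_simp
  simp only [e] at h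
  rw [h]
  calc _ ≤ ∫⁻ m, ENNReal.ofReal (t * (1 + m ^ 2)⁻¹) := by
        refine lintegral_mono fun m => ENNReal.ofReal_le_ofReal ?_
        refine mul_le_mul_of_nonneg_left ?_ ht.le
        refine inv_anti₀ (by positivity) ?_
        rw [ell]; nlinarith [sq_nonneg m]
    _ = _ := by
        rw [← ofReal_integral_eq_lintegral_ofReal (integrable_inv_one_add_sq.const_mul t)
          (Filter.Eventually.of_forall fun m => by positivity), integral_const_mul,
          integral_univ_inv_one_add_sq]

/-- The splitting of the first coordinate. -/
def splitFirst (n : ℕ) : ℝ × Space n → Space (n + 1) := fun p =>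
  WithLp.toLp 2 (Fin.cons p.1 p.2.ofLp)

theorem measurePreserving_splitFirst (n : ℕ) : MeasurePreserving (splitFirst n) := by
  have h1 := (volume_preserving_piFinSuccAbove (fun _ : Fin (n + 1) => ℝ) 0).symm
  have h2 := (MeasurePreserving.id (volume : Measure ℝ)).prod (PiLp.volume_preserving_ofLp (Fin n))
  have h3 := (PiLp.volume_preserving_toLp (Fin (n + 1))).comp (h1.comp h2)
  have e : splitFirst n = WithLp.toLp 2 ∘ (MeasurableEquiv.piFinSuccAbove (fun _ => ℝ) 0).symm ∘
      Prod.map id WithLp.ofLp := by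
    ext p j
    simp [splitFirst, MeasurableEquiv.piFinSuccAbove]
  rw [e]
  exact h3

theorem measurableEmbedding_splitFirst (n : ℕ) : MeasurableEmbedding (splitFirst n) := by
  have h1 := (MeasurableEquiv.piFinSuccAbove (fun _ : Fin (n + 1) => ℝ) 0).symm.measurableEmbedding
  have h3 := (MeasurableEquiv.toLp 2 (Fin (n + 1) → ℝ)).measurableEmbedding.comp (h1.comp
    ((MeasurableEquiv.refl ℝ).prodCongr (MeasurableEquiv.toLp 2 (Fin n → ℝ)).symm).measurableEmbedding)
  convert h3 using 1
  ext p j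
  simp [splitFirst, MeasurableEquiv.piFinSuccAbove]
  rfl

theorem splitFirst_zero {n : ℕ} (p : ℝ × Space n) : splitFirst n p 0 = p.1 := rfl

theorem perpInner_splitFirst {n : ℕ} (p q : ℝ × Space n) :
    perpInner (splitFirst n p) (splitFirst n q) = inner ℝ p.2 q.2 := by
  rw [perpInner, PiLp.inner_apply, PiLp.inner_apply, Fin.sum_univ_succ]
  simp [splitFirst]
  ring

/-- The main part of the remainder kernel for data supported in a ball of radius `√t`. -/
def nearKern (d : ℕ) [NeZero d] (t : ℝ) (x y : Space d) : ℂ :=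
  (kern t (x 0 - y 0) - lead t (y 0) (x 0)) * (transvPhase d t x y * chirp d t y)

theorem continuous_nearKern {d : ℕ} [NeZero d] {t : ℝ} (ht : 1 ≤ t) :
    Continuous (Function.uncurry (nearKern d t)) := by
  have hg : Continuous fun p : Space d × Space d => ((p.2 0 : ℝ), (p.1 0 : ℝ)) := by fun_prop
  have h1 := (continuous_lead ht).comp hg
  have hg' : Continuous fun p : Space d × Space d => (p.1 0 - p.2 0 : ℝ) := by fun_prop
  have h2 := (continuous_kern (t := t) (by linarith)).comp hg'
  exact (h2.sub h1).mul ((continuous_transvPhase t).mul ((continuous_chirp t).comp continuous_snd))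

theorem lintegral_enorm_sq {d : ℕ} (ψ : L2 d) : ∫⁻ y, ‖ψ y‖ₑ ^ 2 = ENNReal.ofReal (‖ψ‖ ^ 2) := by
  rw [Lp.norm_def, ENNReal.ofReal_pow ENNReal.toReal_nonneg,
    ENNReal.ofReal_toReal (Lp.eLpNorm_ne_top ψ),
    eLpNorm_eq_lintegral_rpow_enorm_toReal (by norm_num) (by norm_num), ENNReal.toReal_ofNat,
    ← ENNReal.rpow_natCast (_ ^ _) 2, ← ENNReal.rpow_mul]
  norm_num

-- The kernel difference on the support is at most `S(a) = K(1+r)/(tℓ)`. Slicing gives `2r S(a)²`,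
-- the transverse powers of `2πt` cancel, and integrating `ℓ⁻²` in `a` returns a factor `πt`;
-- altogether `r³/t`.
set_option maxHeartbeats 400000 in
theorem lintegral_kernelOp_nearKern_le (n : ℕ) {K : ℝ} (hK : 0 ≤ K) {t : ℝ} (ht : 1 ≤ t)
    (hD : ∀ a b : ℝ, |b| ≤ √t → ‖kern t (a - b) - lead t b a‖ ≤ K * ((1 + |b|) / (t * ell (mu₁ t a))))
    {r : ℝ} (hr : 1 ≤ r) (hrt : r ≤ √t) {ψ : L2 (n + 1)} (hψ : SupportedIn ψ r) :
    ∫⁻ x, ‖kernelOp (nearKern (n + 1) t) ψ x‖ₑ ^ 2 ≤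
      ENNReal.ofReal (8 * Real.pi * K ^ 2 * r ^ 3 / t * ‖ψ‖ ^ 2) := by
  have ht0 : 0 < t := by linarith
  have hpi := Real.pi_pos
  set g : Space (n + 1) → ℂ := (Metric.closedBall (0 : Space (n + 1)) r).indicator ψ with hg
  have hgm : Measurable g := (Lp.stronglyMeasurable ψ).measurable.indicator measurableSet_closedBall
  have hgψ : ψ =ᵐ[volume] g := hψ.ae_eq_indicator
  have hgi : Integrable g := hψ.integrable.congr hgψ
  have mp := measurePreserving_splitFirst n
  have me := measurableEmbedding_splitFirst n
  set G : ℝ × Space n → ℂ := fun p => chirp (n + 1) t (splitFirst n p) * g (splitFirst n p) with hG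
  have hGn : ∀ p, ‖G p‖ₑ = ‖g (splitFirst n p)‖ₑ := fun p => by
    rw [hG, enorm_mul, ← ofReal_norm (chirp _ _ _), norm_chirp, ENNReal.ofReal_one, one_mul]
  have hGm : Measurable G := ((continuous_chirp t).measurable.mul hgm).comp me.measurable
  have hGi : Integrable G := by
    have h1 : Integrable fun y => chirp (n + 1) t y * g y := hgi.bdd_mul (c := 1) (continuous_chirp t).aestronglyMeasurable
      (Filter.Eventually.of_forall fun y => (norm_chirp t y).le)
    exact (mp.integrable_comp_emb me).2 h1
  have hG2 : ∫⁻ p, ‖G p‖ₑ ^ 2 = ENNReal.ofReal (‖ψ‖ ^ 2) := by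
    simp only [hGn]
    rw [mp.lintegral_comp_emb me (fun y => ‖g y‖ₑ ^ 2), ← lintegral_enorm_sq]
    refine lintegral_congr_ae ?_
    filter_upwards [hgψ] with y hy
    rw [hy]
  have hG0 : ∀ p : ℝ × Space n, r < |p.1| → G p = 0 := fun p hp => by
    have : splitFirst n p ∉ Metric.closedBall (0 : Space (n + 1)) r := by
      rw [mem_closedBall_zero_iff, not_le]
      refine hp.trans_le ?_
      have := abs_coord_le (splitFirst n p)
      rwa [splitFirst_zero] at this
    simp only [hG, hg, Set.indicator_of_notMem this, mul_zero]
  set S : ℝ → ℝ := fun a => K * ((1 + r) / (t * ell (mu₁ t a))) with hS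
  have hS0 : ∀ a, 0 ≤ S a := fun a => by
    have := ell_pos (mu₁ t a)
    simp only [hS]; positivity
  have hDS : ∀ a b, |b| ≤ r → ‖kern t (a - b) - lead t b a‖ ≤ S a := fun a b hb => by
    refine (hD a b (hb.trans hrt)).trans ?_
    have := ell_pos (mu₁ t a)
    simp only [hS]
    gcongr
  have hDm : ∀ a, Measurable fun b => kern t (a - b) - lead t b a := fun a => by
    have hb : Continuous fun b : ℝ => (b, a) := by fun_prop
    have hc : Continuous fun b : ℝ => a - b := by fun_prop
    have h1 := (continuous_lead ht).comp hb
    have h2 := (continuous_kern ht0).comp hc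
    exact (h2.sub h1).measurable
  have hF : ∀ (a : ℝ) (v : Space n), kernelOp (nearKern (n + 1) t) ψ (splitFirst n (a, v)) =
      transv (n + 1) t (splitFirst n (a, v)) * ∫ p : ℝ × Space n,
      Complex.exp (Complex.I * ((-(inner ℝ v p.2 / t) : ℝ) : ℂ)) *
        ((kern t (a - p.1) - lead t p.1 a) * G p) := by
    intro a v
    have h1 : kernelOp (nearKern (n + 1) t) ψ (splitFirst n (a, v)) =
        ∫ y, nearKern (n + 1) t (splitFirst n (a, v)) y * g y := by
      refine integral_congr_ae ?_
      filter_upwards [hgψ] with y hy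
      rw [hy]
    rw [h1, ← mp.integral_comp me, ← integral_const_mul]
    refine integral_congr_ae (Filter.Eventually.of_forall fun p => ?_)
    simp only [nearKern, transvPhase, perpInner_splitFirst, splitFirst_zero, hG]
    ring
  have hFm : Measurable fun p => ‖kernelOp (nearKern (n + 1) t) ψ (splitFirst n p)‖ₑ ^ 2 :=
    (((stronglyMeasurable_kernelOp (continuous_nearKern ht).measurable ψ).measurable.comp
      me.measurable).enorm).pow_const 2
  rw [← mp.lintegral_comp_emb me, Measure.volume_eq_prod, lintegral_prod _ hFm.aemeasurable]
  have htr : ∀ x : Space (n + 1), ‖transv (n + 1) t x‖ₑ ^ 2 =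
      ENNReal.ofReal (((2 * Real.pi * t) ^ n)⁻¹) := fun x => by
    rw [← ofReal_norm, ← ENNReal.ofReal_pow (norm_nonneg _), norm_transv ht0,
      ← Real.rpow_natCast _ 2, ← Real.rpow_mul (by positivity), ← Real.rpow_natCast _ n,
      ← Real.rpow_neg (by positivity)]
    congr 2
    push_cast; ring
  calc _ ≤ ∫⁻ a, ENNReal.ofReal (S a ^ 2 * (2 * r)) * ENNReal.ofReal (‖ψ‖ ^ 2) := by
        refine lintegral_mono fun a => ?_
        have e4 := fun v : Space n => (congrArg (fun z => ‖z‖ₑ ^ 2) (hF a v)).trans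
          ((congrArg (· ^ 2) (enorm_mul _ _)).trans ((mul_pow _ _ 2).trans
            (congrArg (· * _) (htr (splitFirst n (a, v))))))
        rw [lintegral_congr e4, lintegral_const_mul' _ _ ENNReal.ofReal_ne_top]
        have h := lintegral_slice_le ht0 (hS0 a) (hDm a) (hDS a) hGm hGi
          (by rw [hG2]; exact ENNReal.ofReal_ne_top) hG0
        refine (mul_le_mul_right h _).trans (le_of_eq ?_)
        rw [← mul_assoc, ← ENNReal.ofReal_mul (by positivity), inv_mul_cancel₀ (by positivity),
          ENNReal.ofReal_one, one_mul, hG2]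
    _ = ENNReal.ofReal (K ^ 2 * (1 + r) ^ 2 / t ^ 2 * (2 * r)) *
          (∫⁻ a, ENNReal.ofReal ((ell (mu₁ t a))⁻¹ ^ 2)) * ENNReal.ofReal (‖ψ‖ ^ 2) := by
        rw [lintegral_mul_const' _ _ ENNReal.ofReal_ne_top,
          ← lintegral_const_mul' _ _ ENNReal.ofReal_ne_top]
        congr 1
        refine lintegral_congr fun a => ?_
        have := ell_pos (mu₁ t a)
        rw [← ENNReal.ofReal_mul (by positivity)]
        congr 1
        simp only [hS]
        field_simp
    _ ≤ ENNReal.ofReal (K ^ 2 * (1 + r) ^ 2 / t ^ 2 * (2 * r)) *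
          ENNReal.ofReal (t * Real.pi) * ENNReal.ofReal (‖ψ‖ ^ 2) := by
        gcongr; exact lintegral_inv_ell_sq_le ht0
    _ ≤ _ := by
        rw [← ENNReal.ofReal_mul (by positivity), ← ENNReal.ofReal_mul (by positivity)]
        refine ENNReal.ofReal_le_ofReal (mul_le_mul_of_nonneg_right ?_ (sq_nonneg _))
        have e : K ^ 2 * (1 + r) ^ 2 / t ^ 2 * (2 * r) * (t * Real.pi) =
            2 * Real.pi * K ^ 2 * (r * (1 + r) ^ 2) / t := by field_simp
        rw [e]
        refine div_le_div_of_nonneg_right ?_ ht0.le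
        -- As `r ≥ 1`, `1 + r ≤ 2r`.
        have : r * (1 + r) ^ 2 ≤ 4 * r ^ 3 := by
          nlinarith [mul_nonneg (sub_nonneg.2 hr) (by linarith : 0 ≤ 3 * r + 1)]
        calc _ ≤ 2 * Real.pi * K ^ 2 * (4 * r ^ 3) := by gcongr
          _ = _ := by ring

section

variable {d : ℕ} [NeZero d]

theorem chirp_isWeightedComp (t : ℝ) :
    IsWeightedComp (volume : Measure (Space d)) (chirp d t) id :=
  isWeightedComp_id (continuous_chirp t).measurable (norm_chirp t)

/-- Multiplication by the chirp. -/
def chirpOp (d : ℕ) [NeZero d] (t : ℝ) : L2 d →ₗᵢ[ℂ] L2 d := weightedComp (chirp_isWeightedComp t)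

theorem coeFn_chirpOp (t : ℝ) (ψ : L2 d) :
    chirpOp d t ψ =ᵐ[volume] fun y => chirp d t y * ψ y := coeFn_weightedComp _ ψ

theorem SupportedIn.chirpOp {ψ : L2 d} {r : ℝ} (h : SupportedIn ψ r) (t : ℝ) :
    SupportedIn (chirpOp d t ψ) r := by
  filter_upwards [h, coeFn_chirpOp t ψ] with y h1 h2 hr
  rw [h2, h1 hr, mul_zero]

theorem norm_chirpOp_sub_le {t : ℝ} (ht : 0 < t) {ψ : L2 d} {r : ℝ} (h : SupportedIn ψ r) :
    ‖Aniso4NLS.chirpOp d t ψ - ψ‖ ≤ r ^ 2 / (2 * t) * ‖ψ‖ := by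
  refine Lp.norm_le_mul_norm_of_ae_le_mul ?_
  filter_upwards [h, coeFn_chirpOp t ψ, Lp.coeFn_sub (Aniso4NLS.chirpOp d t ψ) ψ] with y h1 h2 h3
  rw [h3, Pi.sub_apply, h2, ← sub_one_mul, norm_mul]
  by_cases hy : ‖y‖ ≤ r
  · refine mul_le_mul_of_nonneg_right ((norm_chirp_sub_one_le ht y).trans ?_) (norm_nonneg _)
    gcongr
  · simp [h1 (not_le.1 hy)]

/-- Applying the leading operator to chirped data reproduces the full transverse factor, so only the
one-dimensional kernels differ. The effect of the chirp is estimated separately on the datum. -/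
theorem evolution_sub_leadOp_chirpOp_ae_eq {t : ℝ} (ht : 1 ≤ t) {ψ : L2 d} {r : ℝ}
    (hψ : SupportedIn ψ r) :
    (evolution d t ψ - leadOp d (zero_lt_one.trans_le ht) (chirpOp d t ψ) : L2 d) =ᵐ[volume]
      kernelOp (nearKern d t) ψ := by
  have ht0 : 0 < t := by linarith
  obtain ⟨C₁, h₁⟩ := exists_norm_fullKern_le d ht
  obtain ⟨C₂, h₂⟩ := exists_norm_leadKern_le d ht
  have hψ' := hψ.chirpOp t
  filter_upwards [evolution_ae_eq ht hψ, leadOp_ae_eq ht0 hψ', Lp.coeFn_sub (evolution d t ψ)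
    (leadOp d ht0 (chirpOp d t ψ))] with x e1 e2 e3
  rw [e3, Pi.sub_apply, e1, e2, kernelOp, kernelOp, ← integral_sub
    (integrable_kernel_mul (k := fun x y => fullKern d t (x - y))
      ((continuous_fullKern ht0).measurable.comp
        (by fun_prop : Measurable fun p : Space d × Space d => p.1 - p.2))
      (fun x y => h₁ (x - y)) hψ.integrable x)
    (integrable_kernel_mul (continuous_leadKern ht).measurable h₂ hψ'.integrable x)]
  refine integral_congr_ae ?_
  filter_upwards [coeFn_chirpOp t ψ] with y hy
  rw [hy, fullKern_sub, leadKern, nearKern]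
  ring

end

/-- For `r ≤ √t` the kernel comparison gives `r^(3/2)/√t`, and the chirp contributes `r²/(2t)`,
which is no larger. For `r > √t` the bound is trivial, because evolution and leading term are
isometries. -/
theorem exists_norm_remainder_le (d : ℕ) [NeZero d] : ∃ C : ℝ, 0 < C ∧ ∀ t : ℝ, ∀ ht : 1 ≤ t,
    ∀ r : ℝ, 1 ≤ r → ∀ ψ : L2 d, SupportedIn ψ r →
      ‖evolution d t ψ - leadOp d (zero_lt_one.trans_le ht) ψ‖ ≤
        C * (r ^ (3 / 2 : ℝ) / √t) * ‖ψ‖ := by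
  obtain ⟨n, rfl⟩ : ∃ n, d = n + 1 := Nat.exists_eq_succ_of_ne_zero (NeZero.ne d)
  obtain ⟨K, hK⟩ : ∃ K : ℝ, K = 24 * (1 + Real.exp 2) * gaussMass 4 := ⟨_, rfl⟩
  have hK0 : 0 ≤ K := by rw [hK]; have := gaussMass_nonneg 4; positivity
  refine ⟨6 * K + 2, by positivity, fun t ht r hr ψ hψ => ?_⟩
  have ht0 : 0 < t := by linarith
  have hs : 0 < √t := Real.sqrt_pos.2 ht0
  have hr0 : 0 < r := by linarith
  have hrr : r ≤ r ^ (3 / 2 : ℝ) := by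
    simpa using Real.rpow_le_rpow_of_exponent_le hr (by norm_num : (1 : ℝ) ≤ 3 / 2)
  have hr3 : (r ^ (3 / 2 : ℝ)) ^ 2 = r ^ 3 := by
    rw [← Real.rpow_natCast, ← Real.rpow_mul hr0.le, ← Real.rpow_natCast r 3]; norm_num
  have hst : √t ^ 2 = t := Real.sq_sqrt ht0.le
  rcases le_or_gt r (√t) with hrt | hrt
  -- The leading term of the chirped datum is inserted in between; since the leading operator is
  -- isometric, the chirp error keeps its norm.
  · have e : evolution (n + 1) t ψ - leadOp (n + 1) ht0 ψ =
        (evolution (n + 1) t ψ - leadOp (n + 1) ht0 (chirpOp (n + 1) t ψ)) +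
          leadOp (n + 1) ht0 (chirpOp (n + 1) t ψ - ψ) := by
      rw [map_sub]; abel
    rw [e]
    refine (norm_add_le _ _).trans ?_
    rw [LinearIsometry.norm_map]
    have h1 : ‖evolution (n + 1) t ψ - leadOp (n + 1) ht0 (chirpOp (n + 1) t ψ)‖ ≤
        6 * K * (r ^ (3 / 2 : ℝ) / √t) * ‖ψ‖ := by
      have h := lintegral_kernelOp_nearKern_le n hK0 ht
        (fun a b hb => hK ▸ norm_kern_sub_lead_le ht hb (x := a)) hr hrt hψ
      have hc := lintegral_congr_ae ((evolution_sub_leadOp_chirpOp_ae_eq ht hψ).fun_comp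
        (fun z => ‖z‖ₑ ^ 2))
      simp only [Function.comp_apply] at hc
      rw [← hc, lintegral_enorm_sq, ENNReal.ofReal_le_ofReal_iff (by positivity)] at h
      refine le_of_sq_le_sq (h.trans ?_) (by positivity)
      rw [mul_pow, mul_pow, mul_pow, div_pow, hr3, hst]
      refine mul_le_mul_of_nonneg_right ?_ (sq_nonneg _)
      rw [← mul_div_assoc]
      refine div_le_div_of_nonneg_right ?_ ht0.le
      have : 8 * Real.pi ≤ 6 ^ 2 := by linarith [Real.pi_lt_d2]
      calc _ = 8 * Real.pi * (K ^ 2 * r ^ 3) := by ring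
        _ ≤ 6 ^ 2 * (K ^ 2 * r ^ 3) := by gcongr
        _ = _ := by ring
    have h2 : ‖chirpOp (n + 1) t ψ - ψ‖ ≤ 2 * (r ^ (3 / 2 : ℝ) / √t) * ‖ψ‖ := by
      refine (norm_chirpOp_sub_le ht0 hψ).trans (mul_le_mul_of_nonneg_right ?_ (norm_nonneg _))
      rw [← mul_div_assoc, div_le_div_iff₀ (by positivity) hs]
      have : r * √t ≤ t := by nlinarith
      calc r ^ 2 * √t = r * (r * √t) := by ring
        _ ≤ r ^ (3 / 2 : ℝ) * t := by gcongr
        _ ≤ _ := by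
          have : 0 ≤ r ^ (3 / 2 : ℝ) * t := by positivity
          linarith
    calc _ ≤ _ := add_le_add h1 h2
      _ = _ := by ring
  · have h1 : 1 ≤ r ^ (3 / 2 : ℝ) / √t := by
      rw [le_div_iff₀ hs]; linarith
    calc _ ≤ ‖evolution (n + 1) t ψ‖ + ‖leadOp (n + 1) ht0 ψ‖ := norm_sub_le _ _
      _ = 2 * 1 * ‖ψ‖ := by rw [LinearIsometry.norm_map, LinearIsometry.norm_map]; ring
      _ ≤ _ := by gcongr; linarith

/-! ### The pointwise bound for the remainder with one derivative -/

section

variable {d : ℕ} [NeZero d]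

theorem sub_smul_e₁_zero (x : Space d) (h : ℝ) : (x - h • e₁ d) 0 = x 0 - h := by
  simp [e₁]

theorem perpInner_sub_smul_e₁ (x y : Space d) (h : ℝ) :
    perpInner (x - h • e₁ d) y = perpInner x y := by
  rw [perpInner, perpInner, sub_smul_e₁_zero, inner_sub_left, real_inner_smul_left]
  have : inner ℝ (e₁ d) y = y 0 := by simp [e₁, EuclideanSpace.inner_single_left]
  rw [this]; ring

theorem perpInner_comm (x y : Space d) : perpInner x y = perpInner y x := by
  rw [perpInner, perpInner, real_inner_comm]; ring

theorem transvPhase_sub_smul_e₁ (t : ℝ) (x y : Space d) (h : ℝ) :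
    transvPhase d t (x - h • e₁ d) y = transvPhase d t x y := by
  rw [transvPhase, transvPhase, transv, transv, perpInner_sub_smul_e₁, ← perpInner_self,
    ← perpInner_self, perpInner_sub_smul_e₁, perpInner_comm, perpInner_sub_smul_e₁]

theorem norm_transvPhase_le {t : ℝ} (ht : 0 < t) (x y : Space d) :
    ‖transvPhase d t x y‖ ≤ t ^ (-((d : ℝ) - 1) / 2) := by
  have hd : (1 : ℝ) ≤ d := by exact_mod_cast Nat.one_le_iff_ne_zero.2 (NeZero.ne d)
  rw [norm_transvPhase ht, Real.mul_rpow (by positivity) ht.le]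
  refine mul_le_of_le_one_left (by positivity)
    (Real.rpow_le_one_of_one_le_of_nonpos ?_ (by linarith))
  linarith [Real.pi_gt_three]

/-- Translation along `x₁` leaves the transverse factors unchanged, so they are constants of modulus
at most `t^(-(d-1)/2)` and the one-dimensional bounds apply. Cancellation is used for `r ≤ √t`;
beyond, the separate bounds of size `1/√t` suffice. -/
theorem exists_heatBounded_remKern (d : ℕ) [NeZero d] : ∃ C : ℝ, 0 < C ∧ ∀ t : ℝ, 1 ≤ t →
    ∀ r : ℝ, 1 ≤ r → ∀ x y : Space d, ‖y‖ ≤ r →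
      HeatBounded (fun h => remKern d t (x - h • e₁ d) y) (C * (t ^ (-(d : ℝ) / 2) * (r / √t))) := by
  obtain ⟨C₁, hC₁, h₁⟩ := exists_heatBounded_diff
  obtain ⟨C₂, hC₂, h₂⟩ := exists_heatBounded_kern
  obtain ⟨Ck, hCk, hk⟩ := exists_kern_bounds
  refine ⟨2 * C₁ + C₂ + 10000, by positivity, fun t ht r hr x y hy => ?_⟩
  have ht0 : 0 < t := by linarith
  have hs : 0 < √t := Real.sqrt_pos.2 ht0
  have hs1 : 1 ≤ √t := Real.one_le_sqrt.2 ht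
  have hst : √t * √t = t := Real.mul_self_sqrt ht0.le
  have hy0 : |y 0| ≤ r := (abs_coord_le y).trans hy
  set τ := t ^ (-((d : ℝ) - 1) / 2) with hτ
  have hτ0 : 0 < τ := by positivity
  have hT := norm_transvPhase_le ht0 x y
  rw [← hτ] at hT
  have e1 : t ^ (-(d : ℝ) / 2) * (r / √t) = τ * (r / t) := by
    have : t ^ (-(d : ℝ) / 2) = τ * t ^ (-(1 / 2) : ℝ) := by
      rw [hτ, ← Real.rpow_add ht0]; congr 1; ring
    rw [this, Real.rpow_neg ht0.le, ← Real.sqrt_eq_rpow,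
      show r / t = r / (√t * √t) by rw [hst]]
    field_simp
  have hkb : ∀ a, ‖kern t a‖ ≤ Ck / √t := fun a => ((hk t ht a).1).trans
    (div_le_self (by positivity) (by linarith [abs_nonneg (mu₁ t a)]))
  have hlb : ∀ b a, ‖lead t b a‖ ≤ 2 / √t := fun b a => (norm_lead_le ht b a).trans
    (div_le_self (by positivity) (by linarith [abs_nonneg (mu₁ t a)]))
  have hgl : Continuous fun h : ℝ => (y 0, x 0 - h) := by fun_prop
  have hml : Measurable fun h : ℝ => lead t (y 0) (x 0 - h) :=
    ((continuous_lead ht).comp hgl).measurable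
  have hrt0 : 0 ≤ r / t := by positivity
  have hP : ‖transvPhase d t x y * chirp d t y‖ ≤ τ := by
    rw [norm_mul, norm_chirp, mul_one]; exact hT
  have hl := heatBounded_lead ht (y 0) (x 0)
  have hly : 1 + |y 0| / t ≤ 2 * r := by
    have : |y 0| / t ≤ r := (div_le_self (abs_nonneg _) ht).trans hy0
    linarith
  have h1y : 1 + |y 0| ≤ 2 * r := by linarith
  have hA2 : 0 ≤ 5000 / √t * (1 + |y 0| / t) := by positivity
  rw [e1]
  rcases le_or_gt r (√t) with hrt | hrt
  · have hd := h₁ t ht (y 0) (hy0.trans hrt) (x 0)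
    have hmd : Measurable fun h : ℝ => kern t (x 0 - h - y 0) - lead t (y 0) (x 0 - h) :=
      ((continuous_kern ht0).measurable.comp (by fun_prop)).sub hml
    have hdb : ∀ h, ‖kern t (x 0 - h - y 0) - lead t (y 0) (x 0 - h)‖ ≤ Ck / √t + 2 / √t :=
      fun h => (norm_sub_le _ _).trans (add_le_add (hkb _) (hlb _ _))
    have := hd.add_mul hl (by positivity) hA2 hmd hml hdb
      (fun h => (hlb _ _).trans (by have : 0 ≤ Ck / √t := by positivity
                                    linarith))
      (transvPhase d t x y * chirp d t y) (transvPhase d t x y * (chirp d t y - 1))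
    have e : (fun h => remKern d t (x - h • e₁ d) y) = fun h =>
        transvPhase d t x y * chirp d t y * (kern t (x 0 - h - y 0) - lead t (y 0) (x 0 - h)) +
        transvPhase d t x y * (chirp d t y - 1) * lead t (y 0) (x 0 - h) := by
      funext h
      rw [remKern, fullKern_sub, leadKern, transvPhase_sub_smul_e₁, sub_smul_e₁_zero]
      ring
    rw [e]
    refine this.mono ?_
    have hQ : ‖transvPhase d t x y * (chirp d t y - 1)‖ ≤ τ * (r ^ 2 / (2 * t)) := by
      rw [norm_mul]
      refine mul_le_mul hT ((norm_chirp_sub_one_le ht0 y).trans ?_) (norm_nonneg _) hτ0.le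
      gcongr
    -- The chirp error `r²/(2t)` times the size `1/√t` of the leading kernel is at most a multiple
    -- of `r/t`, since `r ≤ √t`.
    have hR : r ^ 2 / (2 * t) * (5000 / √t * (1 + |y 0| / t)) ≤ 10000 * (r / t) := by
      have c1 : |y 0| / t ≤ 1 := by
        rw [div_le_one ht0]
        exact hy0.trans (hrt.trans (by nlinarith))
      have c2 : r ^ 2 / (2 * t) * (5000 / √t * (1 + |y 0| / t)) ≤
          r ^ 2 / (2 * t) * (5000 / √t * 2) := by gcongr; linarith
      refine c2.trans ?_
      have : r ^ 2 / (2 * t) * (5000 / √t * 2) = 5000 * ((r / t) * (r / √t)) := by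
        field_simp
      rw [this]
      have c3 : r / √t ≤ 1 := (div_le_one hs).2 hrt
      nlinarith [mul_le_mul_of_nonneg_left c3 hrt0]
    calc _ ≤ τ * (C₁ * (2 * r / t)) + τ * (r ^ 2 / (2 * t)) * (5000 / √t * (1 + |y 0| / t)) := by
          refine add_le_add (mul_le_mul hP ?_ (by positivity) hτ0.le)
            (mul_le_mul_of_nonneg_right hQ hA2)
          gcongr
      _ ≤ τ * (C₁ * (2 * r / t)) + τ * (10000 * (r / t)) := by
          rw [mul_assoc τ (r ^ 2 / (2 * t))]
          gcongr
      _ = (2 * C₁ + 10000) * (τ * (r / t)) := by ring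
      _ ≤ _ := by
          have : 0 ≤ C₂ * (τ * (r / t)) := by positivity
          nlinarith
  · have hd := h₂ t ht (x 0 - y 0)
    have hmd : Measurable fun h : ℝ => kern t (x 0 - y 0 - h) :=
      (continuous_kern ht0).measurable.comp (by fun_prop)
    have := hd.add_mul hl (by positivity) hA2 hmd hml
      (M := Ck / √t + 2 / √t)
      (fun h => (hkb _).trans (by have : 0 ≤ 2 / √t := by positivity
                                  linarith))
      (fun h => (hlb _ _).trans (by have : 0 ≤ Ck / √t := by positivity
                                    linarith))
      (transvPhase d t x y * chirp d t y) (-transvPhase d t x y)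
    have e : (fun h => remKern d t (x - h • e₁ d) y) = fun h =>
        transvPhase d t x y * chirp d t y * kern t (x 0 - y 0 - h) +
        -transvPhase d t x y * lead t (y 0) (x 0 - h) := by
      funext h
      rw [remKern, fullKern_sub, leadKern, transvPhase_sub_smul_e₁, sub_smul_e₁_zero,
        sub_right_comm]
      ring
    rw [e]
    refine this.mono ?_
    -- This is where `r > √t` is used: the bound without cancellation already has the required size.
    have c1 : 1 / √t ≤ r / t := by
      rw [div_le_div_iff₀ hs ht0]
      nlinarith
    have hR : 5000 / √t * (1 + |y 0| / t) ≤ 10000 * (r / t) := by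
      have c2 : 1 / √t ≤ 1 := (div_le_one hs).2 hs1
      have c3 : |y 0| / t ≤ r / t := by gcongr
      have c4 : 1 / √t * (|y 0| / t) ≤ r / t :=
        (mul_le_of_le_one_left (by positivity) c2).trans c3
      calc _ = 5000 * (1 / √t) + 5000 * (1 / √t * (|y 0| / t)) := by ring
        _ ≤ 5000 * (r / t) + 5000 * (r / t) := by gcongr
        _ = _ := by ring
    calc _ ≤ τ * (C₂ * (r / t)) + τ * (10000 * (r / t)) := by
          rw [norm_neg]
          refine add_le_add (mul_le_mul hP ?_ (by positivity) hτ0.le)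
            (mul_le_mul hT hR hA2 hτ0.le)
          rw [div_eq_mul_one_div]
          gcongr
      _ = (C₂ + 10000) * (τ * (r / t)) := by ring
      _ ≤ _ := by
          have : 0 ≤ C₁ * (τ * (r / t)) := by positivity
          nlinarith

end

/-- Minkowski's inequality for both quantities in `HeatBounded`, after the heat operator has been
moved under the integral. The uniform bound `M` serves only Fubini. -/
theorem heatBounded_integral {α : Type*} [MeasurableSpace α] {μ : Measure α} [SFinite μ]
    {k : ℝ → α → ℂ} {ψ : α → ℂ} {A M : ℝ} (hA : 0 ≤ A) (hk : Measurable (Function.uncurry k))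
    (hM : ∀ h y, ‖k h y‖ ≤ M) (hψm : Measurable ψ) (hψ : Integrable ψ μ)
    (hb : ∀ᵐ y ∂μ, ψ y ≠ 0 → HeatBounded (fun h => k h y) A) :
    HeatBounded (fun h => ∫ y, k h y * ψ y ∂μ) (A * ∫ y, ‖ψ y‖ ∂μ) := by
  have hm : StronglyMeasurable fun p : ℝ × α => heatOp (fun h => k h p.2) p.1 := by
    have h1 : Measurable fun q : (ℝ × α) × ℝ => (heatKer q.1.1 q.2 : ℂ) * k q.2 q.1.2 :=
      (Complex.measurable_ofReal.comp (measurable_heatKer.comp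
        (by fun_prop : Measurable fun q : (ℝ × α) × ℝ => (q.1.1, q.2)))).mul
        (hk.comp (by fun_prop : Measurable fun q : (ℝ × α) × ℝ => (q.2, q.1.2)))
    exact h1.stronglyMeasurable.integral_prod_right
  have key : ∀ σ : ℝ, 0 < σ → heatOp (fun h => ∫ y, k h y * ψ y ∂μ) σ =
      ∫ y, heatOp (fun h => k h y) σ * ψ y ∂μ := by
    intro σ hσ
    simp only [heatOp, ← integral_const_mul, ← integral_mul_const]
    rw [integral_integral_swap]
    · refine integral_congr_ae (Filter.Eventually.of_forall fun y => ?_)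
      exact integral_congr_ae (Filter.Eventually.of_forall fun h => by simp only; ring)
    · have h1 : Integrable (fun p : ℝ × α => (heatKer σ p.1 : ℂ) * ψ p.2) (volume.prod μ) :=
        (integrable_heatKer hσ).ofReal.mul_prod hψ
      refine (h1.bdd_mul (c := M) hk.aestronglyMeasurable
        (Filter.Eventually.of_forall fun p => hM _ _)).congr
        (Filter.Eventually.of_forall fun p => ?_)
      simp only [Function.uncurry]
      ring
  have hn : ∀ σ : ℝ, 0 < σ → ‖heatOp (fun h => ∫ y, k h y * ψ y ∂μ) σ‖ₑ ≤
      ∫⁻ y, ‖heatOp (fun h => k h y) σ‖ₑ * ‖ψ y‖ₑ ∂μ := fun σ hσ => by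
    rw [key σ hσ]
    refine (enorm_integral_le_lintegral_enorm _).trans (le_of_eq ?_)
    simp only [enorm_mul]
  refine ⟨fun σ hσ => ?_, ?_⟩
  · rw [key σ hσ, mul_div_right_comm, ← integral_const_mul]
    refine norm_integral_le_of_norm_le (hψ.norm.const_mul _) ?_
    filter_upwards [hb] with y hy
    rw [norm_mul]
    by_cases h0 : ψ y = 0
    · simp [h0]
    · exact mul_le_mul_of_nonneg_right ((hy h0).1 σ hσ) (norm_nonneg _)
  · calc _ ≤ ∫⁻ σ in Set.Ioi (0 : ℝ), ∫⁻ y, ENNReal.ofReal (σ ^ (-(1 / 2) : ℝ) *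
          ‖heatOp (fun h => k h y) σ‖) * ‖ψ y‖ₑ ∂μ := by
          refine setLIntegral_mono' measurableSet_Ioi fun σ hσ => ?_
          have hσ0 : 0 ≤ σ ^ (-(1 / 2) : ℝ) := Real.rpow_nonneg (le_of_lt hσ) _
          simp only [ENNReal.ofReal_mul hσ0, ofReal_norm, mul_assoc]
          rw [lintegral_const_mul' _ _ ENNReal.ofReal_ne_top]
          exact mul_le_mul_right (hn σ hσ) _
      _ = ∫⁻ y, ∫⁻ σ in Set.Ioi (0 : ℝ), ENNReal.ofReal (σ ^ (-(1 / 2) : ℝ) *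
          ‖heatOp (fun h => k h y) σ‖) * ‖ψ y‖ₑ ∂volume ∂μ := by
          refine lintegral_lintegral_swap (Measurable.aemeasurable ?_)
          have h1 : Measurable fun p : ℝ × α => p.1 ^ (-(1 / 2) : ℝ) :=
            measurable_fst.pow_const _
          exact ((h1.mul hm.measurable.norm).ennreal_ofReal).mul (hψm.comp measurable_snd).enorm
      _ ≤ ∫⁻ y, ENNReal.ofReal (4 * A) * ‖ψ y‖ₑ ∂μ := by
          refine lintegral_mono_ae ?_
          filter_upwards [hb] with y hy
          rw [lintegral_mul_const' _ _ enorm_ne_top]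
          by_cases h0 : ψ y = 0
          · simp [h0]
          · exact mul_le_mul_left (hy h0).2 _
      _ = _ := by
          rw [lintegral_const_mul' _ _ ENNReal.ofReal_ne_top, ← mul_assoc 4,
            ENNReal.ofReal_mul (p := 4 * A) (by positivity), ofReal_integral_norm_eq_lintegral_enorm hψ]

/-- The kernel contributes `r/√t`, and passing from the `L¹` to the `L²` norm of the datum
contributes `r^(d/2)`. -/
theorem exists_heatBounded_remainder (d : ℕ) [NeZero d] : ∃ C : ℝ, 0 < C ∧ ∀ t : ℝ, 1 ≤ t →
    ∀ r : ℝ, 1 ≤ r → ∀ ψ : L2 d, SupportedIn ψ r → ∀ x : Space d,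
      HeatBounded (fun h => kernelOp (remKern d t) ψ (x - h • e₁ d))
        (C * (t ^ (-(d : ℝ) / 2) * (r ^ (1 + (d : ℝ) / 2) / √t)) * ‖ψ‖) := by
  obtain ⟨C₁, hC₁, h₁⟩ := exists_heatBounded_remKern d
  obtain ⟨C₂, hC₂, h₂⟩ := exists_lintegral_enorm_le d
  refine ⟨C₁ * C₂, by positivity, fun t ht r hr ψ hψ x => ?_⟩
  obtain ⟨M, hM⟩ := exists_norm_remKern_le d ht
  have ht0 : 0 < t := by linarith
  have hr0 : 0 < r := by linarith
  have hi := hψ.integrable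
  have hg : Continuous fun p : ℝ × Space d => (x - p.1 • e₁ d, p.2) := by fun_prop
  have hmeas : Measurable (Function.uncurry fun (h : ℝ) (y : Space d) =>
      remKern d t (x - h • e₁ d) y) := ((continuous_remKern ht).comp hg).measurable
  have h := heatBounded_integral (μ := volume) (ψ := ψ)
    (k := fun h y => remKern d t (x - h • e₁ d) y) (A := C₁ * (t ^ (-(d : ℝ) / 2) * (r / √t))) (by positivity) hmeas (fun h y => hM _ _)
    (Lp.stronglyMeasurable ψ).measurable hi (by
      filter_upwards [hψ] with y hy h0
      exact h₁ t ht r hr x y (not_lt.1 fun hlt => h0 (hy hlt)))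
  refine h.mono ?_
  have h3 : ∫ y, ‖ψ y‖ ≤ C₂ * r ^ ((d : ℝ) / 2) * ‖ψ‖ := by
    have := h₂ ψ r hr0 hψ
    rw [← ofReal_integral_norm_eq_lintegral_enorm hi, ENNReal.ofReal_le_ofReal_iff (by positivity)]
      at this
    exact this
  rw [Real.rpow_add hr0, Real.rpow_one]
  calc _ ≤ C₁ * (t ^ (-(d : ℝ) / 2) * (r / √t)) * (C₂ * r ^ ((d : ℝ) / 2) * ‖ψ‖) := by gcongr
    _ = _ := by ring

/-! ### Gamma and Gaussian integrals, and the interpolation inequality -/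

theorem integrableOn_rpow_mul_exp {a r : ℝ} (ha : 0 < a) (hr : 0 < r) :
    IntegrableOn (fun σ : ℝ => σ ^ (a - 1) * Real.exp (-(r * σ))) (Set.Ioi 0) := by
  have := integrableOn_rpow_mul_exp_neg_mul_rpow (s := a - 1) (p := 1) (b := r) (by linarith)
    zero_lt_one hr
  simpa [neg_mul] using this

theorem lintegral_rpow_mul_exp {a r : ℝ} (ha : 0 < a) (hr : 0 < r) :
    ∫⁻ σ in Set.Ioi (0 : ℝ), ENNReal.ofReal (σ ^ (a - 1) * Real.exp (-(r * σ))) =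
      ENNReal.ofReal (r ^ (-a) * Real.Gamma a) := by
  rw [← ofReal_integral_eq_lintegral_ofReal (integrableOn_rpow_mul_exp ha hr)
    ((ae_restrict_iff' measurableSet_Ioi).2 (Filter.Eventually.of_forall fun σ hσ => by
      have : (0 : ℝ) < σ := hσ
      show 0 ≤ σ ^ (a - 1) * Real.exp (-(r * σ))
      positivity)), Real.integral_rpow_mul_exp_neg_mul_Ioi ha hr, one_div,
    Real.inv_rpow hr.le, Real.rpow_neg hr.le]

theorem integral_gaussKer_mul_exp {σ : ℝ} (hσ : 0 < σ) (η : ℝ) :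
    ∫ h, (gaussKer σ h : ℂ) * Complex.exp (-(2 * Real.pi * η * Complex.I) * h) =
      Real.exp (-(σ * (2 * Real.pi * η) ^ 2)) := by
  have hb : 0 < (((4 * σ)⁻¹ : ℝ) : ℂ).re := by rw [Complex.ofReal_re]; positivity
  have h := fourierIntegral_gaussian hb (((-(2 * Real.pi * η) : ℝ)) : ℂ)
  have e : ∀ x : ℝ, (gaussKer σ x : ℂ) * Complex.exp (-(2 * Real.pi * η * Complex.I) * x) =
      (((√(4 * Real.pi * σ))⁻¹ : ℝ) : ℂ) *
      (Complex.exp (Complex.I * (((-(2 * Real.pi * η) : ℝ)) : ℂ) * x) *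
        Complex.exp (-(((4 * σ)⁻¹ : ℝ) : ℂ) * x ^ 2)) := by
    intro x
    have : ((gaussKer σ x : ℝ) : ℂ) = (((√(4 * Real.pi * σ))⁻¹ : ℝ) : ℂ) *
        Complex.exp (-(((4 * σ)⁻¹ : ℝ) : ℂ) * x ^ 2) := by
      rw [gaussKer, Complex.ofReal_mul, Complex.ofReal_exp]
      congr 2
      push_cast; field_simp
    rw [this, show -(2 * Real.pi * η * Complex.I) * (x : ℂ) =
      Complex.I * (((-(2 * Real.pi * η) : ℝ)) : ℂ) * x by push_cast; ring]
    ring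
  simp only [e]
  rw [integral_const_mul, h]
  have h1 : ((Real.pi : ℂ) / (((4 * σ)⁻¹ : ℝ) : ℂ)) ^ (1 / 2 : ℂ) = ((√(4 * Real.pi * σ) : ℝ) : ℂ) := by
    rw [Real.sqrt_eq_rpow, Complex.ofReal_cpow (by positivity)]
    congr 1
    · push_cast; field_simp
    · push_cast; ring
  rw [h1, ← mul_assoc, ← Complex.ofReal_mul, inv_mul_cancel₀ (Real.sqrt_pos.2 (by positivity)).ne',
    Complex.ofReal_one, one_mul, Complex.ofReal_exp]
  congr 1
  push_cast; field_simp

/-- Identifies the Fourier multiplier of the heat operators as `X e^{-σX}` with `X = 1 + (2πη)²`, by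
testing on a character. -/
theorem heatOp_exp {σ : ℝ} (hσ : 0 < σ) (η : ℝ) :
    heatOp (fun h => Complex.exp (-(2 * Real.pi * η * Complex.I) * h)) σ =
      (((1 + (2 * Real.pi * η) ^ 2) * Real.exp (-((1 + (2 * Real.pi * η) ^ 2) * σ)) : ℝ) : ℂ) := by
  obtain ⟨c, hc⟩ : ∃ c : ℂ, c = -(2 * Real.pi * η * Complex.I) := ⟨_, rfl⟩
  have hn : ∀ h : ℝ, ‖Complex.exp (c * h)‖ = 1 := fun h => by
    rw [show c * (h : ℂ) = ((-(2 * Real.pi * η * h) : ℝ) : ℂ) * Complex.I by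
      rw [hc]; push_cast; ring, Complex.norm_exp_ofReal_mul_I]
  have hd : ∀ h : ℝ, HasDerivAt (fun h : ℝ => Complex.exp (c * h)) (c * Complex.exp (c * h)) h :=
    fun h => by
      have := ((Complex.ofRealCLM.hasDerivAt (x := h)).const_mul c).cexp
      simpa [mul_comm] using this
  have hb : ∀ {z : ℂ}, ‖z‖ ≤ 1 + ‖c‖ + ‖c‖ ^ 2 → ∀ h : ℝ,
      ‖z * Complex.exp (c * h)‖ ≤ (1 + ‖c‖ + ‖c‖ ^ 2) * (1 + |h|) := fun hz h => by
    rw [norm_mul, hn, mul_one]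
    exact hz.trans (le_mul_of_one_le_right (by positivity) (by linarith [abs_nonneg h]))
  have hcc : Continuous fun h : ℝ => Complex.exp (c * h) := by fun_prop
  have key := heatOp_eq (φ := fun h : ℝ => Complex.exp (c * h))
    (φ' := fun h => c * Complex.exp (c * h)) (φ'' := fun h => c ^ 2 * Complex.exp (c * h))
    hd (fun h => by simpa [pow_two, mul_assoc] using (hd h).const_mul c)
    (hcc.const_mul _).aestronglyMeasurable (M := 1 + ‖c‖ + ‖c‖ ^ 2)
    (fun h => by
      have := hb (z := 1) (by rw [norm_one]; nlinarith [norm_nonneg c]) h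
      rwa [one_mul] at this)
    (hb (by nlinarith [norm_nonneg c]))
    (hb (by rw [norm_pow]; nlinarith [norm_nonneg c])) hσ
  rw [← hc, key]
  have e : ∀ h : ℝ, (gaussKer σ h : ℂ) * (Complex.exp (c * h) - c ^ 2 * Complex.exp (c * h)) =
      (1 - c ^ 2) * ((gaussKer σ h : ℂ) * Complex.exp (c * h)) := fun h => by ring
  simp only [e]
  rw [integral_const_mul, hc, integral_gaussKer_mul_exp hσ]
  have e2 : (-(2 * Real.pi * η * Complex.I)) ^ 2 = -((((2 * Real.pi * η) ^ 2 : ℝ)) : ℂ) := by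
    rw [neg_sq, mul_pow, Complex.I_sq]; push_cast; ring
  rw [e2, show -((1 + (2 * Real.pi * η) ^ 2) * σ) = -σ + -(σ * (2 * Real.pi * η) ^ 2) by ring,
    Real.exp_add]
  push_cast; ring

/-- Interpolation between the sup bound and the square function. -/
theorem exists_lintegral_rpow_le {θ : ℝ} (hθ : 0 ≤ θ) (hθ2 : θ < 1 / 2) :
    ∃ K : ℝ, 0 < K ∧ ∀ (φ : ℝ → ℂ) (B : ℝ), Measurable φ → 0 ≤ B → HeatBounded φ B →
      ∫⁻ σ in Set.Ioi (0 : ℝ), ENNReal.ofReal (σ ^ (θ - 1 / 2)) * ‖heatOp φ σ‖ₑ ≤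
        ENNReal.ofReal K * ENNReal.ofReal B ^ (1 - 2 * θ) *
          (∫⁻ σ in Set.Ioi (0 : ℝ), ENNReal.ofReal σ * ‖heatOp φ σ‖ₑ ^ 2) ^ θ := by
  rcases hθ.eq_or_lt with rfl | hθ0
  -- For `θ = 0` the bound `B/√σ` would leave a divergent integral of `1/σ` near zero, so the second
  -- half of `HeatBounded` is used directly.
  · refine ⟨4, by norm_num, fun φ B _ hB h => ?_⟩
    rw [ENNReal.rpow_zero, mul_one, mul_zero, sub_zero, ENNReal.rpow_one,
      ← ENNReal.ofReal_mul (by norm_num)]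
    refine le_trans (le_of_eq ?_) h.2
    refine setLIntegral_congr_fun measurableSet_Ioi fun σ hσ => ?_
    have : (0 : ℝ) < σ := hσ
    rw [ENNReal.ofReal_mul (by positivity), ofReal_norm, zero_sub]
  refine ⟨1 / θ + 1 + 1 / (1 - 2 * θ), by
    have : 0 < 1 - 2 * θ := by linarith
    positivity, fun φ B hφ hB h => ?_⟩
  have hm := measurable_heatOp hφ
  obtain ⟨q, hq⟩ : ∃ q, q = ∫⁻ σ in Set.Ioi (0 : ℝ), ENNReal.ofReal σ * ‖heatOp φ σ‖ₑ ^ 2 := ⟨_, rfl⟩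
  rw [← hq]
  have zero_case : (∀ᵐ σ ∂(volume.restrict (Set.Ioi (0 : ℝ))), heatOp φ σ = 0) →
      ∫⁻ σ in Set.Ioi (0 : ℝ), ENNReal.ofReal (σ ^ (θ - 1 / 2)) * ‖heatOp φ σ‖ₑ = 0 := fun h0 => by
    refine (lintegral_congr_ae (g := fun _ => 0) ?_).trans lintegral_zero
    filter_upwards [h0] with σ hσ
    simp [hσ]
  rcases hB.eq_or_lt with rfl | hB0
  · rw [zero_case]
    · exact zero_le
    · refine (ae_restrict_iff' measurableSet_Ioi).2 (Filter.Eventually.of_forall fun σ hσ => ?_)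
      simpa using h.1 σ hσ
  rcases eq_or_ne q 0 with h0 | h0
  · rw [zero_case]
    · exact zero_le
    · have h1 := (lintegral_eq_zero_iff (μ := volume.restrict (Set.Ioi (0 : ℝ)))
        (ENNReal.measurable_ofReal.mul (hm.enorm.pow_const 2))).1 (hq.symm.trans h0)
      filter_upwards [h1, ae_restrict_mem measurableSet_Ioi] with σ h2 hσ
      have hσ0 : (0 : ℝ) < σ := hσ
      simpa [hσ0, not_le.2 hσ0] using h2
  have hθ' : 0 < 1 - 2 * θ := by linarith
  rcases eq_or_ne q ∞ with h1 | h1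
  · rw [h1, ENNReal.top_rpow_of_pos hθ0, ENNReal.mul_top]
    · exact le_top
    · refine mul_ne_zero (by simp; positivity) ?_
      rw [ENNReal.ofReal_rpow_of_pos hB0]
      simp; positivity
  obtain ⟨Q, hQ⟩ : ∃ Q, Q = q.toReal := ⟨_, rfl⟩
  have hqQ : q = ENNReal.ofReal Q := by rw [hQ, ENNReal.ofReal_toReal h1]
  have hQ0 : 0 < Q := by rw [hQ]; exact ENNReal.toReal_pos h0 h1
  -- The threshold balances the two estimates: below it the sup bound is integrated, above it the
  -- square function is used. Both then have size `B τ^θ = B^(1-2θ) Q^θ`.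
  obtain ⟨τ, hτ⟩ : ∃ τ, τ = Q / B ^ 2 := ⟨_, rfl⟩
  have hτ0 : 0 < τ := by rw [hτ]; positivity
  -- Weight in Young's inequality `√σ v · σ^(θ-1) ≤ λ⁻¹ σv² + λ σ^(2θ-2)`, chosen so that `Q/λ` and
  -- `λ τ^(2θ-1)` are equal. Convergence at infinity requires `θ < 1/2`.
  obtain ⟨lam, hl⟩ : ∃ l, l = B * τ ^ (1 - θ) := ⟨_, rfl⟩
  have hl0 : 0 < lam := by rw [hl]; positivity
  have hBτ : B * τ ^ θ = B ^ (1 - 2 * θ) * Q ^ θ := by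
    rw [hτ, Real.div_rpow hQ0.le (by positivity), ← Real.rpow_natCast, ← Real.rpow_mul hB,
      Real.rpow_sub hB0, Real.rpow_one]
    push_cast; ring
  have hQl : Q / lam = B * τ ^ θ := by
    have : Q = τ * B ^ 2 := by rw [hτ]; field_simp
    rw [hl, Real.rpow_sub hτ0, Real.rpow_one, this]
    field_simp
  have hlτ : lam * τ ^ (2 * θ - 1) = B * τ ^ θ := by
    rw [hl, mul_assoc, ← Real.rpow_add hτ0]; congr 2; ring
  have small : ∫⁻ σ in Set.Ioc (0 : ℝ) τ, ENNReal.ofReal (σ ^ (θ - 1 / 2)) * ‖heatOp φ σ‖ₑ ≤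
      ENNReal.ofReal (B * (τ ^ θ / θ)) := by
    have := lintegral_Ioc_rpow (r := θ - 1) (by linarith) hτ0.le hB
    rw [sub_add_cancel] at this
    rw [← this]
    refine setLIntegral_mono' measurableSet_Ioc fun σ hσ => ?_
    have hσ0 : 0 < σ := hσ.1
    rw [← ofReal_norm, ← ENNReal.ofReal_mul (by positivity)]
    refine ENNReal.ofReal_le_ofReal ?_
    calc _ ≤ σ ^ (θ - 1 / 2) * (B / √σ) := mul_le_mul_of_nonneg_left (h.1 σ hσ0) (by positivity)
      _ = B * (σ ^ (θ - 1 / 2) * σ ^ (-(1 / 2) : ℝ)) := by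
          rw [Real.rpow_neg hσ0.le, ← Real.sqrt_eq_rpow]; ring
      _ = _ := by rw [← Real.rpow_add hσ0]; congr 2; ring
  have large : ∫⁻ σ in Set.Ioi τ, ENNReal.ofReal (σ ^ (θ - 1 / 2)) * ‖heatOp φ σ‖ₑ ≤
      ENNReal.ofReal (B * τ ^ θ) + ENNReal.ofReal (B * τ ^ θ / (1 - 2 * θ)) := by
    have e1 : ∀ σ ∈ Set.Ioi τ, ENNReal.ofReal (σ ^ (θ - 1 / 2)) * ‖heatOp φ σ‖ₑ ≤
        ENNReal.ofReal lam⁻¹ * (ENNReal.ofReal σ * ‖heatOp φ σ‖ₑ ^ 2) +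
          ENNReal.ofReal (lam * σ ^ (2 * θ - 2)) := fun σ hσ => by
      have hσ0 : 0 < σ := hτ0.trans hσ
      rw [← ofReal_norm, ← ENNReal.ofReal_pow (norm_nonneg _), ← ENNReal.ofReal_mul (by positivity),
        ← ENNReal.ofReal_mul (by positivity), ← ENNReal.ofReal_mul (by positivity),
        ← ENNReal.ofReal_add (by positivity) (by positivity)]
      refine ENNReal.ofReal_le_ofReal ?_
      obtain ⟨v, hv⟩ : ∃ v, v = ‖heatOp φ σ‖ := ⟨_, rfl⟩
      have hv0 : 0 ≤ v := hv ▸ norm_nonneg _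
      rw [← hv]
      have e2 : σ ^ (θ - 1 / 2) = √σ * σ ^ (θ - 1) := by
        rw [Real.sqrt_eq_rpow, ← Real.rpow_add hσ0]; congr 1; ring
      have e3 : σ ^ (2 * θ - 2) = (σ ^ (θ - 1)) ^ 2 := by
        rw [← Real.rpow_natCast, ← Real.rpow_mul hσ0.le]; congr 1; push_cast; ring
      have e4 : √σ ^ 2 = σ := Real.sq_sqrt hσ0.le
      rw [e2, e3]
      have e5 : lam⁻¹ * (√σ ^ 2 * v ^ 2) + lam * (σ ^ (θ - 1)) ^ 2 - √σ * σ ^ (θ - 1) * v =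
          lam⁻¹ * ((√σ * v - lam * σ ^ (θ - 1) / 2) ^ 2 + 3 / 4 * (lam * σ ^ (θ - 1)) ^ 2) := by
        field_simp; ring
      rw [e4] at e5
      have e6 : 0 ≤ lam⁻¹ * ((√σ * v - lam * σ ^ (θ - 1) / 2) ^ 2 +
          3 / 4 * (lam * σ ^ (θ - 1)) ^ 2) := by positivity
      linarith
    refine (setLIntegral_mono' measurableSet_Ioi e1).trans ?_
    rw [lintegral_add_right _ (by fun_prop)]
    refine add_le_add ?_ (le_of_eq ?_)
    · rw [lintegral_const_mul _ (by fun_prop)]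
      calc _ ≤ ENNReal.ofReal lam⁻¹ * q := by
            rw [hq]
            exact mul_le_mul_right (lintegral_mono_set (Set.Ioi_subset_Ioi hτ0.le)) _
        _ = _ := by
            rw [hqQ, ← ENNReal.ofReal_mul (by positivity), ← hQl]; congr 1; ring
    · rw [lintegral_Ioi_rpow (by linarith) hτ0 hl0.le, ← hlτ]
      congr 1
      rw [show 2 * θ - 2 + 1 = 2 * θ - 1 by ring, show 2 * θ - 1 = -(1 - 2 * θ) by ring, neg_div_neg_eq]
      ring
  rw [lintegral_Ioi_split hτ0.le, hqQ, ENNReal.ofReal_rpow_of_pos hB0, ENNReal.ofReal_rpow_of_pos hQ0,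
    ← ENNReal.ofReal_mul (by positivity), ← ENNReal.ofReal_mul (by positivity)]
  refine (add_le_add small large).trans (le_of_eq ?_)
  rw [← ENNReal.ofReal_add (by positivity) (by positivity),
    ← ENNReal.ofReal_add (by positivity) (by positivity)]
  congr 1
  rw [mul_assoc, ← hBτ]
  ring

/-! ### The heat operators in the first variable and their square function -/

section

variable {d : ℕ} [NeZero d]

/-- The symbol of `1 - ∂₁²` in the frequency variable of `𝓕`. -/
def bessel (ξ : Space d) : ℝ := 1 + (2 * Real.pi * ξ 0) ^ 2

theorem bessel_pos (ξ : Space d) : 0 < bessel ξ := by unfold bessel; positivity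

theorem continuous_bessel : Continuous (bessel (d := d)) := by unfold bessel; fun_prop

/-- The heat operator acting in the first variable. -/
def slideHeat (F : Space d → ℂ) (σ : ℝ) (x : Space d) : ℂ := heatOp (fun h => F (x - h • e₁ d)) σ

theorem measurable_slide {F : Space d → ℂ} (hF : Measurable F) :
    Measurable fun q : Space d × ℝ => F (q.1 - q.2 • e₁ d) := by
  have hg : Continuous fun q : Space d × ℝ => q.1 - q.2 • e₁ d := by fun_prop
  exact hF.comp hg.measurable

theorem measurable_slideHeat {F : Space d → ℂ} (hF : Measurable F) :
    Measurable (Function.uncurry (slideHeat F)) := by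
  have : Measurable (Function.uncurry fun (p : ℝ × Space d) (h : ℝ) =>
      (heatKer p.1 h : ℂ) * F (p.2 - h • e₁ d)) := by
    have h1 : Measurable fun q : (ℝ × Space d) × ℝ => heatKer q.1.1 q.2 :=
      measurable_heatKer.comp (by fun_prop : Measurable fun q : (ℝ × Space d) × ℝ => (q.1.1, q.2))
    have h2 : Measurable fun q : (ℝ × Space d) × ℝ => F (q.1.2 - q.2 • e₁ d) :=
      (measurable_slide hF).comp
        (by fun_prop : Measurable fun q : (ℝ × Space d) × ℝ => (q.1.2, q.2))
    exact (Complex.measurable_ofReal.comp h1).mul h2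
  exact (this.stronglyMeasurable.integral_prod_right).measurable

theorem norm_slideHeat_le {F : Space d → ℂ} {M : ℝ} (hM : ∀ x, ‖F x‖ ≤ M) {σ : ℝ} (hσ : 0 < σ)
    (x : Space d) : ‖slideHeat F σ x‖ ≤ 100 * M / σ := by
  have hM0 : 0 ≤ M := (norm_nonneg _).trans (hM 0)
  exact norm_heatOp_le (fun h => (hM _).trans
    (le_mul_of_one_le_right hM0 (by linarith [abs_nonneg h]))) hσ

theorem fourierInv_translate (φ : 𝓢(Space d, ℂ)) (h : ℝ) (ξ : Space d) :
    (𝓕⁻ (φ.compSubConstCLM ℂ (-(h • e₁ d)))) ξ =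
      Complex.exp (-(2 * Real.pi * ξ 0 * Complex.I) * h) * (𝓕⁻ φ) ξ := by
  rw [SchwartzMap.fourierInv_coe, SchwartzMap.fourierInv_coe, Real.fourierInv_eq',
    Real.fourierInv_eq', ← integral_const_mul,
    ← integral_add_right_eq_self _ (-(h • e₁ d))]
  refine integral_congr_ae (Filter.Eventually.of_forall fun y => ?_)
  have hin : inner ℝ (e₁ d) ξ = ξ 0 := by simp [e₁, EuclideanSpace.inner_single_left]
  simp only [compSubConstCLM_apply, sub_neg_eq_add, neg_add_cancel_right, smul_eq_mul,
    inner_add_left, inner_neg_left, real_inner_smul_left, hin]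
  rw [← mul_assoc, ← Complex.exp_add]
  congr 2
  push_cast; ring

/-- The translation is moved to the test function, whose inverse transform then acquires a phase. -/
theorem integral_translate_mul {f : L2 d} {F : Space d → ℂ} (hfF : f =ᵐ[volume] F)
    (φ : 𝓢(Space d, ℂ)) (h : ℝ) : ∫ x, F (x - h • e₁ d) * φ x =
      ∫ ξ, Complex.exp (-(2 * Real.pi * ξ 0 * Complex.I) * h) *
        ((𝓕 f : L2 d) ξ * (𝓕⁻ φ) ξ) := by
  calc _ = ∫ x, F x * φ.compSubConstCLM ℂ (-(h • e₁ d)) x := by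
        rw [← integral_add_right_eq_self _ (h • e₁ d)]
        simp
    _ = ∫ x, f x * φ.compSubConstCLM ℂ (-(h • e₁ d)) x := by
        refine integral_congr_ae ?_
        filter_upwards [hfF] with x hx
        rw [hx]
    _ = _ := by
        rw [integral_mul_eq_fourier]
        refine integral_congr_ae (Filter.Eventually.of_forall fun ξ => ?_)
        simp only [fourierInv_translate]
        ring

theorem norm_exp_neg_mul (ξ : Space d) (h : ℝ) :
    ‖Complex.exp (-(2 * Real.pi * ξ 0 * Complex.I) * h)‖ = 1 := by
  rw [show -(2 * Real.pi * ξ 0 * Complex.I) * (h : ℂ) =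
    ((-(2 * Real.pi * ξ 0 * h) : ℝ) : ℂ) * Complex.I by push_cast; ring,
    Complex.norm_exp_ofReal_mul_I]

theorem integrable_heatKer_mul_translate {F : Space d → ℂ} (hF : Measurable F) {M : ℝ}
    (hM : ∀ x, ‖F x‖ ≤ M) (φ : 𝓢(Space d, ℂ)) {σ : ℝ} (hσ : 0 < σ) :
    Integrable (Function.uncurry fun (x : Space d) (h : ℝ) =>
      (heatKer σ h : ℂ) * F (x - h • e₁ d) * φ x) (volume.prod volume) := by
  have hk : Integrable fun h => (heatKer σ h : ℂ) := (integrable_heatKer hσ).ofReal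
  have h1 : Integrable (fun p : Space d × ℝ => φ p.1 * (heatKer σ p.2 : ℂ))
    (volume.prod volume) := (φ.integrable (μ := volume)).mul_prod hk
  refine (h1.bdd_mul (c := M) (measurable_slide hF).aestronglyMeasurable
    (Filter.Eventually.of_forall fun p => hM _)).congr (Filter.Eventually.of_forall fun p => ?_)
  simp only [Function.uncurry]; ring

theorem integrable_heatKer_mul_exp {G : Space d → ℂ} (hG : Integrable G) {σ : ℝ} (hσ : 0 < σ) :
    Integrable (Function.uncurry fun (h : ℝ) (ξ : Space d) =>
      (heatKer σ h : ℂ) * (Complex.exp (-(2 * Real.pi * ξ 0 * Complex.I) * h) * G ξ))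
      (volume.prod volume) := by
  have hk : Integrable fun h => (heatKer σ h : ℂ) := (integrable_heatKer hσ).ofReal
  have h1 := hk.mul_prod hG
  have hc : Continuous fun p : ℝ × Space d =>
    Complex.exp (-(2 * Real.pi * p.2 0 * Complex.I) * p.1) := by fun_prop
  refine (h1.bdd_mul (c := 1) hc.aestronglyMeasurable
    (Filter.Eventually.of_forall fun p => (norm_exp_neg_mul _ _).le)).congr
    (Filter.Eventually.of_forall fun p => ?_)
  simp only [Function.uncurry]; ring

theorem integral_heatKer_mul_exp (G : Space d → ℂ) {σ : ℝ} (hσ : 0 < σ) (ξ : Space d) :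
    ∫ h, (heatKer σ h : ℂ) * (Complex.exp (-(2 * Real.pi * ξ 0 * Complex.I) * h) * G ξ) =
      ((bessel ξ * Real.exp (-(bessel ξ * σ)) : ℝ) : ℂ) * G ξ := by
  have h := heatOp_exp hσ (ξ 0)
  rw [heatOp] at h
  rw [bessel, ← h, ← integral_mul_const]
  simp only [mul_assoc]

/-- Averaging translations against the heat kernel averages characters in frequency, so the
multiplier is read off from `heatOp_exp`. -/
theorem integral_slideHeat_mul {f : L2 d} {F : Space d → ℂ} (hF : Measurable F) {M : ℝ}
    (hM : ∀ x, ‖F x‖ ≤ M) (hfF : f =ᵐ[volume] F) (φ : 𝓢(Space d, ℂ)) {σ : ℝ} (hσ : 0 < σ) :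
    ∫ x, slideHeat F σ x * φ x = ∫ ξ, ((bessel ξ * Real.exp (-(bessel ξ * σ)) : ℝ) : ℂ) *
      ((𝓕 f : L2 d) ξ * (𝓕⁻ φ) ξ) := by
  obtain ⟨G, hG⟩ : ∃ G : Space d → ℂ, G = fun ξ => (𝓕 f : L2 d) ξ * (𝓕⁻ φ) ξ := ⟨_, rfl⟩
  have hGi : Integrable G := hG ▸ integrable_L2_mul_schwartz (𝓕 f : L2 d) (𝓕⁻ φ)
  have e0 : ∀ x, slideHeat F σ x * φ x = ∫ h, (heatKer σ h : ℂ) * F (x - h • e₁ d) * φ x :=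
    fun x => (integral_mul_const _ _).symm
  have e1 : ∀ h : ℝ, ∫ x, (heatKer σ h : ℂ) * F (x - h • e₁ d) * φ x =
      ∫ ξ, (heatKer σ h : ℂ) * (Complex.exp (-(2 * Real.pi * ξ 0 * Complex.I) * h) * G ξ) :=
    fun h => by
      rw [integral_const_mul, hG, ← integral_translate_mul hfF, ← integral_const_mul]
      simp only [mul_assoc]
  simp only [e0]
  rw [integral_integral_swap (integrable_heatKer_mul_translate hF hM φ hσ)]
  simp only [e1]
  rw [integral_integral_swap (integrable_heatKer_mul_exp hGi hσ)]
  have e2 : ∀ ξ, ((bessel ξ * Real.exp (-(bessel ξ * σ)) : ℝ) : ℂ) *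
      ((𝓕 f : L2 d) ξ * (𝓕⁻ φ) ξ) = ((bessel ξ * Real.exp (-(bessel ξ * σ)) : ℝ) : ℂ) * G ξ :=
    fun ξ => by rw [hG]
  simp only [e2]
  exact integral_congr_ae (Filter.Eventually.of_forall (integral_heatKer_mul_exp G hσ))

/-- The multiplier `X e^{-σX}` is bounded by `1/σ`. -/
theorem norm_bessel_mul_exp_le {σ : ℝ} (hσ : 0 < σ) (ξ : Space d) :
    ‖((bessel ξ * Real.exp (-(bessel ξ * σ)) : ℝ) : ℂ)‖ ≤ σ⁻¹ := by
  have hX := bessel_pos ξ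
  rw [Complex.norm_real, Real.norm_of_nonneg (by positivity), Real.exp_neg, ← div_eq_mul_inv,
    div_le_iff₀ (Real.exp_pos _), ← div_eq_inv_mul, le_div_iff₀ hσ]
  exact self_le_exp _

/-- An `L²` function is built by applying the multiplier in frequency. Testing identifies it with
the integral operator, which is a priori only bounded, and Plancherel concludes. -/
theorem lintegral_slideHeat_sq {f : L2 d} {F : Space d → ℂ} (hF : Measurable F) {M : ℝ}
    (hM : ∀ x, ‖F x‖ ≤ M) (hfF : f =ᵐ[volume] F) {σ : ℝ} (hσ : 0 < σ) :
    ∫⁻ x, ‖slideHeat F σ x‖ₑ ^ 2 =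
      ∫⁻ ξ, ENNReal.ofReal (bessel ξ * Real.exp (-(bessel ξ * σ))) ^ 2 *
        ‖(𝓕 f : L2 d) ξ‖ₑ ^ 2 := by
  have hc := continuous_bessel (d := d)
  have hcm : Continuous fun ξ : Space d => ((bessel ξ * Real.exp (-(bessel ξ * σ)) : ℝ) : ℂ) := by
    fun_prop
  have hm : MemLp (fun ξ => ((bessel ξ * Real.exp (-(bessel ξ * σ)) : ℝ) : ℂ) * (𝓕 f : L2 d) ξ) 2
      (volume : Measure (Space d)) :=
    (Lp.memLp (𝓕 f : L2 d)).of_le_mul (c := σ⁻¹)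
      (hcm.aestronglyMeasurable.mul (Lp.aestronglyMeasurable _))
      (Filter.Eventually.of_forall fun ξ => by
        rw [norm_mul]
        exact mul_le_mul_of_nonneg_right (norm_bessel_mul_exp_le hσ ξ) (norm_nonneg _))
  obtain ⟨g, hg⟩ : ∃ g : L2 d, g = 𝓕⁻ (hm.toLp _ : L2 d) := ⟨_, rfl⟩
  have hFg : (𝓕 g : L2 d) = hm.toLp _ := by rw [hg, FourierTransform.fourier_fourierInv_eq]
  have hms : Measurable (slideHeat F σ) :=
    (measurable_slideHeat hF).comp (measurable_const.prodMk measurable_id)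
  have hae : slideHeat F σ =ᵐ[volume] g := by
    refine ae_eq_of_integral_mul_schwartz
      (locallyIntegrable_of_bounded hms.aestronglyMeasurable (norm_slideHeat_le hM hσ))
      (locallyIntegrable_Lp g) fun φ _ => ?_
    rw [integral_slideHeat_mul hF hM hfF φ hσ, integral_mul_eq_fourier, hFg]
    refine integral_congr_ae ?_
    filter_upwards [hm.coeFn_toLp] with ξ hξ
    rw [hξ]; ring
  calc _ = ∫⁻ x, ‖g x‖ₑ ^ 2 := by
        refine lintegral_congr_ae ?_
        filter_upwards [hae] with x hx
        rw [hx]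
    _ = ENNReal.ofReal (‖(𝓕 g : L2 d)‖ ^ 2) := by
        rw [lintegral_enorm_sq, Lp.norm_fourier_eq]
    _ = _ := by
        rw [hFg, ← lintegral_enorm_sq]
        refine lintegral_congr_ae ?_
        filter_upwards [hm.coeFn_toLp] with ξ hξ
        have hX := bessel_pos ξ
        rw [hξ, enorm_mul, mul_pow, ← ofReal_norm (E := ℂ) (Complex.ofReal _), Complex.norm_real,
          Real.norm_of_nonneg (by positivity)]

/-- The square function of the heat operator. -/
def heatSquare (F : Space d → ℂ) (x : Space d) : ℝ≥0∞ :=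
  ∫⁻ σ in Set.Ioi (0 : ℝ), ENNReal.ofReal σ * ‖slideHeat F σ x‖ₑ ^ 2

theorem measurable_heatSquare {F : Space d → ℂ} (hF : Measurable F) : Measurable (heatSquare F) := by
  have : Measurable (Function.uncurry fun (x : Space d) (σ : ℝ) =>
      ENNReal.ofReal σ * ‖slideHeat F σ x‖ₑ ^ 2) := by
    have h1 : Measurable fun p : Space d × ℝ => slideHeat F p.2 p.1 :=
      (measurable_slideHeat hF).comp measurable_swap
    exact measurable_snd.ennreal_ofReal.mul (h1.enorm.pow_const 2)
  exact this.lintegral_prod_right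

/-- By Plancherel for each `σ` and Fubini, the claim reduces to `∫ σ X² e^{-2σX} dσ = 1/4`,
independently of the frequency. -/
theorem lintegral_heatSquare_le {f : L2 d} {F : Space d → ℂ} (hF : Measurable F) {M : ℝ}
    (hM : ∀ x, ‖F x‖ ≤ M) (hfF : f =ᵐ[volume] F) :
    ∫⁻ x, heatSquare F x ≤ ENNReal.ofReal (‖f‖ ^ 2) := by
  have hc := continuous_bessel (d := d)
  have m1 : Measurable (Function.uncurry fun (x : Space d) (σ : ℝ) =>
      ENNReal.ofReal σ * ‖slideHeat F σ x‖ₑ ^ 2) := by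
    have h1 : Measurable fun p : Space d × ℝ => slideHeat F p.2 p.1 :=
      (measurable_slideHeat hF).comp measurable_swap
    exact measurable_snd.ennreal_ofReal.mul (h1.enorm.pow_const 2)
  have m2 : Measurable (Function.uncurry fun (σ : ℝ) (ξ : Space d) => ENNReal.ofReal σ *
      (ENNReal.ofReal (bessel ξ * Real.exp (-(bessel ξ * σ))) ^ 2 * ‖(𝓕 f : L2 d) ξ‖ₑ ^ 2)) := by
    have h1 : Continuous fun p : ℝ × Space d =>
        bessel p.2 * Real.exp (-(bessel p.2 * p.1)) := by fun_prop
    exact measurable_fst.ennreal_ofReal.mul ((h1.measurable.ennreal_ofReal.pow_const 2).mul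
      (((Lp.stronglyMeasurable (𝓕 f : L2 d)).measurable.comp measurable_snd).enorm.pow_const 2))
  calc _ = ∫⁻ σ in Set.Ioi (0 : ℝ), ∫⁻ x, ENNReal.ofReal σ * ‖slideHeat F σ x‖ₑ ^ 2 :=
        lintegral_lintegral_swap m1.aemeasurable
    _ = ∫⁻ σ in Set.Ioi (0 : ℝ), ∫⁻ ξ, ENNReal.ofReal σ *
        (ENNReal.ofReal (bessel ξ * Real.exp (-(bessel ξ * σ))) ^ 2 *
          ‖(𝓕 f : L2 d) ξ‖ₑ ^ 2) := by
        refine setLIntegral_congr_fun measurableSet_Ioi fun σ hσ => ?_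
        simp only [lintegral_const_mul' _ _ ENNReal.ofReal_ne_top]
        rw [lintegral_slideHeat_sq hF hM hfF hσ]
    _ = ∫⁻ ξ, ∫⁻ σ in Set.Ioi (0 : ℝ), ENNReal.ofReal σ *
        (ENNReal.ofReal (bessel ξ * Real.exp (-(bessel ξ * σ))) ^ 2 *
          ‖(𝓕 f : L2 d) ξ‖ₑ ^ 2) := lintegral_lintegral_swap m2.aemeasurable
    _ ≤ ∫⁻ ξ, ‖(𝓕 f : L2 d) ξ‖ₑ ^ 2 := by
        refine lintegral_mono fun ξ => ?_
        have hX := bessel_pos ξ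
        have h1 : ∀ σ ∈ Set.Ioi (0 : ℝ), ENNReal.ofReal σ *
            (ENNReal.ofReal (bessel ξ * Real.exp (-(bessel ξ * σ))) ^ 2 *
              ‖(𝓕 f : L2 d) ξ‖ₑ ^ 2) = ENNReal.ofReal (bessel ξ ^ 2) *
                ENNReal.ofReal (σ ^ ((2 : ℝ) - 1) * Real.exp (-(2 * bessel ξ * σ))) *
              ‖(𝓕 f : L2 d) ξ‖ₑ ^ 2 := fun σ hσ => by
          have hσ0 : 0 < σ := hσ
          rw [← mul_assoc, ← ENNReal.ofReal_pow (by positivity), ← ENNReal.ofReal_mul hσ0.le,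
            ← ENNReal.ofReal_mul (by positivity)]
          congr 2
          rw [show -(2 * bessel ξ * σ) = -(bessel ξ * σ) + -(bessel ξ * σ) by ring, Real.exp_add,
            show (2 : ℝ) - 1 = 1 by norm_num, Real.rpow_one]
          ring
        rw [setLIntegral_congr_fun measurableSet_Ioi h1, lintegral_mul_const' _ _ (by simp),
          lintegral_const_mul' _ _ ENNReal.ofReal_ne_top, lintegral_rpow_mul_exp two_pos (by positivity),
          ← ENNReal.ofReal_mul (by positivity)]
        refine mul_le_of_le_one_left' ?_
        rw [ENNReal.ofReal_le_one, Real.rpow_neg (by positivity), Real.Gamma_two]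
        norm_num
        field_simp
        norm_num
    _ = _ := by rw [lintegral_enorm_sq, Lp.norm_fourier_eq]

end

theorem rpow_le_one_add (q : ℝ≥0∞) {θ : ℝ} (hθ : 0 ≤ θ) (hθ1 : θ ≤ 1) : q ^ θ ≤ 1 + q := by
  rcases le_total q 1 with h | h
  · exact (ENNReal.rpow_le_one h hθ).trans le_self_add
  · calc q ^ θ ≤ q ^ (1 : ℝ) := ENNReal.rpow_le_rpow_of_exponent_le h hθ1
      _ = q := ENNReal.rpow_one q
      _ ≤ _ := le_add_self

/-! ### Fractional powers of `1 - ∂₁²` and the `L^p` bound -/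

section

variable {d : ℕ} [NeZero d]

/-- `(1 - ∂₁²)^{1/2-θ}`, written as an integral of the heat operators. -/
def besselPow (θ : ℝ) (F : Space d → ℂ) (x : Space d) : ℂ :=
  (((Real.Gamma (θ + 1 / 2))⁻¹ : ℝ) : ℂ) *
    ∫ σ in Set.Ioi (0 : ℝ), ((σ ^ (θ - 1 / 2) : ℝ) : ℂ) * slideHeat F σ x

theorem measurable_rpow_mul_slideHeat (θ : ℝ) {F : Space d → ℂ} (hF : Measurable F) :
    Measurable (Function.uncurry fun (x : Space d) (σ : ℝ) =>
      ((σ ^ (θ - 1 / 2) : ℝ) : ℂ) * slideHeat F σ x) := by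
  have h1 : Measurable fun p : Space d × ℝ => slideHeat F p.2 p.1 :=
    (measurable_slideHeat hF).comp measurable_swap
  have h2 : Measurable fun p : Space d × ℝ => p.2 ^ (θ - 1 / 2) := measurable_snd.pow_const _
  exact (Complex.measurable_ofReal.comp h2).mul h1

theorem stronglyMeasurable_besselPow (θ : ℝ) {F : Space d → ℂ} (hF : Measurable F) :
    StronglyMeasurable (besselPow θ F) :=
  (measurable_rpow_mul_slideHeat θ hF).stronglyMeasurable.integral_prod_right.const_mul _

theorem lintegral_enorm_rpow_mul (θ : ℝ) (F : Space d → ℂ) (x : Space d) :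
    ∫⁻ σ in Set.Ioi (0 : ℝ), ‖((σ ^ (θ - 1 / 2) : ℝ) : ℂ) * slideHeat F σ x‖ₑ =
      ∫⁻ σ in Set.Ioi (0 : ℝ), ENNReal.ofReal (σ ^ (θ - 1 / 2)) * ‖slideHeat F σ x‖ₑ := by
  refine setLIntegral_congr_fun measurableSet_Ioi fun σ hσ => ?_
  have hσ0 : 0 < σ := hσ
  rw [enorm_mul, ← ofReal_norm (E := ℂ) (Complex.ofReal _), Complex.norm_real,
    Real.norm_of_nonneg (by positivity)]

/-- The power of the square function is linearised by `q^θ ≤ 1 + q`: the constant is integrated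
against `|φ|`, the other term uses the sup of `|φ|` and the integrability of the square function. -/
theorem integrable_rpow_mul_slideHeat {f : L2 d} {F : Space d → ℂ} (hF : Measurable F) {M : ℝ}
    (hM : ∀ x, ‖F x‖ ≤ M) (hfF : f =ᵐ[volume] F) {θ : ℝ} (hθ : 0 ≤ θ) (hθ1 : θ ≤ 1) {A : ℝ≥0∞}
    (hA : A ≠ ∞) (hb : ∀ x, ∫⁻ σ in Set.Ioi (0 : ℝ), ENNReal.ofReal (σ ^ (θ - 1 / 2)) *
      ‖slideHeat F σ x‖ₑ ≤ A * heatSquare F x ^ θ) (φ : 𝓢(Space d, ℂ)) :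
    Integrable (Function.uncurry fun (x : Space d) (σ : ℝ) =>
      ((σ ^ (θ - 1 / 2) : ℝ) : ℂ) * slideHeat F σ x * φ x)
      (volume.prod (volume.restrict (Set.Ioi 0))) := by
  have hm : Measurable (Function.uncurry fun (x : Space d) (σ : ℝ) =>
      ((σ ^ (θ - 1 / 2) : ℝ) : ℂ) * slideHeat F σ x * φ x) :=
    (measurable_rpow_mul_slideHeat θ hF).mul (φ.continuous.measurable.comp measurable_fst)
  refine ⟨hm.aestronglyMeasurable, ?_⟩
  obtain ⟨S, hS⟩ : ∃ S : ℝ, ∀ x, ‖φ x‖ ≤ S := ⟨_, φ.norm_le_seminorm ℂ⟩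
  rw [HasFiniteIntegral, lintegral_prod _ hm.enorm.aemeasurable]
  simp only [Function.uncurry, enorm_mul (_ * _)]
  have hφ : ∫⁻ x, ‖φ x‖ₑ < ∞ := (φ.integrable (μ := volume)).2
  calc _ ≤ ∫⁻ x, A * (‖φ x‖ₑ + ENNReal.ofReal S * heatSquare F x) := by
        refine lintegral_mono fun x => ?_
        rw [lintegral_mul_const' _ _ enorm_ne_top, lintegral_enorm_rpow_mul]
        calc _ ≤ A * (1 + heatSquare F x) * ‖φ x‖ₑ :=
              mul_le_mul_left ((hb x).trans (mul_le_mul_right (rpow_le_one_add _ hθ hθ1) _)) _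
          _ = A * (‖φ x‖ₑ + ‖φ x‖ₑ * heatSquare F x) := by ring
          _ ≤ _ := by
              have : ‖φ x‖ₑ ≤ ENNReal.ofReal S := by
                rw [← ofReal_norm]; exact ENNReal.ofReal_le_ofReal (hS x)
              exact mul_le_mul_right (add_le_add le_rfl (mul_le_mul_left this _)) _
    _ = A * ((∫⁻ x, ‖φ x‖ₑ) + ENNReal.ofReal S * ∫⁻ x, heatSquare F x) := by
        rw [lintegral_const_mul' _ _ hA, lintegral_add_right _
          ((measurable_heatSquare hF).const_mul _), lintegral_const_mul' _ _ ENNReal.ofReal_ne_top]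
    _ < ∞ := by
        refine ENNReal.mul_lt_top hA.lt_top (ENNReal.add_lt_top.2 ⟨hφ, ?_⟩)
        exact ENNReal.mul_lt_top ENNReal.ofReal_lt_top
          ((lintegral_heatSquare_le hF hM hfF).trans_lt ENNReal.ofReal_lt_top)

theorem integrable_rpow_mul_bessel {θ : ℝ} (hθ : 0 ≤ θ) {G : Space d → ℂ} (hG : Measurable G)
    (hGi : Integrable fun ξ => ((bessel ξ ^ (1 / 2 - θ) : ℝ) : ℂ) * G ξ) :
    Integrable (Function.uncurry fun (σ : ℝ) (ξ : Space d) => ((σ ^ (θ - 1 / 2) : ℝ) : ℂ) *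
      (((bessel ξ * Real.exp (-(bessel ξ * σ)) : ℝ) : ℂ) * G ξ))
      ((volume.restrict (Set.Ioi 0)).prod volume) := by
  have hc := continuous_bessel (d := d)
  have hm : Measurable (Function.uncurry fun (σ : ℝ) (ξ : Space d) => ((σ ^ (θ - 1 / 2) : ℝ) : ℂ) *
      (((bessel ξ * Real.exp (-(bessel ξ * σ)) : ℝ) : ℂ) * G ξ)) := by
    have h1 : Continuous fun p : ℝ × Space d =>
        ((bessel p.2 * Real.exp (-(bessel p.2 * p.1)) : ℝ) : ℂ) := by fun_prop
    have h2 : Measurable fun p : ℝ × Space d => p.1 ^ (θ - 1 / 2) := measurable_fst.pow_const _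
    exact (Complex.measurable_ofReal.comp h2).mul (h1.measurable.mul (hG.comp measurable_snd))
  refine ⟨hm.aestronglyMeasurable, ?_⟩
  rw [HasFiniteIntegral, lintegral_prod_symm _ hm.enorm.aemeasurable]
  have key : ∀ ξ : Space d, ∫⁻ σ in Set.Ioi (0 : ℝ), ‖((σ ^ (θ - 1 / 2) : ℝ) : ℂ) *
      (((bessel ξ * Real.exp (-(bessel ξ * σ)) : ℝ) : ℂ) * G ξ)‖ₑ =
      ENNReal.ofReal (Real.Gamma (θ + 1 / 2)) * ‖((bessel ξ ^ (1 / 2 - θ) : ℝ) : ℂ) * G ξ‖ₑ := by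
    intro ξ
    have hX := bessel_pos ξ
    have h1 : ∀ σ ∈ Set.Ioi (0 : ℝ), ‖((σ ^ (θ - 1 / 2) : ℝ) : ℂ) *
        (((bessel ξ * Real.exp (-(bessel ξ * σ)) : ℝ) : ℂ) * G ξ)‖ₑ =
        ENNReal.ofReal (σ ^ (θ + 1 / 2 - 1) * Real.exp (-(bessel ξ * σ))) *
          (ENNReal.ofReal (bessel ξ) * ‖G ξ‖ₑ) := fun σ hσ => by
      have hσ0 : 0 < σ := hσ
      rw [← mul_assoc, enorm_mul, ← Complex.ofReal_mul, ← ofReal_norm (E := ℂ) (Complex.ofReal _),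
        Complex.norm_real, Real.norm_of_nonneg (by positivity), ← mul_assoc (ENNReal.ofReal _),
        ← ENNReal.ofReal_mul (by positivity), show θ + 1 / 2 - 1 = θ - 1 / 2 by ring]
      congr 2; ring
    rw [setLIntegral_congr_fun measurableSet_Ioi h1,
      lintegral_mul_const' _ _ (ENNReal.mul_ne_top ENNReal.ofReal_ne_top enorm_ne_top),
      lintegral_rpow_mul_exp (by linarith) hX, enorm_mul, ← ofReal_norm (E := ℂ) (Complex.ofReal _),
      Complex.norm_real, Real.norm_of_nonneg (by positivity), ← mul_assoc, ← mul_assoc,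
      ← ENNReal.ofReal_mul (by
        have := Real.Gamma_pos_of_pos (s := θ + 1 / 2) (by linarith); positivity),
      ← ENNReal.ofReal_mul (Real.Gamma_pos_of_pos (by linarith)).le]
    congr 2
    rw [show 1 / 2 - θ = -(θ + 1 / 2) + 1 by ring, Real.rpow_add hX, Real.rpow_one]
    ring
  simp only [Function.uncurry, key]
  rw [lintegral_const_mul' _ _ ENNReal.ofReal_ne_top]
  exact ENNReal.mul_lt_top ENNReal.ofReal_lt_top hGi.2

/-- The Gamma integral gives `X^(-(θ+1/2))`, and the factor `X` of the multiplier raises this to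
`X^(1/2-θ)`. -/
theorem integral_rpow_mul_bessel {θ : ℝ} (hθ : 0 ≤ θ) (G : Space d → ℂ) (ξ : Space d) :
    ∫ σ in Set.Ioi (0 : ℝ), ((σ ^ (θ - 1 / 2) : ℝ) : ℂ) *
      (((bessel ξ * Real.exp (-(bessel ξ * σ)) : ℝ) : ℂ) * G ξ) =
      ((Real.Gamma (θ + 1 / 2) : ℝ) : ℂ) * (((bessel ξ ^ (1 / 2 - θ) : ℝ) : ℂ) * G ξ) := by
  have hX := bessel_pos ξ
  have e : ∀ σ : ℝ, ((σ ^ (θ - 1 / 2) : ℝ) : ℂ) *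
      (((bessel ξ * Real.exp (-(bessel ξ * σ)) : ℝ) : ℂ) * G ξ) =
      ((σ ^ (θ + 1 / 2 - 1) * Real.exp (-(bessel ξ * σ)) : ℝ) : ℂ) * ((bessel ξ : ℂ) * G ξ) :=
    fun σ => by
      rw [show θ + 1 / 2 - 1 = θ - 1 / 2 by ring]
      push_cast; ring
  simp only [e]
  rw [integral_mul_const, integral_complex_ofReal,
    Real.integral_rpow_mul_exp_neg_mul_Ioi (by linarith) hX,
    show 1 / 2 - θ = -(θ + 1 / 2) + 1 by ring, Real.rpow_add hX, Real.rpow_one, one_div,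
    Real.inv_rpow hX.le, Real.rpow_neg hX.le]
  push_cast; ring

/-- Two applications of Fubini around the frequency formula for each heat operator. This identifies
the absolutely convergent integral over `σ` with the multiplier in the sense of distributions. -/
theorem integral_besselPow_mul {f : L2 d} {F : Space d → ℂ} (hF : Measurable F) {M : ℝ}
    (hM : ∀ x, ‖F x‖ ≤ M) (hfF : f =ᵐ[volume] F) {θ : ℝ} (hθ : 0 ≤ θ) (hθ1 : θ ≤ 1) {A : ℝ≥0∞}
    (hA : A ≠ ∞) (hb : ∀ x, ∫⁻ σ in Set.Ioi (0 : ℝ), ENNReal.ofReal (σ ^ (θ - 1 / 2)) *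
      ‖slideHeat F σ x‖ₑ ≤ A * heatSquare F x ^ θ) (φ : 𝓢(Space d, ℂ))
    (hGi : Integrable fun ξ => ((bessel ξ ^ (1 / 2 - θ) : ℝ) : ℂ) *
      ((𝓕 f : L2 d) ξ * (𝓕⁻ φ) ξ)) :
    ∫ x, besselPow θ F x * φ x = ∫ ξ, ((bessel ξ ^ (1 / 2 - θ) : ℝ) : ℂ) *
      ((𝓕 f : L2 d) ξ * (𝓕⁻ φ) ξ) := by
  obtain ⟨G, hG⟩ : ∃ G : Space d → ℂ, G = fun ξ => (𝓕 f : L2 d) ξ * (𝓕⁻ φ) ξ := ⟨_, rfl⟩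
  have hGm : Measurable G := by
    rw [hG]
    exact (Lp.stronglyMeasurable (𝓕 f : L2 d)).measurable.mul (𝓕⁻ φ).continuous.measurable
  obtain ⟨c, hc⟩ : ∃ c : ℝ, c = Real.Gamma (θ + 1 / 2) := ⟨_, rfl⟩
  have hc0 : (c : ℂ) ≠ 0 := by
    rw [hc]; exact_mod_cast (Real.Gamma_pos_of_pos (by linarith)).ne'
  have e0 : ∀ x, besselPow θ F x * φ x = (c : ℂ)⁻¹ *
      ∫ σ in Set.Ioi (0 : ℝ), ((σ ^ (θ - 1 / 2) : ℝ) : ℂ) * slideHeat F σ x * φ x := fun x => by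
    rw [integral_mul_const, besselPow, ← hc, Complex.ofReal_inv, mul_assoc]
  have e1 : ∀ σ ∈ Set.Ioi (0 : ℝ),
      ∫ x, ((σ ^ (θ - 1 / 2) : ℝ) : ℂ) * slideHeat F σ x * φ x =
      ∫ ξ, ((σ ^ (θ - 1 / 2) : ℝ) : ℂ) *
        (((bessel ξ * Real.exp (-(bessel ξ * σ)) : ℝ) : ℂ) * G ξ) := fun σ hσ => by
    rw [integral_const_mul, hG, ← integral_slideHeat_mul hF hM hfF φ hσ, ← integral_const_mul]
    simp only [mul_assoc]
  have e2 : ∀ ξ, ((bessel ξ ^ (1 / 2 - θ) : ℝ) : ℂ) * ((𝓕 f : L2 d) ξ * (𝓕⁻ φ) ξ) =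
      ((bessel ξ ^ (1 / 2 - θ) : ℝ) : ℂ) * G ξ := fun ξ => by rw [hG]
  simp only [e0, e2] at hGi ⊢
  rw [integral_const_mul,
    integral_integral_swap (integrable_rpow_mul_slideHeat hF hM hfF hθ hθ1 hA hb φ),
    setIntegral_congr_fun measurableSet_Ioi e1,
    integral_integral_swap (integrable_rpow_mul_bessel hθ hGm hGi)]
  simp only [integral_rpow_mul_bessel hθ, ← hc]
  rw [integral_const_mul, inv_mul_cancel_left₀ hc0]

theorem enorm_besselPow_le {θ : ℝ} (hθ : 0 ≤ θ) (F : Space d → ℂ) (x : Space d) :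
    ‖besselPow θ F x‖ₑ ≤ ENNReal.ofReal (Real.Gamma (θ + 1 / 2))⁻¹ *
      ∫⁻ σ in Set.Ioi (0 : ℝ), ENNReal.ofReal (σ ^ (θ - 1 / 2)) * ‖slideHeat F σ x‖ₑ := by
  have := Real.Gamma_pos_of_pos (s := θ + 1 / 2) (by linarith)
  rw [besselPow, enorm_mul, ← ofReal_norm (E := ℂ) (Complex.ofReal _), Complex.norm_real,
    Real.norm_of_nonneg (by positivity), ← lintegral_enorm_rpow_mul]
  exact mul_le_mul_right (enorm_integral_le_lintegral_enorm _) _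

/-- With exponent `1/p` on the square function, the `p`-th power of the pointwise bound is the
square function itself, whose integral is at most the squared `L²` norm. For `p = ∞` the pointwise
bound is the claim. -/
theorem eLpNorm_besselPow_le {f : L2 d} {F : Space d → ℂ} (hF : Measurable F) {M : ℝ}
    (hM : ∀ x, ‖F x‖ ≤ M) (hfF : f =ᵐ[volume] F) {p : ℝ≥0∞} (hp : p ≠ 0) {A : ℝ≥0∞}
    (hb : ∀ x, ‖besselPow p⁻¹.toReal F x‖ₑ ≤ A * heatSquare F x ^ p⁻¹.toReal) :
    eLpNorm (besselPow p⁻¹.toReal F) p volume ≤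
      A * ENNReal.ofReal (‖f‖ ^ (2 * p⁻¹.toReal)) := by
  rcases eq_or_ne p ∞ with rfl | hp'
  · simp only [ENNReal.inv_top, ENNReal.toReal_zero, ENNReal.rpow_zero, mul_one, mul_zero,
      Real.rpow_zero, ENNReal.ofReal_one] at hb ⊢
    rw [eLpNorm_exponent_top]
    exact essSup_le_of_ae_le _ (Filter.Eventually.of_forall hb)
  · have hp0 : 0 < p.toReal := ENNReal.toReal_pos hp hp'
    rw [eLpNorm_eq_lintegral_rpow_enorm_toReal hp hp', ENNReal.toReal_inv, one_div] at *
    have hcancel : p.toReal⁻¹ * p.toReal = 1 := inv_mul_cancel₀ hp0.ne'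
    calc _ ≤ (∫⁻ x, A ^ p.toReal * heatSquare F x) ^ p.toReal⁻¹ := by
          refine ENNReal.rpow_le_rpow (lintegral_mono fun x => ?_) (by positivity)
          refine (ENNReal.rpow_le_rpow (hb x) hp0.le).trans (le_of_eq ?_)
          rw [ENNReal.mul_rpow_of_nonneg _ _ hp0.le, ← ENNReal.rpow_mul, hcancel, ENNReal.rpow_one]
      _ ≤ (A ^ p.toReal * ENNReal.ofReal (‖f‖ ^ 2)) ^ p.toReal⁻¹ := by
          refine ENNReal.rpow_le_rpow ?_ (by positivity)
          rw [lintegral_const_mul _ (measurable_heatSquare hF)]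
          exact mul_le_mul_right (lintegral_heatSquare_le hF hM hfF) _
      _ = _ := by
          rw [ENNReal.mul_rpow_of_nonneg _ _ (by positivity), ← ENNReal.rpow_mul,
            mul_inv_cancel₀ hp0.ne', ENNReal.rpow_one,
            ENNReal.ofReal_rpow_of_nonneg (by positivity) (by positivity), ← Real.rpow_natCast,
            ← Real.rpow_mul (norm_nonneg _)]
          norm_num

theorem japDeriv₁_apply (a : ℝ) (f : L2 d) (φ : 𝓢(Space d, ℂ)) :
    japDeriv₁ d a (Lp.toTemperedDistribution f) φ =
      ∫ ξ, (𝓕 f : L2 d) ξ * SchwartzMap.smulLeftCLM ℂ (japSymbol d a) (𝓕⁻ φ) ξ := by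
  rw [japDeriv₁, TemperedDistribution.fourierMultiplierCLM_apply_apply,
    toTemperedDistribution_fourier, pairing_toLp]

/-- The Gagliardo–Nirenberg type bound for `⟨∂₁⟩^{1-2/p}`. -/
theorem exists_norm_japDeriv₁_le (p : ℝ≥0∞) [Fact (1 ≤ p)] (hp : 2 ≤ p) : ∃ C : ℝ, 0 < C ∧
    ∀ (f : L2 d) (F : Space d → ℂ) (M B : ℝ), Measurable F → (∀ x, ‖F x‖ ≤ M) →
      f =ᵐ[volume] F → 0 ≤ B → (∀ x, HeatBounded (fun h => F (x - h • e₁ d)) B) →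
      ∃ g : Lp ℂ p (volume : Measure (Space d)),
        japDeriv₁ d (1 - 2 * p⁻¹.toReal) (Lp.toTemperedDistribution f) =
          Lp.toTemperedDistribution g ∧
        ‖g‖ ≤ C * (B ^ (1 - 2 * p⁻¹.toReal) * ‖f‖ ^ (2 * p⁻¹.toReal)) := by
  rcases eq_or_ne p 2 with rfl | hp2
  -- At `p = 2` the order of the operator is zero and its symbol is `1`. This endpoint `θ = 1/2` is
  -- excluded from the interpolation lemma.
  · refine ⟨1, one_pos, fun f F M B _ _ _ _ _ => ⟨f, ?_, ?_⟩⟩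
    · have : japSymbol d (1 - 2 * (2 : ℝ≥0∞)⁻¹.toReal) = fun _ => 1 := by
        ext ξ; simp [japSymbol]
      rw [japDeriv₁, this, TemperedDistribution.fourierMultiplierCLM_const]
      simp
    · simp
  obtain ⟨θ, hθ⟩ : ∃ θ, θ = p⁻¹.toReal := ⟨_, rfl⟩
  have hp2' : 2 < p := lt_of_le_of_ne hp (Ne.symm hp2)
  have hθ0 : 0 ≤ θ := hθ ▸ ENNReal.toReal_nonneg
  have hθ2 : θ < 1 / 2 := by
    have := (ENNReal.toReal_lt_toReal (by simp; exact (zero_lt_two.trans hp2').ne') (by simp)).2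
      (ENNReal.inv_lt_inv.2 hp2')
    rw [← hθ] at this
    simpa using this
  have hΓ := Real.Gamma_pos_of_pos (s := θ + 1 / 2) (by linarith)
  obtain ⟨K, hK, hKb⟩ := exists_lintegral_rpow_le hθ0 hθ2
  refine ⟨(Real.Gamma (θ + 1 / 2))⁻¹ * K, by positivity, fun f F M B hF hM hfF hB hH => ?_⟩
  have hA : ENNReal.ofReal K * ENNReal.ofReal B ^ (1 - 2 * θ) =
      ENNReal.ofReal (K * B ^ (1 - 2 * θ)) := by
    rw [ENNReal.ofReal_rpow_of_nonneg hB (by linarith), ← ENNReal.ofReal_mul hK.le]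
  have hb : ∀ x, ∫⁻ σ in Set.Ioi (0 : ℝ), ENNReal.ofReal (σ ^ (θ - 1 / 2)) *
      ‖slideHeat F σ x‖ₑ ≤ ENNReal.ofReal (K * B ^ (1 - 2 * θ)) * heatSquare F x ^ θ := fun x => by
    have hsl : Measurable fun h : ℝ => F (x - h • e₁ d) :=
      (measurable_slide hF).comp (measurable_const.prodMk measurable_id)
    rw [← hA]
    exact hKb _ B hsl hB (hH x)
  have hb' : ∀ x, ‖besselPow p⁻¹.toReal F x‖ₑ ≤ ENNReal.ofReal ((Real.Gamma (θ + 1 / 2))⁻¹ *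
      (K * B ^ (1 - 2 * θ))) * heatSquare F x ^ p⁻¹.toReal := fun x => by
    rw [← hθ, ENNReal.ofReal_mul (by positivity), mul_assoc]
    exact (enorm_besselPow_le hθ0 F x).trans (mul_le_mul_right (hb x) _)
  have hL := eLpNorm_besselPow_le hF hM hfF (zero_lt_two.trans hp2').ne' hb'
  rw [← hθ, ← ENNReal.ofReal_mul (by positivity)] at hL
  have hmem : MemLp (besselPow θ F) p volume :=
    ⟨(stronglyMeasurable_besselPow θ hF).aestronglyMeasurable, hL.trans_lt ENNReal.ofReal_lt_top⟩
  refine ⟨hmem.toLp _, ?_, ?_⟩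
  · ext φ
    -- The order `1 - 2θ` of `⟨∂₁⟩` corresponds to the power `1/2 - θ` of the symbol of `1 - ∂₁²`.
    rw [← hθ, japDeriv₁_apply, Lp.toTemperedDistribution_apply]
    have e : ∀ ξ, (𝓕 f : L2 d) ξ * SchwartzMap.smulLeftCLM ℂ (japSymbol d (1 - 2 * θ)) (𝓕⁻ φ) ξ =
        ((bessel ξ ^ (1 / 2 - θ) : ℝ) : ℂ) * ((𝓕 f : L2 d) ξ * (𝓕⁻ φ) ξ) := fun ξ => by
      rw [SchwartzMap.smulLeftCLM_apply_apply (japSymbol_hasTemperateGrowth d _), japSymbol, bessel,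
        show (1 - 2 * θ) / 2 = 1 / 2 - θ by ring, smul_eq_mul]
      ring
    have hi := integrable_L2_mul_schwartz (𝓕 f : L2 d)
      (SchwartzMap.smulLeftCLM ℂ (japSymbol d (1 - 2 * θ)) (𝓕⁻ φ))
    simp only [e] at hi ⊢
    rw [← integral_besselPow_mul hF hM hfF hθ0 (by linarith) ENNReal.ofReal_ne_top hb φ hi]
    refine integral_congr_ae ?_
    filter_upwards [hmem.coeFn_toLp] with x hx
    rw [hx, smul_eq_mul, mul_comm]
  · rw [Lp.norm_toLp, ← hθ]
    refine (ENNReal.toReal_mono ENNReal.ofReal_ne_top hL).trans (le_of_eq ?_)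
    rw [ENNReal.toReal_ofReal (by positivity)]
    ring

end

/-! ### Dyadic decomposition of the datum and summation -/

section

variable {d : ℕ}

/-- The restriction of `ψ` to the region `⟨x⟩ < 2^n`. -/
def truncate (n : ℕ) (ψ : L2 d) : L2 d :=
  ((Lp.memLp ψ).indicator (s := {x : Space d | √(‖x‖ ^ 2 + 1) < 2 ^ n}) (by
    have hc : Continuous fun x : Space d => √(‖x‖ ^ 2 + 1) := by fun_prop
    exact measurableSet_lt hc.measurable measurable_const)).toLp _

theorem coeFn_truncate (n : ℕ) (ψ : L2 d) : truncate n ψ =ᵐ[volume]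
    {x : Space d | √(‖x‖ ^ 2 + 1) < 2 ^ n}.indicator ψ := MemLp.coeFn_toLp _

/-- Since `⟨x⟩ ≥ 1` everywhere, the region `⟨x⟩ < 2⁰` is empty, and the telescoping sum of shells
starts from zero. -/
theorem truncate_zero (ψ : L2 d) : truncate 0 ψ = 0 := by
  refine Lp.ext ?_
  filter_upwards [coeFn_truncate 0 ψ, Lp.coeFn_zero ℂ 2 (volume : Measure (Space d))] with x hx h0
  rw [hx, h0]
  simp

/-- A function dominated by `ψ` and living where `⟨x⟩ ≥ 2^n` is small. -/
theorem norm_le_of_weighted {s : ℝ} (hs : 0 ≤ s) {ψ ψ' : L2 d} (hψ : MemH0 s ψ) {n : ℕ}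
    (h : ∀ᵐ x : Space d, ‖ψ' x‖ ≤ ‖ψ x‖ ∧ (√(‖x‖ ^ 2 + 1) < 2 ^ n → ψ' x = 0)) :
    ‖ψ'‖ ≤ ((2 : ℝ) ^ n) ^ (-s) * normH0 s ψ := by
  have hN : ‖(MemLp.toLp (weighted s ψ) hψ : L2 d)‖ = normH0 s ψ := Lp.norm_toLp _ hψ
  rw [← hN]
  refine Lp.norm_le_mul_norm_of_ae_le_mul ?_
  filter_upwards [h, MemLp.coeFn_toLp hψ] with x hx hw
  rw [hw, weighted, norm_mul, Complex.norm_real, Real.norm_of_nonneg (by positivity)]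
  rcases lt_or_ge √(‖x‖ ^ 2 + 1) (2 ^ n) with h1 | h1
  · rw [hx.2 h1, norm_zero]; positivity
  · have h2 : ((2 : ℝ) ^ n) ^ s ≤ √(‖x‖ ^ 2 + 1) ^ s := Real.rpow_le_rpow (by positivity) h1 hs
    rw [Real.rpow_neg (by positivity), ← div_eq_inv_mul, le_div_iff₀ (by positivity)]
    calc _ ≤ ‖ψ x‖ * √(‖x‖ ^ 2 + 1) ^ s := mul_le_mul hx.1 h2 (by positivity) (norm_nonneg _)
      _ = _ := mul_comm _ _

theorem norm_truncate_succ_sub_le {s : ℝ} (hs : 0 ≤ s) {ψ : L2 d} (hψ : MemH0 s ψ) (n : ℕ) :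
    ‖truncate (n + 1) ψ - truncate n ψ‖ ≤ ((2 : ℝ) ^ n) ^ (-s) * normH0 s ψ := by
  refine norm_le_of_weighted hs hψ ?_
  filter_upwards [Lp.coeFn_sub (truncate (n + 1) ψ) (truncate n ψ), coeFn_truncate n ψ,
    coeFn_truncate (n + 1) ψ] with x h1 h2 h3
  rw [h1, Pi.sub_apply, h2, h3]
  have h4 : (2 : ℝ) ^ n ≤ 2 ^ (n + 1) := pow_le_pow_right₀ (by norm_num) n.le_succ
  by_cases h5 : √(‖x‖ ^ 2 + 1) < 2 ^ n
  · have h6 : √(‖x‖ ^ 2 + 1) < 2 ^ (n + 1) := h5.trans_le h4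
    simp [Set.indicator, h5, h6]
  · by_cases h6 : √(‖x‖ ^ 2 + 1) < 2 ^ (n + 1) <;> simp [Set.indicator, h5, h6]

theorem norm_sub_truncate_le {s : ℝ} (hs : 0 ≤ s) {ψ : L2 d} (hψ : MemH0 s ψ) (n : ℕ) :
    ‖truncate n ψ - ψ‖ ≤ ((2 : ℝ) ^ n) ^ (-s) * normH0 s ψ := by
  refine norm_le_of_weighted hs hψ ?_
  filter_upwards [Lp.coeFn_sub (truncate n ψ) ψ, coeFn_truncate n ψ] with x h1 h2
  rw [h1, Pi.sub_apply, h2]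
  by_cases h5 : √(‖x‖ ^ 2 + 1) < 2 ^ n <;> simp [Set.indicator, h5]

theorem supportedIn_truncate_succ_sub (ψ : L2 d) (n : ℕ) :
    SupportedIn (truncate (n + 1) ψ - truncate n ψ) (2 ^ (n + 1)) := by
  filter_upwards [Lp.coeFn_sub (truncate (n + 1) ψ) (truncate n ψ), coeFn_truncate n ψ,
    coeFn_truncate (n + 1) ψ] with x h1 h2 h3 h
  rw [h1, Pi.sub_apply, h2, h3]
  have h4 : (2 : ℝ) ^ n ≤ 2 ^ (n + 1) := pow_le_pow_right₀ (by norm_num) n.le_succ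
  have h5 : ‖x‖ ≤ √(‖x‖ ^ 2 + 1) := Real.le_sqrt_of_sq_le (by linarith)
  have h6 : ¬ √(‖x‖ ^ 2 + 1) < 2 ^ n := not_lt.2 (by linarith)
  have h7 : ¬ √(‖x‖ ^ 2 + 1) < 2 ^ (n + 1) := not_lt.2 (by linarith)
  simp [Set.indicator, h6, h7]

theorem rpow_two_pow_eq (n : ℕ) (s : ℝ) : ((2 : ℝ) ^ n) ^ s = ((2 : ℝ) ^ s) ^ n := by
  rw [← Real.rpow_natCast, ← Real.rpow_natCast, ← Real.rpow_mul (by norm_num),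
    ← Real.rpow_mul (by norm_num), mul_comm]

theorem tendsto_truncate {s : ℝ} (hs : 0 < s) {ψ : L2 d} (hψ : MemH0 s ψ) :
    Filter.Tendsto (fun n => truncate n ψ) Filter.atTop (nhds ψ) := by
  rw [tendsto_iff_norm_sub_tendsto_zero]
  refine squeeze_zero (fun _ => norm_nonneg _) (fun n => norm_sub_truncate_le hs.le hψ n) ?_
  simp only [rpow_two_pow_eq]
  have h1 : (2 : ℝ) ^ (-s) < 1 := Real.rpow_lt_one_of_one_lt_of_neg (by norm_num) (by linarith)
  simpa using (tendsto_pow_atTop_nhds_zero_of_lt_one (by positivity) h1).mul_const (normH0 s ψ)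

variable [NeZero d]

/-- The remainder operator: the evolution minus its leading term. -/
def remOp (d : ℕ) [NeZero d] {t : ℝ} (ht : 1 ≤ t) : L2 d →L[ℂ] L2 d :=
  (evolution d t).toContinuousLinearMap -
    (leadOp d (zero_lt_one.trans_le ht)).toContinuousLinearMap

theorem remOp_apply {t : ℝ} (ht : 1 ≤ t) (ψ : L2 d) :
    remOp d ht ψ = evolution d t ψ - leadOp d (zero_lt_one.trans_le ht) ψ := rfl

/-- The remainder estimate for data supported in a ball. -/
theorem exists_norm_japDeriv₁_remOp_le (d : ℕ) [NeZero d] (p : ℝ≥0∞) [Fact (1 ≤ p)] (hp : 2 ≤ p) :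
    ∃ C : ℝ, 0 < C ∧ ∀ t : ℝ, ∀ ht : 1 ≤ t, ∀ r : ℝ, 1 ≤ r → ∀ ψ : L2 d, SupportedIn ψ r →
      ∃ g : Lp ℂ p (volume : Measure (Space d)),
        japDeriv₁ d (1 - 2 * p⁻¹.toReal) (Lp.toTemperedDistribution (remOp d ht ψ)) =
          Lp.toTemperedDistribution g ∧
        ‖g‖ ≤ C * (t ^ (-(d : ℝ) * (1 / 2 - p⁻¹.toReal) - 1 / 2) *
          r ^ ((d : ℝ) / 2 - ((d : ℝ) - 1) * p⁻¹.toReal + 1)) * ‖ψ‖ := by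
  obtain ⟨C₀, hC₀, h₀⟩ := exists_norm_japDeriv₁_le (d := d) p hp
  obtain ⟨C₁, hC₁, h₁⟩ := exists_heatBounded_remainder d
  obtain ⟨C₂, hC₂, h₂⟩ := exists_norm_remainder_le d
  obtain ⟨θ, hθ⟩ : ∃ θ, θ = p⁻¹.toReal := ⟨_, rfl⟩
  have hθ0 : 0 ≤ θ := hθ ▸ ENNReal.toReal_nonneg
  have hθ2 : θ ≤ 1 / 2 := by
    have := ENNReal.toReal_mono (by simp) (ENNReal.inv_le_inv.2 hp)
    rw [← hθ] at this
    simpa using this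
  rw [← hθ] at h₀ ⊢
  refine ⟨C₀ * (C₁ ^ (1 - 2 * θ) * C₂ ^ (2 * θ)), by positivity, fun t ht r hr ψ hψ => ?_⟩
  have ht0 : 0 < t := by linarith
  have hr0 : 0 < r := by linarith
  obtain ⟨M, hM⟩ := exists_norm_remKern_le d ht
  obtain ⟨g, hg, hgn⟩ := h₀ (remOp d ht ψ) (kernelOp (remKern d t) ψ) _ _
    (stronglyMeasurable_kernelOp (continuous_remKern ht).measurable ψ).measurable
    (norm_kernelOp_le hM hψ.integrable) (evolution_sub_leadOp_ae_eq ht hψ)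
    (by positivity) (h₁ t ht r hr ψ hψ)
  refine ⟨g, hg, hgn.trans ?_⟩
  rw [mul_assoc C₀, mul_assoc C₀]
  refine mul_le_mul_of_nonneg_left ?_ hC₀.le
  have h3 := h₂ t ht r hr ψ hψ
  rw [← remOp_apply ht] at h3
  have e1 : C₁ * (t ^ (-(d : ℝ) / 2) * (r ^ (1 + (d : ℝ) / 2) / √t)) * ‖ψ‖ =
      C₁ * (t ^ (-(d : ℝ) / 2 - 1 / 2) * r ^ (1 + (d : ℝ) / 2)) * ‖ψ‖ := by
    rw [Real.rpow_sub ht0, ← Real.sqrt_eq_rpow]; ring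
  have e2 : C₂ * (r ^ (3 / 2 : ℝ) / √t) * ‖ψ‖ =
      C₂ * (t ^ (-(1 / 2) : ℝ) * r ^ (3 / 2 : ℝ)) * ‖ψ‖ := by
    rw [Real.rpow_neg ht0.le, ← Real.sqrt_eq_rpow]; ring
  rw [e1]
  rw [e2] at h3
  have ha : 0 ≤ 1 - 2 * θ := by linarith
  have hb : 0 ≤ 2 * θ := by linarith
  have hn : ‖ψ‖ ^ (1 - 2 * θ) * ‖ψ‖ ^ (2 * θ) = ‖ψ‖ := by
    rw [← Real.rpow_add_of_nonneg (norm_nonneg _) ha hb, sub_add_cancel, Real.rpow_one]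
  have htt : (t ^ (-(d : ℝ) / 2 - 1 / 2)) ^ (1 - 2 * θ) * (t ^ (-(1 / 2) : ℝ)) ^ (2 * θ) =
      t ^ (-(d : ℝ) * (1 / 2 - θ) - 1 / 2) := by
    rw [← Real.rpow_mul ht0.le, ← Real.rpow_mul ht0.le, ← Real.rpow_add ht0]; congr 1; ring
  -- Interpolating the powers `1 + d/2` and `3/2` with weights `1 - 2θ` and `2θ` produces exactly
  -- the threshold imposed on `s`.
  have hrr : (r ^ (1 + (d : ℝ) / 2)) ^ (1 - 2 * θ) * (r ^ (3 / 2 : ℝ)) ^ (2 * θ) =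
      r ^ ((d : ℝ) / 2 - ((d : ℝ) - 1) * θ + 1) := by
    rw [← Real.rpow_mul hr0.le, ← Real.rpow_mul hr0.le, ← Real.rpow_add hr0]; congr 1; ring
  calc _ ≤ (C₁ * (t ^ (-(d : ℝ) / 2 - 1 / 2) * r ^ (1 + (d : ℝ) / 2)) * ‖ψ‖) ^ (1 - 2 * θ) *
        (C₂ * (t ^ (-(1 / 2) : ℝ) * r ^ (3 / 2 : ℝ)) * ‖ψ‖) ^ (2 * θ) :=
        mul_le_mul_of_nonneg_left (Real.rpow_le_rpow (norm_nonneg _) h3 hb) (by positivity)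
    _ = _ := by
        rw [← htt, ← hrr]
        nth_rewrite 3 [← hn]
        rw [Real.mul_rpow (by positivity) (norm_nonneg _), Real.mul_rpow hC₁.le (by positivity),
          Real.mul_rpow (by positivity) (by positivity),
          Real.mul_rpow (by positivity) (norm_nonneg _), Real.mul_rpow hC₂.le (by positivity),
          Real.mul_rpow (by positivity) (by positivity)]
        ring

/-- The shell `2^n ≤ ⟨x⟩ < 2^(n+1)` has radius at most `2^(n+1)` and `L²` norm at most `2^(-ns)`
times the weighted norm. With `a` the exponent of the radius, the contributions form a geometric
series of ratio `2^(a-s) < 1`. -/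
theorem exists_norm_japDeriv₁_remOp_le_normH0 (d : ℕ) [NeZero d] (p : ℝ≥0∞) [Fact (1 ≤ p)]
    (hp : 2 ≤ p) (s : ℝ) (hs : (d : ℝ) / 2 - ((d : ℝ) - 1) * p⁻¹.toReal + 1 < s) :
    ∃ C : ℝ, 0 < C ∧ ∀ t : ℝ, ∀ ht : 1 ≤ t, ∀ ψ : L2 d, MemH0 s ψ →
      ∃ g : Lp ℂ p (volume : Measure (Space d)),
        japDeriv₁ d (1 - 2 * p⁻¹.toReal) (Lp.toTemperedDistribution (remOp d ht ψ)) =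
          Lp.toTemperedDistribution g ∧
        ‖g‖ ≤ C * t ^ (-(d : ℝ) * (1 / 2 - p⁻¹.toReal) - 1 / 2) * normH0 s ψ := by
  obtain ⟨C, hC, h⟩ := exists_norm_japDeriv₁_remOp_le d p hp
  obtain ⟨a, ha⟩ : ∃ a, a = (d : ℝ) / 2 - ((d : ℝ) - 1) * p⁻¹.toReal + 1 := ⟨_, rfl⟩
  rw [← ha] at h hs
  have ha0 : 0 < a := by
    have hθ2 : p⁻¹.toReal ≤ 1 / 2 := by
      simpa using ENNReal.toReal_mono (by simp) (ENNReal.inv_le_inv.2 hp)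
    have hd : (1 : ℝ) ≤ d := by exact_mod_cast Nat.one_le_iff_ne_zero.2 (NeZero.ne d)
    rw [ha]; nlinarith
  have hs0 : 0 < s := ha0.trans hs
  have hρ : (2 : ℝ) ^ (a - s) < 1 := Real.rpow_lt_one_of_one_lt_of_neg (by norm_num) (by linarith)
  refine ⟨C * 2 ^ a * (1 - (2 : ℝ) ^ (a - s))⁻¹, by
    have := sub_pos.2 hρ; positivity, fun t ht ψ hψ => ?_⟩
  have ht0 : 0 < t := by linarith
  have hN : 0 ≤ normH0 s ψ := ENNReal.toReal_nonneg
  obtain ⟨K, hK⟩ : ∃ K, K = t ^ (-(d : ℝ) * (1 / 2 - p⁻¹.toReal) - 1 / 2) := ⟨_, rfl⟩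
  have hK0 : 0 < K := hK ▸ Real.rpow_pos_of_pos ht0 _
  rw [← hK]
  have h' := fun n : ℕ => h t ht (2 ^ (n + 1)) (one_le_pow₀ (by norm_num)) _
    (supportedIn_truncate_succ_sub ψ n)
  choose g hg hgn using h'
  have hgb : ∀ n, ‖g n‖ ≤ C * 2 ^ a * K * normH0 s ψ * ((2 : ℝ) ^ (a - s)) ^ n := fun n => by
    refine (hgn n).trans ?_
    rw [← hK]
    calc _ ≤ C * (K * ((2 : ℝ) ^ (n + 1)) ^ a) * (((2 : ℝ) ^ n) ^ (-s) * normH0 s ψ) :=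
          mul_le_mul_of_nonneg_left (norm_truncate_succ_sub_le hs0.le hψ n) (by positivity)
      _ = _ := by
          rw [rpow_two_pow_eq, rpow_two_pow_eq, sub_eq_add_neg, Real.rpow_add two_pos, mul_pow,
            pow_succ]
          ring
  have hgeo := (hasSum_geometric_of_lt_one (by positivity) hρ).mul_left (C * 2 ^ a * K * normH0 s ψ)
  have hsum : Summable g := Summable.of_norm_bounded hgeo.summable hgb
  refine ⟨∑' n, g n, ?_, ?_⟩
  -- The partial sums converge in `L^p`, and the remainders of the truncated data are mapped
  -- continuously from `L²`. Both limits are compared in the space of tempered distributions.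
  · have l1 : Filter.Tendsto (fun n => Lp.toTemperedDistributionCLM ℂ volume p
        (∑ k ∈ Finset.range n, g k)) Filter.atTop
        (nhds (Lp.toTemperedDistributionCLM ℂ volume p (∑' n, g n))) :=
      ((Lp.toTemperedDistributionCLM ℂ (volume : Measure (Space d)) p).continuous.tendsto _).comp
        hsum.hasSum.tendsto_sum_nat
    have l2 : Filter.Tendsto (fun n => japDeriv₁ d (1 - 2 * p⁻¹.toReal)
        (Lp.toTemperedDistributionCLM ℂ volume 2 (remOp d ht (truncate n ψ)))) Filter.atTop
        (nhds (japDeriv₁ d (1 - 2 * p⁻¹.toReal)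
          (Lp.toTemperedDistributionCLM ℂ volume 2 (remOp d ht ψ)))) :=
      ((((japDeriv₁ d (1 - 2 * p⁻¹.toReal)).continuous.comp
        (Lp.toTemperedDistributionCLM ℂ (volume : Measure (Space d)) 2).continuous).comp
          (remOp d ht).continuous).tendsto ψ).comp (tendsto_truncate hs0 hψ)
    refine tendsto_nhds_unique l2 (l1.congr fun n => ?_)
    have : truncate n ψ = ∑ k ∈ Finset.range n, (truncate (k + 1) ψ - truncate k ψ) := by
      rw [Finset.sum_range_sub (fun k => truncate k ψ), truncate_zero, sub_zero]
    rw [this]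
    simp only [map_sum]
    exact Finset.sum_congr rfl fun k _ => (hg k).symm
  · refine (tsum_of_norm_bounded hgeo hgb).trans (le_of_eq ?_)
    ring

end

end Aniso4NLS

end

theorem proposition2p1 (d : ℕ) [NeZero d] (p : ℝ≥0∞) [Fact (1 ≤ p)] (hp : 2 ≤ p)
    (β : ℝ) (hβ₁ : 3 / 8 < β) (hβ₂ : β < 1 / 2)
    (s : ℝ) (hs : (d : ℝ) / 2 - ((d : ℝ) - 1) * p⁻¹.toReal + 1 < s) :
    ∃ C : ℝ, ∀ ψ : Aniso4NLS.L2 d, Aniso4NLS.MemH0 s ψ →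
      ∀ u : ℝ → Aniso4NLS.L2 d, Aniso4NLS.IsSolution ψ u →
        ∃ R : ℝ → Aniso4NLS.L2 d, ∀ t : ℝ, 2 ≤ t →
          (∀ᵐ x : Aniso4NLS.Space d, u t x = Aniso4NLS.leading ψ t x + R t x) ∧
          ∃ g : Lp ℂ p (volume : Measure (Aniso4NLS.Space d)),
            Aniso4NLS.japDeriv₁ d (1 - 2 * p⁻¹.toReal) (Lp.toTemperedDistribution (R t))
              = Lp.toTemperedDistribution g ∧
            ‖g‖ ≤ C * t ^ (-(d : ℝ) * (1 / 2 - p⁻¹.toReal) - β) * Aniso4NLS.normH0 s ψ := by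
  obtain ⟨C, hC, h⟩ := Aniso4NLS.exists_norm_japDeriv₁_remOp_le_normH0 d p hp s hs
  refine ⟨C, fun ψ hψ u hu =>
    ⟨fun t => if ht : 1 ≤ t then Aniso4NLS.remOp d ht ψ else 0, fun t ht => ?_⟩⟩
  have ht1 : 1 ≤ t := one_le_two.trans ht
  have ht0 : 0 < t := zero_lt_one.trans_le ht1
  simp only [ht1, dite_true]
  refine ⟨?_, ?_⟩
  · filter_upwards [Aniso4NLS.coeFn_leadOp ht0 ψ,
      Lp.coeFn_sub (Aniso4NLS.evolution d t ψ) (Aniso4NLS.leadOp d ht0 ψ)] with x h1 h2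
    rw [hu.eq_evolution ht0, ← h1, Aniso4NLS.remOp_apply, h2, Pi.sub_apply, add_sub_cancel]
  · obtain ⟨g, hg, hgn⟩ := h t ht1 ψ hψ
    refine ⟨g, hg, hgn.trans ?_⟩
    refine mul_le_mul_of_nonneg_right (mul_le_mul_of_nonneg_left ?_ hC.le) ENNReal.toReal_nonneg
    -- The decay `t^(-1/2)` is weakened to `t^(-β)`, which is legitimate for `t ≥ 1` and `β < 1/2`.
    exact Real.rpow_le_rpow_of_exponent_le ht1 (by linarith)
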